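/- **Setting.** Fix integers $d,N\ge 0$. Let $\theta^{\mu\nu}=-\theta^{\nu\mu}$ ($1\le\mu,\nu\le d$) be formal parameters. On formal power series in $\theta$ with coefficients matrix-valued complex smooth functions on $\mathbb R^d$, let $\star$ be the Moyal–Weyl product $(f\star g)(\sigma)=\exp\bigl(i\pi\theta^{\mu\nu}\tfrac{\partial}{\partial\sigma^\mu}\tfrac{\partial}{\partial\rho^\nu}\bigr)f(\sigma)g(\rho)|_{\rho=\sigma}$, and write $[f,g]_\star=f\star g-g\star f$, $\{f,g\}_\star=f\star g+g\star f$. Gauge potentials $A_\mu$, gauge parameters $\varepsilon$ and adjoint fields $\Psi$ are smooth and $M_N(\mathbb C)$-valued, fundamental fields $\phi$ are smooth and $\mathbb C^N$-valued. For a (possibly $\theta$-dependent) potential $a$ put $F_{\mu\nu}=\partial_\mu a_\nu-\partial_\nu a_\mu-i[a_\mu,a_\nu]_\star$, $D_\mu\phi=\partial_\mu\phi-ia_\mu\star\phi$, $D_\mu\Psi=\partial_\mu\Psi-i[a_\mu,\Psi]_\star$ (every adjoint-valued expression is differentiated in the latter way), and $\hat\delta_e a_\mu=\partial_\mu e-i[a_\mu,e]_\star$,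 $\hat\delta_e\phi=ie\star\phi$, $\hat\delta_e\Psi=i[e,\Psi]_\star$; $\delta_\varepsilon$ denotes the same variations at $\theta=0$. A *local functional* is a formal power series in $\theta$ each of whose coefficients is a smooth function of the arguments and of finitely many of their derivatives; it is evaluated on $\theta$-dependent arguments by Taylor expansion in $\theta$. Consider local functionals $\hat A(A)=A+O(\theta)$, $\hat\varepsilon(\varepsilon,A)=\varepsilon+O(\theta)$ ($\mathbb R$-linear in $\varepsilon$), $\hat\phi(\phi,A)=\phi+O(\theta)$ and $\hat\Psi(\Psi,A)=\Psi+O(\theta)$ ($\mathbb C$-linear in $\phi$, $\Psi$). The Seiberg–Witten conditions are, for all $A,\varepsilon,\phi,\Psi$ and to first order in $\varepsilon$, $$\hat A(A+\delta_\varepsilon A)=\hat A(A)+\hat\delta_{\hat\varepsilon}\hat A(A),\quad \hat\phi(\phi+\delta_\varepsilon\phi,A+\delta_\varepsilon A)=\hat\phi(\phi,A)+\hat\delta_{\hat\varepsilon}\hat\phi(\phi,A),$$ and likewise for $\hat\Psi$. For a functional $\hat D(A)$ or $\hat C(\Psi,A)$ with adjoint values let $\delta'_\varepsilon$ be its first-order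 change under $\hat\delta_\varepsilon$ of its arguments minus $i[\varepsilon,\cdot\,]_\star$ of its value; for $\hat C(\phi,A)$ with fundamental values subtract $i\varepsilon\star(\cdot)$ instead. (On $\star$-polynomials in $A_\mu$, $D_\mu$ and matter fields, $\delta'_\varepsilon$ replaces each $A_\mu$ in turn by $\partial_\mu\varepsilon$ and leaves the $D_\mu$ unchanged.) Let $\hat D_{\mu\nu\kappa}(A)$, $\hat E_{\mu\nu}(\varepsilon,A)$, $\hat C_{\mu\nu}(\phi,A)$ or $\hat C_{\mu\nu}(\Psi,A)$ be antisymmetric in $\mu,\nu$, with $\hat E$ $\mathbb R$-linear in $\varepsilon$ and $\hat C$ $\mathbb C$-linear in the matter field. **(I) General solutions.** $(\hat A,\hat\varepsilon)$ satisfies the Seiberg–Witten condition for the potential if and only if there are local functionals $\hat D,\hat E$ as above such that, for all antisymmetric $\delta\theta$, $$\delta\theta^{\mu\nu}\frac{\partial\hat A_\kappa}{\partial\theta^{\mu\nu}}=-\frac\pi2\,\delta\theta^{\mu\nu}\bigl(\{\hat A_\mu,\partial_\nu\hat A_\kappa+\hat F_{\nu\kappa}\}_\star+\hat D_{\mu\nu\kappa}(\hat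 A)\bigr),$$ $$\delta\theta^{\mu\nu}\frac{\partial\hat\varepsilon}{\partial\theta^{\mu\nu}}=\frac\pi2\,\delta\theta^{\mu\nu}\bigl(\{\partial_\mu\hat\varepsilon,\hat A_\nu\}_\star+\hat E_{\mu\nu}(\hat\varepsilon,\hat A)\bigr),$$ where the left sides are the derivatives in the direction $\delta\theta$, and $$\delta'_\varepsilon\hat D_{\mu\nu\kappa}=-D_\kappa\hat E_{\mu\nu}.\tag{1}$$ $(\hat A,\hat\varepsilon,\hat\phi)$, respectively $(\hat A,\hat\varepsilon,\hat\Psi)$, satisfies the Seiberg–Witten conditions for the potential and the matter field if and only if there are $\hat D,\hat E$ as before and a local $\hat C$ such that moreover $$\delta\theta^{\mu\nu}\frac{\partial\hat\phi}{\partial\theta^{\mu\nu}}=-\frac\pi2\,\delta\theta^{\mu\nu}\bigl(\hat A_\mu\star(\partial_\nu\hat\phi+D_\nu\hat\phi)+\hat C_{\mu\nu}(\hat\phi,\hat A)\bigr),\qquad \delta'_\varepsilon\hat C_{\mu\nu}(\phi,A)=-i\hat E_{\mu\nu}\star\phi,\tag{2}$$ respectively $$\delta\theta^{\mu\nu}\frac{\partial\hat\Psi}{\partial\theta^{\mu\nu}}=-\frac\pi2\,\delta\theta^{\mu\nu}\bigl(\{\hat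 A_\mu,\partial_\nu\hat\Psi+D_\nu\hat\Psi\}_\star+\hat C_{\mu\nu}(\hat\Psi,\hat A)\bigr),\qquad \delta'_\varepsilon\hat C_{\mu\nu}(\Psi,A)=-i[\hat E_{\mu\nu},\Psi]_\star.\tag{3}$$ **(II) Classification.** Now let $\hat D,\hat E,\hat C$ be given by $\star$-polynomials, with complex coefficients and without explicit $\theta$, in the letters $A_\mu,D_\mu$ and, respectively, $\varepsilon$ (for $\hat E$) and $\phi$ or $\Psi$ (for $\hat C$), which are $GL(d,\mathbb R)$-covariant: replacing $A_\mu,D_\mu$ by $g_\mu{}^\nu A_\nu,g_\mu{}^\nu D_\nu$ transforms them as tensors with the indicated lower indices. Within this class (antisymmetric and linear as above), the solutions $(\hat D,\hat E)$ of the constraint (1) are exactly $$\hat D_{\mu\nu\kappa}=\alpha D_\kappa F_{\mu\nu}-\beta D_\kappa[A_\mu,A_\nu]_\star,\qquad \hat E_{\mu\nu}=\beta\bigl([\partial_\mu\varepsilon,A_\nu]_\star-[\partial_\nu\varepsilon,A_\mu]_\star\bigr),$$ with $\alpha,\beta\in\mathbb C$. (Contracted with an antisymmetric $\delta\theta^{\mu\nu}$,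 $\hat E_{\mu\nu}$ amounts to $2\beta[\partial_\mu\varepsilon,A_\nu]_\star$.) The solutions $(\hat D,\hat E,\hat C)$ of (1) and the constraint in (2) (fundamental representation), respectively of (1) and the constraint in (3) (adjoint representation), are exactly those with $\hat D,\hat E$ as above and, with the same $\beta$, $$\hat C_{\mu\nu}=-i\beta[A_\mu,A_\nu]_\star\star\phi+\gamma F_{\mu\nu}\star\phi,$$ respectively $$\hat C_{\mu\nu}=-i\beta[[A_\mu,A_\nu]_\star,\Psi]_\star+\gamma'F_{\mu\nu}\star\Psi+\tilde\gamma\,\Psi\star F_{\mu\nu},$$ with $\gamma,\gamma',\tilde\gamma\in\mathbb C$. -/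

import Mathlib

open scoped ContDiff

attribute [local instance] Matrix.normedAddCommGroup Matrix.normedSpace

noncomputable section

namespace SW

/-! ### Points, matrices, formal power series in the noncommutativity parameter -/

/-- Points `σ` of the plane `ℝ^d`. -/
abbrev Pt (d : ℕ) := Fin d → ℝ

/-- Complex `a × b` matrices. -/
abbrev Mat (a b : ℕ) := Matrix (Fin a) (Fin b) ℂ

/-- The independent components `θ^{μν}`, `μ < ν`, of the antisymmetric parameter `θ`. -/
abbrev Idx (d : ℕ) := {p : Fin d × Fin d // p.1 < p.2}

/-- Exponents of the monomials in the independent components of `θ`. -/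
abbrev Mon (d : ℕ) := Idx d →₀ ℕ

/-- Formal power series in `θ` whose coefficients are `V`-valued functions on `ℝ^d`:
`f J` is the coefficient of the monomial with exponent `J`. -/
abbrev Ser (d : ℕ) (V : Type) := Mon d → Pt d → V

/-- The antisymmetric parameter `θ^{μν}` as a polynomial in its independent components. -/
def theta {d : ℕ} (μ ν : Fin d) : MvPolynomial (Idx d) ℝ :=
  if h : μ < ν then MvPolynomial.X ⟨(μ, ν), h⟩
  else if h : ν < μ then -MvPolynomial.X ⟨(ν, μ), h⟩
  else 0

/-- Partial derivative of a function of finitely many real variables. -/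
def pd {ι V : Type} [Fintype ι] [DecidableEq ι] [NormedAddCommGroup V] [NormedSpace ℝ V]
    (i : ι) (f : (ι → ℝ) → V) : (ι → ℝ) → V :=
  fun x => fderiv ℝ f x (Pi.single i 1)

/-- Iterated partial derivative along a list of directions. -/
def pdL {ι V : Type} [Fintype ι] [DecidableEq ι] [NormedAddCommGroup V] [NormedSpace ℝ V]
    (l : List ι) (f : (ι → ℝ) → V) : (ι → ℝ) → V :=
  l.foldr pd f

/-- Smooth functions. -/
def Smooth {d : ℕ} {V : Type} [NormedAddCommGroup V] [NormedSpace ℝ V] (f : Pt d → V) : Prop :=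
  ContDiff ℝ ∞ f

/-- The coefficient of the monomial `I` in
`exp (i π θ^{μν} ∂/∂σ^μ ∂/∂ρ^ν) f(σ) g(ρ)` at `ρ = σ`. With `n` the degree of `I`, only the
`n`-th term `(i π)^n / n! · θ^{μ₁ν₁} ⋯ θ^{μₙνₙ} (∂_{μ₁} ⋯ ∂_{μₙ} f) (∂_{ν₁} ⋯ ∂_{νₙ} g)`
of the exponential contributes. -/
def starCoeff {d a b c : ℕ} (I : Mon d) (f : Pt d → Mat a b) (g : Pt d → Mat b c) :
    Pt d → Mat a c :=
  fun x => ((Complex.I * (Real.pi : ℂ)) ^ I.degree / (Nat.factorial I.degree : ℂ)) •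
    ∑ s : Fin I.degree → Fin d × Fin d,
      ((MvPolynomial.coeff I (∏ i, theta (s i).1 (s i).2) : ℝ) : ℂ) •
        (pdL (List.ofFn fun i => (s i).1) f x * pdL (List.ofFn fun i => (s i).2) g x)

/-- The Moyal-Weyl star product of (rectangular) matrix valued formal power series. -/
def star {d a b c : ℕ} (f : Ser d (Mat a b)) (g : Ser d (Mat b c)) : Ser d (Mat a c) :=
  fun J => ∑ p ∈ Finset.HasAntidiagonal.antidiagonal J, ∑ q ∈ Finset.HasAntidiagonal.antidiagonal p.2,
    starCoeff p.1 (f q.1) (g q.2)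

/-- The star commutator. -/
def comm {d N : ℕ} (f g : Ser d (Mat N N)) : Ser d (Mat N N) := star f g - star g f

/-- The star anticommutator. -/
def acomm {d N : ℕ} (f g : Ser d (Mat N N)) : Ser d (Mat N N) := star f g + star g f

/-- A `θ`-independent function as a power series. -/
def const {d : ℕ} {V : Type} [Zero V] (f : Pt d → V) : Ser d V :=
  fun J => if J = 0 then f else 0

/-- Coefficientwise partial derivative `∂_μ`. -/
def pdS {d : ℕ} {V : Type} [NormedAddCommGroup V] [NormedSpace ℝ V]
    (μ : Fin d) (f : Ser d V) : Ser d V :=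
  fun J => pd μ (f J)

/-- `δθ^{μν} ∂f/∂θ^{μν}` for an antisymmetric `δθ`: the derivative of `f` in the direction `δθ`. -/
def dTheta {d : ℕ} {V : Type} [AddCommGroup V] [Module ℝ V]
    (δθ : Fin d → Fin d → ℝ) (f : Ser d V) : Ser d V :=
  fun J => ∑ p : Idx d, (δθ p.1.1 p.1.2 * ((J p : ℝ) + 1)) • f (J + Finsupp.single p 1)

/-- Component of a power series of covector fields. -/
def cpt {d : ℕ} {V : Type} (u : Ser d (Fin d → V)) (μ : Fin d) : Ser d V :=
  fun J x => u J x μ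

/-- Component of a power series of tensor fields with two lower indices. -/
def cpt2 {d : ℕ} {V : Type} (u : Ser d (Fin d → Fin d → V)) (μ ν : Fin d) : Ser d V :=
  fun J x => u J x μ ν

/-- Component of a power series of tensor fields with three lower indices. -/
def cpt3 {d : ℕ} {V : Type} (u : Ser d (Fin d → Fin d → Fin d → V)) (μ ν κ : Fin d) : Ser d V :=
  fun J x => u J x μ ν κ

/-- A pair of power series as a power series of pairs. -/
def pairS {d : ℕ} {V W : Type} (u : Ser d V) (v : Ser d W) : Ser d (V × W) :=
  fun J x => (u J x, v J x)

/-! ### Noncommutative gauge theory -/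

/-- Noncommutative field strength
`F_{μν} = ∂_μ a_ν - ∂_ν a_μ - i a_μ ⋆ a_ν + i a_ν ⋆ a_μ`. -/
def field {d N : ℕ} (a : Fin d → Ser d (Mat N N)) (μ ν : Fin d) : Ser d (Mat N N) :=
  pdS μ (a ν) - pdS ν (a μ) - Complex.I • star (a μ) (a ν) + Complex.I • star (a ν) (a μ)

/-- Covariant derivative of fields in the fundamental representation. -/
def covF {d N : ℕ} (a : Fin d → Ser d (Mat N N)) (μ : Fin d) (f : Ser d (Mat N 1)) :
    Ser d (Mat N 1) :=
  pdS μ f - Complex.I • star (a μ) f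

/-- Covariant derivative of fields in the adjoint representation. -/
def covA {d N : ℕ} (a : Fin d → Ser d (Mat N N)) (μ : Fin d) (f : Ser d (Mat N N)) :
    Ser d (Mat N N) :=
  pdS μ f - Complex.I • star (a μ) f + Complex.I • star f (a μ)

/-- Noncommutative gauge variation of the potential,
`∂_μ e - i a_μ ⋆ e + i e ⋆ a_μ`. -/
def gaugeA {d N : ℕ} (a : Fin d → Ser d (Mat N N)) (e : Ser d (Mat N N)) :
    Ser d (Fin d → Mat N N) :=
  fun J x μ => (pdS μ e - Complex.I • star (a μ) e + Complex.I • star e (a μ)) J x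

/-- Noncommutative gauge variation of a field in the fundamental, `i e ⋆ f`. -/
def gaugeF {d N : ℕ} (e : Ser d (Mat N N)) (f : Ser d (Mat N 1)) : Ser d (Mat N 1) :=
  Complex.I • star e f

/-- Noncommutative gauge variation of a field in the adjoint, `i e ⋆ f - i f ⋆ e`. -/
def gaugeAd {d N : ℕ} (e f : Ser d (Mat N N)) : Ser d (Mat N N) :=
  Complex.I • star e f - Complex.I • star f e

/-- Commutative gauge variation of the potential, `∂_μ ε - i A_μ ε + i ε A_μ`. -/
def cgaugeA {d N : ℕ} (A : Pt d → Fin d → Mat N N) (ε : Pt d → Mat N N) :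
    Pt d → Fin d → Mat N N :=
  fun x μ => pd μ ε x - Complex.I • (A x μ * ε x) + Complex.I • (ε x * A x μ)

/-! ### Functionals of the fields -/

/-- Functionals that map `V`-valued fields on `ℝ^d` to formal power series in `θ` of `W`-valued
fields. They are only ever evaluated on smooth fields. -/
abbrev Fun (d : ℕ) (V W : Type) := Mon d → (Pt d → V) → Pt d → W

/-- Value of a functional on a field. -/
def app {d : ℕ} {V W : Type} (F : Fun d V W) (u : Pt d → V) : Ser d W := fun J => F J u

/-- Each coefficient is a smooth function of the field and of finitely many of its
derivatives. -/
def IsLocal {d : ℕ} {V W : Type} [NormedAddCommGroup V] [NormedSpace ℝ V]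
    [NormedAddCommGroup W] [NormedSpace ℝ W] (F : Fun d V W) : Prop :=
  ∀ J, ∃ (S : Finset (List (Fin d))) (g : (S → V) → W), ContDiff ℝ ∞ g ∧
    ∀ u : Pt d → V, Smooth u → ∀ x, F J u x = g (fun l => pdL l.1 u x)

/-- `R`-linearity of a functional in the first of its two arguments. -/
def IsLinearFst (R : Type) {d : ℕ} {U V W : Type} [Semiring R]
    [NormedAddCommGroup U] [NormedSpace ℝ U] [NormedAddCommGroup V] [NormedSpace ℝ V]
    [AddCommGroup W] [Module R U] [Module R W] (F : Fun d (U × V) W) : Prop :=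
  ∀ J (u₁ u₂ : Pt d → U) (v : Pt d → V), Smooth u₁ → Smooth u₂ → Smooth v → ∀ (c : R) x,
    F J (fun y => (u₁ y + c • u₂ y, v y)) x =
      F J (fun y => (u₁ y, v y)) x + c • F J (fun y => (u₂ y, v y)) x

/-- The first-order change `F(u + v) - F(u)` for an infinitesimal formal power series `v`:
the differential of `F` at `u` in the direction `v`. -/
def variation {d : ℕ} {V W : Type} [AddCommGroup V] [Module ℝ V]
    [NormedAddCommGroup W] [NormedSpace ℝ W]
    (F : Fun d V W) (u : Pt d → V) (v : Ser d V) : Ser d W :=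
  fun J x => ∑ p ∈ Finset.HasAntidiagonal.antidiagonal J,
    deriv (fun s : ℝ => F p.1 (fun y => u y + s • v p.2 y) x) 0

/-- The coefficient of the monomial `K` in the Taylor expansion in `θ` of `G(u)`, for a functional
`G` without `θ`-dependence evaluated on the formal power series `u`: the corresponding mixed partial
derivative at `t = 0` of `G` on the polynomial family `∑_{L ≤ K} t^L u_L`, divided by `K!`. -/
def taylor {d : ℕ} {V W : Type} [AddCommGroup V] [Module ℝ V]
    [NormedAddCommGroup W] [NormedSpace ℝ W]
    (K : Mon d) (G : (Pt d → V) → Pt d → W) (u : Ser d V) : Pt d → W :=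
  fun x => (∏ p : Idx d, (Nat.factorial (K p) : ℝ))⁻¹ •
    pdL (Finsupp.toMultiset K).toList
      (fun t : Idx d → ℝ => G (fun y => ∑ L ∈ Finset.Iic K, (∏ p : Idx d, t p ^ L p) • u L y) x) 0

/-- Value of a functional on a formal power series of fields, as a formal power series. -/
def subst {d : ℕ} {V W : Type} [AddCommGroup V] [Module ℝ V]
    [NormedAddCommGroup W] [NormedSpace ℝ W] (F : Fun d V W) (u : Ser d V) : Ser d W :=
  fun J x => ∑ p ∈ Finset.HasAntidiagonal.antidiagonal J, taylor p.2 (F p.1) u x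

/-- Functionals `Â(A)`. -/
abbrev PotFun (d N : ℕ) := Fun d (Fin d → Mat N N) (Fin d → Mat N N)

/-- Functionals `ε̂(ε, A)`. -/
abbrev ParFun (d N : ℕ) := Fun d (Mat N N × (Fin d → Mat N N)) (Mat N N)

/-- Functionals `φ̂(φ, A)` of a matter field with values in `N × m` matrices; `m = 1` for the
fundamental and `m = N` for the adjoint representation. -/
abbrev MatFun (d N m : ℕ) := Fun d (Mat N m × (Fin d → Mat N N)) (Mat N m)

/-- Functionals `D̂_{μνκ}(A)`. -/
abbrev DFun (d N : ℕ) := Fun d (Fin d → Mat N N) (Fin d → Fin d → Fin d → Mat N N)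

/-- Functionals `Ê_{μν}(ε, A)`. -/
abbrev EFun (d N : ℕ) := Fun d (Mat N N × (Fin d → Mat N N)) (Fin d → Fin d → Mat N N)

/-- Functionals `Ĉ_{μν}(φ, A)`; `m = 1` for the fundamental, `m = N` for the adjoint. -/
abbrev CFun (d N m : ℕ) := Fun d (Mat N m × (Fin d → Mat N N)) (Fin d → Fin d → Mat N m)

/-- `Â(A) = A + O(θ)`, a formal power series of local functionals. -/
def IsPotMap {d N : ℕ} (Ah : PotFun d N) : Prop :=
  IsLocal Ah ∧ ∀ A, Smooth A → Ah 0 A = A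

/-- `ε̂(ε, A) = ε + O(θ)`, a formal power series of local functionals linear in `ε`. -/
def IsParMap {d N : ℕ} (eh : ParFun d N) : Prop :=
  IsLocal eh ∧ IsLinearFst ℝ eh ∧
    ∀ ε A, Smooth ε → Smooth A → eh 0 (fun x => (ε x, A x)) = ε

/-- `φ̂(φ, A) = φ + O(θ)`, a formal power series of local functionals linear in `φ`. -/
def IsMatMap {d N m : ℕ} (ph : MatFun d N m) : Prop :=
  IsLocal ph ∧ IsLinearFst ℂ ph ∧
    ∀ φ A, Smooth φ → Smooth A → ph 0 (fun x => (φ x, A x)) = φ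

/-- Antisymmetry of `D̂_{μνκ}` in `μ, ν`. -/
def AntisymmD {d N : ℕ} (D : DFun d N) : Prop :=
  ∀ A, Smooth A → ∀ J x μ ν κ, D J A x μ ν κ = -D J A x ν μ κ

/-- Antisymmetry of `Ê_{μν}` or `Ĉ_{μν}` in `μ, ν`. -/
def Antisymm2 {d N m : ℕ} (C : CFun d N m) : Prop :=
  ∀ φ A, Smooth φ → Smooth A → ∀ J x μ ν,
    C J (fun y => (φ y, A y)) x μ ν = -C J (fun y => (φ y, A y)) x ν μ

/-! ### The Seiberg-Witten conditions -/

/-- `Â(A + δ_ε A) = Â(A) + δ̂_{ε̂} Â(A)` to first order in `ε`. -/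
def SWGauge {d N : ℕ} (Ah : PotFun d N) (eh : ParFun d N) : Prop :=
  ∀ A ε, Smooth A → Smooth ε →
    variation Ah A (const (cgaugeA A ε)) =
      gaugeA (cpt (app Ah A)) (app eh (fun x => (ε x, A x)))

/-- `φ̂(A + δ_ε A, φ + δ_ε φ) = φ̂(A, φ) + δ̂_{ε̂} φ̂(A, φ)` to first order in `ε`, fundamental
representation, `δ_ε φ = i ε φ`. -/
def SWFund {d N : ℕ} (eh : ParFun d N) (ph : MatFun d N 1) : Prop :=
  ∀ A ε φ, Smooth A → Smooth ε → Smooth φ →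
    variation ph (fun x => (φ x, A x))
        (const (fun x => (Complex.I • (ε x * φ x), cgaugeA A ε x))) =
      gaugeF (app eh (fun x => (ε x, A x))) (app ph (fun x => (φ x, A x)))

/-- The same condition in the adjoint representation, `δ_ε Ψ = i ε Ψ - i Ψ ε`. -/
def SWAdj {d N : ℕ} (eh : ParFun d N) (ph : MatFun d N N) : Prop :=
  ∀ A ε Ψ, Smooth A → Smooth ε → Smooth Ψ →
    variation ph (fun x => (Ψ x, A x))
        (const (fun x => (Complex.I • (ε x * Ψ x) - Complex.I • (Ψ x * ε x), cgaugeA A ε x))) =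
      gaugeAd (app eh (fun x => (ε x, A x))) (app ph (fun x => (Ψ x, A x)))

/-! ### The Seiberg-Witten differential equations with extra terms -/

/-- `δθ^{μν} ∂Â_κ/∂θ^{μν}
  = -(π/2) δθ^{μν} ({Â_μ, ∂_ν Â_κ + F̂_{νκ}}_⋆ + D̂_{μνκ}(Â))`. -/
def EqA {d N : ℕ} (Ah : PotFun d N) (D : DFun d N) : Prop :=
  ∀ A, Smooth A → ∀ δθ : Fin d → Fin d → ℝ, (∀ μ ν, δθ μ ν = -δθ ν μ) → ∀ κ,
    let a := cpt (app Ah A)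
    dTheta δθ (a κ) = (-(Real.pi / 2)) • ∑ μ, ∑ ν, δθ μ ν •
      (acomm (a μ) (pdS ν (a κ) + field a ν κ) + cpt3 (subst D (app Ah A)) μ ν κ)

/-- `δθ^{μν} ∂ε̂/∂θ^{μν} = (π/2) δθ^{μν} ({∂_μ ε̂, Â_ν}_⋆ + Ê_{μν}(ε̂, Â))`. -/
def EqE {d N : ℕ} (Ah : PotFun d N) (eh : ParFun d N) (E : EFun d N) : Prop :=
  ∀ A ε, Smooth A → Smooth ε →
    ∀ δθ : Fin d → Fin d → ℝ, (∀ μ ν, δθ μ ν = -δθ ν μ) →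
    let a := cpt (app Ah A)
    let e := app eh (fun x => (ε x, A x))
    dTheta δθ e = (Real.pi / 2) • ∑ μ, ∑ ν, δθ μ ν •
      (acomm (pdS μ e) (a ν) + cpt2 (subst E (pairS e (app Ah A))) μ ν)

/-- `δθ^{μν} ∂φ̂/∂θ^{μν}
  = -(π/2) δθ^{μν} (Â_μ ⋆ ∂_ν φ̂ + Â_μ ⋆ D_ν φ̂ + Ĉ_{μν}(φ̂, Â))`. -/
def EqF {d N : ℕ} (Ah : PotFun d N) (ph : MatFun d N 1) (C : CFun d N 1) : Prop :=
  ∀ A φ, Smooth A → Smooth φ →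
    ∀ δθ : Fin d → Fin d → ℝ, (∀ μ ν, δθ μ ν = -δθ ν μ) →
    let a := cpt (app Ah A)
    let f := app ph (fun x => (φ x, A x))
    dTheta δθ f = (-(Real.pi / 2)) • ∑ μ, ∑ ν, δθ μ ν •
      (star (a μ) (pdS ν f) + star (a μ) (covF a ν f) +
        cpt2 (subst C (pairS f (app Ah A))) μ ν)

/-- `δθ^{μν} ∂Ψ̂/∂θ^{μν}
  = -(π/2) δθ^{μν} ({Â_μ, ∂_ν Ψ̂ + D_ν Ψ̂}_⋆ + Ĉ_{μν}(Ψ̂, Â))`. -/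
def EqAd {d N : ℕ} (Ah : PotFun d N) (ph : MatFun d N N) (C : CFun d N N) : Prop :=
  ∀ A Ψ, Smooth A → Smooth Ψ →
    ∀ δθ : Fin d → Fin d → ℝ, (∀ μ ν, δθ μ ν = -δθ ν μ) →
    let a := cpt (app Ah A)
    let f := app ph (fun x => (Ψ x, A x))
    dTheta δθ f = (-(Real.pi / 2)) • ∑ μ, ∑ ν, δθ μ ν •
      (acomm (a μ) (pdS ν f + covA a ν f) +
        cpt2 (subst C (pairS f (app Ah A))) μ ν)

/-! ### The constraints

`δ'_ε = δ̂_ε - i 𝓛_ε`, where `δ̂_ε` is the noncommutative gauge variation of a functional induced by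
that of its arguments and `𝓛_ε` is the action of `ε` on the value. The constraints are identities
between formal power series of functionals, so it is enough to impose them for arguments that do
not depend on `θ`. -/

/-- The potential as a family of `θ`-independent power series. -/
def pot {d N : ℕ} (A : Pt d → Fin d → Mat N N) (μ : Fin d) : Ser d (Mat N N) :=
  const (fun x => A x μ)

/-- `δ'_ε D̂_{μνκ}`. -/
def dPrimeD {d N : ℕ} (D : DFun d N) (A : Pt d → Fin d → Mat N N) (ε : Pt d → Mat N N)
    (μ ν κ : Fin d) : Ser d (Mat N N) :=
  cpt3 (variation D A (gaugeA (pot A) (const ε))) μ ν κ -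
    Complex.I • comm (const ε) (cpt3 (app D A) μ ν κ)

/-- `δ'_ε Ĉ_{μν}`, fundamental representation. -/
def dPrimeF {d N : ℕ} (C : CFun d N 1) (A : Pt d → Fin d → Mat N N) (ε : Pt d → Mat N N)
    (φ : Pt d → Mat N 1) (μ ν : Fin d) : Ser d (Mat N 1) :=
  cpt2 (variation C (fun x => (φ x, A x))
      (pairS (gaugeF (const ε) (const φ)) (gaugeA (pot A) (const ε)))) μ ν -
    Complex.I • star (const ε) (cpt2 (app C (fun x => (φ x, A x))) μ ν)

/-- `δ'_ε Ĉ_{μν}`, adjoint representation. -/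
def dPrimeAd {d N : ℕ} (C : CFun d N N) (A : Pt d → Fin d → Mat N N) (ε : Pt d → Mat N N)
    (Ψ : Pt d → Mat N N) (μ ν : Fin d) : Ser d (Mat N N) :=
  cpt2 (variation C (fun x => (Ψ x, A x))
      (pairS (gaugeAd (const ε) (const Ψ)) (gaugeA (pot A) (const ε)))) μ ν -
    Complex.I • comm (const ε) (cpt2 (app C (fun x => (Ψ x, A x))) μ ν)

/-- `δ'_ε D̂_{μνκ}(A) = - D_κ Ê_{μν}(ε, A)`. -/
def ConstrD {d N : ℕ} (D : DFun d N) (E : EFun d N) : Prop :=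
  ∀ A ε, Smooth A → Smooth ε → ∀ μ ν κ,
    dPrimeD D A ε μ ν κ = -covA (pot A) κ (cpt2 (app E (fun x => (ε x, A x))) μ ν)

/-- `δ'_ε Ĉ_{μν}(φ, A) = - i Ê_{μν}(ε, A) ⋆ φ`. -/
def ConstrF {d N : ℕ} (E : EFun d N) (C : CFun d N 1) : Prop :=
  ∀ A ε φ, Smooth A → Smooth ε → Smooth φ → ∀ μ ν,
    dPrimeF C A ε φ μ ν =
      -(Complex.I • star (cpt2 (app E (fun x => (ε x, A x))) μ ν) (const φ))

/-- `δ'_ε Ĉ_{μν}(Ψ, A) = - i [Ê_{μν}(ε, A), Ψ]_⋆`. -/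
def ConstrAd {d N : ℕ} (E : EFun d N) (C : CFun d N N) : Prop :=
  ∀ A ε Ψ, Smooth A → Smooth ε → Smooth Ψ → ∀ μ ν,
    dPrimeAd C A ε Ψ μ ν =
      -(Complex.I • comm (cpt2 (app E (fun x => (ε x, A x))) μ ν) (const Ψ))

/-- `D̂` is an admissible extra term: local, antisymmetric in `μ, ν`. -/
def IsExtraD {d N : ℕ} (D : DFun d N) : Prop := IsLocal D ∧ AntisymmD D

/-- `Ê` is an admissible extra term: local, linear in `ε`, antisymmetric in `μ, ν`. -/
def IsExtraE {d N : ℕ} (E : EFun d N) : Prop :=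
  IsLocal E ∧ IsLinearFst ℝ E ∧ Antisymm2 E

/-- `Ĉ` is an admissible extra term: local, linear in the matter field, antisymmetric in
`μ, ν`. -/
def IsExtraC {d N m : ℕ} (C : CFun d N m) : Prop :=
  IsLocal C ∧ IsLinearFst ℂ C ∧ Antisymm2 C

/-! ### Star polynomials -/

/-- Star polynomials with complex coefficients in the potential `A_μ`, the covariant derivatives
`D_μ` and further letters `L` with values in the adjoint representation. The letter `θ` does not
occur. -/
inductive Word (d : ℕ) (L : Type) : Type
  | A (μ : Fin d) : Word d L
  | letter (l : L) : Word d L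
  | one : Word d L
  | add (w v : Word d L) : Word d L
  | smul (c : ℂ) (w : Word d L) : Word d L
  | mul (w v : Word d L) : Word d L
  | D (μ : Fin d) (w : Word d L) : Word d L

/-- Star polynomials with values in the fundamental representation, in the potential `A_μ`, the
covariant derivatives `D_μ` and the fundamental field `φ`. -/
inductive FWord (d : ℕ) : Type
  | phi : FWord d
  | add (w v : FWord d) : FWord d
  | smul (c : ℂ) (w : FWord d) : FWord d
  | mul (v : Word d Empty) (w : FWord d) : FWord d
  | D (μ : Fin d) (w : FWord d) : FWord d

/-- Value of a star polynomial, given what stands for `A_μ`, for the operators `D_μ` and for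
the other letters. -/
def Word.eval {d N : ℕ} {L : Type} (a : Fin d → Ser d (Mat N N))
    (Dop : Fin d → Ser d (Mat N N) → Ser d (Mat N N)) (l : L → Ser d (Mat N N)) :
    Word d L → Ser d (Mat N N)
  | .A μ => a μ
  | .letter x => l x
  | .one => const (fun _ => 1)
  | .add w v => w.eval a Dop l + v.eval a Dop l
  | .smul c w => c • w.eval a Dop l
  | .mul w v => star (w.eval a Dop l) (v.eval a Dop l)
  | .D μ w => Dop μ (w.eval a Dop l)

/-- Value of a star polynomial in the fundamental representation. -/
def FWord.eval {d N : ℕ} (a : Fin d → Ser d (Mat N N))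
    (Dop : Fin d → Ser d (Mat N N) → Ser d (Mat N N))
    (DopF : Fin d → Ser d (Mat N 1) → Ser d (Mat N 1)) (φ : Ser d (Mat N 1)) :
    FWord d → Ser d (Mat N 1)
  | .phi => φ
  | .add w v => w.eval a Dop DopF φ + v.eval a Dop DopF φ
  | .smul c w => c • w.eval a Dop DopF φ
  | .mul v w => star (v.eval a Dop Empty.elim) (w.eval a Dop DopF φ)
  | .D μ w => DopF μ (w.eval a Dop DopF φ)

/-- The constant coordinate transformation `g` on a family of letters with one lower index. -/
def tr {d : ℕ} {M : Type} [AddCommGroup M] [Module ℝ M]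
    (g : GL (Fin d) ℝ) (a : Fin d → M) (μ : Fin d) : M :=
  ∑ μ', g.1 μ μ' • a μ'

/-- `D̂_{μνκ}` is given by star polynomials in `A_μ, D_μ` that are `GL(d, ℝ)`-covariant: replacing
the letters `A_μ, D_μ` by `g_μ^ν A_ν, g_μ^ν D_ν` transforms the value as a tensor with three lower
indices. -/
def IsCovStarPolyD {d N : ℕ} (D : DFun d N) : Prop :=
  ∃ W : Fin d → Fin d → Fin d → Word d Empty,
    (∀ A, Smooth A → ∀ μ ν κ,
      cpt3 (app D A) μ ν κ = (W μ ν κ).eval (pot A) (covA (pot A)) Empty.elim) ∧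
    ∀ (g : GL (Fin d) ℝ) (A : Pt d → Fin d → Mat N N), Smooth A → ∀ μ ν κ,
      (W μ ν κ).eval (tr g (pot A)) (tr g (covA (pot A))) Empty.elim =
        ∑ μ', ∑ ν', ∑ κ', (g.1 μ μ' * g.1 ν ν' * g.1 κ κ') •
          (W μ' ν' κ').eval (pot A) (covA (pot A)) Empty.elim

/-- `Ê_{μν}(ε, A)`, or `Ĉ_{μν}(Ψ, A)` in the adjoint representation, is given by
`GL(d, ℝ)`-covariant star polynomials in `A_μ, D_μ` and the letter `ε`, or `Ψ`. -/
def IsCovStarPoly2 {d N : ℕ} (E : EFun d N) : Prop :=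
  ∃ W : Fin d → Fin d → Word d Unit,
    (∀ ε A, Smooth ε → Smooth A → ∀ μ ν,
      cpt2 (app E (fun x => (ε x, A x))) μ ν =
        (W μ ν).eval (pot A) (covA (pot A)) (fun _ => const ε)) ∧
    ∀ (g : GL (Fin d) ℝ) (ε : Pt d → Mat N N) (A : Pt d → Fin d → Mat N N),
      Smooth ε → Smooth A → ∀ μ ν,
      (W μ ν).eval (tr g (pot A)) (tr g (covA (pot A))) (fun _ => const ε) =
        ∑ μ', ∑ ν', (g.1 μ μ' * g.1 ν ν') •
          (W μ' ν').eval (pot A) (covA (pot A)) (fun _ => const ε)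

/-- `Ĉ_{μν}(φ, A)` in the fundamental representation is given by `GL(d, ℝ)`-covariant star
polynomials in `A_μ, D_μ, φ`. -/
def IsCovStarPolyF {d N : ℕ} (C : CFun d N 1) : Prop :=
  ∃ W : Fin d → Fin d → FWord d,
    (∀ φ A, Smooth φ → Smooth A → ∀ μ ν,
      cpt2 (app C (fun x => (φ x, A x))) μ ν =
        (W μ ν).eval (pot A) (covA (pot A)) (covF (pot A)) (const φ)) ∧
    ∀ (g : GL (Fin d) ℝ) (φ : Pt d → Mat N 1) (A : Pt d → Fin d → Mat N N),
      Smooth φ → Smooth A → ∀ μ ν,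
      (W μ ν).eval (tr g (pot A)) (tr g (covA (pot A))) (tr g (covF (pot A))) (const φ) =
        ∑ μ', ∑ ν', (g.1 μ μ' * g.1 ν ν') •
          (W μ' ν').eval (pot A) (covA (pot A)) (covF (pot A)) (const φ)

/-- `D̂` is in the class to be classified. -/
def ClassD {d N : ℕ} (D : DFun d N) : Prop := IsCovStarPolyD D ∧ AntisymmD D

/-- `Ê` is in the class to be classified. -/
def ClassE {d N : ℕ} (E : EFun d N) : Prop :=
  IsCovStarPoly2 E ∧ IsLinearFst ℝ E ∧ Antisymm2 E

/-- `Ĉ` in the fundamental representation is in the class to be classified. -/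
def ClassF {d N : ℕ} (C : CFun d N 1) : Prop :=
  IsCovStarPolyF C ∧ IsLinearFst ℂ C ∧ Antisymm2 C

/-- `Ĉ` in the adjoint representation is in the class to be classified. -/
def ClassAd {d N : ℕ} (C : CFun d N N) : Prop :=
  IsCovStarPoly2 C ∧ IsLinearFst ℂ C ∧ Antisymm2 C

/-! ### The explicit solutions -/

/-- `D̂_{μνκ} = α D_κ F_{μν} - β D_κ [A_μ, A_ν]_⋆`. -/
def SolD {d N : ℕ} (α β : ℂ) (D : DFun d N) : Prop :=
  ∀ A, Smooth A → ∀ μ ν κ,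
    cpt3 (app D A) μ ν κ =
      α • covA (pot A) κ (field (pot A) μ ν) -
        β • covA (pot A) κ (comm (pot A μ) (pot A ν))

/-- `Ê_{μν} = β ([∂_μ ε, A_ν]_⋆ - [∂_ν ε, A_μ]_⋆)`. -/
def SolE {d N : ℕ} (β : ℂ) (E : EFun d N) : Prop :=
  ∀ A ε, Smooth A → Smooth ε → ∀ μ ν,
    cpt2 (app E (fun x => (ε x, A x))) μ ν =
      β • (comm (pdS μ (const ε)) (pot A ν) - comm (pdS ν (const ε)) (pot A μ))

/-- `Ĉ_{μν} = -i β [A_μ, A_ν]_⋆ ⋆ φ + γ F_{μν} ⋆ φ`. -/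
def SolF {d N : ℕ} (β γ : ℂ) (C : CFun d N 1) : Prop :=
  ∀ A φ, Smooth A → Smooth φ → ∀ μ ν,
    cpt2 (app C (fun x => (φ x, A x))) μ ν =
      -((Complex.I * β) • star (comm (pot A μ) (pot A ν)) (const φ)) +
        γ • star (field (pot A) μ ν) (const φ)

/-- `Ĉ_{μν} = -i β [[A_μ, A_ν]_⋆, Ψ]_⋆ + γ' F_{μν} ⋆ Ψ + γ̃ Ψ ⋆ F_{μν}`. -/
def SolAd {d N : ℕ} (β γ' γt : ℂ) (C : CFun d N N) : Prop :=
  ∀ A Ψ, Smooth A → Smooth Ψ → ∀ μ ν,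
    cpt2 (app C (fun x => (Ψ x, A x))) μ ν =
      -((Complex.I * β) • comm (comm (pot A μ) (pot A ν)) (const Ψ)) +
        γ' • star (field (pot A) μ ν) (const Ψ) + γt • star (const Ψ) (field (pot A) μ ν)

end SW

end

noncomputable section

namespace SW

set_option linter.unusedSectionVars false
set_option linter.unusedSimpArgs false

open Complex (I)
open ContinuousLinearMap (fst snd proj)
open Finset (sum_congr sum_add_distrib smul_sum mul_sum sum_smul sum_insert sum_eq_single
  mem_univ sum_sub_distrib prod_congr univ mem_insert_self mem_insert_of_mem)
open Finset.HasAntidiagonal (antidiagonal mem_antidiagonal)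
open Finsupp (single)

variable {U V W X : Type} [NormedAddCommGroup U] [NormedSpace ℝ U] [NormedAddCommGroup V]
  [NormedSpace ℝ V] [NormedAddCommGroup W] [NormedSpace ℝ W] [NormedAddCommGroup X]
  [NormedSpace ℝ X]

/-! ### Partial derivatives of smooth functions -/

section PartialDerivatives

variable {ι : Type} [Fintype ι] [DecidableEq ι]

lemma contDiff_differentiable {f : (ι → ℝ) → V} (hf : ContDiff ℝ ∞ f) : Differentiable ℝ f :=
  hf.differentiable (by simp)

lemma contDiff_pd {f : (ι → ℝ) → V} (hf : ContDiff ℝ ∞ f) (i : ι) : ContDiff ℝ ∞ (pd i f) :=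
  (hf.fderiv_right (m := ∞) (by simp)).clm_apply contDiff_const

lemma contDiff_pdL {f : (ι → ℝ) → V} (hf : ContDiff ℝ ∞ f) (l : List ι) :
    ContDiff ℝ ∞ (pdL l f) := by
  induction l with
  | nil => exact hf
  | cons i l ih => exact contDiff_pd ih i

@[simp] lemma pdL_nil (f : (ι → ℝ) → V) : pdL [] f = f := rfl

@[simp] lemma pdL_cons (i : ι) (l : List ι) (f : (ι → ℝ) → V) :
    pdL (i :: l) f = pd i (pdL l f) := rfl

lemma pdL_append (l l' : List ι) (f : (ι → ℝ) → V) : pdL (l ++ l') f = pdL l (pdL l' f) := by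
  simp [pdL, List.foldr_append]

lemma pd_add {f g : (ι → ℝ) → V} (hf : ContDiff ℝ ∞ f) (hg : ContDiff ℝ ∞ g) (i : ι) :
    pd i (f + g) = pd i f + pd i g := by
  ext1 x
  simp [pd, fderiv_add (contDiff_differentiable hf x) (contDiff_differentiable hg x)]

lemma pdL_add {f g : (ι → ℝ) → V} (hf : ContDiff ℝ ∞ f) (hg : ContDiff ℝ ∞ g) (l : List ι) :
    pdL l (f + g) = pdL l f + pdL l g := by
  induction l with
  | nil => rfl
  | cons i l ih => simp [ih, pd_add (contDiff_pdL hf l) (contDiff_pdL hg l)]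

lemma pd_smul {R : Type} [Semiring R] [Module R V] [SMulCommClass ℝ R V]
    [ContinuousConstSMul R V] {f : (ι → ℝ) → V} (hf : ContDiff ℝ ∞ f) (c : R) (i : ι) :
    pd i (c • f) = c • pd i f := by
  ext1 x
  simp [pd, fderiv_const_smul (contDiff_differentiable hf x) c]

lemma contDiff_smul {R : Type} [Semiring R] [Module R V] [SMulCommClass ℝ R V]
    [ContinuousConstSMul R V] {f : (ι → ℝ) → V} (hf : ContDiff ℝ ∞ f) (c : R) :
    ContDiff ℝ ∞ (c • f) := hf.const_smul c

lemma pdL_smul {R : Type} [Semiring R] [Module R V] [SMulCommClass ℝ R V]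
    [ContinuousConstSMul R V] {f : (ι → ℝ) → V} (hf : ContDiff ℝ ∞ f) (c : R) (l : List ι) :
    pdL l (c • f) = c • pdL l f := by
  induction l with
  | nil => rfl
  | cons i l ih => simp [ih, pd_smul (contDiff_pdL hf l)]

@[simp] lemma pd_const (c : V) (i : ι) : pd i (fun _ : ι → ℝ => c) = 0 := by
  ext1 x; simp [pd]

@[simp] lemma pd_zero (i : ι) : pd i (0 : (ι → ℝ) → V) = 0 := pd_const 0 i

@[simp] lemma pdL_zero (l : List ι) : pdL l (0 : (ι → ℝ) → V) = 0 := by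
  induction l with
  | nil => rfl
  | cons i l ih => simp [ih]

lemma contDiff_sum {κ : Type} {s : Finset κ} {f : κ → (ι → ℝ) → V}
    (hf : ∀ k ∈ s, ContDiff ℝ ∞ (f k)) : ContDiff ℝ ∞ (∑ k ∈ s, f k) := by
  have := ContDiff.sum (𝕜 := ℝ) (f := f) (s := s) (n := ∞) hf
  convert this using 1
  ext1 x; simp

lemma pdL_sum {κ : Type} {s : Finset κ} {f : κ → (ι → ℝ) → V}
    (hf : ∀ k ∈ s, ContDiff ℝ ∞ (f k)) (l : List ι) :
    pdL l (∑ k ∈ s, f k) = ∑ k ∈ s, pdL l (f k) := by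
  classical
  induction s using Finset.induction_on with
  | empty => simp
  | insert a s ha ih =>
    have h2 : ∀ k ∈ s, ContDiff ℝ ∞ (f k) := fun k hk => hf k (mem_insert_of_mem hk)
    rw [sum_insert ha, sum_insert ha,
      pdL_add (hf a (mem_insert_self a s)) (contDiff_sum h2), ih h2]

lemma pd_comm {f : (ι → ℝ) → V} (hf : ContDiff ℝ ∞ f) (i j : ι) :
    pd i (pd j f) = pd j (pd i f) := by
  ext1 x
  have hd : DifferentiableAt ℝ (fderiv ℝ f) x :=
    (hf.fderiv_right (m := ∞) (by simp)).differentiable (by simp) x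
  have key : ∀ a b : ι, pd a (pd b f) x =
      fderiv ℝ (fderiv ℝ f) x (Pi.single a 1) (Pi.single b 1) := by
    intro a b
    unfold pd
    rw [fderiv_clm_apply hd (differentiableAt_const _)]
    simp
  rw [key, key]
  have hs : IsSymmSndFDerivAt ℝ f x :=
    (hf.contDiffAt).isSymmSndFDerivAt (by
      rw [minSmoothness_of_isRCLikeNormedField]; exact WithTop.coe_le_coe.mpr (le_top : (2 : ℕ∞) ≤ ⊤))
  exact hs _ _

lemma pdL_perm {f : (ι → ℝ) → V} (hf : ContDiff ℝ ∞ f) {l l' : List ι} (h : l.Perm l') :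
    pdL l f = pdL l' f := by
  induction h with
  | nil => rfl
  | cons i _ ih => simp [ih]
  | swap i j l => simp [pd_comm (contDiff_pdL hf l)]
  | trans _ _ h1 h2 => exact h1.trans h2

lemma pdL_pd {f : (ι → ℝ) → V} (hf : ContDiff ℝ ∞ f) (l : List ι) (i : ι) :
    pdL l (pd i f) = pd i (pdL l f) := by
  have h := pdL_perm hf (List.perm_append_singleton i l)
  rwa [pdL_append] at h

lemma pd_clm (L : V →L[ℝ] W) {f : (ι → ℝ) → V} (hf : ContDiff ℝ ∞ f) (i : ι) :
    pd i (fun x => L (f x)) = fun x => L (pd i f x) := by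
  ext1 x
  unfold pd
  have := (L.hasFDerivAt.comp x (contDiff_differentiable hf x).hasFDerivAt).fderiv
  erw [this]
  rfl

lemma pdL_clm (L : V →L[ℝ] W) {f : (ι → ℝ) → V} (hf : ContDiff ℝ ∞ f) (l : List ι) :
    pdL l (fun x => L (f x)) = fun x => L (pdL l f x) := by
  induction l with
  | nil => rfl
  | cons i l ih => rw [pdL_cons, ih, pd_clm L (contDiff_pdL hf l)]; rfl

lemma pdL_pair {f : (ι → ℝ) → V} {g : (ι → ℝ) → W} (hf : ContDiff ℝ ∞ f)
    (hg : ContDiff ℝ ∞ g) (l : List ι) (x : ι → ℝ) :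
    pdL l (fun y => (f y, g y)) x = (pdL l f x, pdL l g x) := by
  have h := hf.prodMk hg
  have h1 := congrFun (pdL_clm (fst ℝ V W) h l) x
  have h2 := congrFun (pdL_clm (snd ℝ V W) h l) x
  exact Prod.ext h1.symm h2.symm

lemma pd_comp {g : V → W} (hg : ContDiff ℝ ∞ g) {c : (ι → ℝ) → V} (hc : ContDiff ℝ ∞ c)
    (i : ι) (x : ι → ℝ) : pd i (fun t => g (c t)) x = fderiv ℝ g (c x) (pd i c x) := by
  unfold pd
  have := ((hg.differentiable (by simp) (c x)).hasFDerivAt.comp x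
    (contDiff_differentiable hc x).hasFDerivAt).fderiv
  erw [this]
  rfl

/-- The mixed partial derivative with multi-index `K`. -/
def pdM (K : ι →₀ ℕ) (f : (ι → ℝ) → V) : (ι → ℝ) → V := pdL (Finsupp.toMultiset K).toList f

@[simp] lemma pdM_zero (f : (ι → ℝ) → V) : pdM 0 f = f := by simp [pdM]

lemma pdM_add_single {f : (ι → ℝ) → V} (hf : ContDiff ℝ ∞ f) (K : ι →₀ ℕ) (i : ι) :
    pdM (K + single i 1) f = pdM K (pd i f) := by
  have h : (Finsupp.toMultiset (K + single i 1)).toList.Perm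
      ((Finsupp.toMultiset K).toList ++ [i]) := by
    rw [← Multiset.coe_eq_coe]
    simp [← Multiset.coe_add]
  unfold pdM
  rw [pdL_perm hf h, pdL_append]
  rfl

lemma exists_add_single {K : ι →₀ ℕ} (h : K ≠ 0) :
    ∃ (L : ι →₀ ℕ) (i : ι), K = L + single i 1 := by
  obtain ⟨i, hi⟩ := Finsupp.ne_iff.mp h
  refine ⟨K - single i 1, i, (tsub_add_cancel_of_le ?_).symm⟩
  rw [Finsupp.single_le_iff]
  exact Nat.one_le_iff_ne_zero.mpr hi

lemma monomial_induction {P : (ι →₀ ℕ) → Prop} (h0 : P 0)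
    (hs : ∀ K i, P K → P (K + single i 1)) (K : ι →₀ ℕ) : P K := by
  induction hn : K.degree generalizing K with
  | zero => rw [(Finsupp.degree_eq_zero_iff K).mp hn]; exact h0
  | succ n ih =>
    obtain ⟨L, i, rfl⟩ := exists_add_single (K := K) (by rintro rfl; simp at hn)
    refine hs L i (ih L ?_)
    simp [Finsupp.degree_single] at hn
    omega

end PartialDerivatives

/-! ### Taylor coefficients of composite functions -/

section Jets

variable {ι : Type} [Fintype ι] [DecidableEq ι]

/-- The tangent map of `g`, without the base point. -/
def tangent (g : V → W) : V × V → W := fun p => fderiv ℝ g p.1 p.2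

lemma contDiff_tangent {g : V → W} (hg : ContDiff ℝ ∞ g) : ContDiff ℝ ∞ (tangent g) :=
  ((hg.fderiv_right (m := ∞) (by simp)).comp contDiff_fst).clm_apply contDiff_snd

lemma pdM_pair {f : (ι → ℝ) → V} {g : (ι → ℝ) → W} (hf : ContDiff ℝ ∞ f)
    (hg : ContDiff ℝ ∞ g) (K : ι →₀ ℕ) (x : ι → ℝ) :
    pdM K (fun y => (f y, g y)) x = (pdM K f x, pdM K g x) := pdL_pair hf hg _ x

/-- The Taylor coefficients of `g ∘ c` up to `K` depend only on those of `c`. -/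
lemma pdM_comp_congr (K : ι →₀ ℕ) : ∀ (V W : Type) [NormedAddCommGroup V] [NormedSpace ℝ V]
    [NormedAddCommGroup W] [NormedSpace ℝ W] (g : V → W) (c c' : (ι → ℝ) → V),
    ContDiff ℝ ∞ g → ContDiff ℝ ∞ c → ContDiff ℝ ∞ c' →
    (∀ M ≤ K, pdM M c 0 = pdM M c' 0) →
    pdM K (fun t => g (c t)) 0 = pdM K (fun t => g (c' t)) 0 := by
  induction K using monomial_induction with
  | h0 =>
    intro V W _ _ _ _ g c c' _ _ _ h
    have := h 0 le_rfl
    simp only [pdM_zero] at this ⊢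
    rw [this]
  | hs K i ih =>
    intro V W _ _ _ _ g c c' hg hc hc' h
    have key : ∀ c : (ι → ℝ) → V, ContDiff ℝ ∞ c → pdM (K + single i 1)
        (fun t => g (c t)) 0 = pdM K (fun t => tangent g (c t, pd i c t)) 0 := by
      intro c hc
      rw [pdM_add_single (f := fun t => g (c t)) (hg.comp hc)]
      congr 1
      ext1 t
      exact pd_comp hg hc i t
    rw [key c hc, key c' hc']
    refine ih (V × V) W (tangent g) _ _ (contDiff_tangent hg) (hc.prodMk (contDiff_pd hc i))
      (hc'.prodMk (contDiff_pd hc' i)) fun M hM => ?_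
    rw [pdM_pair hc (contDiff_pd hc i), pdM_pair hc' (contDiff_pd hc' i),
      ← pdM_add_single hc, ← pdM_add_single hc', h M (hM.trans le_self_add),
      h (M + single i 1) (by gcongr)]

/-- The monomial `t ^ L`. -/
def monoFn (L : ι →₀ ℕ) (t : ι → ℝ) : ℝ := ∏ p, t p ^ L p

lemma contDiff_monoFn (L : ι →₀ ℕ) : ContDiff ℝ ∞ (monoFn L) := by
  unfold monoFn
  fun_prop

lemma pd_monoFn (L : ι →₀ ℕ) (i : ι) :
    pd i (monoFn L) = (L i : ℝ) • monoFn (L - single i 1) := by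
  ext1 t
  unfold pd
  rw [← (contDiff_differentiable (contDiff_monoFn L) t).lineDeriv_eq_fderiv, lineDeriv]
  have h : ∀ (M : ι →₀ ℕ) (s : ℝ), monoFn M (t + s • Pi.single i 1) =
      (t i + s) ^ M i * ∏ p ∈ univ.erase i, t p ^ M p := by
    intro M s
    unfold monoFn
    rw [← Finset.mul_prod_erase _ _ (mem_univ i)]
    congr 1
    · simp
    · refine prod_congr rfl fun p hp => ?_
      simp [Pi.single_eq_of_ne (Finset.ne_of_mem_erase hp)]
  have h0 := h (L - single i 1) 0
  simp only [zero_smul, add_zero] at h0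
  simp only [h, Pi.smul_apply, smul_eq_mul, h0]
  have hprod : ∏ p ∈ univ.erase i, t p ^ (L - single i 1 : ι →₀ ℕ) p =
      ∏ p ∈ univ.erase i, t p ^ L p := by
    refine prod_congr rfl fun p hp => ?_
    simp [Finsupp.single_eq_of_ne (Finset.ne_of_mem_erase hp)]
  rw [hprod]
  have hd : HasDerivAt (fun s : ℝ => (t i + s) ^ L i) ((L i : ℝ) * t i ^ (L i - 1)) 0 := by
    have := ((hasDerivAt_id' (0 : ℝ)).const_add (t i)).fun_pow (L i)
    simpa using this
  rw [(hd.mul_const _).deriv]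
  simp [mul_assoc]

/-- The product of factorials `L!`. -/
def mfact (L : ι →₀ ℕ) : ℝ := ∏ p, (Nat.factorial (L p) : ℝ)

lemma mfact_ne_zero (L : ι →₀ ℕ) : mfact L ≠ 0 :=
  Finset.prod_ne_zero_iff.mpr fun p _ => by exact_mod_cast Nat.factorial_ne_zero _

lemma mfact_add_single (L : ι →₀ ℕ) (i : ι) :
    mfact (L + single i 1) = ((L i : ℝ) + 1) * mfact L := by
  unfold mfact
  rw [← Finset.mul_prod_erase _ _ (mem_univ i),
    ← Finset.mul_prod_erase _ (fun p => (Nat.factorial (L p) : ℝ)) (mem_univ i)]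
  have : ∏ p ∈ univ.erase i, (Nat.factorial ((L + single i 1 : ι →₀ ℕ) p) : ℝ) =
      ∏ p ∈ univ.erase i, (Nat.factorial (L p) : ℝ) := by
    refine prod_congr rfl fun p hp => ?_
    simp [Finsupp.single_eq_of_ne (Finset.ne_of_mem_erase hp)]
  rw [this]
  simp [Nat.factorial_succ]
  ring

lemma pdM_smul {R : Type} [Semiring R] [Module R V] [SMulCommClass ℝ R V]
    [ContinuousConstSMul R V] {f : (ι → ℝ) → V} (hf : ContDiff ℝ ∞ f) (c : R) (K : ι →₀ ℕ) :
    pdM K (c • f) = c • pdM K f := pdL_smul hf c _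

lemma pdM_add {f g : (ι → ℝ) → V} (hf : ContDiff ℝ ∞ f) (hg : ContDiff ℝ ∞ g) (K : ι →₀ ℕ) :
    pdM K (f + g) = pdM K f + pdM K g := pdL_add hf hg _

lemma pdM_monoFn (M L : ι →₀ ℕ) : pdM M (monoFn L) 0 = if M = L then mfact L else 0 := by
  induction M using monomial_induction generalizing L with
  | h0 =>
    simp only [pdM_zero]
    split_ifs with h
    · subst h; simp [monoFn, mfact]
    · obtain ⟨i, hi⟩ := Finsupp.ne_iff.mp (Ne.symm h)
      exact Finset.prod_eq_zero (mem_univ i) (by simpa using hi)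
  | hs M i ih =>
    rw [pdM_add_single (contDiff_monoFn L), pd_monoFn, pdM_smul (contDiff_monoFn _),
      Pi.smul_apply, ih]
    by_cases hL : L i = 0
    · have : M + single i 1 ≠ L := by
        rintro rfl; simp at hL
      simp [hL, this]
    · have hle : single i 1 ≤ L := by
        rw [Finsupp.single_le_iff]; exact Nat.one_le_iff_ne_zero.mpr hL
      have hiff : M = L - single i 1 ↔ M + single i 1 = L :=
        (eq_tsub_iff_add_eq_of_le hle)
      by_cases h : M + single i 1 = L
      · subst h
        simp [mfact_add_single]
      · simp [h, hiff]

/-- The polynomial curve with given Taylor coefficients, truncated at `K`. -/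
def polyCurve (K : ι →₀ ℕ) (j : (ι →₀ ℕ) → V) (t : ι → ℝ) : V :=
  ∑ L ∈ Finset.Iic K, (∏ p, t p ^ L p) • j L

lemma contDiff_polyCurve (K : ι →₀ ℕ) (j : (ι →₀ ℕ) → V) : ContDiff ℝ ∞ (polyCurve K j) := by
  unfold polyCurve
  fun_prop

lemma pdM_polyCurve {K M : ι →₀ ℕ} (h : M ≤ K) (j : (ι →₀ ℕ) → V) :
    pdM M (polyCurve K j) 0 = mfact M • j M := by
  have h1 : polyCurve K j = ∑ L ∈ Finset.Iic K,
      fun t => (ContinuousLinearMap.toSpanSingleton ℝ (j L)) (monoFn L t) := by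
    ext1 t; simp [polyCurve, monoFn]
  have h2 : ∀ L, ContDiff ℝ ∞
      (fun t => (ContinuousLinearMap.toSpanSingleton ℝ (j L)) (monoFn L t)) := fun L =>
    (ContinuousLinearMap.contDiff _).comp (contDiff_monoFn L)
  unfold pdM
  rw [h1, pdL_sum (fun L _ => h2 L)]
  simp only [pdL_clm _ (contDiff_monoFn _), Finset.sum_apply]
  have h3 : ∀ L, pdL (Finsupp.toMultiset M).toList (monoFn L) 0 =
    if M = L then mfact L else 0 := pdM_monoFn M
  simp only [h3, ContinuousLinearMap.toSpanSingleton_apply]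
  rw [sum_eq_single M]
  · simp
  · intro L _ hL; simp [hL.symm]
  · intro hM; exact absurd (Finset.mem_Iic.mpr h) hM

end Jets

/-! ### Local functionals -/

section Local

variable {d : ℕ}

/-- A single local functional. -/
def Loc (G : (Pt d → V) → Pt d → W) : Prop :=
  ∃ (S : Finset (List (Fin d))) (g : (S → V) → W), ContDiff ℝ ∞ g ∧
    ∀ u : Pt d → V, Smooth u → ∀ x, G u x = g (fun l => pdL l.1 u x)

/-- Series of smooth functions. -/
def SmoothS (u : Ser d V) : Prop := ∀ J, Smooth (u J)

/-- The derivative of `G` at `u` in the direction `v`, as a functional of the pair `(u, v)`. -/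
def d1 (G : (Pt d → V) → Pt d → W) : (Pt d → V × V) → Pt d → W :=
  fun w x => deriv (fun s : ℝ => G (fun y => (w y).1 + s • (w y).2) x) 0

/-- The coefficientwise derivative of a functional. -/
def dFun (F : Fun d V W) : Fun d (V × V) W := fun J => d1 (F J)

/-- The derivative with respect to the component `p` of `θ`. -/
def dT {M : Type} [AddCommGroup M] [Module ℝ M] (p : Idx d) (f : Mon d → M) : Mon d → M :=
  fun J => ((J p : ℝ) + 1) • f (J + single p 1)

lemma smooth_fst {w : Pt d → V × W} (h : Smooth w) : Smooth (fun y => (w y).1) :=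
  contDiff_fst.comp h

lemma smooth_snd {w : Pt d → V × W} (h : Smooth w) : Smooth (fun y => (w y).2) :=
  contDiff_snd.comp h

lemma smooth_pair {u : Pt d → V} {v : Pt d → W} (hu : Smooth u) (hv : Smooth v) :
    Smooth (fun y => (u y, v y)) := ContDiff.prodMk hu hv

lemma Loc.congr {G H : (Pt d → V) → Pt d → W} (hG : Loc G)
    (h : ∀ u, Smooth u → H u = G u) : Loc H := by
  obtain ⟨S, g, hg, hr⟩ := hG
  exact ⟨S, g, hg, fun u hu x => by rw [h u hu, hr u hu]⟩

lemma jet_line {w : Pt d → V × V} (hw : Smooth w) (s : ℝ) (l : List (Fin d)) (x : Pt d) :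
    pdL l (fun y => (w y).1 + s • (w y).2) x =
      pdL l (fun y => (w y).1) x + s • pdL l (fun y => (w y).2) x := by
  have h2 : ContDiff ℝ ∞ (s • fun y => (w y).2) := contDiff_smul (smooth_snd hw) s
  have := congrFun (pdL_add (smooth_fst hw) h2 l) x
  rw [pdL_smul (smooth_snd hw)] at this
  exact this

lemma hasDerivAt_line {G : (Pt d → V) → Pt d → W} {S : Finset (List (Fin d))}
    {g : (S → V) → W} (hg : ContDiff ℝ ∞ g)
    (hr : ∀ u : Pt d → V, Smooth u → ∀ x, G u x = g (fun l => pdL l.1 u x))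
    {w : Pt d → V × V} (hw : Smooth w) (x : Pt d) :
    HasDerivAt (fun s : ℝ => G (fun y => (w y).1 + s • (w y).2) x)
      (tangent g (fun l => pdL l.1 (fun y => (w y).1) x, fun l => pdL l.1 (fun y => (w y).2) x)) 0 := by
  have hsm : ∀ s : ℝ, Smooth (fun y => (w y).1 + s • (w y).2) := fun s =>
    ContDiff.add (smooth_fst hw) (contDiff_smul (smooth_snd hw) s)
  have h1 : (fun s : ℝ => G (fun y => (w y).1 + s • (w y).2) x) = fun s : ℝ =>
      g ((fun l : S => pdL l.1 (fun y => (w y).1) x) +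
        s • (fun l : S => pdL l.1 (fun y => (w y).2) x)) := by
    ext1 s
    rw [hr _ (hsm s)]
    congr 1
    ext1 l
    exact jet_line hw s l.1 x
  rw [h1]
  set a : S → V := fun l => pdL l.1 (fun y => (w y).1) x
  set b : S → V := fun l => pdL l.1 (fun y => (w y).2) x
  have hc : HasDerivAt (fun s : ℝ => a + s • b) b 0 := by
    simpa using ((hasDerivAt_id (0 : ℝ)).smul_const b).const_add a
  have hg' : HasFDerivAt g (fderiv ℝ g a) (a + (0 : ℝ) • b) := by
    simpa using (hg.differentiable (by simp) a).hasFDerivAt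
  exact hg'.comp_hasDerivAt (0 : ℝ) hc

lemma d1_eq {G : (Pt d → V) → Pt d → W} {S : Finset (List (Fin d))}
    {g : (S → V) → W} (hg : ContDiff ℝ ∞ g)
    (hr : ∀ u : Pt d → V, Smooth u → ∀ x, G u x = g (fun l => pdL l.1 u x))
    {w : Pt d → V × V} (hw : Smooth w) (x : Pt d) :
    d1 G w x = tangent g (fun l => pdL l.1 (fun y => (w y).1) x,
      fun l => pdL l.1 (fun y => (w y).2) x) :=
  (hasDerivAt_line hg hr hw x).deriv

/-- The linear map from jets of pairs to pairs of jets. -/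
def unzipL (S : Type) [Fintype S] : (S → V × W) →L[ℝ] (S → V) × (S → W) :=
  (ContinuousLinearMap.pi fun l => (fst ℝ V W).comp
    (proj l)).prod
  (ContinuousLinearMap.pi fun l => (snd ℝ V W).comp
    (proj l))

@[simp] lemma unzipL_apply (S : Type) [Fintype S] (c : S → V × W) :
    unzipL S c = (fun l => (c l).1, fun l => (c l).2) := rfl

lemma jet_fst {w : Pt d → V × W} (hw : Smooth w) (l : List (Fin d)) (x : Pt d) :
    (pdL l w x).1 = pdL l (fun y => (w y).1) x :=
  (congrFun (pdL_clm (fst ℝ V W) hw l) x).symm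

lemma jet_snd {w : Pt d → V × W} (hw : Smooth w) (l : List (Fin d)) (x : Pt d) :
    (pdL l w x).2 = pdL l (fun y => (w y).2) x :=
  (congrFun (pdL_clm (snd ℝ V W) hw l) x).symm

lemma d1_rep {G : (Pt d → V) → Pt d → W} {S : Finset (List (Fin d))}
    {g : (S → V) → W} (hg : ContDiff ℝ ∞ g)
    (hr : ∀ u : Pt d → V, Smooth u → ∀ x, G u x = g (fun l => pdL l.1 u x)) :
    ∀ w : Pt d → V × V, Smooth w → ∀ x,
      d1 G w x = (fun c => tangent g (unzipL S c)) (fun l => pdL l.1 w x) := by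
  intro w hw x
  rw [d1_eq hg hr hw]
  simp only [unzipL_apply, jet_fst hw, jet_snd hw]

lemma Loc.d1 {G : (Pt d → V) → Pt d → W} (hG : Loc G) : Loc (SW.d1 G) := by
  obtain ⟨S, g, hg, hr⟩ := hG
  exact ⟨S, fun c => tangent g (unzipL S c), (contDiff_tangent hg).comp
    (unzipL (V := V) (W := V) S).contDiff,
    d1_rep hg hr⟩

lemma taylor_eq {K : Mon d} {G : (Pt d → V) → Pt d → W} {S : Finset (List (Fin d))}
    {g : (S → V) → W} (hr : ∀ u : Pt d → V, Smooth u → ∀ x, G u x = g (fun l => pdL l.1 u x))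
    {u : Ser d V} (hu : SmoothS u) (x : Pt d) :
    taylor K G u x = (mfact K)⁻¹ •
      pdM K (fun t => g (polyCurve K (fun L (l : S) => pdL l.1 (u L) x) t)) 0 := by
  unfold taylor pdM mfact
  have h1 : (fun t : Idx d → ℝ => G (fun y => ∑ L ∈ Finset.Iic K, (∏ p, t p ^ L p) • u L y) x) =
      fun t => g (polyCurve K (fun L (l : S) => pdL l.1 (u L) x) t) := by
    ext1 t
    have hs : ∀ L ∈ Finset.Iic K, ContDiff ℝ ∞ ((∏ p : Idx d, t p ^ L p) • u L) :=
      fun L _ => contDiff_smul (hu L) _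
    have he : (fun y => ∑ L ∈ Finset.Iic K, (∏ p, t p ^ L p) • u L y) =
        ∑ L ∈ Finset.Iic K, (∏ p : Idx d, t p ^ L p) • u L := by
      ext1 y; simp
    rw [he, hr _ (contDiff_sum hs)]
    congr 1
    ext1 l
    rw [pdL_sum hs]
    simp [polyCurve, pdL_smul (hu _)]
  rw [h1]

lemma taylor_eq_of_curve {K : Mon d} {G : (Pt d → V) → Pt d → W} {S : Finset (List (Fin d))}
    {g : (S → V) → W} (hg : ContDiff ℝ ∞ g)
    (hr : ∀ u : Pt d → V, Smooth u → ∀ x, G u x = g (fun l => pdL l.1 u x))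
    {u : Ser d V} (hu : SmoothS u) (x : Pt d) {c : (Idx d → ℝ) → S → V} (hc : ContDiff ℝ ∞ c)
    (h : ∀ M ≤ K, pdM M c 0 = mfact M • fun l : S => pdL l.1 (u M) x) :
    taylor K G u x = (mfact K)⁻¹ • pdM K (fun t => g (c t)) 0 := by
  rw [taylor_eq hr hu]
  congr 1
  refine pdM_comp_congr K _ _ g _ _ hg (contDiff_polyCurve _ _) hc fun M hM => ?_
  rw [pdM_polyCurve hM, h M hM]

lemma smoothS_pairS {u : Ser d V} {v : Ser d W} (hu : SmoothS u) (hv : SmoothS v) :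
    SmoothS (pairS u v) := fun J => smooth_pair (hu J) (hv J)

lemma smoothS_dT {u : Ser d V} (hu : SmoothS u) (p : Idx d) : SmoothS (dT p u) :=
  fun _ => contDiff_smul (hu _) _

lemma pdL_dT {u : Ser d V} (hu : SmoothS u) (p : Idx d) (M : Mon d) (l : List (Fin d))
    (x : Pt d) : pdL l (dT p u M) x =
      ((M p : ℝ) + 1) • pdL l (u (M + single p 1)) x := by
  unfold dT
  rw [pdL_smul (hu _)]
  rfl

lemma taylor_add_single {G : (Pt d → V) → Pt d → W} (hG : Loc G) {u : Ser d V}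
    (hu : SmoothS u) (K : Mon d) (p : Idx d) :
    ((K p : ℝ) + 1) • taylor (K + single p 1) G u =
      taylor K (d1 G) (pairS u (dT p u)) := by
  obtain ⟨S, g, hg, hr⟩ := hG
  ext1 x
  rw [Pi.smul_apply, taylor_eq hr hu]
  set c := polyCurve (K + single p 1) (fun L (l : S) => pdL l.1 (u L) x) with hcdef
  have hc : ContDiff ℝ ∞ c := contDiff_polyCurve _ _
  let zipL : (S → V) × (S → V) →L[ℝ] (S → V × V) :=
    ContinuousLinearMap.pi fun l =>
      ((proj l).comp (fst ℝ (S → V) (S → V))).prod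
      ((proj l).comp (snd ℝ (S → V) (S → V)))
  have hc2 := hc.prodMk (contDiff_pd hc p)
  have hzip : ∀ M ≤ K, pdM M (fun t => zipL (c t, pd p c t)) 0 =
      mfact M • fun l : S => pdL l.1 (pairS u (dT p u) M) x := by
    intro M hM
    have h1 : pdM M (fun t => zipL (c t, pd p c t)) 0 = zipL (pdM M (fun t => (c t, pd p c t)) 0) :=
      congrFun (pdL_clm zipL hc2 _) 0
    rw [h1, pdM_pair hc (contDiff_pd hc p), ← pdM_add_single hc,
      pdM_polyCurve (hM.trans le_self_add), pdM_polyCurve (by gcongr), mfact_add_single]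
    ext1 l
    have h2 : pdL l.1 (pairS u (dT p u) M) x = (pdL l.1 (u M) x, pdL l.1 (dT p u M) x) :=
      pdL_pair (hu M) (smoothS_dT hu p M) _ x
    simp only [Pi.smul_apply, h2, pdL_dT hu]
    simp [zipL, mul_comm, mul_smul]
  rw [taylor_eq_of_curve (g := fun c => tangent g (unzipL S c))
    ((contDiff_tangent hg).comp
    (unzipL (V := V) (W := V) S).contDiff) (d1_rep hg hr)
    (smoothS_pairS hu (smoothS_dT hu p)) x (c := fun t => zipL (c t, pd p c t))
    (zipL.contDiff.comp hc2) hzip, pdM_add_single (f := fun t => g (c t)) (hg.comp hc),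
    mfact_add_single, mul_inv, smul_smul, ← mul_assoc, mul_inv_cancel₀ (by positivity), one_mul]
  congr 2
  ext1 t
  exact pd_comp hg hc p t

lemma taylor_zero {G : (Pt d → V) → Pt d → W} (u : Ser d V) : taylor 0 G u = G (u 0) := by
  ext1 x
  simp only [taylor]
  have h : (Finset.Iic (0 : Mon d)) = {0} := by
    ext L; simp
  simp [h]

/-- The polynomial family of fields attached to a series. -/
def family (K : Mon d) (u : Ser d V) (t : Idx d → ℝ) : Pt d → V :=
  fun y => ∑ L ∈ Finset.Iic K, (∏ p, t p ^ L p) • u L y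

lemma smooth_family {u : Ser d V} (hu : SmoothS u) (K : Mon d) (t : Idx d → ℝ) :
    Smooth (family K u t) := by
  have : family K u t = ∑ L ∈ Finset.Iic K, (∏ p : Idx d, t p ^ L p) • u L := by
    ext1 y; simp [family]
  rw [this]
  exact contDiff_sum fun L _ => contDiff_smul (hu L) _

lemma pdL_family {u : Ser d V} (hu : SmoothS u) (K : Mon d) (t : Idx d → ℝ) (l : List (Fin d))
    (x : Pt d) : pdL l (family K u t) x = polyCurve K (fun L => pdL l (u L) x) t := by
  have : family K u t = ∑ L ∈ Finset.Iic K, (∏ p : Idx d, t p ^ L p) • u L := by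
    ext1 y; simp [family]
  rw [this, pdL_sum fun L _ => contDiff_smul (hu L) _]
  simp [polyCurve, pdL_smul (hu _)]

lemma taylor_def (K : Mon d) (G : (Pt d → V) → Pt d → W) (u : Ser d V) (x : Pt d) :
    taylor K G u x = (mfact K)⁻¹ • pdM K (fun t => G (family K u t) x) 0 := rfl

lemma contDiff_along_family {G : (Pt d → V) → Pt d → W} (hG : Loc G) {u : Ser d V}
    (hu : SmoothS u) (K : Mon d) (x : Pt d) : ContDiff ℝ ∞ (fun t => G (family K u t) x) := by
  obtain ⟨S, g, hg, hr⟩ := hG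
  have : (fun t => G (family K u t) x) =
      fun t => g (polyCurve K (fun L (l : S) => pdL l.1 (u L) x) t) := by
    ext1 t
    rw [hr _ (smooth_family hu K t)]
    congr 1
    ext1 l
    rw [pdL_family hu]
    simp [polyCurve]
  rw [this]
  exact hg.comp (contDiff_polyCurve _ _)

lemma taylor_add {G H : (Pt d → V) → Pt d → W} (hG : Loc G) (hH : Loc H) {u : Ser d V}
    (hu : SmoothS u) (K : Mon d) : taylor K (G + H) u = taylor K G u + taylor K H u := by
  ext1 x
  rw [Pi.add_apply, taylor_def, taylor_def, taylor_def, ← smul_add, ← Pi.add_apply (pdM K _),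
    ← pdM_add (contDiff_along_family hG hu K x) (contDiff_along_family hH hu K x)]
  rfl

lemma taylor_smul {R : Type} [Semiring R] [Module R W] [SMulCommClass ℝ R W]
    [ContinuousConstSMul R W] {G : (Pt d → V) → Pt d → W} (hG : Loc G) {u : Ser d V}
    (hu : SmoothS u) (K : Mon d) (c : R) : taylor K (c • G) u = c • taylor K G u := by
  ext1 x
  have := SMulCommClass.symm ℝ R W
  rw [Pi.smul_apply, taylor_def, taylor_def, smul_comm c,
    ← Pi.smul_apply c (pdM K _), ← pdM_smul (contDiff_along_family hG hu K x)]
  rfl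

lemma taylor_congr {G H : (Pt d → V) → Pt d → W} (h : ∀ u, Smooth u → G u = H u)
    {u : Ser d V} (hu : SmoothS u) (K : Mon d) : taylor K G u = taylor K H u := by
  ext1 x
  rw [taylor_def, taylor_def]
  congr 2
  ext1 t
  rw [h _ (smooth_family hu K t)]

lemma taylor_congr_right {G : (Pt d → V) → Pt d → W} {u v : Ser d V} {K : Mon d}
    (h : ∀ L ≤ K, u L = v L) : taylor K G u = taylor K G v := by
  ext1 x
  rw [taylor_def, taylor_def]
  have : family K u = family K v := by
    ext t y
    exact sum_congr rfl fun L hL => by rw [h L (Finset.mem_Iic.mp hL)]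
  rw [this]

lemma d1_congr {G H : (Pt d → V) → Pt d → W} (h : ∀ u, Smooth u → G u = H u)
    {w : Pt d → V × V} (hw : Smooth w) : d1 G w = d1 H w := by
  ext1 x
  unfold d1
  congr 1
  ext1 s
  rw [h]
  exact ContDiff.add (smooth_fst hw) (contDiff_smul (smooth_snd hw) s)

/-! ### The Leibniz rule for substitution of series -/

lemma sum_antidiagonal_add_single {M : Type} [AddCommGroup M] [Module ℝ M] (J : Mon d)
    (p : Idx d) (f : Mon d → Mon d → M) :
    ((J p : ℝ) + 1) • ∑ q ∈ antidiagonal (J + single p 1), f q.1 q.2 =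
      (∑ q ∈ antidiagonal J,
        ((q.1 p : ℝ) + 1) • f (q.1 + single p 1) q.2) +
      ∑ q ∈ antidiagonal J,
        ((q.2 p : ℝ) + 1) • f q.1 (q.2 + single p 1) := by
  have key : ∀ f : Mon d → Mon d → M,
      ∑ q ∈ antidiagonal (J + single p 1),
        ((q.1 : Mon d) p : ℝ) • f q.1 q.2 =
      ∑ q ∈ antidiagonal J,
        ((q.1 p : ℝ) + 1) • f (q.1 + single p 1) q.2 := by
    intro f
    symm
    refine Finset.sum_of_injOn (fun q => (q.1 + single p 1, q.2)) ?_ ?_ ?_ ?_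
    · rintro ⟨a, b⟩ _ ⟨a', b'⟩ _ h
      simpa using h
    · rintro ⟨a, b⟩ h
      simp only [Finset.mem_coe, mem_antidiagonal] at h ⊢
      rw [← h]; abel
    · rintro ⟨a, b⟩ h h'
      by_cases ha : a p = 0
      · simp [ha]
      · exfalso
        apply h'
        rw [mem_antidiagonal] at h
        have hle : single p 1 ≤ a := by
          rw [Finsupp.single_le_iff]; exact Nat.one_le_iff_ne_zero.mpr ha
        refine ⟨(a - single p 1, b), ?_, ?_⟩
        · simp only [Finset.mem_coe, mem_antidiagonal]
          have h2 : (a - single p 1) + single p 1 = a := tsub_add_cancel_of_le hle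
          have h3 : (a - single p 1 + b) + single p 1 = J + single p 1 := by
            rw [add_right_comm, h2, h]
          exact add_right_cancel h3
        · simp [tsub_add_cancel_of_le hle]
    · rintro ⟨a, b⟩ _
      simp
  have h1 := key f
  have h2 := key fun a b => f b a
  have swap : ∀ (J : Mon d) (g : Mon d → Mon d → M),
      ∑ q ∈ antidiagonal J, g q.1 q.2 =
      ∑ q ∈ antidiagonal J, g q.2 q.1 := fun J g => by
    exact Finset.sum_nbij' Prod.swap Prod.swap (by simp [add_comm]) (by simp [add_comm])
      (by simp) (by simp) (by simp)
  rw [← h1, swap J fun a b => ((b p : ℝ) + 1) • f a (b + single p 1), ← h2,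
    swap _ fun a b => (a p : ℝ) • f b a, ← sum_add_distrib, smul_sum]
  refine sum_congr rfl fun q hq => ?_
  rw [mem_antidiagonal] at hq
  rw [← add_smul]
  congr 1
  have := congrArg (fun L : Mon d => (L p : ℝ)) hq
  simpa using this.symm

lemma subst_zero (F : Fun d V W) (u : Ser d V) : subst F u 0 = F 0 (u 0) := by
  ext1 x
  simp [subst, taylor_zero]

lemma subst_apply (F : Fun d V W) (u : Ser d V) (J : Mon d) :
    subst F u J = ∑ q ∈ antidiagonal J, taylor q.2 (F q.1) u := by
  ext1 x
  simp [subst]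

lemma IsLocal.dT {F : Fun d V W} (hF : IsLocal F) (p : Idx d) : IsLocal (SW.dT p F) := by
  intro J
  obtain ⟨S, g, hg, hr⟩ := hF (J + single p 1)
  exact ⟨S, ((J p : ℝ) + 1) • g, hg.const_smul _, fun u hu x => by
    simp [SW.dT, hr u hu]⟩

lemma IsLocal.dFun {F : Fun d V W} (hF : IsLocal F) : IsLocal (SW.dFun F) := fun J =>
  Loc.d1 (hF J)

lemma dT_subst {F : Fun d V W} (hF : IsLocal F) {u : Ser d V} (hu : SmoothS u) (p : Idx d) :
    dT p (subst F u) = subst (dT p F) u + subst (dFun F) (pairS u (dT p u)) := by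
  ext1 J
  rw [dT, subst_apply, sum_antidiagonal_add_single J p fun a b => taylor b (F a) u]
  simp only [Pi.add_apply, subst_apply]
  congr 1
  · refine sum_congr rfl fun q _ => ?_
    rw [← taylor_smul (hF _) hu]
    rfl
  · refine sum_congr rfl fun q _ => ?_
    rw [taylor_add_single (hF _) hu]
    rfl

/-- Induction on the coefficients of two series that solve the same differential equations. -/
lemma ser_ext {M : Type} [AddCommGroup M] [Module ℝ M] {f g : Mon d → M}
    (h0 : f 0 = g 0) (h : ∀ J p, (∀ L ≤ J, f L = g L) → dT p f J = dT p g J) : f = g := by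
  ext1 J
  suffices ∀ L ≤ J, f L = g L from this J le_rfl
  induction hn : J.degree using Nat.strong_induction_on generalizing J with
  | _ n ih =>
    intro L hL
    by_cases hL0 : L = 0
    · rw [hL0, h0]
    · obtain ⟨L', p, rfl⟩ := exists_add_single hL0
      have hlt : L'.degree < n := by
        have : (L' + single p 1).degree ≤ J.degree := Finsupp.degree_mono hL
        rw [map_add, Finsupp.degree_single] at this
        omega
      have h1 := h L' p (ih _ hlt L' rfl)
      unfold dT at h1
      have h2 : ((L' p : ℝ) + 1) ≠ 0 := by positivity
      exact smul_right_injective M h2 h1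

end Local

section FunctionalCalculus

variable {d : ℕ}

/-! ### Closure properties of local functionals -/

/-- The restriction of families along a map of index sets. -/
def restrictL (V : Type) [NormedAddCommGroup V] [NormedSpace ℝ V] {S T : Type} [Fintype S]
    [Fintype T] (e : S → T) : (T → V) →L[ℝ] (S → V) :=
  ContinuousLinearMap.pi fun l => proj (e l)

lemma contDiff_restrictL {S T : Type} [Fintype S] [Fintype T] (e : S → T) :
    ContDiff ℝ ∞ (fun c : T → V => restrictL V e c) :=
  ContinuousLinearMap.contDiff (𝕜 := ℝ) (restrictL V e)

lemma loc_jet (l : List (Fin d)) : Loc (fun u : Pt d → V => pdL l u) :=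
  ⟨{l}, fun c => c ⟨l, by simp⟩, contDiff_apply ℝ V _, fun _ _ _ => rfl⟩

lemma loc_id : Loc (fun u : Pt d → V => u) := loc_jet []

lemma Loc.pi {I : Type} [Fintype I] {G : I → (Pt d → V) → Pt d → W} (hG : ∀ i, Loc (G i)) :
    Loc (fun u x i => G i u x) := by
  classical
  choose S g hg hr using hG
  refine ⟨univ.biUnion S,
    fun c i => g i (restrictL V (fun l : S i => (⟨l.1, Finset.mem_biUnion.mpr
      ⟨i, mem_univ i, l.2⟩⟩ : (univ.biUnion S : Finset (List (Fin d))))) c), ?_, ?_⟩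
  · exact contDiff_pi.mpr fun i => (hg i).comp (contDiff_restrictL _)
  · intro u hu x
    ext1 i
    exact hr i u hu x

lemma Loc.post {G : (Pt d → V) → Pt d → W} (hG : Loc G) {h : W → X} (hh : ContDiff ℝ ∞ h) :
    Loc (fun u x => h (G u x)) := by
  obtain ⟨S, g, hg, hr⟩ := hG
  exact ⟨S, fun c => h (g c), hh.comp hg, fun u hu x => congrArg h (hr u hu x)⟩

lemma Loc.prod {G : (Pt d → V) → Pt d → W} {H : (Pt d → V) → Pt d → X} (hG : Loc G)
    (hH : Loc H) : Loc (fun u x => (G u x, H u x)) := by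
  classical
  obtain ⟨S, g, hg, hr⟩ := hG
  obtain ⟨T, h, hh, hs⟩ := hH
  refine ⟨S ∪ T, fun c => (g (restrictL V (fun l : S => (⟨l.1, Finset.mem_union_left T l.2⟩ :
    (S ∪ T : Finset (List (Fin d))))) c), h (restrictL V (fun l : T =>
    (⟨l.1, Finset.mem_union_right S l.2⟩ : (S ∪ T : Finset (List (Fin d))))) c)), ?_, ?_⟩
  · exact (hg.comp (contDiff_restrictL _)).prodMk (hh.comp (contDiff_restrictL _))
  · intro u hu x
    exact Prod.ext (hr u hu x) (hs u hu x)

lemma Loc.add {G H : (Pt d → V) → Pt d → W} (hG : Loc G) (hH : Loc H) : Loc (G + H) :=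
  (hG.prod hH).post (h := fun p : W × W => p.1 + p.2) (contDiff_fst.add contDiff_snd)

lemma Loc.smul {R : Type} [Semiring R] [Module R W] [SMulCommClass ℝ R W]
    [ContinuousConstSMul R W] {G : (Pt d → V) → Pt d → W} (hG : Loc G) (c : R) : Loc (c • G) :=
  hG.post (h := fun p : W => c • p) (contDiff_id.const_smul c)

lemma loc_zero : Loc (0 : (Pt d → V) → Pt d → W) :=
  ⟨∅, fun _ => 0, contDiff_const, fun _ _ _ => rfl⟩

lemma Loc.sum {I : Type} {s : Finset I} {G : I → (Pt d → V) → Pt d → W}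
    (hG : ∀ i ∈ s, Loc (G i)) : Loc (∑ i ∈ s, G i) := by
  classical
  induction s using Finset.induction_on with
  | empty => exact loc_zero
  | insert a s ha ih =>
    rw [sum_insert ha]
    exact (hG a (mem_insert_self a s)).add
      (ih fun i hi => hG i (mem_insert_of_mem hi))

lemma Loc.smooth {G : (Pt d → V) → Pt d → W} (hG : Loc G) {u : Pt d → V} (hu : Smooth u) :
    Smooth (G u) := by
  obtain ⟨S, g, hg, hr⟩ := hG
  have : G u = fun x => g (fun l => pdL l.1 u x) := funext fun x => hr u hu x
  rw [this]
  exact hg.comp (contDiff_pi.mpr fun l => contDiff_pdL hu l.1)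

/-- Derivatives of a local functional are obtained by differentiating the field. -/
lemma pd_apply_loc {G : (Pt d → V) → Pt d → W} (hG : Loc G) {u : Pt d → V} (hu : Smooth u)
    (i : Fin d) : pd i (G u) = d1 G (fun y => (u y, pd i u y)) := by
  obtain ⟨S, g, hg, hr⟩ := hG
  ext1 x
  rw [d1_eq hg hr (smooth_pair hu (contDiff_pd hu i))]
  have : G u = fun x => g ((fun x (l : S) => pdL l.1 u x) x) := funext fun x => hr u hu x
  have hj : ContDiff ℝ ∞ (fun x (l : S) => pdL l.1 u x) :=
    contDiff_pi.mpr fun l => contDiff_pdL hu l.1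
  rw [this, pd_comp hg hj]
  unfold tangent
  congr 1
  ext1 l
  have h1 := congrFun (pd_clm (proj (R := ℝ) (φ := fun _ : S => V) l) hj i) x
  refine h1.symm.trans ?_
  exact (congrFun (pdL_pd hu l.1 i) x).symm

lemma Loc.pd {G : (Pt d → V) → Pt d → W} (hG : Loc G) (i : Fin d) :
    Loc (fun u => SW.pd i (G u)) := by
  classical
  have h1 := hG.d1
  obtain ⟨S, g, hg, hr⟩ := h1
  have h2 : Loc (fun (u : Pt d → V) x (l : S) => (pdL l.1 u x, pdL (l.1 ++ [i]) u x)) :=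
    Loc.pi fun l : S => (loc_jet l.1).prod (loc_jet (l.1 ++ [i]))
  refine (h2.post hg).congr fun u hu => ?_
  ext1 x
  rw [pd_apply_loc hG hu, hr _ (smooth_pair hu (contDiff_pd hu i))]
  congr 1
  ext1 l
  rw [pdL_pair hu (contDiff_pd hu i), pdL_append]
  rfl

lemma Loc.pdL {G : (Pt d → V) → Pt d → W} (hG : Loc G) (l : List (Fin d)) :
    Loc (fun u => SW.pdL l (G u)) := by
  induction l with
  | nil => exact hG
  | cons i l ih => exact ih.pd i

lemma Loc.comp {H : (Pt d → V) → Pt d → W} (hH : Loc H) {G : (Pt d → U) → Pt d → V}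
    (hG : Loc G) : Loc (fun u => H (G u)) := by
  obtain ⟨S, h, hh, hr⟩ := hH
  have h2 : Loc (fun (u : Pt d → U) x (l : S) => SW.pdL l.1 (G u) x) :=
    Loc.pi fun l : S => hG.pdL l.1
  refine (h2.post hh).congr fun u hu => ?_
  ext1 x
  exact hr _ (hG.smooth hu) x

lemma Loc.pre {H : (Pt d → V) → Pt d → W} (hH : Loc H) (L : U →L[ℝ] V) :
    Loc (fun u => H (fun y => L (u y))) :=
  hH.comp (loc_id.post L.contDiff)

/-! ### Derivatives of local functionals -/

lemma tangent_add (g : V → W) (a b b' : V) :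
    tangent g (a, b + b') = tangent g (a, b) + tangent g (a, b') := by simp [tangent]

lemma tangent_smul (g : V → W) (a b : V) (c : ℝ) :
    tangent g (a, c • b) = c • tangent g (a, b) := by simp [tangent]

lemma d1_add_right {G : (Pt d → V) → Pt d → W} (hG : Loc G) {u v v' : Pt d → V}
    (hu : Smooth u) (hv : Smooth v) (hv' : Smooth v') :
    d1 G (fun y => (u y, v y + v' y)) =
      d1 G (fun y => (u y, v y)) + d1 G (fun y => (u y, v' y)) := by
  obtain ⟨S, g, hg, hr⟩ := hG
  ext1 x
  have hs : Smooth (fun y => v y + v' y) := ContDiff.add hv hv'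
  rw [Pi.add_apply, d1_eq hg hr (smooth_pair hu hs), d1_eq hg hr (smooth_pair hu hv),
    d1_eq hg hr (smooth_pair hu hv'), ← tangent_add]
  congr 2
  ext1 l
  exact congrFun (pdL_add hv hv' l.1) x

lemma d1_smul_right {G : (Pt d → V) → Pt d → W} (hG : Loc G) {u v : Pt d → V}
    (hu : Smooth u) (hv : Smooth v) (c : ℝ) :
    d1 G (fun y => (u y, c • v y)) = c • d1 G (fun y => (u y, v y)) := by
  obtain ⟨S, g, hg, hr⟩ := hG
  ext1 x
  have hs : Smooth (fun y => c • v y) := contDiff_smul hv c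
  rw [Pi.smul_apply, d1_eq hg hr (smooth_pair hu hs), d1_eq hg hr (smooth_pair hu hv),
    ← tangent_smul]
  congr 2
  ext1 l
  exact congrFun (pdL_smul hv c l.1) x

lemma d1_zero_right (G : (Pt d → V) → Pt d → W) (u : Pt d → V) :
    d1 G (fun y => (u y, 0)) = 0 := by
  ext1 x
  simp [d1]

lemma hasDerivAt_d1 {G : (Pt d → V) → Pt d → W} (hG : Loc G) {w : Pt d → V × V}
    (hw : Smooth w) (x : Pt d) :
    HasDerivAt (fun s : ℝ => G (fun y => (w y).1 + s • (w y).2) x) (d1 G w x) 0 := by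
  obtain ⟨S, g, hg, hr⟩ := hG
  rw [d1_eq hg hr hw]
  exact hasDerivAt_line hg hr hw x

lemma d1_add {G H : (Pt d → V) → Pt d → W} (hG : Loc G) (hH : Loc H) {w : Pt d → V × V}
    (hw : Smooth w) : d1 (G + H) w = d1 G w + d1 H w :=
  funext fun x => ((hasDerivAt_d1 hG hw x).add (hasDerivAt_d1 hH hw x)).deriv

lemma d1_smul {R : Type} [Semiring R] [Module R W] [SMulCommClass ℝ R W]
    [ContinuousConstSMul R W] {G : (Pt d → V) → Pt d → W} (hG : Loc G) (c : R)
    {w : Pt d → V × V} (hw : Smooth w) : d1 (c • G) w = c • d1 G w :=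
  funext fun x => ((hasDerivAt_d1 hG hw x).const_smul c).deriv

lemma d1_zero (w : Pt d → V × V) : d1 (0 : (Pt d → V) → Pt d → W) w = 0 := by
  ext1 x; simp [d1]

lemma d1_sum {I : Type} {s : Finset I} {G : I → (Pt d → V) → Pt d → W}
    (hG : ∀ i ∈ s, Loc (G i)) {w : Pt d → V × V} (hw : Smooth w) :
    d1 (∑ i ∈ s, G i) w = ∑ i ∈ s, d1 (G i) w := by
  classical
  induction s using Finset.induction_on with
  | empty => simp [d1_zero]
  | insert a s ha ih =>
    have h2 : ∀ i ∈ s, Loc (G i) := fun i hi => hG i (mem_insert_of_mem hi)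
    rw [sum_insert ha, sum_insert ha,
      d1_add (hG a (mem_insert_self a s)) (Loc.sum h2) hw, ih h2]

lemma d1_prod {G : (Pt d → V) → Pt d → W} {H : (Pt d → V) → Pt d → X} (hG : Loc G)
    (hH : Loc H) {w : Pt d → V × V} (hw : Smooth w) :
    d1 (fun u x => (G u x, H u x)) w = fun x => (d1 G w x, d1 H w x) :=
  funext fun x => ((hasDerivAt_d1 hG hw x).prodMk (hasDerivAt_d1 hH hw x)).deriv

lemma fderiv_tangent {E F : Type} [NormedAddCommGroup E] [NormedSpace ℝ E]
    [NormedAddCommGroup F] [NormedSpace ℝ F] {g : E → F} (hg : ContDiff ℝ ∞ g) (a b c e : E) :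
    fderiv ℝ (tangent g) (a, b) (c, e) = fderiv ℝ (fderiv ℝ g) a c b + fderiv ℝ g a e := by
  have hd : HasFDerivAt (fderiv ℝ g) (fderiv ℝ (fderiv ℝ g) a) a :=
    ((hg.fderiv_right (m := ∞) (by simp)).differentiable (by simp) a).hasFDerivAt
  have h1 : HasFDerivAt (fun p : E × E => fderiv ℝ g p.1)
      ((fderiv ℝ (fderiv ℝ g) a).comp (fst ℝ E E)) (a, b) :=
    HasFDerivAt.comp (a, b) (f := Prod.fst) hd hasFDerivAt_fst
  have h2 := h1.clm_apply (hasFDerivAt_snd (𝕜 := ℝ) (p := (a, b)))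
  have h3 : HasFDerivAt (tangent g) _ (a, b) := h2
  rw [h3.fderiv]
  simp [add_comm]

lemma d1_d1_swap {G : (Pt d → V) → Pt d → W} (hG : Loc G) {a b c e : Pt d → V}
    (ha : Smooth a) (hb : Smooth b) (hc : Smooth c) (he : Smooth e) :
    d1 (d1 G) (fun y => ((a y, b y), (c y, e y))) =
      d1 (d1 G) (fun y => ((a y, c y), (b y, e y))) := by
  obtain ⟨S, g, hg, hr⟩ := hG
  have hg1 : ContDiff ℝ ∞ (fun c : S → V × V => tangent g (unzipL S c)) :=
    (contDiff_tangent hg).comp (unzipL (V := V) (W := V) S).contDiff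
  have key : ∀ {a b c e : Pt d → V}, Smooth a → Smooth b → Smooth c → Smooth e → ∀ x,
      d1 (d1 G) (fun y => ((a y, b y), (c y, e y))) x =
        fderiv ℝ (fderiv ℝ g) (fun l => pdL l.1 a x) (fun l => pdL l.1 c x)
          (fun l => pdL l.1 b x) + fderiv ℝ g (fun l => pdL l.1 a x) (fun l => pdL l.1 e x) := by
    intro a b c e ha hb hc he x
    rw [d1_eq hg1 (d1_rep hg hr) (smooth_pair (smooth_pair ha hb) (smooth_pair hc he))]
    have hf : fderiv ℝ (fun c : S → V × V => tangent g (unzipL S c))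
        (fun l : S => pdL l.1 (fun y => (a y, b y)) x) =
        (fderiv ℝ (tangent g) (unzipL S (fun l : S => pdL l.1 (fun y => (a y, b y)) x))).comp
          (unzipL (V := V) (W := V) S) := by
      have h1 := ((contDiff_tangent hg).differentiable (by simp)
        (unzipL S (fun l : S => pdL l.1 (fun y => (a y, b y)) x))).hasFDerivAt
      exact (h1.comp _ (unzipL (V := V) (W := V) S).hasFDerivAt).fderiv
    unfold tangent at hf ⊢
    rw [hf]
    have e1 : unzipL S (fun l : S => pdL l.1 (fun y => (a y, b y)) x) =
      (fun l : S => pdL l.1 a x, fun l : S => pdL l.1 b x) := by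
      simp only [unzipL_apply, pdL_pair ha hb]
    have e2 : unzipL S (fun l : S => pdL l.1 (fun y => (c y, e y)) x) =
      (fun l : S => pdL l.1 c x, fun l : S => pdL l.1 e x) := by
      simp only [unzipL_apply, pdL_pair hc he]
    rw [ContinuousLinearMap.comp_apply, e1, e2]
    exact fderiv_tangent hg _ _ _ _
  ext1 x
  rw [key ha hb hc he, key ha hc hb he]
  have hs : IsSymmSndFDerivAt ℝ g (fun l : S => pdL l.1 a x) :=
    (hg.contDiffAt).isSymmSndFDerivAt (by
      rw [minSmoothness_of_isRCLikeNormedField]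
      exact WithTop.coe_le_coe.mpr (le_top : (2 : ℕ∞) ≤ ⊤))
  rw [hs]

lemma d1_pd {G : (Pt d → V) → Pt d → W} (hG : Loc G) (i : Fin d) {w : Pt d → V × V}
    (hw : Smooth w) : d1 (fun u => pd i (G u)) w = pd i (d1 G w) := by
  have hu := smooth_fst hw
  have hv := smooth_snd hw
  have hu' := contDiff_pd hu i
  have hv' := contDiff_pd hv i
  rw [pd_apply_loc hG.d1 hw]
  have h1 : (fun y => (w y, pd i w y)) =
      fun y => (((w y).1, (w y).2), (pd i (fun y => (w y).1) y, pd i (fun y => (w y).2) y)) := by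
    ext1 y
    refine Prod.ext rfl ?_
    exact pdL_pair hu hv [i] y
  rw [h1, d1_d1_swap hG hu hv hu' hv']
  ext1 x
  refine Eq.trans ?_ (hasDerivAt_d1 hG.d1
    (smooth_pair (smooth_pair hu hu') (smooth_pair hv hv')) x).deriv
  unfold d1
  congr 1
  ext1 s
  have hl : Smooth (fun y => (w y).1 + s • (w y).2) :=
    ContDiff.add hu (contDiff_smul hv s)
  have h2 := congrFun (pd_apply_loc hG hl i) x
  refine h2.trans ?_
  unfold d1
  congr 1
  ext1 r
  have h3 : pd i (fun y => (w y).1 + s • (w y).2) =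
      fun y => pd i (fun y => (w y).1) y + s • pd i (fun y => (w y).2) y := by
    ext1 y
    exact jet_line hw s [i] y
  rw [h3]
  rfl

lemma d1_pdL {G : (Pt d → V) → Pt d → W} (hG : Loc G) (l : List (Fin d)) {w : Pt d → V × V}
    (hw : Smooth w) : d1 (fun u => pdL l (G u)) w = pdL l (d1 G w) := by
  induction l with
  | nil => rfl
  | cons i l ih =>
    have := d1_pd (hG.pdL l) i hw
    rw [ih] at this
    exact this

lemma d1_comp {H : (Pt d → V) → Pt d → W} (hH : Loc H) {G : (Pt d → U) → Pt d → V}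
    (hG : Loc G) {w : Pt d → U × U} (hw : Smooth w) :
    d1 (fun u => H (G u)) w = d1 H (fun y => (G (fun y => (w y).1) y, d1 G w y)) := by
  obtain ⟨S, h, hh, hr⟩ := hH
  ext1 x
  have hGu := hG.smooth (smooth_fst hw)
  rw [d1_eq hh hr (smooth_pair hGu (hG.d1.smooth hw))]
  have hs : ∀ s : ℝ, Smooth (fun y => (w y).1 + s • (w y).2) := fun s =>
    ContDiff.add (smooth_fst hw) (contDiff_smul (smooth_snd hw) s)
  have h1 : (fun s : ℝ => H (G (fun y => (w y).1 + s • (w y).2)) x) =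
      fun s : ℝ => h (fun l : S => pdL l.1 (G (fun y => (w y).1 + s • (w y).2)) x) := by
    ext1 s
    exact hr _ (hG.smooth (hs s)) x
  have h2 : HasDerivAt (fun (s : ℝ) (l : S) => pdL l.1 (G (fun y => (w y).1 + s • (w y).2)) x)
      (fun l : S => pdL l.1 (d1 G w) x) 0 := by
    refine hasDerivAt_pi.mpr fun l => ?_
    have := hasDerivAt_d1 (hG.pdL l.1) hw x
    rwa [d1_pdL hG l.1 hw] at this
  have h0 : (fun l : S => pdL l.1 (G (fun y => (w y).1 + (0 : ℝ) • (w y).2)) x) =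
      fun l : S => pdL l.1 (G (fun y => (w y).1)) x := by simp
  have h3 : HasFDerivAt h (fderiv ℝ h (fun l : S => pdL l.1 (G (fun y => (w y).1)) x))
      (fun l : S => pdL l.1 (G (fun y => (w y).1 + (0 : ℝ) • (w y).2)) x) := by
    rw [h0]; exact (hh.differentiable (by simp) _).hasFDerivAt
  unfold d1
  rw [h1]
  exact (h3.comp_hasDerivAt (0 : ℝ) h2).deriv

/-! ### Taylor coefficients and linear maps -/

lemma family_clm (L : V →L[ℝ] W) (K : Mon d) (u : Ser d V) (t : Idx d → ℝ) :
    family K (fun J y => L (u J y)) t = fun y => L (family K u t y) := by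
  ext1 y
  simp [family]

lemma taylor_pre (L : U →L[ℝ] V) (K : Mon d) (G : (Pt d → V) → Pt d → W) (u : Ser d U) :
    taylor K (fun v => G (fun y => L (v y))) u = taylor K G (fun J y => L (u J y)) := by
  ext1 x
  rw [taylor_def, taylor_def]
  simp only [family_clm]

lemma taylor_post (L : W →L[ℝ] X) (K : Mon d) {G : (Pt d → V) → Pt d → W} (hG : Loc G)
    {u : Ser d V} (hu : SmoothS u) :
    taylor K (fun v x => L (G v x)) u = fun x => L (taylor K G u x) := by
  ext1 x
  rw [taylor_def, taylor_def, map_smul]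
  congr 1
  exact congrFun (pdL_clm L (contDiff_along_family hG hu K x) _) 0

lemma taylor_pair {G : (Pt d → V) → Pt d → W} {H : (Pt d → V) → Pt d → X} (hG : Loc G)
    (hH : Loc H) (K : Mon d) {u : Ser d V} (hu : SmoothS u) :
    taylor K (fun v x => (G v x, H v x)) u = fun x => (taylor K G u x, taylor K H u x) := by
  ext1 x
  have h1 := congrFun (taylor_post (fst ℝ W X) K (hG.prod hH) hu) x
  have h2 := congrFun (taylor_post (snd ℝ W X) K (hG.prod hH) hu) x
  exact Prod.ext h1.symm h2.symm

lemma family_pairS (K : Mon d) (u : Ser d V) (v : Ser d W) (t : Idx d → ℝ) :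
    family K (pairS u v) t = fun y => (family K u t y, family K v t y) := by
  ext1 y
  refine Prod.ext ?_ ?_ <;> simp [family, pairS, Prod.fst_sum, Prod.snd_sum]

lemma family_add (K : Mon d) (u v : Ser d V) (t : Idx d → ℝ) :
    family K (u + v) t = fun y => family K u t y + family K v t y := by
  ext1 y
  simp [family, sum_add_distrib]

lemma family_smul (K : Mon d) (u : Ser d V) (c : ℝ) (t : Idx d → ℝ) :
    family K (c • u) t = fun y => c • family K u t y := by
  ext1 y
  simp [family, smul_sum, smul_comm c]

lemma taylor_d1_add_right {G : (Pt d → V) → Pt d → W} (hG : Loc G) {a b c : Ser d V}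
    (ha : SmoothS a) (hb : SmoothS b) (hc : SmoothS c) (K : Mon d) :
    taylor K (d1 G) (pairS a (b + c)) =
      taylor K (d1 G) (pairS a b) + taylor K (d1 G) (pairS a c) := by
  ext1 x
  rw [Pi.add_apply, taylor_def, taylor_def, taylor_def, ← smul_add, ← Pi.add_apply (pdM K _),
    ← pdM_add (contDiff_along_family hG.d1 (smoothS_pairS ha hb) K x)
      (contDiff_along_family hG.d1 (smoothS_pairS ha hc) K x)]
  congr 2
  ext1 t
  rw [Pi.add_apply, ← Pi.add_apply (d1 G _), family_pairS, family_pairS, family_pairS, family_add,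
    d1_add_right hG (smooth_family ha K t) (smooth_family hb K t) (smooth_family hc K t)]

lemma taylor_d1_smul_right {G : (Pt d → V) → Pt d → W} (hG : Loc G) {a b : Ser d V}
    (ha : SmoothS a) (hb : SmoothS b) (c : ℝ) (K : Mon d) :
    taylor K (d1 G) (pairS a (c • b)) = c • taylor K (d1 G) (pairS a b) := by
  ext1 x
  rw [Pi.smul_apply, taylor_def, taylor_def, smul_comm c, ← Pi.smul_apply c (pdM K _),
    ← pdM_smul (contDiff_along_family hG.d1 (smoothS_pairS ha hb) K x)]
  congr 2
  ext1 t
  rw [Pi.smul_apply, ← Pi.smul_apply c (d1 G _), family_pairS, family_pairS, family_smul,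
    d1_smul_right hG (smooth_family ha K t) (smooth_family hb K t)]

/-! ### Composition of functionals -/

/-- Pairing of functionals. -/
def pairF (F : Fun d U V) (G : Fun d U W) : Fun d U (V × W) := fun J u x => (F J u x, G J u x)

/-- Composition of functionals. -/
def compF (F : Fun d V W) (G : Fun d U V) : Fun d U W := fun J u => subst F (app G u) J

/-- Precomposition with a linear map of the fields. -/
def preF (F : Fun d V W) (L : U →L[ℝ] V) : Fun d U W := fun J u => F J (fun y => L (u y))

lemma IsLocal.smoothS {F : Fun d V W} (hF : IsLocal F) {u : Pt d → V} (hu : Smooth u) :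
    SmoothS (app F u) := fun J => Loc.smooth (hF J) hu

lemma IsLocal.pairF {F : Fun d U V} {G : Fun d U W} (hF : IsLocal F) (hG : IsLocal G) :
    IsLocal (SW.pairF F G) := fun J => Loc.prod (hF J) (hG J)

lemma IsLocal.preF {F : Fun d V W} (hF : IsLocal F) (L : U →L[ℝ] V) :
    IsLocal (SW.preF F L) := fun J => Loc.pre (hF J) L

lemma IsLocal.add {F G : Fun d V W} (hF : IsLocal F) (hG : IsLocal G) : IsLocal (F + G) :=
  fun J => Loc.add (hF J) (hG J)

lemma IsLocal.smul {R : Type} [Semiring R] [Module R W] [SMulCommClass ℝ R W]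
    [ContinuousConstSMul R W] {F : Fun d V W} (hF : IsLocal F) (c : R) : IsLocal (c • F) :=
  fun J => Loc.smul (hF J) c

lemma IsLocal.congr {F G : Fun d V W} (hF : IsLocal F)
    (h : ∀ u, Smooth u → app G u = app F u) : IsLocal G :=
  fun J => Loc.congr (hF J) fun u hu => congrFun (h u hu) J

lemma app_dT (F : Fun d V W) (p : Idx d) (u : Pt d → V) : app (dT p F) u = dT p (app F u) := rfl

lemma loc_taylor (K : Mon d) : ∀ (V W : Type) [NormedAddCommGroup V] [NormedSpace ℝ V]
    [NormedAddCommGroup W] [NormedSpace ℝ W] (H : (Pt d → V) → Pt d → W) (G : Fun d U V),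
    Loc H → IsLocal G → Loc (fun u => taylor K H (app G u)) := by
  induction K using monomial_induction with
  | h0 =>
    intro V W _ _ _ _ H G hH hG
    simp only [taylor_zero]
    exact hH.comp (hG 0)
  | hs K p ih =>
    intro V W _ _ _ _ H G hH hG
    have h1 := (ih (V × V) W (d1 H) (pairF G (dT p G)) hH.d1 (hG.pairF (hG.dT p))).smul
      (((K p : ℝ) + 1)⁻¹)
    refine h1.congr fun u hu => ?_
    have h2 := taylor_add_single hH (hG.smoothS hu) K p
    have h3 : ((K p : ℝ) + 1) ≠ 0 := by positivity
    change _ = ((K p : ℝ) + 1)⁻¹ • taylor K (d1 H) (app (pairF G (dT p G)) u)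
    rw [eq_inv_smul_iff₀ h3, h2]
    rfl

lemma IsLocal.compF {F : Fun d V W} (hF : IsLocal F) {G : Fun d U V} (hG : IsLocal G) :
    IsLocal (SW.compF F G) := by
  intro J
  have h := Loc.sum (s := antidiagonal J)
    (G := fun (q : Mon d × Mon d) u => taylor q.2 (F q.1) (app G u))
    (fun q _ => loc_taylor q.2 V W (F q.1) G (hF q.1) hG)
  refine h.congr fun u hu => ?_
  simp only [SW.compF, subst_apply, Finset.sum_apply]

lemma d1_taylor (K : Mon d) : ∀ (V W : Type) [NormedAddCommGroup V] [NormedSpace ℝ V]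
    [NormedAddCommGroup W] [NormedSpace ℝ W] (H : (Pt d → V) → Pt d → W) (G : Fun d U V),
    Loc H → IsLocal G → ∀ w : Pt d → U × U, Smooth w →
    d1 (fun u => taylor K H (app G u)) w =
      taylor K (d1 H) (pairS (app G (fun y => (w y).1)) (app (dFun G) w)) := by
  induction K using monomial_induction with
  | h0 =>
    intro V W _ _ _ _ H G hH hG w hw
    simp only [taylor_zero]
    exact d1_comp hH (hG 0) hw
  | hs K p ih =>
    intro V W _ _ _ _ H G hH hG w hw
    have h3 : ((K p : ℝ) + 1) ≠ 0 := by positivity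
    have hu := smooth_fst hw
    refine smul_right_injective _ h3 ?_
    change ((K p : ℝ) + 1) • _ = ((K p : ℝ) + 1) • _
    have hsG := hG.smoothS hu
    have hsd := hG.dFun.smoothS hw
    rw [taylor_add_single hH.d1 (smoothS_pairS hsG hsd),
      ← d1_smul (loc_taylor _ V W H G hH hG) _ hw]
    have h4 : d1 (((K p : ℝ) + 1) • fun u => taylor (K + single p 1) H (app G u)) w =
        d1 (fun u => taylor K (d1 H) (app (pairF G (dT p G)) u)) w :=
      d1_congr (fun u hu => taylor_add_single hH (hG.smoothS hu) K p) hw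
    rw [h4, ih (V × V) W (d1 H) (pairF G (dT p G)) hH.d1 (hG.pairF (hG.dT p)) w hw]
    let sw : (V × V) × (V × V) →L[ℝ] (V × V) × (V × V) :=
      (((fst ℝ V V).comp (fst ℝ (V × V) (V × V))).prod
        ((fst ℝ V V).comp (snd ℝ (V × V) (V × V)))).prod
      (((snd ℝ V V).comp (fst ℝ (V × V) (V × V))).prod
        ((snd ℝ V V).comp (snd ℝ (V × V) (V × V))))
    have h5 : app (dFun (pairF G (dT p G))) w =
        pairS (app (dFun G) w) (dT p (app (dFun G) w)) := by
      ext1 J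
      have := d1_prod (hG J) (hG.dT p J) hw
      refine this.trans ?_
      ext1 x
      refine Prod.ext rfl ?_
      exact congrFun (d1_smul (hG _) ((J p : ℝ) + 1) hw) x
    rw [h5]
    have hs1 : SmoothS (pairS (pairS (app G fun y => (w y).1) (app (dFun G) w))
        (dT p (pairS (app G fun y => (w y).1) (app (dFun G) w)))) :=
      smoothS_pairS (smoothS_pairS hsG hsd) (smoothS_dT (smoothS_pairS hsG hsd) p)
    rw [← taylor_congr (G := fun v => d1 (d1 H) (fun y => sw (v y))) (fun v hv => ?_) hs1 K,
      taylor_pre sw]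
    · rfl
    · exact d1_d1_swap hH (smooth_fst (smooth_fst hv)) (smooth_fst (smooth_snd hv))
        (smooth_snd (smooth_fst hv)) (smooth_snd (smooth_snd hv))

lemma app_dFun_compF {F : Fun d V W} (hF : IsLocal F) {G : Fun d U V} (hG : IsLocal G)
    {w : Pt d → U × U} (hw : Smooth w) :
    app (dFun (compF F G)) w =
      subst (dFun F) (pairS (app G (fun y => (w y).1)) (app (dFun G) w)) := by
  ext1 J
  rw [subst_apply]
  have h1 : app (dFun (compF F G)) w J = d1 (∑ q ∈ antidiagonal J,
      fun u => taylor q.2 (F q.1) (app G u)) w := by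
    refine d1_congr (fun u _ => ?_) hw
    simp only [compF, subst_apply, Finset.sum_apply]
  rw [h1, d1_sum (fun (q : Mon d × Mon d) _ => loc_taylor q.2 V W (F q.1) G (hF q.1) hG) hw]
  exact sum_congr rfl fun q _ => d1_taylor q.2 V W (F q.1) G (hF q.1) hG w hw

lemma subst_congr {F G : Fun d V W} (h : ∀ u, Smooth u → app F u = app G u) {u : Ser d V}
    (hu : SmoothS u) : subst F u = subst G u := by
  ext1 J
  rw [subst_apply, subst_apply]
  exact sum_congr rfl fun q _ => taylor_congr (fun v hv => congrFun (h v hv) q.1) hu q.2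

lemma subst_add {F G : Fun d V W} (hF : IsLocal F) (hG : IsLocal G) {u : Ser d V}
    (hu : SmoothS u) : subst (F + G) u = subst F u + subst G u := by
  ext1 J
  simp only [Pi.add_apply, subst_apply, ← sum_add_distrib]
  exact sum_congr rfl fun q _ => taylor_add (hF q.1) (hG q.1) hu q.2

lemma subst_smul {R : Type} [Semiring R] [Module R W] [SMulCommClass ℝ R W]
    [ContinuousConstSMul R W] {F : Fun d V W} (hF : IsLocal F) (c : R) {u : Ser d V}
    (hu : SmoothS u) : subst (c • F) u = c • subst F u := by
  ext1 J
  simp only [Pi.smul_apply, subst_apply, smul_sum]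
  exact sum_congr rfl fun q _ => taylor_smul (hF q.1) hu q.2 c

lemma subst_pairF {F : Fun d U V} {G : Fun d U W} (hF : IsLocal F) (hG : IsLocal G)
    {u : Ser d U} (hu : SmoothS u) :
    subst (pairF F G) u = pairS (subst F u) (subst G u) := by
  ext1 J
  rw [subst_apply]
  have h : ∀ q : Mon d × Mon d, taylor q.2 (pairF F G q.1) u =
      fun x => (taylor q.2 (F q.1) u x, taylor q.2 (G q.1) u x) := fun q =>
    taylor_pair (hF q.1) (hG q.1) q.2 hu
  ext1 x
  simp only [Finset.sum_apply, h]
  refine Prod.ext ?_ ?_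
  · simp [Prod.fst_sum, pairS, subst]
  · simp [Prod.snd_sum, pairS, subst]

lemma subst_preF (F : Fun d V W) (L : U →L[ℝ] V) (u : Ser d U) :
    subst (preF F L) u = subst F (fun J y => L (u J y)) := by
  ext1 J
  rw [subst_apply, subst_apply]
  exact sum_congr rfl fun q _ => taylor_pre L q.2 (F q.1) u

lemma subst_dFun_add {F : Fun d V W} (hF : IsLocal F) {a b c : Ser d V}
    (ha : SmoothS a) (hb : SmoothS b) (hc : SmoothS c) :
    subst (dFun F) (pairS a (b + c)) = subst (dFun F) (pairS a b) + subst (dFun F) (pairS a c) := by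
  ext1 J
  simp only [Pi.add_apply, subst_apply, ← sum_add_distrib]
  exact sum_congr rfl fun q _ => taylor_d1_add_right (hF q.1) ha hb hc q.2

lemma subst_dFun_smul {F : Fun d V W} (hF : IsLocal F) {a b : Ser d V}
    (ha : SmoothS a) (hb : SmoothS b) (c : ℝ) :
    subst (dFun F) (pairS a (c • b)) = c • subst (dFun F) (pairS a b) := by
  ext1 J
  simp only [Pi.smul_apply, subst_apply, smul_sum]
  exact sum_congr rfl fun q _ => taylor_d1_smul_right (hF q.1) ha hb c q.2

lemma subst_congr_right {F : Fun d V W} {u v : Ser d V} {J : Mon d}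
    (h : ∀ L ≤ J, u L = v L) : subst F u J = subst F v J := by
  rw [subst_apply, subst_apply]
  refine sum_congr rfl fun q hq => taylor_congr_right fun L hL => h L (hL.trans ?_)
  rw [mem_antidiagonal] at hq
  rw [← hq]
  exact le_add_self

lemma smoothS_subst {F : Fun d V W} (hF : IsLocal F) {u : Ser d V} (hu : SmoothS u) :
    SmoothS (subst F u) := by
  let G : Fun d V V := fun J _ => u J
  have hG : SmoothS u := hu
  intro J
  rw [subst_apply]
  refine contDiff_sum fun q _ => ?_
  have key : ∀ (K : Mon d) (V W : Type) [NormedAddCommGroup V] [NormedSpace ℝ V]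
      [NormedAddCommGroup W] [NormedSpace ℝ W] (H : (Pt d → V) → Pt d → W) (u : Ser d V),
      Loc H → SmoothS u → Smooth (taylor K H u) := by
    intro K
    induction K using monomial_induction with
    | h0 =>
      intro V W _ _ _ _ H u hH hu
      rw [taylor_zero]
      exact hH.smooth (hu 0)
    | hs K p ih =>
      intro V W _ _ _ _ H u hH hu
      have h1 := ih _ _ (d1 H) _ hH.d1 (smoothS_pairS hu (smoothS_dT hu p))
      rw [← taylor_add_single hH hu] at h1
      have h3 : ((K p : ℝ) + 1) ≠ 0 := by positivity
      have h4 := contDiff_smul h1 (((K p : ℝ) + 1)⁻¹)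
      rwa [inv_smul_smul₀ h3] at h4
  exact key q.2 V W (F q.1) u (hF q.1) hu

lemma app_dT_compF {F : Fun d V W} (hF : IsLocal F) {G : Fun d U V} (hG : IsLocal G)
    (p : Idx d) {u : Pt d → U} (hu : Smooth u) :
    app (dT p (compF F G)) u =
      app (compF (dT p F) G + compF (dFun F) (pairF G (dT p G))) u := by
  have := dT_subst hF (hG.smoothS hu) p
  exact this

/-- Substitution into a composite functional. -/
lemma subst_compF_apply (J : Mon d) : ∀ (U V W : Type)
    [NormedAddCommGroup U] [NormedSpace ℝ U] [NormedAddCommGroup V] [NormedSpace ℝ V]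
    [NormedAddCommGroup W] [NormedSpace ℝ W] (F : Fun d V W) (G : Fun d U V) (u : Ser d U),
    IsLocal F → IsLocal G → SmoothS u → subst (compF F G) u J = subst F (subst G u) J := by
  induction J using monomial_induction with
  | h0 =>
    intro U V W _ _ _ _ _ _ F G u hF hG hu
    rw [subst_zero, subst_zero, subst_zero]
    exact subst_zero F _
  | hs J p ih =>
    intro U V W _ _ _ _ _ _ F G u hF hG hu
    have h3 : ((J p : ℝ) + 1) ≠ 0 := by positivity
    refine smul_right_injective _ h3 ?_
    change dT p (subst (compF F G) u) J = dT p (subst F (subst G u)) J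
    have hv := smoothS_dT hu p
    have huv := smoothS_pairS hu hv
    have hGu := smoothS_subst hG hu
    have hl1 := hF.compF hG
    have hl2 := (hF.dT p).compF hG
    have hl3 := hF.dFun.compF (hG.pairF (hG.dT p))
    have hp := hG.preF (fst ℝ U U)
    rw [dT_subst hl1 hu, dT_subst hF hGu, dT_subst hG hu,
      subst_congr (fun u hu => app_dT_compF hF hG p hu) hu, subst_add hl2 hl3 hu,
      subst_congr (G := compF (dFun F) (pairF (preF G (fst ℝ U U)) (dFun G)))
        (fun w hw => app_dFun_compF hF hG hw) huv,
      subst_dFun_add hF hGu (smoothS_subst (hG.dT p) hu) (smoothS_subst hG.dFun huv)]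
    simp only [Pi.add_apply]
    rw [ih _ _ _ _ _ _ (hF.dT p) hG hu, ih _ _ _ _ _ _ hF.dFun (hG.pairF (hG.dT p)) hu,
      ih _ _ _ _ _ _ hF.dFun (hp.pairF hG.dFun) huv, subst_pairF hG (hG.dT p) hu,
      subst_pairF hp hG.dFun huv, subst_preF, add_assoc]
    rfl

lemma subst_compF {F : Fun d V W} (hF : IsLocal F) {G : Fun d U V} (hG : IsLocal G)
    {u : Ser d U} (hu : SmoothS u) : subst (compF F G) u = subst F (subst G u) :=
  funext fun J => subst_compF_apply J U V W F G u hF hG hu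

end FunctionalCalculus

/-! ### The star product: smoothness and recursion -/

section Star

variable {d a b c e : ℕ}

/-- A bilinear map of finite-dimensional spaces is continuous. -/
def bilinL [FiniteDimensional ℝ V]
    [FiniteDimensional ℝ W]
    (B : V →ₗ[ℝ] W →ₗ[ℝ] X) : V →L[ℝ] W →L[ℝ] X :=
  LinearMap.toContinuousLinearMap
    ((LinearMap.toContinuousLinearMap : (W →ₗ[ℝ] X) ≃ₗ[ℝ] (W →L[ℝ] X)).toLinearMap.comp B)

lemma contDiff_bilin {E : Type} [NormedAddCommGroup E] [NormedSpace ℝ E]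
        (B : V →L[ℝ] W →L[ℝ] X) {f : E → V} {g : E → W}
    (hf : ContDiff ℝ ∞ f) (hg : ContDiff ℝ ∞ g) : ContDiff ℝ ∞ (fun x => B (f x) (g x)) :=
  (B.contDiff.comp hf).clm_apply hg

lemma hasFDerivAt_bilin {E : Type} [NormedAddCommGroup E] [NormedSpace ℝ E]
        (B : V →L[ℝ] W →L[ℝ] X) {f : E → V} {g : E → W}
    {x : E} {f' : E →L[ℝ] V} {g' : E →L[ℝ] W}
    (hf : HasFDerivAt f f' x) (hg : HasFDerivAt g g' x) :
    HasFDerivAt (fun x => B (f x) (g x)) ((B (f x)).comp g' + (B.flip (g x)).comp f') x := by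
  have h1 : HasFDerivAt (fun x => B (f x)) (B.comp f') x := B.hasFDerivAt.comp x hf
  exact h1.clm_apply hg

lemma pd_bilin         (B : V →L[ℝ] W →L[ℝ] X) {f : Pt d → V} {g : Pt d → W} (hf : Smooth f) (hg : Smooth g)
    (i : Fin d) : pd i (fun x => B (f x) (g x)) = fun x => B (pd i f x) (g x) + B (f x) (pd i g x) := by
  ext1 x
  have := (hasFDerivAt_bilin B (contDiff_differentiable hf x).hasFDerivAt
    (contDiff_differentiable hg x).hasFDerivAt).fderiv
  unfold pd
  rw [this]
  simp [add_comm]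

lemma hasDerivAt_bilin         (B : V →L[ℝ] W →L[ℝ] X) {f : ℝ → V} {g : ℝ → W} {s : ℝ} {f' : V} {g' : W}
    (hf : HasDerivAt f f' s) (hg : HasDerivAt g g' s) :
    HasDerivAt (fun s => B (f s) (g s)) (B f' (g s) + B (f s) g') s := by
  have := (hasFDerivAt_bilin B hf.hasFDerivAt hg.hasFDerivAt).hasDerivAt
  simpa [add_comm] using this

/-- Matrix multiplication as a bilinear map. -/
def mulM (a b c : ℕ) : Mat a b →ₗ[ℝ] Mat b c →ₗ[ℝ] Mat a c :=
  LinearMap.mk₂ ℝ (fun (M : Mat a b) (M' : Mat b c) => M * M') Matrix.add_mul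
    (fun _ _ _ => Matrix.smul_mul _ _ _) Matrix.mul_add (fun _ _ _ => Matrix.mul_smul _ _ _)

lemma smooth_mul {f : Pt d → Mat a b} {g : Pt d → Mat b c} (hf : Smooth f) (hg : Smooth g) :
    Smooth (fun x => f x * g x) :=
  contDiff_bilin (bilinL (mulM a b c)) hf hg

lemma pd_mul {f : Pt d → Mat a b} {g : Pt d → Mat b c} (hf : Smooth f) (hg : Smooth g)
    (i : Fin d) : pd i (fun x => f x * g x) = fun x => pd i f x * g x + f x * pd i g x :=
  pd_bilin (bilinL (mulM a b c)) hf hg i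

lemma pderiv_prod {σ : Type} {n : ℕ} (p : σ) (t : Fin (n + 1) → MvPolynomial σ ℝ) :
    MvPolynomial.pderiv p (∏ i, t i) =
      ∑ i, MvPolynomial.pderiv p (t i) * ∏ j, t (i.succAbove j) := by
  classical
  have h : ∀ s : Finset (Fin (n + 1)), MvPolynomial.pderiv p (∏ i ∈ s, t i) =
      ∑ i ∈ s, MvPolynomial.pderiv p (t i) * ∏ j ∈ s.erase i, t j := by
    intro s
    induction s using Finset.induction_on with
    | empty => simp
    | insert i s hi ih =>
      rw [Finset.prod_insert hi, MvPolynomial.pderiv_mul, ih, sum_insert hi,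
        Finset.erase_insert hi, mul_sum]
      congr 1
      refine sum_congr rfl fun j hj => ?_
      have hij : i ≠ j := fun h => hi (h ▸ hj)
      rw [Finset.erase_insert_of_ne hij, Finset.prod_insert (fun h => hi (Finset.mem_of_mem_erase h))]
      ring
  rw [h]
  refine sum_congr rfl fun i _ => ?_
  congr 1
  have h1 : univ.erase i = univ.image i.succAbove := by
    rw [Fin.image_succAbove_univ]; ext j; simp
  rw [h1, Finset.prod_image fun x _ y _ h => Fin.succAbove_right_injective h]

/-- The coefficient of the variable `p` in `θ^{μν}`. -/
def thetaSign (p : Idx d) (q : Fin d × Fin d) : ℝ :=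
  if q = p.1 then 1 else if q = p.1.swap then -1 else 0

lemma pderiv_theta (p : Idx d) (μ ν : Fin d) :
    MvPolynomial.pderiv p (theta μ ν) = MvPolynomial.C (thetaSign p (μ, ν)) := by
  classical
  obtain ⟨⟨α, β⟩, hp⟩ := p
  simp only at hp
  unfold theta thetaSign
  by_cases h1 : μ < ν
  · rw [dif_pos h1, MvPolynomial.pderiv_X]
    by_cases h : μ = α ∧ ν = β
    · obtain ⟨rfl, rfl⟩ := h
      simp
    · have h2 : ¬ (μ = β ∧ ν = α) := by
        rintro ⟨rfl, rfl⟩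
        exact absurd h1 (not_lt_of_gt hp)
      have h3 : (⟨(μ, ν), h1⟩ : Idx d) ≠ ⟨(α, β), hp⟩ := by
        simpa [Subtype.ext_iff, Prod.ext_iff] using h
      simp [h, h2]
  · rw [dif_neg h1]
    by_cases h4 : ν < μ
    · rw [dif_pos h4, map_neg, MvPolynomial.pderiv_X]
      have h2 : ¬ (μ = α ∧ ν = β) := by
        rintro ⟨rfl, rfl⟩
        exact h1 hp
      by_cases h : μ = β ∧ ν = α
      · obtain ⟨rfl, rfl⟩ := h
        simp [h2]
      · have h3 : (⟨(ν, μ), h4⟩ : Idx d) ≠ ⟨(α, β), hp⟩ := by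
          simp only [ne_eq, Subtype.mk.injEq, Prod.mk.injEq]
          tauto
        simp only [Pi.single_apply, if_neg h3]
        simp [h, h2]
    · rw [dif_neg h4, map_zero]
      have hμ : μ = ν := le_antisymm (not_lt.mp h4) (not_lt.mp h1)
      subst hμ
      have h2 : ¬ (μ = α ∧ μ = β) := by
        rintro ⟨rfl, rfl⟩; exact lt_irrefl _ hp
      have h3 : ¬ (μ = β ∧ μ = α) := by
        rintro ⟨rfl, rfl⟩; exact lt_irrefl _ hp
      simp [h2, h3]

/-- The `n`-th order part of the coefficient of `I` in the star product. -/
def starN (n : ℕ) (I : Mon d) (f : Pt d → Mat a b) (g : Pt d → Mat b c) : Pt d → Mat a c :=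
  fun x => ((Complex.I * (Real.pi : ℂ)) ^ n / (Nat.factorial n : ℂ)) •
    ∑ s : Fin n → Fin d × Fin d,
      ((MvPolynomial.coeff I (∏ i, theta (s i).1 (s i).2) : ℝ) : ℂ) •
        (pdL (List.ofFn fun i => (s i).1) f x * pdL (List.ofFn fun i => (s i).2) g x)

lemma starCoeff_eq (I : Mon d) (f : Pt d → Mat a b) (g : Pt d → Mat b c) :
    starCoeff I f g = starN I.degree I f g := rfl

lemma starCoeff_zero (f : Pt d → Mat a b) (g : Pt d → Mat b c) :
    starCoeff 0 f g = fun x => f x * g x := by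
  have : (0 : Mon d).degree = 0 := map_zero _
  rw [starCoeff_eq, this]
  ext1 x
  simp [starN]

lemma ofFn_perm_succAbove {α : Type} {n : ℕ} (t : Fin (n + 1) → α) (i : Fin (n + 1)) :
    (List.ofFn t).Perm ((List.ofFn fun j => t (i.succAbove j)) ++ [t i]) := by
  refine List.Perm.trans ?_ (List.perm_append_singleton _ _).symm
  rw [← Multiset.coe_eq_coe, ← Multiset.cons_coe, ← Fin.univ_val_map, ← Fin.univ_val_map,
    Fin.univ_succAbove n i]
  simp [Function.comp_def]

lemma starN_add_single (n : ℕ) (J : Mon d) (p : Idx d) {f : Pt d → Mat a b}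
    {g : Pt d → Mat b c} (hf : Smooth f) (hg : Smooth g) :
    ((J p : ℝ) + 1) • starN (n + 1) (J + single p 1) f g =
      (I * (Real.pi : ℂ)) • (starN n J (pd p.1.1 f) (pd p.1.2 g) -
        starN n J (pd p.1.2 f) (pd p.1.1 g)) := by
  ext1 x
  set M : Fin d × Fin d → (Fin n → Fin d × Fin d) → Mat a c := fun q s =>
    pdL (List.ofFn fun i => (s i).1) (pd q.1 f) x * pdL (List.ofFn fun i => (s i).2) (pd q.2 g) x
    with hM
  set T : Fin d × Fin d → Mat a c := fun q => ∑ s : Fin n → Fin d × Fin d,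
    ((MvPolynomial.coeff J (∏ i, theta (s i).1 (s i).2) : ℝ) : ℂ) • M q s with hT
  have h1 : ∑ s : Fin (n + 1) → Fin d × Fin d,
      ((((J p : ℝ) + 1) * MvPolynomial.coeff (J + single p 1)
        (∏ i, theta (s i).1 (s i).2) : ℝ) : ℂ) •
        (pdL (List.ofFn fun i => (s i).1) f x * pdL (List.ofFn fun i => (s i).2) g x) =
      ((n : ℂ) + 1) • ∑ q, ((thetaSign p q : ℝ) : ℂ) • T q := by
    have h2 : ∀ s : Fin (n + 1) → Fin d × Fin d,
        ((J p : ℝ) + 1) * MvPolynomial.coeff (J + single p 1)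
          (∏ i, theta (s i).1 (s i).2) = ∑ i, thetaSign p (s i) *
            MvPolynomial.coeff J (∏ j, theta (s (i.succAbove j)).1 (s (i.succAbove j)).2) := by
      intro s
      rw [mul_comm, ← MvPolynomial.coeff_pderiv, pderiv_prod, MvPolynomial.coeff_sum]
      refine sum_congr rfl fun i _ => ?_
      rw [pderiv_theta, MvPolynomial.coeff_C_mul]
    simp only [h2, Complex.ofReal_sum, sum_smul]
    rw [Finset.sum_comm]
    have h3 : ∀ i : Fin (n + 1), ∑ s : Fin (n + 1) → Fin d × Fin d,
        ((thetaSign p (s i) * MvPolynomial.coeff J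
          (∏ j, theta (s (i.succAbove j)).1 (s (i.succAbove j)).2) : ℝ) : ℂ) •
          (pdL (List.ofFn fun i => (s i).1) f x * pdL (List.ofFn fun i => (s i).2) g x) =
        ∑ q, ((thetaSign p q : ℝ) : ℂ) • T q := by
      intro i
      rw [← (Fin.insertNthEquiv (fun _ => Fin d × Fin d) i).sum_comp, Fintype.sum_prod_type]
      refine sum_congr rfl fun q _ => ?_
      rw [hT, smul_sum]
      refine sum_congr rfl fun s _ => ?_
      simp only [Fin.insertNthEquiv_apply, Fin.insertNth_apply_same,
        Fin.insertNth_apply_succAbove, smul_smul, Complex.ofReal_mul]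
      congr 1
      have hl : ∀ (π : Fin d × Fin d → Fin d) {m k : ℕ} (h : Pt d → Mat m k), Smooth h →
          pdL (List.ofFn fun j => π (Fin.insertNth (α := fun _ => Fin d × Fin d) i q s j)) h x =
            pdL (List.ofFn fun j => π (s j)) (pd (π q) h) x := by
        intro π m k h hh
        rw [pdL_perm hh (ofFn_perm_succAbove _ i), pdL_append]
        simp
      rw [hM]
      exact congrArg₂ _ (hl Prod.fst f hf) (hl Prod.snd g hg)
    simp only [h3]
    simp [← Nat.cast_smul_eq_nsmul ℂ]
  have h4 : ∑ q, ((thetaSign p q : ℝ) : ℂ) • T q = T p.1 - T p.1.swap := by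
    have hne : p.1 ≠ p.1.swap := by
      intro h
      have := congrArg Prod.fst h
      exact absurd p.2 (by simp at this; simp [this])
    rw [← Finset.sum_subset (Finset.subset_univ {p.1, p.1.swap}), Finset.sum_pair hne]
    · simp [thetaSign, hne.symm, sub_eq_add_neg]
    · intro q _ hq
      simp only [Finset.mem_insert, Finset.mem_singleton, not_or] at hq
      simp [thetaSign, hq.1, hq.2]
  rw [h4] at h1
  have h5 : ∀ (r : ℝ) (A : Mat a c), r • A = (r : ℂ) • A := fun r A => by
    rw [Complex.coe_smul]
  rw [Pi.smul_apply, Pi.smul_apply, Pi.sub_apply]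
  unfold starN
  rw [smul_comm, smul_sum]
  simp only [h5, smul_smul, ← Complex.ofReal_mul]
  rw [h1, ← smul_sub, smul_smul, smul_smul, pow_succ, Nat.factorial_succ]
  congr 1
  have : (Nat.factorial n : ℂ) ≠ 0 := by exact_mod_cast Nat.factorial_ne_zero n
  have h6 : ((n : ℂ) + 1) ≠ 0 := by exact_mod_cast Nat.succ_ne_zero n
  push_cast
  field_simp

/-- The recursion for the coefficients of the star product. -/
lemma starCoeff_add_single (J : Mon d) (p : Idx d) {f : Pt d → Mat a b}
    {g : Pt d → Mat b c} (hf : Smooth f) (hg : Smooth g) :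
    ((J p : ℝ) + 1) • starCoeff (J + single p 1) f g =
      (I * (Real.pi : ℂ)) • (starCoeff J (pd p.1.1 f) (pd p.1.2 g) -
        starCoeff J (pd p.1.2 f) (pd p.1.1 g)) := by
  have : (J + single p 1).degree = J.degree + 1 := by
    rw [map_add, Finsupp.degree_single]
  rw [starCoeff_eq, this, starN_add_single _ J p hf hg]
  rfl

/-- A property of star coefficients follows from the product and from the recursion. -/
lemma starCoeff_succ (J : Mon d) (p : Idx d) {f : Pt d → Mat a b}
    {g : Pt d → Mat b c} (hf : Smooth f) (hg : Smooth g) :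
    starCoeff (J + single p 1) f g = (((J p : ℝ) + 1)⁻¹) •
      (I * (Real.pi : ℂ)) • (starCoeff J (pd p.1.1 f) (pd p.1.2 g) -
        starCoeff J (pd p.1.2 f) (pd p.1.1 g)) := by
  have h3 : ((J p : ℝ) + 1) ≠ 0 := by positivity
  rw [eq_inv_smul_iff₀ h3, starCoeff_add_single J p hf hg]

lemma smooth_starCoeff (J : Mon d) {f : Pt d → Mat a b} {g : Pt d → Mat b c}
    (hf : Smooth f) (hg : Smooth g) : Smooth (starCoeff J f g) := by
  induction J using monomial_induction generalizing f g with
  | h0 => rw [starCoeff_zero]; exact smooth_mul hf hg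
  | hs J p ih =>
    rw [starCoeff_succ J p hf hg]
    exact contDiff_smul (contDiff_smul (ContDiff.sub (ih (contDiff_pd hf _) (contDiff_pd hg _))
      (ih (contDiff_pd hf _) (contDiff_pd hg _))) _) _

lemma starCoeff_add_left (J : Mon d) {f f' : Pt d → Mat a b} {g : Pt d → Mat b c}
    (hf : Smooth f) (hf' : Smooth f') (hg : Smooth g) :
    starCoeff J (f + f') g = starCoeff J f g + starCoeff J f' g := by
  induction J using monomial_induction generalizing f f' g with
  | h0 => simp only [starCoeff_zero]; ext1 x; simp [Matrix.add_mul]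
  | hs J p ih =>
    rw [starCoeff_succ J p hf hg, starCoeff_succ J p hf' hg,
      starCoeff_succ J p (f := f + f') (ContDiff.add hf hf') hg, pd_add hf hf', pd_add hf hf',
      ih (contDiff_pd hf _) (contDiff_pd hf' _) (contDiff_pd hg _),
      ih (contDiff_pd hf _) (contDiff_pd hf' _) (contDiff_pd hg _)]
    module

lemma starCoeff_add_right (J : Mon d) {f : Pt d → Mat a b} {g g' : Pt d → Mat b c}
    (hf : Smooth f) (hg : Smooth g) (hg' : Smooth g') :
    starCoeff J f (g + g') = starCoeff J f g + starCoeff J f g' := by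
  induction J using monomial_induction generalizing f g g' with
  | h0 => simp only [starCoeff_zero]; ext1 x; simp [Matrix.mul_add]
  | hs J p ih =>
    rw [starCoeff_succ J p hf hg, starCoeff_succ J p hf hg',
      starCoeff_succ J p (g := g + g') hf (ContDiff.add hg hg'), pd_add hg hg', pd_add hg hg',
      ih (contDiff_pd hf _) (contDiff_pd hg _) (contDiff_pd hg' _),
      ih (contDiff_pd hf _) (contDiff_pd hg _) (contDiff_pd hg' _)]
    module

lemma starCoeff_smul_left (J : Mon d) (r : ℂ) {f : Pt d → Mat a b} {g : Pt d → Mat b c}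
    (hf : Smooth f) (hg : Smooth g) : starCoeff J (r • f) g = r • starCoeff J f g := by
  induction J using monomial_induction generalizing f g with
  | h0 => simp only [starCoeff_zero]; ext1 x; simp
  | hs J p ih =>
    rw [starCoeff_succ J p hf hg, starCoeff_succ J p (contDiff_smul hf r) hg,
      pd_smul hf, pd_smul hf, ih (contDiff_pd hf _) (contDiff_pd hg _),
      ih (contDiff_pd hf _) (contDiff_pd hg _)]
    module

lemma starCoeff_smul_right (J : Mon d) (r : ℂ) {f : Pt d → Mat a b} {g : Pt d → Mat b c}
    (hf : Smooth f) (hg : Smooth g) : starCoeff J f (r • g) = r • starCoeff J f g := by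
  induction J using monomial_induction generalizing f g with
  | h0 => simp only [starCoeff_zero]; ext1 x; simp
  | hs J p ih =>
    rw [starCoeff_succ J p hf hg, starCoeff_succ J p hf (contDiff_smul hg r),
      pd_smul hg, pd_smul hg, ih (contDiff_pd hf _) (contDiff_pd hg _),
      ih (contDiff_pd hf _) (contDiff_pd hg _)]
    module

lemma pd_starCoeff (J : Mon d) (i : Fin d) {f : Pt d → Mat a b} {g : Pt d → Mat b c}
    (hf : Smooth f) (hg : Smooth g) :
    pd i (starCoeff J f g) = starCoeff J (pd i f) g + starCoeff J f (pd i g) := by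
  induction J using monomial_induction generalizing f g with
  | h0 => simp only [starCoeff_zero]; exact pd_mul hf hg i
  | hs J p ih =>
    have s : ∀ μ ν, Smooth (starCoeff J (pd μ f) (pd ν g)) := fun μ ν =>
      smooth_starCoeff J (contDiff_pd hf _) (contDiff_pd hg _)
    have sneg : ∀ {h h' : Pt d → Mat a c}, Smooth h → Smooth h' →
        pd i (h - h') = pd i h - pd i h' := by
      intro h h' hh hh'
      have h1 := pd_add hh (contDiff_smul hh' (-1 : ℝ)) i
      rw [pd_smul hh'] at h1
      simpa [sub_eq_add_neg] using h1
    have sc : Smooth (starCoeff J (pd p.1.1 f) (pd p.1.2 g) -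
        starCoeff J (pd p.1.2 f) (pd p.1.1 g)) := ContDiff.sub (s _ _) (s _ _)
    rw [starCoeff_succ J p hf hg, starCoeff_succ J p (contDiff_pd hf i) hg,
      starCoeff_succ J p hf (contDiff_pd hg i), pd_smul (contDiff_smul sc _), pd_smul sc,
      sneg (s _ _) (s _ _), ih (contDiff_pd hf _) (contDiff_pd hg _),
      ih (contDiff_pd hf _) (contDiff_pd hg _), pd_comm hf i p.1.1, pd_comm hf i p.1.2,
      pd_comm hg i p.1.1, pd_comm hg i p.1.2]
    module

end Star

/-! ### The star product of series -/

section StarSeries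

variable {d a b c e : ℕ}

lemma star_apply_zero (f : Ser d (Mat a b)) (g : Ser d (Mat b c)) :
    star f g 0 = fun x => f 0 x * g 0 x := by
  simp [star, starCoeff_zero]

lemma smoothS_star {f : Ser d (Mat a b)} {g : Ser d (Mat b c)} (hf : SmoothS f)
    (hg : SmoothS g) : SmoothS (star f g) := fun J => by
  unfold star
  exact contDiff_sum fun p _ => contDiff_sum fun q _ => smooth_starCoeff _ (hf _) (hg _)

lemma star_add_left {f f' : Ser d (Mat a b)} {g : Ser d (Mat b c)} (hf : SmoothS f)
    (hf' : SmoothS f') (hg : SmoothS g) : star (f + f') g = star f g + star f' g := by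
  ext1 J
  simp only [star, Pi.add_apply, starCoeff_add_left _ (hf _) (hf' _) (hg _),
    sum_add_distrib]

lemma star_add_right {f : Ser d (Mat a b)} {g g' : Ser d (Mat b c)} (hf : SmoothS f)
    (hg : SmoothS g) (hg' : SmoothS g') : star f (g + g') = star f g + star f g' := by
  ext1 J
  simp only [star, Pi.add_apply, starCoeff_add_right _ (hf _) (hg _) (hg' _),
    sum_add_distrib]

lemma star_smul_left (r : ℂ) {f : Ser d (Mat a b)} {g : Ser d (Mat b c)} (hf : SmoothS f)
    (hg : SmoothS g) : star (r • f) g = r • star f g := by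
  ext1 J
  simp only [star, Pi.smul_apply, starCoeff_smul_left _ r (hf _) (hg _), smul_sum]

lemma star_smul_right (r : ℂ) {f : Ser d (Mat a b)} {g : Ser d (Mat b c)} (hf : SmoothS f)
    (hg : SmoothS g) : star f (r • g) = r • star f g := by
  ext1 J
  simp only [star, Pi.smul_apply, starCoeff_smul_right _ r (hf _) (hg _), smul_sum]

lemma smoothS_pdS {f : Ser d V}
    (hf : SmoothS f) (i : Fin d) : SmoothS (pdS i f) := fun J => contDiff_pd (hf J) i

lemma pdS_star (i : Fin d) {f : Ser d (Mat a b)} {g : Ser d (Mat b c)} (hf : SmoothS f)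
    (hg : SmoothS g) : pdS i (star f g) = star (pdS i f) g + star f (pdS i g) := by
  ext1 J
  have h := fun p : Mon d × Mon d => pdL_sum (s := antidiagonal p.2)
    (f := fun q => starCoeff p.1 (f q.1) (g q.2)) (fun q _ => smooth_starCoeff p.1 (hf _) (hg _)) [i]
  have h' := pdL_sum (s := antidiagonal J)
    (f := fun p => ∑ q ∈ antidiagonal p.2, starCoeff p.1 (f q.1) (g q.2))
    (fun p _ => contDiff_sum fun q _ => smooth_starCoeff p.1 (hf _) (hg _)) [i]
  simp only [pdL_cons, pdL_nil] at h h'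
  simp only [pdS, star, h', h, pd_starCoeff _ i (hf _) (hg _), Pi.add_apply,
    sum_add_distrib]

lemma dT_star (p : Idx d) {f : Ser d (Mat a b)} {g : Ser d (Mat b c)} (hf : SmoothS f)
    (hg : SmoothS g) :
    dT p (star f g) = star (dT p f) g + star f (dT p g) + (Complex.I * (Real.pi : ℂ)) •
      (star (pdS p.1.1 f) (pdS p.1.2 g) - star (pdS p.1.2 f) (pdS p.1.1 g)) := by
  ext1 J
  unfold dT star
  rw [sum_antidiagonal_add_single J p fun I K =>
    ∑ q ∈ antidiagonal K, starCoeff I (f q.1) (g q.2)]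
  rw [add_comm]
  simp only [Pi.add_apply, Pi.smul_apply, Pi.sub_apply]
  congr 1
  · rw [← sum_add_distrib]
    refine sum_congr rfl fun q _ => ?_
    rw [sum_antidiagonal_add_single q.2 p fun K L => starCoeff q.1 (f K) (g L)]
    have hr : ∀ (r : ℝ) {V : Type} [AddCommGroup V] [Module ℂ V] (v : V), (r : ℂ) • v = r • v :=
      fun r V _ _ v => Complex.coe_smul r v
    congr 1
    · refine sum_congr rfl fun s _ => ?_
      rw [← hr, ← hr, starCoeff_smul_left _ _ (hf _) (hg _)]
    · refine sum_congr rfl fun s _ => ?_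
      rw [← hr, ← hr, starCoeff_smul_right _ _ (hf _) (hg _)]
  · rw [← sum_sub_distrib, smul_sum]
    refine sum_congr rfl fun q _ => ?_
    rw [← sum_sub_distrib, smul_sum, smul_sum]
    exact sum_congr rfl fun s _ => starCoeff_add_single q.1 p (hf _) (hg _)

lemma pdS_dT (p : Idx d) (i : Fin d)
    {f : Ser d V} (hf : SmoothS f) : pdS i (dT p f) = dT p (pdS i f) := by
  ext1 J
  exact pd_smul (hf _) _ i

lemma pdS_comm (i j : Fin d)
    {f : Ser d V} (hf : SmoothS f) : pdS i (pdS j f) = pdS j (pdS i f) := by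
  ext1 J
  exact pd_comm (hf _) i j

/-! ### Smooth matrix-valued series -/

/-- The space of series of smooth matrix-valued functions. -/
def SS (d a b : ℕ) : Submodule ℂ (Ser d (Mat a b)) where
  carrier := {f | SmoothS f}
  add_mem' hf hg := fun J => ContDiff.add (hf J) (hg J)
  zero_mem' := fun _ => contDiff_const
  smul_mem' r _ hf := fun J => contDiff_smul (hf J) r

/-- The star product on smooth series. -/
def mulS (f : SS d a b) (g : SS d b c) : SS d a c := ⟨star f.1 g.1, smoothS_star f.2 g.2⟩

infixl:70 " ⋆ " => mulS

@[simp] lemma coe_mulS (f : SS d a b) (g : SS d b c) : (f ⋆ g).1 = star f.1 g.1 := rfl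

/-- The star product as a bilinear map. -/
def mulSL (d a b c : ℕ) : SS d a b →ₗ[ℂ] SS d b c →ₗ[ℂ] SS d a c :=
  LinearMap.mk₂ ℂ mulS (fun f f' g => Subtype.ext (star_add_left f.2 f'.2 g.2))
    (fun r f g => Subtype.ext (star_smul_left r f.2 g.2))
    (fun f g g' => Subtype.ext (star_add_right f.2 g.2 g'.2))
    (fun r f g => Subtype.ext (star_smul_right r f.2 g.2))

lemma add_mulS (f f' : SS d a b) (g : SS d b c) : (f + f') ⋆ g = f ⋆ g + f' ⋆ g :=
  LinearMap.map_add₂ (mulSL d a b c) f f' g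

lemma mulS_add (f : SS d a b) (g g' : SS d b c) : f ⋆ (g + g') = f ⋆ g + f ⋆ g' :=
  (mulSL d a b c f).map_add g g'

lemma smul_mulS (r : ℂ) (f : SS d a b) (g : SS d b c) : (r • f) ⋆ g = r • (f ⋆ g) :=
  LinearMap.map_smul₂ (mulSL d a b c) r f g

lemma mulS_smul (r : ℂ) (f : SS d a b) (g : SS d b c) : f ⋆ (r • g) = r • (f ⋆ g) :=
  (mulSL d a b c f).map_smul r g

lemma sub_mulS (f f' : SS d a b) (g : SS d b c) : (f - f') ⋆ g = f ⋆ g - f' ⋆ g :=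
  LinearMap.map_sub₂ (mulSL d a b c) f f' g

lemma mulS_sub (f : SS d a b) (g g' : SS d b c) : f ⋆ (g - g') = f ⋆ g - f ⋆ g' :=
  (mulSL d a b c f).map_sub g g'

lemma neg_mulS (f : SS d a b) (g : SS d b c) : (-f) ⋆ g = -(f ⋆ g) :=
  LinearMap.map_neg₂ (mulSL d a b c) f g

lemma mulS_neg (f : SS d a b) (g : SS d b c) : f ⋆ (-g) = -(f ⋆ g) :=
  (mulSL d a b c f).map_neg g

lemma zero_mulS (g : SS d b c) : (0 : SS d a b) ⋆ g = 0 :=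
  LinearMap.map_zero₂ (mulSL d a b c) g

lemma mulS_zero (f : SS d a b) : f ⋆ (0 : SS d b c) = 0 :=
  (mulSL d a b c f).map_zero

lemma sum_mulS {I : Type} (s : Finset I) (f : I → SS d a b) (g : SS d b c) :
    (∑ i ∈ s, f i) ⋆ g = ∑ i ∈ s, f i ⋆ g :=
  LinearMap.map_sum₂ (mulSL d a b c) s f g

lemma mulS_sum {I : Type} (s : Finset I) (f : SS d a b) (g : I → SS d b c) :
    f ⋆ (∑ i ∈ s, g i) = ∑ i ∈ s, f ⋆ g i :=
  map_sum (mulSL d a b c f) g s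

/-- Partial derivatives of smooth series. -/
def pdSS (i : Fin d) : SS d a b →ₗ[ℂ] SS d a b where
  toFun f := ⟨pdS i f.1, smoothS_pdS f.2 i⟩
  map_add' f g := Subtype.ext (funext fun J => pd_add (f.2 J) (g.2 J) i)
  map_smul' r f := Subtype.ext (funext fun J => pd_smul (f.2 J) r i)

/-- Derivatives of smooth series with respect to the components of `θ`. -/
def dTS (p : Idx d) : SS d a b →ₗ[ℂ] SS d a b where
  toFun f := ⟨dT p f.1, smoothS_dT f.2 p⟩
  map_add' f g := Subtype.ext (funext fun J => smul_add _ _ _)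
  map_smul' r f := Subtype.ext (funext fun J => by
    change ((J p : ℝ) + 1) • r • f.1 (J + single p 1) =
      r • ((J p : ℝ) + 1) • f.1 (J + single p 1)
    exact smul_comm _ _ _)

@[simp] lemma coe_dTS (p : Idx d) (f : SS d a b) : (dTS p f).1 = dT p f.1 := rfl

lemma pdSS_mulS (i : Fin d) (f : SS d a b) (g : SS d b c) :
    pdSS i (f ⋆ g) = pdSS i f ⋆ g + f ⋆ pdSS i g := Subtype.ext (pdS_star i f.2 g.2)

lemma dTS_mulS (p : Idx d) (f : SS d a b) (g : SS d b c) :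
    dTS p (f ⋆ g) = dTS p f ⋆ g + f ⋆ dTS p g + (I * (Real.pi : ℂ)) •
      (pdSS p.1.1 f ⋆ pdSS p.1.2 g - pdSS p.1.2 f ⋆ pdSS p.1.1 g) :=
  Subtype.ext (dT_star p f.2 g.2)

lemma pdSS_dTS (p : Idx d) (i : Fin d) (f : SS d a b) : pdSS i (dTS p f) = dTS p (pdSS i f) :=
  Subtype.ext (pdS_dT p i f.2)

lemma pdSS_comm (i j : Fin d) (f : SS d a b) : pdSS i (pdSS j f) = pdSS j (pdSS i f) :=
  Subtype.ext (pdS_comm i j f.2)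

lemma mulS_assoc_apply (J : Mon d) : ∀ (f : SS d a b) (g : SS d b c) (h : SS d c e),
    ((f ⋆ g) ⋆ h).1 J = (f ⋆ (g ⋆ h)).1 J := by
  induction J using monomial_induction with
  | h0 =>
    intro f g h
    simp only [coe_mulS, star_apply_zero]
    ext1 x
    exact Matrix.mul_assoc _ _ _
  | hs J p ih =>
    intro f g h
    have h3 : ((J p : ℝ) + 1) ≠ 0 := by positivity
    refine smul_right_injective _ h3 ?_
    change (dTS p ((f ⋆ g) ⋆ h)).1 J = (dTS p (f ⋆ (g ⋆ h))).1 J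
    have add1 : ∀ u v : SS d a e, (u + v).1 J = u.1 J + v.1 J := fun _ _ => rfl
    have sub1 : ∀ u v : SS d a e, (u - v).1 J = u.1 J - v.1 J := fun _ _ => rfl
    have smul1 : ∀ (r : ℂ) (u : SS d a e), (r • u).1 J = r • u.1 J := fun _ _ => rfl
    simp only [dTS_mulS, pdSS_mulS, add_mulS, mulS_add, smul_mulS, mulS_smul, sub_mulS, mulS_sub,
      add1, sub1, smul1, ih]
    module

lemma mulS_assoc (f : SS d a b) (g : SS d b c) (h : SS d c e) :
    (f ⋆ g) ⋆ h = f ⋆ (g ⋆ h) :=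
  Subtype.ext (funext fun J => mulS_assoc_apply J f g h)

end StarSeries

/-! ### Star products of functionals -/

section StarFunctionals

variable {d a b c : ℕ}

lemma Loc.sub {G H : (Pt d → V) → Pt d → W} (hG : Loc G) (hH : Loc H) : Loc (G - H) := by
  rw [sub_eq_add_neg, ← neg_one_smul ℝ H]
  exact hG.add (hH.smul _)

lemma d1_sub {G H : (Pt d → V) → Pt d → W} (hG : Loc G) (hH : Loc H) {w : Pt d → V × V}
    (hw : Smooth w) : d1 (G - H) w = d1 G w - d1 H w :=
  funext fun x => ((hasDerivAt_d1 hG hw x).sub (hasDerivAt_d1 hH hw x)).deriv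

lemma loc_starCoeff (J : Mon d) {F : (Pt d → V) → Pt d → Mat a b}
    {G : (Pt d → V) → Pt d → Mat b c} (hF : Loc F) (hG : Loc G) :
    Loc (fun u => starCoeff J (F u) (G u)) := by
  induction J using monomial_induction generalizing F G with
  | h0 =>
    simp only [starCoeff_zero]
    exact (hF.prod hG).post (contDiff_bilin (bilinL (mulM a b c)) contDiff_fst contDiff_snd)
  | hs J p ih =>
    exact ((((ih (hF.pd p.1.1) (hG.pd p.1.2)).sub (ih (hF.pd p.1.2) (hG.pd p.1.1))).smul
      (I * (Real.pi : ℂ))).smul (((J p : ℝ) + 1)⁻¹)).congr fun u hu =>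
        starCoeff_succ J p (hF.smooth hu) (hG.smooth hu)

lemma d1_starCoeff (J : Mon d) {F : (Pt d → V) → Pt d → Mat a b}
    {G : (Pt d → V) → Pt d → Mat b c} (hF : Loc F) (hG : Loc G) {w : Pt d → V × V}
    (hw : Smooth w) : d1 (fun u => starCoeff J (F u) (G u)) w =
      starCoeff J (d1 F w) (G (fun y => (w y).1)) + starCoeff J (F (fun y => (w y).1)) (d1 G w) := by
  induction J using monomial_induction generalizing F G with
  | h0 =>
    simp only [starCoeff_zero]
    ext1 x
    refine (hasDerivAt_bilin (bilinL (mulM a b c)) (hasDerivAt_d1 hF hw x)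
      (hasDerivAt_d1 hG hw x)).deriv.trans ?_
    simp
    rfl
  | hs J p ih =>
    have l1 := loc_starCoeff J (hF.pd p.1.1) (hG.pd p.1.2)
    have l2 := loc_starCoeff J (hF.pd p.1.2) (hG.pd p.1.1)
    have hu := smooth_fst hw
    rw [starCoeff_succ J p (hF.d1.smooth hw) (hG.smooth hu),
      starCoeff_succ J p (hF.smooth hu) (hG.d1.smooth hw)]
    have h1 := d1_congr (w := w) (fun u hu => starCoeff_succ J p (hF.smooth hu) (hG.smooth hu)) hw
    have h2 := d1_smul ((l1.sub l2).smul (I * (Real.pi : ℂ))) (((J p : ℝ) + 1)⁻¹) hw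
    have h3 := d1_smul (l1.sub l2) (I * (Real.pi : ℂ)) hw
    have h4 := d1_sub l1 l2 hw
    rw [h4, ih (hF.pd _) (hG.pd _), ih (hF.pd _) (hG.pd _), d1_pd hF _ hw, d1_pd hF _ hw,
      d1_pd hG _ hw, d1_pd hG _ hw] at h3
    rw [h3] at h2
    refine h1.trans (h2.trans ?_)
    module

/-- The star product of functionals. -/
def starF (F : Fun d V (Mat a b)) (G : Fun d V (Mat b c)) : Fun d V (Mat a c) :=
  fun J u => star (app F u) (app G u) J

/-- Partial derivatives of functionals. -/
def pdF (i : Fin d) (F : Fun d V W) : Fun d V W := fun J u => pd i (F J u)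

/-- The functional given by a linear map of the values. -/
def linF (L : V →L[ℝ] W) : Fun d V W := fun J u x => if J = 0 then L (u x) else 0

lemma IsLocal.sub {F G : Fun d V W} (hF : IsLocal F) (hG : IsLocal G) : IsLocal (F - G) :=
  fun J => Loc.sub (hF J) (hG J)

lemma IsLocal.pdF {F : Fun d V W} (hF : IsLocal F) (i : Fin d) : IsLocal (SW.pdF i F) :=
  fun J => Loc.pd (hF J) i

lemma IsLocal.starF {F : Fun d V (Mat a b)} {G : Fun d V (Mat b c)} (hF : IsLocal F)
    (hG : IsLocal G) : IsLocal (SW.starF F G) := by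
  intro J
  have h := Loc.sum (s := antidiagonal J)
    (G := fun (p : Mon d × Mon d) => ∑ q ∈ antidiagonal p.2,
      fun u => starCoeff p.1 (F q.1 u) (G q.2 u))
    (fun p _ => Loc.sum fun q _ => loc_starCoeff p.1 (hF q.1) (hG q.2))
  refine h.congr fun u hu => ?_
  simp only [SW.starF, star, Finset.sum_apply, app]

lemma isLocal_linF (L : V →L[ℝ] W) : IsLocal (linF (d := d) L) := by
  intro J
  by_cases hJ : J = 0
  · subst hJ
    exact (loc_id.post L.contDiff).congr fun u _ => by ext1 x; simp [linF]
  · exact loc_zero.congr fun u _ => by ext1 x; simp [linF, hJ]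

lemma app_starF (F : Fun d V (Mat a b)) (G : Fun d V (Mat b c)) (u : Pt d → V) :
    app (starF F G) u = star (app F u) (app G u) := rfl

lemma app_linF (L : V →L[ℝ] W) (u : Pt d → V) :
    app (linF L) u = const (fun x => L (u x)) := by
  ext J x
  by_cases hJ : J = 0 <;> simp [app, linF, const, hJ]

lemma app_dFun_starF {F : Fun d V (Mat a b)} {G : Fun d V (Mat b c)} (hF : IsLocal F)
    (hG : IsLocal G) {w : Pt d → V × V} (hw : Smooth w) :
    app (dFun (starF F G)) w = star (app (dFun F) w) (app G (fun y => (w y).1)) +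
      star (app F (fun y => (w y).1)) (app (dFun G) w) := by
  ext1 J
  have h1 : app (dFun (starF F G)) w J = d1 (∑ p ∈ antidiagonal J,
      ∑ q ∈ antidiagonal p.2,
        fun u => starCoeff p.1 (F q.1 u) (G q.2 u)) w := by
    refine d1_congr (fun u _ => ?_) hw
    simp only [starF, star, Finset.sum_apply, app]
  rw [h1, d1_sum (fun p _ => Loc.sum fun (q : Mon d × Mon d) _ =>
    loc_starCoeff p.1 (hF q.1) (hG q.2)) hw]
  simp only [star, Pi.add_apply, ← sum_add_distrib]
  refine sum_congr rfl fun p _ => ?_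
  rw [d1_sum (fun (q : Mon d × Mon d) _ => loc_starCoeff p.1 (hF q.1) (hG q.2)) hw]
  exact sum_congr rfl fun q _ => d1_starCoeff p.1 (hF q.1) (hG q.2) hw

lemma app_dFun_pdF (i : Fin d) {F : Fun d V W} (hF : IsLocal F) {w : Pt d → V × V}
    (hw : Smooth w) : app (dFun (pdF i F)) w = pdS i (app (dFun F) w) :=
  funext fun J => d1_pd (hF J) i hw

lemma app_dFun_linF (L : V →L[ℝ] W) (w : Pt d → V × V) :
    app (dFun (linF L)) w = const (fun x => L (w x).2) := by
  ext1 J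
  ext1 x
  by_cases hJ : J = 0
  · subst hJ
    have h : HasDerivAt (fun s : ℝ => L ((w x).1 + s • (w x).2)) (L (w x).2) 0 := by
      simp only [map_add, map_smul]
      simpa using ((hasDerivAt_id (0 : ℝ)).smul_const (L (w x).2)).const_add (L (w x).1)
    simp [app, dFun, d1, linF, const] at h ⊢
    simpa using h.deriv
  · simp [app, dFun, d1, linF, const, hJ]

lemma app_dFun_add {F G : Fun d V W} (hF : IsLocal F) (hG : IsLocal G) {w : Pt d → V × V}
    (hw : Smooth w) : app (dFun (F + G)) w = app (dFun F) w + app (dFun G) w :=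
  funext fun J => d1_add (hF J) (hG J) hw

lemma app_dFun_sub {F G : Fun d V W} (hF : IsLocal F) (hG : IsLocal G) {w : Pt d → V × V}
    (hw : Smooth w) : app (dFun (F - G)) w = app (dFun F) w - app (dFun G) w :=
  funext fun J => d1_sub (hF J) (hG J) hw

lemma app_dFun_smul {R : Type} [Semiring R] [Module R W] [SMulCommClass ℝ R W]
    [ContinuousConstSMul R W] {F : Fun d V W} (hF : IsLocal F) (c : R) {w : Pt d → V × V}
    (hw : Smooth w) : app (dFun (c • F)) w = c • app (dFun F) w :=
  funext fun J => d1_smul (hF J) c hw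

lemma subst_sub {F G : Fun d V W} (hF : IsLocal F) (hG : IsLocal G) {u : Ser d V}
    (hu : SmoothS u) : subst (F - G) u = subst F u - subst G u := by
  have h := subst_add hF (hG.smul (-1 : ℝ)) hu
  rw [subst_smul hG _ hu] at h
  simpa [sub_eq_add_neg] using h

lemma taylor_pd (i : Fin d) (K : Mon d) : ∀ (V W : Type) [NormedAddCommGroup V]
    [NormedSpace ℝ V] [NormedAddCommGroup W] [NormedSpace ℝ W] (G : (Pt d → V) → Pt d → W)
    (u : Ser d V), Loc G → SmoothS u →
    Smooth (taylor K G u) ∧ taylor K (fun u => pd i (G u)) u = pd i (taylor K G u) := by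
  induction K using monomial_induction with
  | h0 =>
    intro V W _ _ _ _ G u hG hu
    simp only [taylor_zero]
    exact ⟨hG.smooth (hu 0), trivial⟩
  | hs K p ih =>
    intro V W _ _ _ _ G u hG hu
    have h3 : ((K p : ℝ) + 1) ≠ 0 := by positivity
    have huv := smoothS_pairS hu (smoothS_dT hu p)
    obtain ⟨hs, he⟩ := ih (V × V) W (d1 G) (pairS u (dT p u)) hG.d1 huv
    have h4 := contDiff_smul hs (((K p : ℝ) + 1)⁻¹)
    rw [← taylor_add_single hG hu, inv_smul_smul₀ h3] at h4
    refine ⟨h4, smul_right_injective _ h3 ?_⟩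
    change ((K p : ℝ) + 1) • _ = ((K p : ℝ) + 1) • _
    rw [taylor_add_single (hG.pd i) hu, ← pd_smul h4, taylor_add_single hG hu, ← he]
    exact taylor_congr (fun w hw => d1_pd hG i hw) huv K

lemma subst_pdF (i : Fin d) {F : Fun d V W} (hF : IsLocal F) {u : Ser d V} (hu : SmoothS u) :
    subst (pdF i F) u = pdS i (subst F u) := by
  ext1 J
  have h := pdL_sum (s := antidiagonal J)
    (f := fun q => taylor q.2 (F q.1) u) (fun q _ => (taylor_pd i q.2 V W _ u (hF q.1) hu).1) [i]
  simp only [pdL_cons, pdL_nil] at h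
  simp only [pdS, subst_apply, h]
  exact sum_congr rfl fun q _ => (taylor_pd i q.2 V W _ u (hF q.1) hu).2

lemma taylor_id (K : Mon d) {u : Ser d V} (hu : SmoothS u) : taylor K (fun v => v) u = u K := by
  induction K using monomial_induction generalizing V with
  | h0 => rw [taylor_zero]
  | hs K p ih =>
    have h3 : ((K p : ℝ) + 1) ≠ 0 := by positivity
    refine smul_right_injective _ h3 ?_
    change ((K p : ℝ) + 1) • _ = dT p u K
    have huv := smoothS_pairS hu (smoothS_dT hu p)
    rw [taylor_add_single loc_id hu]
    have h : ∀ w : Pt d → V × V, Smooth w → d1 (fun v : Pt d → V => v) w = fun x => (w x).2 := by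
      intro w hw
      ext1 x
      have : HasDerivAt (fun s : ℝ => (w x).1 + s • (w x).2) (w x).2 0 := by
        simpa using ((hasDerivAt_id (0 : ℝ)).smul_const (w x).2).const_add (w x).1
      exact this.deriv
    rw [taylor_congr h huv]
    have h5 := taylor_post (snd ℝ V V) K (loc_id (V := V × V)) huv
    rw [ih huv] at h5
    exact h5

lemma subst_linF (L : V →L[ℝ] W) {u : Ser d V} (hu : SmoothS u) :
    subst (linF L) u = fun J y => L (u J y) := by
  ext1 J
  rw [subst_apply, sum_eq_single (0, J)]
  · have h := taylor_post L J (loc_id (V := V)) hu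
    rw [taylor_id J hu] at h
    rw [← h]
    refine taylor_congr (fun v _ => ?_) hu J
    ext1 x
    simp [linF]
  · rintro ⟨p, q⟩ hpq hne
    rw [mem_antidiagonal] at hpq
    have hp : p ≠ 0 := by
      rintro rfl
      apply hne
      simpa using hpq
    have h2 : (linF L : Fun d V W) p = 0 := by
      ext v x; simp [linF, hp]
    have h4 := taylor_smul (loc_zero (d := d) (V := V) (W := W)) hu q (0 : ℝ)
    simp only [zero_smul] at h4
    rw [h2, h4]
  · intro h
    simp at h

lemma app_dT_starF {F : Fun d V (Mat a b)} {G : Fun d V (Mat b c)} (hF : IsLocal F)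
    (hG : IsLocal G) (p : Idx d) {u : Pt d → V} (hu : Smooth u) :
    app (dT p (starF F G)) u = app (starF (dT p F) G + starF F (dT p G) +
      (I * (Real.pi : ℂ)) •
        (starF (pdF p.1.1 F) (pdF p.1.2 G) - starF (pdF p.1.2 F) (pdF p.1.1 G))) u := by
  rw [app_dT, app_starF, dT_star p (hF.smoothS hu) (hG.smoothS hu)]
  rfl

lemma subst_starF_apply (J : Mon d) : ∀ (V : Type) [NormedAddCommGroup V] [NormedSpace ℝ V]
    (F : Fun d V (Mat a b)) (G : Fun d V (Mat b c)) (u : Ser d V), IsLocal F → IsLocal G →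
    SmoothS u → subst (starF F G) u J = star (subst F u) (subst G u) J := by
  induction J using monomial_induction with
  | h0 =>
    intro V _ _ F G u hF hG hu
    rw [subst_zero, star_apply_zero, subst_zero, subst_zero]
    exact star_apply_zero _ _
  | hs J p ih =>
    intro V _ _ F G u hF hG hu
    have h3 : ((J p : ℝ) + 1) ≠ 0 := by positivity
    refine smul_right_injective _ h3 ?_
    change dT p (subst (starF F G) u) J = dT p (star (subst F u) (subst G u)) J
    have huv := smoothS_pairS hu (smoothS_dT hu p)
    have hFp := hF.preF (fst ℝ V V)
    have hGp := hG.preF (fst ℝ V V)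
    have l1 := (hF.dT p).starF hG
    have l2 := hF.starF (hG.dT p)
    have l3 := (hF.pdF p.1.1).starF (hG.pdF p.1.2)
    have l4 := (hF.pdF p.1.2).starF (hG.pdF p.1.1)
    rw [dT_subst (hF.starF hG) hu,
      dT_star p (smoothS_subst hF hu) (smoothS_subst hG hu), dT_subst hF hu, dT_subst hG hu,
      subst_congr (G := starF (dT p F) G + starF F (dT p G) + (I * (Real.pi : ℂ)) •
        (starF (pdF p.1.1 F) (pdF p.1.2 G) - starF (pdF p.1.2 F) (pdF p.1.1 G)))
        (fun v hv => app_dT_starF hF hG p hv) hu,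
      subst_congr (G := starF (dFun F) (preF G (fst ℝ V V)) +
        starF (preF F (fst ℝ V V)) (dFun G))
        (fun w hw => app_dFun_starF hF hG hw) huv,
      subst_add (l1.add l2) ((l3.sub l4).smul _) hu, subst_add l1 l2 hu,
      subst_smul (l3.sub l4) _ hu, subst_sub l3 l4 hu,
      subst_add (hF.dFun.starF hGp) (hFp.starF hG.dFun) huv,
      star_add_left (smoothS_subst (hF.dT p) hu) (smoothS_subst hF.dFun huv)
        (smoothS_subst hG hu),
      star_add_right (smoothS_subst hF hu) (smoothS_subst (hG.dT p) hu)
        (smoothS_subst hG.dFun huv)]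
    simp only [Pi.add_apply, Pi.smul_apply, Pi.sub_apply]
    rw [ih _ _ _ _ (hF.dT p) hG hu, ih _ _ _ _ hF (hG.dT p) hu,
      ih _ _ _ _ (hF.pdF _) (hG.pdF _) hu, ih _ _ _ _ (hF.pdF _) (hG.pdF _) hu,
      ih _ _ _ _ hF.dFun hGp huv, ih _ _ _ _ hFp hG.dFun huv, subst_pdF _ hF hu,
      subst_pdF _ hF hu, subst_pdF _ hG hu, subst_pdF _ hG hu, subst_preF, subst_preF]
    have e : (fun (J : Mon d) y => (fst ℝ V V) (pairS u (dT p u) J y)) = u := rfl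
    rw [e]
    module

lemma subst_starF {F : Fun d V (Mat a b)} {G : Fun d V (Mat b c)} (hF : IsLocal F)
    (hG : IsLocal G) {u : Ser d V} (hu : SmoothS u) :
    subst (starF F G) u = star (subst F u) (subst G u) :=
  funext fun J => subst_starF_apply J V F G u hF hG hu

end StarFunctionals

section Flow

variable {d : ℕ} {E Q : Type} [NormedAddCommGroup E] [NormedSpace ℝ E]
  [NormedAddCommGroup Q] [NormedSpace ℝ Q]

/-! ### Variations -/

lemma const_apply_zero (f : Pt d → V) : const f 0 = f := by simp [const]

lemma smoothS_const {f : Pt d → V} (hf : Smooth f) : SmoothS (const f) := by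
  intro J
  by_cases hJ : J = 0
  · simpa [const, hJ] using hf
  · simp only [const, hJ, if_false]; exact contDiff_const

lemma dT_const (f : Pt d → V) (p : Idx d) : dT p (const f) = 0 := by
  ext1 J
  have : J + single p 1 ≠ 0 := by
    intro h
    have := congrArg (fun L : Mon d => L p) h
    simp at this
  simp [dT, const, this]

lemma family_const (K : Mon d) (u : Pt d → V) (t : Idx d → ℝ) : family K (const u) t = u := by
  ext1 y
  simp only [family, const]
  rw [sum_eq_single 0]
  · simp
  · intro L _ hL; simp [hL]
  · intro h; simp at h

lemma d1_sum_right {I : Type} {G : (Pt d → V) → Pt d → W} (hG : Loc G) {u : Pt d → V}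
    (hu : Smooth u) (s : Finset I) (c : I → ℝ) {v : I → Pt d → V} (hv : ∀ i, Smooth (v i)) :
    d1 G (fun y => (u y, ∑ i ∈ s, c i • v i y)) = ∑ i ∈ s, c i • d1 G (fun y => (u y, v i y)) := by
  classical
  induction s using Finset.induction_on with
  | empty => simp [d1_zero_right]
  | insert a s ha ih =>
    have h1 : Smooth (fun y => ∑ i ∈ s, c i • v i y) := by
      have := contDiff_sum (s := s) fun i _ => contDiff_smul (hv i) (c i)
      have e : (fun y => ∑ i ∈ s, c i • v i y) = ∑ i ∈ s, c i • v i := by ext1 y; simp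
      unfold Smooth
      rw [e]; exact this
    simp only [sum_insert ha]
    rw [d1_add_right hG hu (v := fun y => c a • v a y) (contDiff_smul (hv a) (c a)) h1, ih,
      d1_smul_right hG hu (hv a)]

lemma taylor_d1_const (K : Mon d) {G : (Pt d → V) → Pt d → W} (hG : Loc G) {u : Pt d → V}
    (hu : Smooth u) {v : Ser d V} (hv : SmoothS v) :
    taylor K (d1 G) (pairS (const u) v) = d1 G (fun y => (u y, v K y)) := by
  ext1 x
  rw [taylor_def]
  have h : (fun t => d1 G (family K (pairS (const u) v) t) x) =
      polyCurve K (fun L => d1 G (fun y => (u y, v L y)) x) := by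
    ext1 t
    rw [family_pairS, family_const]
    have := congrFun (d1_sum_right hG hu (Finset.Iic K) (fun L => ∏ p, t p ^ L p) hv) x
    refine this.trans ?_
    simp [polyCurve]
  rw [h, pdM_polyCurve le_rfl, inv_smul_smul₀ (mfact_ne_zero K)]

lemma variation_eq_subst {F : Fun d V W} (hF : IsLocal F) {u : Pt d → V} (hu : Smooth u)
    {v : Ser d V} (hv : SmoothS v) :
    variation F u v = subst (dFun F) (pairS (const u) v) := by
  ext1 J
  rw [subst_apply]
  ext1 x
  simp only [variation, Finset.sum_apply]
  exact sum_congr rfl fun q _ => (congrFun (taylor_d1_const q.2 (hF q.1) hu hv) x).symm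

lemma variation_const {F : Fun d V W} (u v : Pt d → V) :
    variation F u (const v) = app (dFun F) (fun y => (u y, v y)) := by
  ext1 J
  ext1 x
  simp only [variation]
  rw [sum_eq_single (J, 0)]
  · simp [const, app, dFun, d1]
  · rintro ⟨p, q⟩ hpq hne
    rw [mem_antidiagonal] at hpq
    have hq : q ≠ 0 := by
      rintro rfl
      apply hne
      simpa using hpq
    simp [const, hq]
  · intro h; simp at h

lemma app_linF_id (u : Pt d → V) : app (linF (ContinuousLinearMap.id ℝ V)) u = const u :=
  app_linF _ u

lemma subst_const {F : Fun d V W} (hF : IsLocal F) {u : Pt d → V} :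
    subst F (const u) = app F u := by
  ext1 J
  rw [subst_apply]
  have h : ∀ K (G : (Pt d → V) → Pt d → W), Loc G → taylor K G (const u) =
      if K = 0 then G u else 0 := by
    intro K G hG
    ext1 x
    rw [taylor_def]
    have h1 : (fun t => G (family K (const u) t) x) =
        polyCurve K (fun L => if L = 0 then G u x else 0) := by
      ext1 t
      rw [family_const]
      unfold polyCurve
      rw [sum_eq_single 0]
      · simp
      · intro L _ hL; simp [hL]
      · intro h; simp at h
    rw [h1, pdM_polyCurve le_rfl, inv_smul_smul₀ (mfact_ne_zero K)]
    split_ifs <;> rfl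
  rw [sum_eq_single (J, 0)]
  · rw [h 0 _ (hF J)]; rfl
  · rintro ⟨p, q⟩ hpq hne
    rw [mem_antidiagonal] at hpq
    have hq : q ≠ 0 := by
      rintro rfl
      apply hne
      simpa using hpq
    simp [h q _ (hF p), hq]
  · intro h; simp at h

lemma smoothS_variation {F : Fun d V W} (hF : IsLocal F) {u : Pt d → V} (hu : Smooth u)
    {v : Ser d V} (hv : SmoothS v) : SmoothS (variation F u v) := by
  rw [variation_eq_subst hF hu hv]
  exact smoothS_subst hF.dFun (smoothS_pairS (smoothS_const hu) hv)

lemma variation_congr {F G : Fun d V W} (h : ∀ u, Smooth u → app F u = app G u)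
    (hG : IsLocal G) {u : Pt d → V} (hu : Smooth u) {v : Ser d V} (hv : SmoothS v) :
    variation F u v = variation G u v := by
  have hF : IsLocal F := hG.congr h
  rw [variation_eq_subst hF hu hv, variation_eq_subst hG hu hv]
  exact subst_congr (fun w hw => funext fun J => d1_congr (fun u hu => congrFun (h u hu) J) hw)
    (smoothS_pairS (smoothS_const hu) hv)

lemma variation_add {F G : Fun d V W} (hF : IsLocal F) (hG : IsLocal G) {u : Pt d → V}
    (hu : Smooth u) {v : Ser d V} (hv : SmoothS v) :
    variation (F + G) u v = variation F u v + variation G u v := by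
  have huv := smoothS_pairS (smoothS_const hu) hv
  rw [variation_eq_subst (hF.add hG) hu hv, variation_eq_subst hF hu hv,
    variation_eq_subst hG hu hv, ← subst_add hF.dFun hG.dFun huv]
  exact subst_congr (fun w hw => app_dFun_add hF hG hw) huv

lemma variation_smul {R : Type} [Semiring R] [Module R W] [SMulCommClass ℝ R W]
    [ContinuousConstSMul R W] {F : Fun d V W} (hF : IsLocal F) (c : R) {u : Pt d → V}
    (hu : Smooth u) {v : Ser d V} (hv : SmoothS v) :
    variation (c • F) u v = c • variation F u v := by
  have huv := smoothS_pairS (smoothS_const hu) hv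
  rw [variation_eq_subst (hF.smul c) hu hv, variation_eq_subst hF hu hv,
    ← subst_smul hF.dFun c huv]
  exact subst_congr (fun w hw => app_dFun_smul hF c hw) huv

lemma variation_sub {F G : Fun d V W} (hF : IsLocal F) (hG : IsLocal G) {u : Pt d → V}
    (hu : Smooth u) {v : Ser d V} (hv : SmoothS v) :
    variation (F - G) u v = variation F u v - variation G u v := by
  have huv := smoothS_pairS (smoothS_const hu) hv
  rw [variation_eq_subst (hF.sub hG) hu hv, variation_eq_subst hF hu hv,
    variation_eq_subst hG hu hv, ← subst_sub hF.dFun hG.dFun huv]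
  exact subst_congr (fun w hw => app_dFun_sub hF hG hw) huv

lemma variation_pdF (i : Fin d) {F : Fun d V W} (hF : IsLocal F) {u : Pt d → V}
    (hu : Smooth u) {v : Ser d V} (hv : SmoothS v) :
    variation (pdF i F) u v = pdS i (variation F u v) := by
  have huv := smoothS_pairS (smoothS_const hu) hv
  rw [variation_eq_subst (hF.pdF i) hu hv, variation_eq_subst hF hu hv,
    ← subst_pdF i hF.dFun huv]
  exact subst_congr (fun w hw => app_dFun_pdF i hF hw) huv

lemma variation_linF (L : V →L[ℝ] W) {u : Pt d → V}
    (hu : Smooth u) {v : Ser d V} (hv : SmoothS v) :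
    variation (linF L) u v = fun J y => L (v J y) := by
  have huv := smoothS_pairS (smoothS_const hu) hv
  rw [variation_eq_subst (isLocal_linF L) hu hv,
    subst_congr (G := linF (L.comp (snd ℝ V V))) (fun w hw => ?_) huv,
    subst_linF _ huv]
  · rfl
  · rw [app_dFun_linF, app_linF]; rfl

lemma variation_starF {a b c : ℕ} {F : Fun d V (Mat a b)} {G : Fun d V (Mat b c)}
    (hF : IsLocal F) (hG : IsLocal G) {u : Pt d → V} (hu : Smooth u) {v : Ser d V}
    (hv : SmoothS v) :
    variation (starF F G) u v =
      star (variation F u v) (app G u) + star (app F u) (variation G u v) := by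
  have huv := smoothS_pairS (smoothS_const hu) hv
  have hFp := hF.preF (fst ℝ V V)
  have hGp := hG.preF (fst ℝ V V)
  rw [variation_eq_subst (hF.starF hG) hu hv, variation_eq_subst hF hu hv,
    variation_eq_subst hG hu hv,
    subst_congr (G := starF (dFun F) (preF G (fst ℝ V V)) +
        starF (preF F (fst ℝ V V)) (dFun G))
        (fun w hw => app_dFun_starF hF hG hw) huv,
    subst_add (hF.dFun.starF hGp) (hFp.starF hG.dFun) huv, subst_starF hF.dFun hGp huv,
    subst_starF hFp hG.dFun huv, subst_preF, subst_preF]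
  have e : (fun (J : Mon d) y => (fst ℝ V V) (pairS (const u) v J y)) =
    const u := rfl
  rw [e, subst_const hF, subst_const hG]

lemma variation_pairF {F : Fun d V W} {G : Fun d V X} (hF : IsLocal F) (hG : IsLocal G)
    {u : Pt d → V} (hu : Smooth u) {v : Ser d V} (hv : SmoothS v) :
    variation (pairF F G) u v = pairS (variation F u v) (variation G u v) := by
  have huv := smoothS_pairS (smoothS_const hu) hv
  rw [variation_eq_subst (hF.pairF hG) hu hv, variation_eq_subst hF hu hv,
    variation_eq_subst hG hu hv, ← subst_pairF hF.dFun hG.dFun huv]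
  exact subst_congr (fun w hw => funext fun J => d1_prod (hF J) (hG J) hw) huv

lemma variation_preF (F : Fun d V W) (L : U →L[ℝ] V) (u : Pt d → U) (v : Ser d U) :
    variation (preF F L) u v = variation F (fun y => L (u y)) (fun J y => L (v J y)) := by
  ext J x
  simp [variation, preF]

/-- Postcomposition with a linear map of the values. -/
def postF (L : W →L[ℝ] X) (F : Fun d V W) : Fun d V X := fun J u x => L (F J u x)

lemma IsLocal.postF {F : Fun d V W} (hF : IsLocal F) (L : W →L[ℝ] X) :
    IsLocal (SW.postF L F) := fun J => Loc.post (hF J) L.contDiff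

lemma subst_postF (L : W →L[ℝ] X) {F : Fun d V W} (hF : IsLocal F) {u : Ser d V}
    (hu : SmoothS u) : subst (postF L F) u = fun J x => L (subst F u J x) := by
  ext1 J
  ext1 x
  simp only [subst, map_sum]
  exact sum_congr rfl fun q _ => congrFun (taylor_post L q.2 (hF q.1) hu) x

lemma variation_postF (L : W →L[ℝ] X) {F : Fun d V W} (hF : IsLocal F) {u : Pt d → V}
    (hu : Smooth u) {v : Ser d V} (hv : SmoothS v) :
    variation (postF L F) u v = fun J x => L (variation F u v J x) := by
  have huv := smoothS_pairS (smoothS_const hu) hv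
  rw [variation_eq_subst (hF.postF L) hu hv, variation_eq_subst hF hu hv,
    ← subst_postF L hF.dFun huv]
  refine subst_congr (fun w hw => funext fun J => funext fun x => ?_) huv
  exact (L.hasFDerivAt.comp_hasDerivAt (0 : ℝ) (hasDerivAt_d1 (hF J) hw x)).deriv

/-! ### Inversion of functionals of the form identity plus higher order -/

/-- A functional is determined by its composite with `h = id + O(θ)`. -/
lemma eq_zero_of_subst_eq_zero {h : Fun d V V} (hh : IsLocal h)
    (h0 : ∀ v, Smooth v → h 0 v = v) {F : Fun d V W}
    (hF : ∀ v, Smooth v → subst F (app h v) = 0) (v : Pt d → V) (hv : Smooth v) :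
    app F v = 0 := by
  ext1 J
  induction hn : J.degree using Nat.strong_induction_on generalizing J v with
  | _ n ih =>
    have h1 := congrFun (hF v hv) J
    rw [subst_apply, sum_eq_single (J, 0), taylor_zero] at h1
    · have h2 : app h v 0 = v := h0 v hv
      rw [h2] at h1
      exact h1
    · rintro ⟨p, q⟩ hpq hne
      rw [mem_antidiagonal] at hpq
      have hq : q ≠ 0 := by
        rintro rfl
        apply hne
        simpa using hpq
      have hlt : p.degree < n := by
        have h3 : p + q = J := hpq
        rw [← hn, ← h3, map_add]
        have : q.degree ≠ 0 := fun h => hq ((Finsupp.degree_eq_zero_iff q).mp h)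
        omega
      have h4 := taylor_smul (loc_zero (d := d) (V := V) (W := W)) (hh.smoothS hv) q (0 : ℝ)
      simp only [zero_smul] at h4
      refine (taylor_congr (fun u hu => ?_) (hh.smoothS hv) q).trans h4
      exact ih _ hlt u hu p rfl
    · intro h; simp at h

/-- The functional whose composite with `h = id + O(θ)` is `F`. -/
def invF (h : Fun d V V) (F : Fun d V W) (J : Mon d) (v : Pt d → V) : Pt d → W :=
  F J v - ∑ q ∈ (antidiagonal J).attach,
    if hq : q.1.2 = 0 then 0 else taylor q.1.2 (invF h F q.1.1) (app h v)
termination_by J.degree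
decreasing_by
  have h1 := q.2
  rw [mem_antidiagonal] at h1
  have h2 := congrArg Finsupp.degree h1
  rw [map_add] at h2
  have : q.1.2.degree ≠ 0 := fun h => hq ((Finsupp.degree_eq_zero_iff _).mp h)
  omega

lemma invF_eq (h : Fun d V V) (F : Fun d V W) (J : Mon d) (v : Pt d → V) :
    invF h F J v = F J v - ∑ q ∈ antidiagonal J,
      if q.2 = 0 then 0 else taylor q.2 (invF h F q.1) (app h v) := by
  conv_lhs => unfold invF
  rw [← Finset.sum_attach (antidiagonal J)]
  simp only [dite_eq_ite]

lemma isLocal_invF {h : Fun d V V} (hh : IsLocal h) {F : Fun d V W} (hF : IsLocal F) :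
    IsLocal (invF h F) := by
  intro J
  induction hn : J.degree using Nat.strong_induction_on generalizing J with
  | _ n ih =>
    have hs : Loc (∑ q ∈ antidiagonal J, fun v =>
        if q.2 = 0 then 0 else taylor q.2 (invF h F q.1) (app h v)) := by
      refine Loc.sum fun q hq => ?_
      rw [mem_antidiagonal] at hq
      by_cases hq0 : q.2 = 0
      · simp only [hq0, if_true]; exact loc_zero
      · simp only [hq0, if_false]
        have hlt : q.1.degree < n := by
          rw [← hn, ← hq, map_add]
          have : q.2.degree ≠ 0 := fun h => hq0 ((Finsupp.degree_eq_zero_iff _).mp h)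
          omega
        exact loc_taylor q.2 V W _ h (ih _ hlt q.1 rfl) hh
    refine (Loc.sub (hF J) hs).congr fun v _ => ?_
    rw [invF_eq]
    simp only [Pi.sub_apply, Finset.sum_apply]

lemma subst_invF {h : Fun d V V} (h0 : ∀ v, Smooth v → h 0 v = v) (F : Fun d V W)
    {v : Pt d → V} (hv : Smooth v) : subst (invF h F) (app h v) = app F v := by
  ext1 J
  have h2 : app h v 0 = v := h0 v hv
  rw [subst_apply, ← Finset.add_sum_erase _ _ (a := (J, 0)) (by simp), taylor_zero, h2,
    invF_eq, ← Finset.add_sum_erase (antidiagonal J)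
      (fun q => if q.2 = 0 then 0 else taylor q.2 (invF h F q.1) (app h v)) (a := (J, 0)) (by simp)]
  have h3 : ∑ q ∈ (antidiagonal J).erase (J, 0),
      (if q.2 = 0 then 0 else taylor q.2 (invF h F q.1) (app h v)) =
      ∑ q ∈ (antidiagonal J).erase (J, 0),
        taylor q.2 (invF h F q.1) (app h v) := by
    refine sum_congr rfl fun q hq => ?_
    rw [Finset.mem_erase, mem_antidiagonal] at hq
    rw [if_neg]
    intro hq0
    apply hq.1
    refine Prod.ext ?_ hq0
    rw [← hq.2, hq0, add_zero]
  rw [h3]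
  simp [app]

/-! ### Flows and gauge variations -/

/-- The map of parameters and fields. -/
def hatF (h : Fun d Q Q) (eh : Fun d (E × Q) E) : Fun d (E × Q) (E × Q) :=
  pairF eh (preF h (snd ℝ E Q))

lemma flow_iff {h : Fun d Q Q} (hh : IsLocal h) (h0 : ∀ q, Smooth q → h 0 q = q)
    {eh : Fun d (E × Q) E} (heh : IsLocal eh)
    (eh0 : ∀ w : Pt d → E × Q, Smooth w → eh 0 w = fun y => (w y).1)
    {RQ : Idx d → Fun d Q Q} (hRQ : ∀ p, IsLocal (RQ p))
    {RE : Idx d → Fun d (E × Q) E} (hRE : ∀ p, IsLocal (RE p))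
    {VG : Fun d (E × Q) Q} (hVG : IsLocal VG)
    (flowQ : ∀ p q, Smooth q → dT p (app h q) = subst (RQ p) (app h q))
    (flowE : ∀ p w, Smooth w → dT p (app eh w) = subst (RE p) (app (hatF h eh) w)) :
    (∀ w : Pt d → E × Q, Smooth w → app (dFun h) (fun y => ((w y).2, VG 0 w y)) =
        subst VG (app (hatF h eh) w)) ↔
      ∀ p, ∀ w : Pt d → E × Q, Smooth w →
        variation (RQ p) (fun y => (w y).2) (app VG w) = dT p (app VG w) +
          variation VG w (pairS (app (RE p) w) (app (RQ p) (fun y => (w y).2))) := by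
  let S := snd ℝ E Q
  have hhat : IsLocal (hatF h eh) := heh.pairF (hh.preF S)
  have hat0 : ∀ w, Smooth w → hatF h eh 0 w = w := by
    intro w hw
    have e1 : eh 0 w = fun y => (w y).1 := eh0 w hw
    have e2 : h 0 (fun y => (w y).2) = fun y => (w y).2 := h0 _ (smooth_snd hw)
    ext1 y
    exact Prod.ext (congrFun e1 y) (congrFun e2 y)
  let I := linF (d := d) (ContinuousLinearMap.id ℝ (E × Q))
  have hI : IsLocal I := isLocal_linF _
  have hS : IsLocal (linF (d := d) S) := isLocal_linF _
  let Z : Idx d → Fun d (E × Q) Q := fun p =>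
    compF (dFun (RQ p)) (pairF (linF S) VG) -
      (dT p VG + compF (dFun VG) (pairF I (pairF (RE p) (preF (RQ p) S))))
  have hZ1 : ∀ p, IsLocal (compF (dFun (RQ p)) (pairF (linF S) VG)) := fun p =>
    (hRQ p).dFun.compF (hS.pairF hVG)
  have hRR : ∀ p, IsLocal (pairF (RE p) (preF (RQ p) S)) := fun p =>
    (hRE p).pairF ((hRQ p).preF S)
  have hZ2 : ∀ p, IsLocal (compF (dFun VG) (pairF I (pairF (RE p) (preF (RQ p) S)))) := fun p =>
    hVG.dFun.compF (hI.pairF (hRR p))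
  have hZl : ∀ p, IsLocal (Z p) := fun p => (hZ1 p).sub ((hVG.dT p).add (hZ2 p))
  have hZ : ∀ p w, Smooth w → (app (Z p) w = 0 ↔
      variation (RQ p) (fun y => (w y).2) (app VG w) = dT p (app VG w) +
        variation VG w (pairS (app (RE p) w) (app (RQ p) (fun y => (w y).2)))) := by
    intro p w hw
    rw [variation_eq_subst (hRQ p) (smooth_snd hw) (hVG.smoothS hw),
      variation_eq_subst hVG hw (smoothS_pairS ((hRE p).smoothS hw)
        ((hRQ p).smoothS (smooth_snd hw)))]
    have e1 : app (linF (d := d) S) w = const (fun y => (w y).2) := app_linF S w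
    have e2 : app I w = const w := app_linF_id w
    have e3 : app (Z p) w = subst (dFun (RQ p)) (pairS (app (linF S) w) (app VG w)) -
      (dT p (app VG w) + subst (dFun VG) (pairS (app I w)
        (pairS (app (RE p) w) (app (RQ p) (fun y => (w y).2))))) := rfl
    rw [e3, e1, e2, sub_eq_zero]
  have key : ∀ w : Pt d → E × Q, Smooth w → ∀ p,
      dT p (app (dFun h) (fun y => ((w y).2, VG 0 w y)) - subst VG (app (hatF h eh) w)) =
        subst (dFun (RQ p)) (pairS (app h (fun y => (w y).2))
          (app (dFun h) (fun y => ((w y).2, VG 0 w y)) - subst VG (app (hatF h eh) w))) +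
        subst (Z p) (app (hatF h eh) w) := by
    intro w hw p
    have hq := smooth_snd hw
    have hv : Smooth (fun y => ((w y).2, VG 0 w y)) := smooth_pair hq (Loc.smooth (hVG 0) hw)
    have hhw := hhat.smoothS hw
    have hhq := hh.smoothS hq
    have hdh := hh.dFun.smoothS hv
    have hVs := smoothS_subst hVG hhw
    have e1 : dT p (app (dFun h) (fun y => ((w y).2, VG 0 w y))) =
        subst (dFun (RQ p)) (pairS (app h (fun y => (w y).2))
          (app (dFun h) (fun y => ((w y).2, VG 0 w y)))) := by
      rw [← app_dFun_compF (hRQ p) hh hv]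
      ext1 J
      have := (d1_smul (hh (J + single p 1)) ((J p : ℝ) + 1) hv).symm
      refine this.trans ?_
      exact d1_congr (fun q hq => congrFun (flowQ p q hq) J) hv
    have e2 : dT p (app (hatF h eh) w) =
        pairS (subst (RE p) (app (hatF h eh) w)) (subst (RQ p) (app h (fun y => (w y).2))) := by
      rw [← flowE p w hw, ← flowQ p _ hq]
      rfl
    have e3 : subst (Z p) (app (hatF h eh) w) =
        subst (dFun (RQ p)) (pairS (app h (fun y => (w y).2)) (subst VG (app (hatF h eh) w))) -
        (subst (dT p VG) (app (hatF h eh) w) + subst (dFun VG) (pairS (app (hatF h eh) w)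
          (dT p (app (hatF h eh) w)))) := by
      rw [subst_sub (hZ1 p) ((hVG.dT p).add (hZ2 p)) hhw, subst_add (hVG.dT p) (hZ2 p) hhw,
        subst_compF (hRQ p).dFun (hS.pairF hVG) hhw, subst_compF hVG.dFun (hI.pairF (hRR p)) hhw,
        subst_pairF hS hVG hhw, subst_pairF hI (hRR p) hhw,
        subst_pairF (hRE p) ((hRQ p).preF S) hhw, subst_linF _ hhw, subst_linF _ hhw, subst_preF,
        e2]
      rfl
    have sub' : ∀ a b : Ser d Q, dT p (a - b) = dT p a - dT p b := fun a b => by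
      ext1 J; simp [dT, smul_sub]
    have e4 : ∀ {a b : Ser d Q}, SmoothS a → SmoothS b →
        subst (dFun (RQ p)) (pairS (app h (fun y => (w y).2)) (a - b)) =
        subst (dFun (RQ p)) (pairS (app h (fun y => (w y).2)) a) -
        subst (dFun (RQ p)) (pairS (app h (fun y => (w y).2)) b) := by
      intro a b ha hb
      have hnb : SmoothS ((-1 : ℝ) • b) := fun J => contDiff_smul (hb J) _
      have := subst_dFun_add (hRQ p) hhq ha hnb
      rw [subst_dFun_smul (hRQ p) hhq hb] at this
      simpa [sub_eq_add_neg] using this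
    rw [sub', e1, dT_subst hVG hhw, e4 hdh hVs, e3]
    abel
  constructor
  · intro hSW p w hw
    rw [← hZ p w hw]
    refine eq_zero_of_subst_eq_zero hhat hat0 (fun w hw => ?_) w hw
    have h1 := key w hw p
    rw [hSW w hw, sub_self] at h1
    have h2 : subst (dFun (RQ p)) (pairS (app h (fun y => (w y).2)) 0) = 0 := by
      have := subst_dFun_smul (hRQ p) (hh.smoothS (smooth_snd hw)) (b := 0)
        (fun _ => contDiff_const) (0 : ℝ)
      simpa using this
    rw [h2, zero_add] at h1
    rw [← h1]
    ext1 J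
    simp [dT]
  · intro hZ0 w hw
    rw [← sub_eq_zero]
    have hq := smooth_snd hw
    refine ser_ext ?_ fun J p hJ => ?_
    · have e1 : subst VG (app (hatF h eh) w) 0 = VG 0 w := by
        rw [subst_zero]
        exact congrArg (VG 0) (hat0 w hw)
      have e2 : app (dFun h) (fun y => ((w y).2, VG 0 w y)) 0 = VG 0 w := by
        have hv : Smooth (fun y => ((w y).2, VG 0 w y)) := smooth_pair hq (Loc.smooth (hVG 0) hw)
        refine (d1_congr (H := fun q => q) (fun q hq => h0 q hq) hv).trans ?_
        ext1 x
        have : HasDerivAt (fun s : ℝ => (w x).2 + s • VG 0 w x) (VG 0 w x) 0 := by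
          simpa using ((hasDerivAt_id (0 : ℝ)).smul_const (VG 0 w x)).const_add (w x).2
        exact this.deriv
      rw [Pi.sub_apply, e1, e2, sub_self]
      rfl
    · rw [key w hw p, Pi.add_apply]
      have hz : subst (Z p) (app (hatF h eh) w) = 0 := by
        have h4 := subst_smul (hZl p) (0 : ℝ) (hhat.smoothS hw)
        rw [zero_smul, zero_smul] at h4
        rw [← h4]
        exact subst_congr (fun w hw => (hZ p w hw).mpr (hZ0 p w hw)) (hhat.smoothS hw)
      have h2 : subst (dFun (RQ p)) (pairS (app h (fun y => (w y).2)) 0) = 0 := by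
        have := subst_dFun_smul (hRQ p) (hh.smoothS (smooth_snd hw)) (b := 0)
          (fun _ => contDiff_const) (0 : ℝ)
        simpa using this
      rw [hz, Pi.zero_apply, add_zero,
        subst_congr_right (v := pairS (app h (fun y => (w y).2)) 0) fun L hL => ?_, h2]
      · simp [dT]
      · ext1 y
        exact Prod.ext rfl (congrFun (hJ L hL) y)

end Flow

section Values

variable {d a b c : ℕ}

/-- The local functional `F` has the value `f` on the power series `u`. -/
structure HasSub (F : Fun d V (Mat a b)) (u : Ser d V) (f : SS d a b) : Prop where
  smooth : SmoothS u
  loc : IsLocal F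
  val : subst F u = f.1

namespace HasSub

variable {F F' : Fun d V (Mat a b)} {G : Fun d V (Mat b c)} {u : Ser d V} {f f' : SS d a b}
  {g : SS d b c}

lemma add (hF : HasSub F u f) (hF' : HasSub F' u f') : HasSub (F + F') u (f + f') :=
  ⟨hF.smooth, hF.loc.add hF'.loc, by rw [subst_add hF.loc hF'.loc hF.smooth, hF.val, hF'.val]; rfl⟩

lemma sub (hF : HasSub F u f) (hF' : HasSub F' u f') : HasSub (F - F') u (f - f') :=
  ⟨hF.smooth, hF.loc.sub hF'.loc, by rw [subst_sub hF.loc hF'.loc hF.smooth, hF.val, hF'.val]; rfl⟩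

lemma smul (r : ℂ) (hF : HasSub F u f) : HasSub (r • F) u (r • f) :=
  ⟨hF.smooth, hF.loc.smul r, by rw [subst_smul hF.loc r hF.smooth, hF.val]; rfl⟩

lemma pd (i : Fin d) (hF : HasSub F u f) : HasSub (pdF i F) u (pdSS i f) :=
  ⟨hF.smooth, hF.loc.pdF i, by rw [subst_pdF i hF.loc hF.smooth, hF.val]; rfl⟩

lemma star (hF : HasSub F u f) (hG : HasSub G u g) : HasSub (starF F G) u (f ⋆ g) :=
  ⟨hF.smooth, hF.loc.starF hG.loc, by rw [subst_starF hF.loc hG.loc hF.smooth, hF.val, hG.val]; rfl⟩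

lemma lin (L : V →L[ℝ] Mat a b) (hu : SmoothS u) (hf : (fun J y => L (u J y)) = f.1) :
    HasSub (linF L) u f :=
  ⟨hu, isLocal_linF L, (subst_linF L hu).trans hf⟩

end HasSub

/-- The local functional `F` has the value `f` at `u`, and `f'` is its first-order change in the
direction `v`. -/
structure HasVar (F : Fun d V (Mat a b)) (u : Pt d → V) (v : Ser d V) (f f' : SS d a b) :
    Prop where
  smooth : Smooth u
  smoothS : SmoothS v
  loc : IsLocal F
  val : app F u = f.1
  var : variation F u v = f'.1

namespace HasVar

variable {F G : Fun d V (Mat a b)} {H : Fun d V (Mat b c)} {u : Pt d → V} {v : Ser d V}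
  {f f' g g' : SS d a b} {h h' : SS d b c}

lemma add (hF : HasVar F u v f f') (hG : HasVar G u v g g') :
    HasVar (F + G) u v (f + g) (f' + g') :=
  ⟨hF.smooth, hF.smoothS, hF.loc.add hG.loc, congrArg₂ (· + ·) hF.val hG.val,
    by rw [variation_add hF.loc hG.loc hF.smooth hF.smoothS, hF.var, hG.var]; rfl⟩

lemma sub (hF : HasVar F u v f f') (hG : HasVar G u v g g') :
    HasVar (F - G) u v (f - g) (f' - g') :=
  ⟨hF.smooth, hF.smoothS, hF.loc.sub hG.loc, congrArg₂ (· - ·) hF.val hG.val,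
    by rw [variation_sub hF.loc hG.loc hF.smooth hF.smoothS, hF.var, hG.var]; rfl⟩

lemma smul (r : ℂ) (hF : HasVar F u v f f') : HasVar (r • F) u v (r • f) (r • f') :=
  ⟨hF.smooth, hF.smoothS, hF.loc.smul r, congrArg (r • ·) hF.val,
    by rw [variation_smul hF.loc r hF.smooth hF.smoothS, hF.var]; rfl⟩

lemma pd (i : Fin d) (hF : HasVar F u v f f') :
    HasVar (pdF i F) u v (pdSS i f) (pdSS i f') :=
  ⟨hF.smooth, hF.smoothS, hF.loc.pdF i, congrArg (pdS i) hF.val,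
    by rw [variation_pdF i hF.loc hF.smooth hF.smoothS, hF.var]; rfl⟩

lemma star (hF : HasVar F u v f f') (hH : HasVar H u v h h') :
    HasVar (starF F H) u v (f ⋆ h) (f' ⋆ h + f ⋆ h') :=
  ⟨hF.smooth, hF.smoothS, hF.loc.starF hH.loc, congrArg₂ SW.star hF.val hH.val,
    by rw [variation_starF hF.loc hH.loc hF.smooth hF.smoothS, hF.var, hH.var, hF.val, hH.val]
       rfl⟩

lemma lin (L : V →L[ℝ] Mat a b) (hu : Smooth u) (hv : SmoothS v)
    (hf : const (fun y => L (u y)) = f.1) (hf' : (fun J y => L (v J y)) = f'.1) :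
    HasVar (linF L) u v f f' :=
  ⟨hu, hv, isLocal_linF L, (app_linF L u).trans hf, (variation_linF L hu hv).trans hf'⟩

end HasVar

/-- A family of functionals as a functional with values in families. -/
def piF {I : Type} (F : I → Fun d V W) : Fun d V (I → W) := fun J u x i => F i J u x

lemma IsLocal.piF {I : Type} [Fintype I] {F : I → Fun d V W} (hF : ∀ i, IsLocal (F i)) :
    IsLocal (SW.piF F) := fun J => Loc.pi fun i => hF i J

lemma subst_piF {I : Type} [Fintype I] {F : I → Fun d V W} (hF : ∀ i, IsLocal (F i))
    {u : Ser d V} (hu : SmoothS u) (i : I) :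
    (fun J x => subst (piF F) u J x i) = subst (F i) u :=
  (subst_postF (proj (R := ℝ) (φ := fun _ : I => W) i)
    (IsLocal.piF hF) hu).symm

lemma variation_piF {I : Type} [Fintype I] {F : I → Fun d V W} (hF : ∀ i, IsLocal (F i))
    {u : Pt d → V} (hu : Smooth u) {v : Ser d V} (hv : SmoothS v) (i : I) :
    (fun J x => variation (piF F) u v J x i) = variation (F i) u v :=
  (variation_postF (proj (R := ℝ) (φ := fun _ : I => W) i)
    (IsLocal.piF hF) hu hv).symm

end Values

section Antisymmetric

variable {d : ℕ} {V W X : Type}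

/-- The antisymmetric array with the given entries above the diagonal. -/
def asym [AddCommGroup W] (X : Idx d → W) (μ ν : Fin d) : W :=
  if h : μ < ν then X ⟨(μ, ν), h⟩ else if h : ν < μ then -X ⟨(ν, μ), h⟩ else 0

lemma asym_swap [AddCommGroup W] (X : Idx d → W) (μ ν : Fin d) :
    asym X μ ν = -asym X ν μ := by
  unfold asym
  rcases lt_trichotomy μ ν with h | h | h
  · simp [h, h.not_gt]
  · simp [h]
  · simp [h, h.not_gt]

lemma asym_idx [AddCommGroup W] (X : Idx d → W) (p : Idx d) :
    asym X p.1.1 p.1.2 = X p := by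
  unfold asym
  rw [dif_pos p.2]

lemma asym_idx' [AddCommGroup W] (X : Idx d → W) (p : Idx d) :
    asym X p.1.2 p.1.1 = -X p := by
  rw [asym_swap, asym_idx]

lemma asym_add [AddCommGroup W] (X Y : Idx d → W) : asym (X + Y) = asym X + asym Y := by
  ext1 μ
  ext1 ν
  simp only [asym, Pi.add_apply]
  split_ifs <;> abel

lemma asym_smul {R : Type} [Semiring R] [AddCommGroup W] [Module R W] (c : R)
    (X : Idx d → W) : asym (c • X) = c • asym X := by
  ext1 μ
  ext1 ν
  simp only [asym, Pi.smul_apply]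
  split_ifs <;> simp

lemma eq_zero_of_antisymm {W : Type} [AddCommGroup W] [Module ℝ W] {Z : Fin d → Fin d → W}
    (hZ : ∀ μ ν, Z μ ν = -Z ν μ) (h : ∀ p : Idx d, Z p.1.1 p.1.2 - Z p.1.2 p.1.1 = 0)
    (μ ν : Fin d) : Z μ ν = 0 := by
  have two : ∀ z : W, z + z = 0 → z = 0 := fun z hz => by
    rw [← two_smul ℝ z] at hz
    exact (smul_eq_zero.mp hz).resolve_left two_ne_zero
  rcases lt_trichotomy μ ν with hl | hl | hl
  · have := h ⟨(μ, ν), hl⟩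
    rw [hZ ν μ, sub_neg_eq_add] at this
    exact two _ this
  · subst hl
    exact two _ (by nth_rw 1 [hZ μ μ]; exact neg_add_cancel _)
  · have := h ⟨(ν, μ), hl⟩
    rw [hZ ν μ, ← neg_add', neg_eq_zero] at this
    exact two _ this

lemma sum_antisymm [AddCommGroup W] [Module ℝ W] {δ : Fin d → Fin d → ℝ}
    (hδ : ∀ μ ν, δ μ ν = -δ ν μ) (X : Fin d → Fin d → W) :
    ∑ μ, ∑ ν, δ μ ν • X μ ν = ∑ p : Idx d, δ p.1.1 p.1.2 • (X p.1.1 p.1.2 - X p.1.2 p.1.1) := by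
  rw [← Finset.sum_product', Finset.univ_product_univ]
  have h0 : ∀ μ, δ μ μ = 0 := fun μ => by have := hδ μ μ; linarith
  have h1 : ∑ x : Fin d × Fin d, δ x.1 x.2 • X x.1 x.2 =
      ∑ x ∈ (univ : Finset (Fin d × Fin d)).filter (fun x => x.1 < x.2),
        δ x.1 x.2 • X x.1 x.2 +
      ∑ x ∈ (univ : Finset (Fin d × Fin d)).filter (fun x => x.2 < x.1),
        δ x.1 x.2 • X x.1 x.2 := by
    rw [Finset.sum_filter, Finset.sum_filter, ← sum_add_distrib]
    refine sum_congr rfl fun x _ => ?_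
    rcases lt_trichotomy x.1 x.2 with h | h | h
    · simp [h, h.not_gt]
    · simp [h, h0]
    · simp [h, h.not_gt]
  have h2 : ∑ x ∈ (univ : Finset (Fin d × Fin d)).filter (fun x => x.2 < x.1),
        δ x.1 x.2 • X x.1 x.2 =
      ∑ x ∈ (univ : Finset (Fin d × Fin d)).filter (fun x => x.1 < x.2),
        δ x.2 x.1 • X x.2 x.1 := by
    refine Finset.sum_bij' (fun x _ => x.swap) (fun x _ => x.swap) ?_ ?_ ?_ ?_ ?_ <;> simp
  rw [h1, h2, ← sum_add_distrib,
    ← Finset.sum_subtype (p := fun x : Fin d × Fin d => x.1 < x.2)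
      (univ.filter (fun x : Fin d × Fin d => x.1 < x.2)) (by simp)
      (fun x => δ x.1 x.2 • (X x.1 x.2 - X x.2 x.1))]
  refine sum_congr rfl fun x _ => ?_
  rw [hδ x.2 x.1, neg_smul, smul_sub, sub_eq_add_neg]

lemma dTheta_eq [AddCommGroup W] [Module ℝ W] (δ : Fin d → Fin d → ℝ) (f : Ser d W) :
    dTheta δ f = ∑ p : Idx d, δ p.1.1 p.1.2 • dT p f := by
  ext1 J
  simp [dTheta, dT, mul_smul]

/-- An equation for the derivative in all antisymmetric directions as equations for the partial
derivatives. -/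
lemma dTheta_iff [AddCommGroup W] [Module ℝ W] (f : Ser d W) (c : ℝ)
    (X : Fin d → Fin d → Ser d W) :
    (∀ δ : Fin d → Fin d → ℝ, (∀ μ ν, δ μ ν = -δ ν μ) →
      dTheta δ f = c • ∑ μ, ∑ ν, δ μ ν • X μ ν) ↔
      ∀ p : Idx d, dT p f = c • (X p.1.1 p.1.2 - X p.1.2 p.1.1) := by
  constructor
  · intro h p
    have h1 := h (asym (Pi.single p 1)) (asym_swap _)
    rw [dTheta_eq, sum_antisymm (asym_swap _)] at h1
    simp only [asym_idx, Pi.single_apply, ite_smul, one_smul, zero_smul, Finset.sum_ite_eq',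
      mem_univ, if_true] at h1
    exact h1
  · intro h δ hδ
    rw [dTheta_eq, sum_antisymm hδ, smul_sum]
    refine sum_congr rfl fun p _ => ?_
    rw [h p, smul_comm]

end Antisymmetric

section Extra

variable {d : ℕ}

/-- A family of functionals as an antisymmetric array. -/
def asymF (F : Idx d → Fun d V W) : Fun d V (Fin d → Fin d → W) :=
  fun J u x => asym (fun p => F p J u x)

lemma IsLocal.asymF {F : Idx d → Fun d V W} (hF : ∀ p, IsLocal (F p)) :
    IsLocal (SW.asymF F) := by
  have : SW.asymF F = SW.piF fun μ => SW.piF fun ν J u x => asym (fun p => F p J u x) μ ν := rfl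
  rw [this]
  refine IsLocal.piF fun μ => IsLocal.piF fun ν J => ?_
  rcases lt_trichotomy μ ν with h | h | h
  · exact Loc.congr (hF ⟨(μ, ν), h⟩ J) fun u _ => by ext1 x; simp [asym, h]
  · exact loc_zero.congr fun u _ => by ext1 x; simp [asym, h]
  · exact Loc.congr (Loc.smul (hF ⟨(ν, μ), h⟩ J) (-1 : ℝ)) fun u _ => by
      ext1 x; simp [asym, h, h.not_gt]

lemma subst_asymF {F : Idx d → Fun d V W} (hF : ∀ p, IsLocal (F p)) {u : Ser d V}
    (hu : SmoothS u) : subst (asymF F) u = fun J x => asym (fun p => subst (F p) u J x) := by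
  have h1 : ∀ μ ν, (fun J x => subst (asymF F) u J x μ ν) =
      subst (fun J u x => asym (fun p => F p J u x) μ ν) u := by
    intro μ ν
    exact (subst_postF ((proj (R := ℝ) (φ := fun _ : Fin d => W) ν).comp
      (proj (R := ℝ) (φ := fun _ : Fin d => Fin d → W) μ))
      (IsLocal.asymF hF) hu).symm
  ext J x μ ν
  refine (congrFun (congrFun (h1 μ ν) J) x).trans ?_
  rcases lt_trichotomy μ ν with h | h | h
  · have e : (fun (J : Mon d) (u : Pt d → V) x => asym (fun p => F p J u x) μ ν) =
      F ⟨(μ, ν), h⟩ := by ext1 J; ext1 u; ext1 x; simp [asym, h]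
    rw [e]; simp [asym, h]
  · have e : (fun (J : Mon d) (u : Pt d → V) x => asym (fun p => F p J u x) μ ν) =
      linF (0 : V →L[ℝ] W) := by ext1 J; ext1 u; ext1 x; simp [asym, h, linF]
    rw [e, subst_linF _ hu]; simp [asym, h]
  · have e : (fun (J : Mon d) (u : Pt d → V) x => asym (fun p => F p J u x) μ ν) =
      (-1 : ℝ) • F ⟨(ν, μ), h⟩ := by ext1 J; ext1 u; ext1 x; simp [asym, h, h.not_gt]
    rw [e, subst_smul (hF _) _ hu]; simp [asym, h, h.not_gt]

/-- Every functional of the form `id + O(θ)` satisfies a differential equation in `θ`. -/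
lemma exists_extra {h : Fun d V V} (hh : IsLocal h) (h0 : ∀ v, Smooth v → h 0 v = v)
    {F : Fun d V W} (hF : IsLocal F) {Q : Idx d → Fun d V W} (hQ : ∀ p, IsLocal (Q p)) (c : ℝ) :
    ∃ X : Fun d V (Fin d → Fin d → W), IsLocal X ∧
      (∀ J u x μ ν, X J u x μ ν = -X J u x ν μ) ∧
      ∀ v, Smooth v → subst X (app h v) = fun J x => asym fun p =>
        ((1 / 2 : ℝ) • (c⁻¹ • dT p (app F v) - subst (Q p) (app h v))) J x := by
  let Y : Idx d → Fun d V W := fun p => (1 / 2 : ℝ) • (c⁻¹ • dT p F - compF (Q p) h)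
  have hY : ∀ p, IsLocal (Y p) := fun p =>
    (((hF.dT p).smul c⁻¹).sub ((hQ p).compF hh)).smul (1 / 2 : ℝ)
  have hX : ∀ p, IsLocal (invF h (Y p)) := fun p => isLocal_invF hh (hY p)
  refine ⟨asymF fun p => invF h (Y p), IsLocal.asymF hX,
    fun J u x μ ν => asym_swap _ _ _, fun v hv => ?_⟩
  rw [subst_asymF hX (hh.smoothS hv)]
  ext1 J
  ext1 x
  congr 1
  ext1 p
  rw [subst_invF h0 _ hv]
  rfl

/-- Linearity of a functional is determined by its composite with a linear `id + O(θ)`. -/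
lemma isLinearFst_of_subst {R : Type} [Ring R] [Module R U] [SMulCommClass ℝ R U]
    [ContinuousConstSMul R U] [Module R W] [SMulCommClass ℝ R W] [ContinuousConstSMul R W]
    {h : Fun d V V} (hh : IsLocal h) (h0 : ∀ v, Smooth v → h 0 v = v)
    {eh : Fun d (U × V) U} (heh : IsLocal eh) (hlin : IsLinearFst R eh)
    (eh0 : ∀ w, Smooth w → eh 0 w = fun y => (w y).1) {F : Fun d (U × V) W} (hF : IsLocal F)
    (H : ∀ (u₁ u₂ : Pt d → U) (v : Pt d → V), Smooth u₁ → Smooth u₂ → Smooth v → ∀ c : R,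
      subst F (app (hatF h eh) fun y => (u₁ y + c • u₂ y, v y)) =
        subst F (app (hatF h eh) fun y => (u₁ y, v y)) +
          c • subst F (app (hatF h eh) fun y => (u₂ y, v y))) :
    IsLinearFst R F := by
  intro J u₁ u₂ v hu₁ hu₂ hv c x
  let P := U × U × V
  let f1 : P →L[ℝ] U := fst ℝ U (U × V)
  let f2 : P →L[ℝ] U := (fst ℝ U V).comp (snd ℝ U (U × V))
  let f3 : P →L[ℝ] V := (snd ℝ U V).comp (snd ℝ U (U × V))
  let L0 : P →L[ℝ] U × V := (f1 + c • f2).prod f3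
  let L1 : P →L[ℝ] U × V := f1.prod f3
  let L2 : P →L[ℝ] U × V := f2.prod f3
  let T : Fun d P W := preF F L0 - (preF F L1 + c • preF F L2)
  let k : Fun d P P := pairF (preF eh L1) (pairF (preF eh L2) (preF h f3))
  have hk : IsLocal k := (heh.preF L1).pairF ((heh.preF L2).pairF (hh.preF f3))
  have k0 : ∀ w, Smooth w → k 0 w = w := by
    intro w hw
    have s : ∀ L : P →L[ℝ] U × V, Smooth (fun y => L (w y)) := fun L => L.contDiff.comp hw
    have e1 : eh 0 (fun y => L1 (w y)) = fun y => (w y).1 := eh0 _ (s L1)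
    have e2 : eh 0 (fun y => L2 (w y)) = fun y => (w y).2.1 := eh0 _ (s L2)
    have e3 : h 0 (fun y => f3 (w y)) = fun y => (w y).2.2 := h0 _ (f3.contDiff.comp hw)
    ext1 y
    exact Prod.ext (congrFun e1 y) (Prod.ext (congrFun e2 y) (congrFun e3 y))
  have key : ∀ w, Smooth w → subst T (app k w) = 0 := by
    intro w hw
    have hs := hk.smoothS hw
    have s1 : Smooth (fun y => (w y).1) := smooth_fst hw
    have s2 : Smooth (fun y => (w y).2.1) := smooth_fst (smooth_snd hw)
    have s3 : Smooth (fun y => (w y).2.2) := smooth_snd (smooth_snd hw)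
    rw [subst_sub (hF.preF _) ((hF.preF _).add ((hF.preF _).smul c)) hs,
      subst_add (hF.preF _) ((hF.preF _).smul c) hs, subst_smul (hF.preF _) c hs, subst_preF,
      subst_preF, subst_preF, sub_eq_zero]
    refine Eq.trans ?_ (H _ _ _ s1 s2 s3 c)
    congr 1
    ext1 J
    ext1 y
    exact Prod.ext (hlin J _ _ _ s1 s2 s3 c y).symm rfl
  have := eq_zero_of_subst_eq_zero hk k0 key (fun y => (u₁ y, u₂ y, v y))
    (smooth_pair hu₁ (smooth_pair hu₂ hv))
  have h1 := congrFun (congrFun this J) x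
  exact sub_eq_zero.mp h1

end Extra

/-! ### Gauge covariance of the differential equations -/

section Identities

variable {d N m : ℕ}

/-- Field strength. -/
def fieldS (A : Fin d → SS d N N) (μ ν : Fin d) : SS d N N :=
  pdSS μ (A ν) - pdSS ν (A μ) - I • (A μ ⋆ A ν) + I • (A ν ⋆ A μ)

/-- Gauge variation of the potential. -/
def gaugeS (A : Fin d → SS d N N) (e : SS d N N) (κ : Fin d) : SS d N N :=
  pdSS κ e - I • (A κ ⋆ e) + I • (e ⋆ A κ)

/-- First-order change of the field strength. -/
def dfieldS (A B : Fin d → SS d N N) (μ ν : Fin d) : SS d N N :=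
  pdSS μ (B ν) - pdSS ν (B μ) - I • (B μ ⋆ A ν + A μ ⋆ B ν) +
    I • (B ν ⋆ A μ + A ν ⋆ B μ)

/-- `{A_μ, ∂_ν A_κ + F_{νκ}}`. -/
def QS (A : Fin d → SS d N N) (μ ν κ : Fin d) : SS d N N :=
  A μ ⋆ (pdSS ν (A κ) + fieldS A ν κ) + (pdSS ν (A κ) + fieldS A ν κ) ⋆ A μ

/-- First-order change of `{A_μ, ∂_ν A_κ + F_{νκ}}`. -/
def dQS (A B : Fin d → SS d N N) (μ ν κ : Fin d) : SS d N N :=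
  (B μ ⋆ (pdSS ν (A κ) + fieldS A ν κ) + A μ ⋆ (pdSS ν (B κ) + dfieldS A B ν κ)) +
    ((pdSS ν (B κ) + dfieldS A B ν κ) ⋆ A μ + (pdSS ν (A κ) + fieldS A ν κ) ⋆ B μ)

/-- `{∂_μ e, A_ν}`. -/
def QES (A : Fin d → SS d N N) (e : SS d N N) (μ ν : Fin d) : SS d N N :=
  pdSS μ e ⋆ A ν + A ν ⋆ pdSS μ e

/-- `A_μ ⋆ ∂_ν f + A_μ ⋆ D_ν f` in the fundamental representation. -/
def QFS (A : Fin d → SS d N N) (f : SS d N m) (μ ν : Fin d) : SS d N m :=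
  A μ ⋆ pdSS ν f + A μ ⋆ (pdSS ν f - I • (A ν ⋆ f))

/-- First-order change of `A_μ ⋆ ∂_ν f + A_μ ⋆ D_ν f`. -/
def dQFS (A B : Fin d → SS d N N) (f g : SS d N m) (μ ν : Fin d) : SS d N m :=
  (B μ ⋆ pdSS ν f + A μ ⋆ pdSS ν g) + (B μ ⋆ (pdSS ν f - I • (A ν ⋆ f)) +
    A μ ⋆ (pdSS ν g - I • (B ν ⋆ f + A ν ⋆ g)))

/-- `∂_ν f + D_ν f` in the adjoint representation. -/
def covAdS (A : Fin d → SS d N N) (f : SS d N N) (ν : Fin d) : SS d N N :=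
  pdSS ν f + (pdSS ν f - I • (A ν ⋆ f) + I • (f ⋆ A ν))

/-- First-order change of `∂_ν f + D_ν f`. -/
def dcovAdS (A B : Fin d → SS d N N) (f g : SS d N N) (ν : Fin d) : SS d N N :=
  pdSS ν g + (pdSS ν g - I • (B ν ⋆ f + A ν ⋆ g) + I • (g ⋆ A ν + f ⋆ B ν))

/-- `{A_μ, ∂_ν f + D_ν f}` in the adjoint representation. -/
def QAdS (A : Fin d → SS d N N) (f : SS d N N) (μ ν : Fin d) : SS d N N :=
  A μ ⋆ covAdS A f ν + covAdS A f ν ⋆ A μ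

/-- First-order change of `{A_μ, ∂_ν f + D_ν f}`. -/
def dQAdS (A B : Fin d → SS d N N) (f g : SS d N N) (μ ν : Fin d) : SS d N N :=
  (B μ ⋆ covAdS A f ν + A μ ⋆ dcovAdS A B f g ν) + (dcovAdS A B f g ν ⋆ A μ + covAdS A f ν ⋆ B μ)

lemma gauge_identity (p : Idx d) (κ : Fin d) (A : Fin d → SS d N N) (e : SS d N N)
    (hA : ∀ μ, dTS p (A μ) = 0) (he : dTS p e = 0) (D₁ D₂ D₁' D₂' E₁ E₂ RA RE : SS d N N)
    (c : ℂ) (hc : c = -(Real.pi / 2 : ℂ))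
    (hRA : RA = c • (QS A p.1.1 p.1.2 κ - QS A p.1.2 p.1.1 κ + (D₁ - D₂)))
    (hRE : RE = (-c) • (QES A e p.1.1 p.1.2 - QES A e p.1.2 p.1.1 + (E₁ - E₂))) :
    c • (dQS A (gaugeS A e) p.1.1 p.1.2 κ - dQS A (gaugeS A e) p.1.2 p.1.1 κ + (D₁' - D₂')) -
      (dTS p (gaugeS A e κ) + (pdSS κ RE - I • (RA ⋆ e + A κ ⋆ RE) +
        I • (RE ⋆ A κ + e ⋆ RA))) =
    c • ((D₁' - I • (e ⋆ D₁ - D₁ ⋆ e) + gaugeS A E₁ κ) -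
      (D₂' - I • (e ⋆ D₂ - D₂ ⋆ e) + gaugeS A E₂ κ)) := by
  subst hRA hRE hc
  simp only [dQS, QS, QES, dfieldS, fieldS, gaugeS, map_add, map_sub, map_smul, dTS_mulS, pdSS_mulS,
    add_mulS, mulS_add, sub_mulS, mulS_sub, smul_mulS, mulS_smul, mulS_assoc, hA, he, zero_mulS,
    mulS_zero, ← pdSS_dTS, map_zero]
  simp only [pdSS_comm p.1.1 κ, pdSS_comm p.1.2 κ]
  match_scalars <;> ring_nf <;> simp only [Complex.I_sq] <;> ring_nf

end Identities

section Functionals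

variable {d N m a b : ℕ}

/-- Values of potentials. -/
abbrev Pot (d N : ℕ) := Fin d → Mat N N

lemma coe_smul_ser (c : ℝ) (f : Ser d (Mat a b)) : (c : ℂ) • f = c • f := by
  ext J x i j
  simp

lemma smoothS_cpt {u : Ser d (Pot d N)} (hu : SmoothS u) (μ : Fin d) : SmoothS (cpt u μ) :=
  fun J => (proj (R := ℝ) (φ := fun _ : Fin d => Mat N N) μ).contDiff.comp
    (hu J)

/-- Components of a power series of potentials. -/
def cptS {u : Ser d (Pot d N)} (hu : SmoothS u) (μ : Fin d) : SS d N N :=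
  ⟨cpt u μ, smoothS_cpt hu μ⟩

/-- A `θ`-independent function as a power series. -/
def constS {f : Pt d → Mat a b} (hf : Smooth f) : SS d a b := ⟨const f, smoothS_const hf⟩

lemma smooth_cpt {A : Pt d → Pot d N} (hA : Smooth A) (μ : Fin d) : Smooth fun x => A x μ :=
  (proj (R := ℝ) (φ := fun _ : Fin d => Mat N N) μ).contDiff.comp hA

/-- The potential as a family of `θ`-independent power series. -/
def potS {A : Pt d → Pot d N} (hA : Smooth A) (μ : Fin d) : SS d N N :=
  ⟨pot A μ, smoothS_const (smooth_cpt hA μ)⟩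

lemma dTS_constS {f : Pt d → Mat a b} (hf : Smooth f) (p : Idx d) : dTS p (constS hf) = 0 :=
  Subtype.ext (dT_const f p)

lemma dTS_potS {A : Pt d → Pot d N} (hA : Smooth A) (p : Idx d) (μ : Fin d) :
    dTS p (potS hA μ) = 0 :=
  Subtype.ext (dT_const _ p)

/-- The letters `A_μ`. -/
def potF (L : V →L[ℝ] Pot d N) (μ : Fin d) : Fun d V (Mat N N) :=
  linF ((proj (R := ℝ) (φ := fun _ : Fin d => Mat N N) μ).comp L)

lemma HasSub.potF (L : V →L[ℝ] Pot d N) {u : Ser d V} (hu : SmoothS u) {A : Ser d (Pot d N)}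
    (hA : SmoothS A) (h : (fun J y => L (u J y)) = A) (μ : Fin d) :
    HasSub (SW.potF L μ) u (cptS hA μ) :=
  HasSub.lin _ hu (by subst h; rfl)

lemma HasVar.potF (L : V →L[ℝ] Pot d N) {u : Pt d → V} (hu : Smooth u) {v : Ser d V}
    (hv : SmoothS v) {A : Pt d → Pot d N} (hA : Smooth A) (h : (fun y => L (u y)) = A)
    {B : Ser d (Pot d N)} (hB : SmoothS B) (h' : (fun J y => L (v J y)) = B) (μ : Fin d) :
    HasVar (SW.potF L μ) u v (potS hA μ) (cptS hB μ) :=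
  HasVar.lin _ hu hv (by subst h; rfl) (by subst h'; rfl)

/-- Field strength. -/
def fieldF (A : Fin d → Fun d V (Mat N N)) (μ ν : Fin d) : Fun d V (Mat N N) :=
  pdF μ (A ν) - pdF ν (A μ) - I • starF (A μ) (A ν) + I • starF (A ν) (A μ)

/-- `{A_μ, ∂_ν A_κ + F_{νκ}}`. -/
def QF (A : Fin d → Fun d V (Mat N N)) (κ μ ν : Fin d) : Fun d V (Mat N N) :=
  starF (A μ) (pdF ν (A κ) + fieldF A ν κ) + starF (pdF ν (A κ) + fieldF A ν κ) (A μ)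

/-- Gauge variation of the potential. -/
def gaugeAF (A : Fin d → Fun d V (Mat N N)) (e : Fun d V (Mat N N)) (κ : Fin d) :
    Fun d V (Mat N N) :=
  pdF κ e - I • starF (A κ) e + I • starF e (A κ)

/-- `{∂_μ e, A_ν}`. -/
def QEF (A : Fin d → Fun d V (Mat N N)) (e : Fun d V (Mat N N)) (μ ν : Fin d) :
    Fun d V (Mat N N) :=
  starF (pdF μ e) (A ν) + starF (A ν) (pdF μ e)

/-- `A_μ ⋆ ∂_ν f + A_μ ⋆ D_ν f`. -/
def QFF (A : Fin d → Fun d V (Mat N N)) (f : Fun d V (Mat N m)) (μ ν : Fin d) :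
    Fun d V (Mat N m) :=
  starF (A μ) (pdF ν f) + starF (A μ) (pdF ν f - I • starF (A ν) f)

/-- `∂_ν f + D_ν f` in the adjoint representation. -/
def covAdF (A : Fin d → Fun d V (Mat N N)) (f : Fun d V (Mat N N)) (ν : Fin d) :
    Fun d V (Mat N N) :=
  pdF ν f + (pdF ν f - I • starF (A ν) f + I • starF f (A ν))

/-- `{A_μ, ∂_ν f + D_ν f}` in the adjoint representation. -/
def QAdF (A : Fin d → Fun d V (Mat N N)) (f : Fun d V (Mat N N)) (μ ν : Fin d) :
    Fun d V (Mat N N) :=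
  starF (A μ) (covAdF A f ν) + starF (covAdF A f ν) (A μ)

section Sub

variable {A : Fin d → Fun d V (Mat N N)} {e : Fun d V (Mat N N)} {f : Fun d V (Mat N m)}
  {u : Ser d V} {A' : Fin d → SS d N N} {e' : SS d N N} {f' : SS d N m}

lemma HasSub.fieldF (hA : ∀ μ, HasSub (A μ) u (A' μ)) (μ ν : Fin d) :
    HasSub (SW.fieldF A μ ν) u (fieldS A' μ ν) :=
  ((((hA ν).pd μ).sub ((hA μ).pd ν)).sub (((hA μ).star (hA ν)).smul _)).add
    (((hA ν).star (hA μ)).smul _)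

lemma HasSub.QF (hA : ∀ μ, HasSub (A μ) u (A' μ)) (κ μ ν : Fin d) :
    HasSub (SW.QF A κ μ ν) u (QS A' μ ν κ) :=
  ((hA μ).star (((hA κ).pd ν).add (HasSub.fieldF hA ν κ))).add
    ((((hA κ).pd ν).add (HasSub.fieldF hA ν κ)).star (hA μ))

lemma HasSub.gaugeAF (hA : ∀ μ, HasSub (A μ) u (A' μ)) (he : HasSub e u e') (κ : Fin d) :
    HasSub (SW.gaugeAF A e κ) u (gaugeS A' e' κ) :=
  ((he.pd κ).sub (((hA κ).star he).smul _)).add ((he.star (hA κ)).smul _)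

lemma HasSub.QEF (hA : ∀ μ, HasSub (A μ) u (A' μ)) (he : HasSub e u e') (μ ν : Fin d) :
    HasSub (SW.QEF A e μ ν) u (QES A' e' μ ν) :=
  ((he.pd μ).star (hA ν)).add ((hA ν).star (he.pd μ))

lemma HasSub.QFF (hA : ∀ μ, HasSub (A μ) u (A' μ)) (hf : HasSub f u f') (μ ν : Fin d) :
    HasSub (SW.QFF A f μ ν) u (QFS A' f' μ ν) :=
  ((hA μ).star (hf.pd ν)).add ((hA μ).star ((hf.pd ν).sub (((hA ν).star hf).smul _)))

lemma HasSub.covAdF (hA : ∀ μ, HasSub (A μ) u (A' μ)) (he : HasSub e u e') (ν : Fin d) :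
    HasSub (SW.covAdF A e ν) u (covAdS A' e' ν) :=
  (he.pd ν).add (((he.pd ν).sub (((hA ν).star he).smul _)).add ((he.star (hA ν)).smul _))

lemma HasSub.QAdF (hA : ∀ μ, HasSub (A μ) u (A' μ)) (he : HasSub e u e') (μ ν : Fin d) :
    HasSub (SW.QAdF A e μ ν) u (QAdS A' e' μ ν) :=
  ((hA μ).star (HasSub.covAdF hA he ν)).add ((HasSub.covAdF hA he ν).star (hA μ))

end Sub

section Var

variable {A : Fin d → Fun d V (Mat N N)} {e : Fun d V (Mat N N)} {f : Fun d V (Mat N m)}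
  {u : Pt d → V} {v : Ser d V} {A' B : Fin d → SS d N N} {e' k : SS d N N} {f' g : SS d N m}

lemma HasVar.fieldF (hA : ∀ μ, HasVar (A μ) u v (A' μ) (B μ)) (μ ν : Fin d) :
    HasVar (SW.fieldF A μ ν) u v (fieldS A' μ ν) (dfieldS A' B μ ν) :=
  ((((hA ν).pd μ).sub ((hA μ).pd ν)).sub (((hA μ).star (hA ν)).smul _)).add
    (((hA ν).star (hA μ)).smul _)

lemma HasVar.QF (hA : ∀ μ, HasVar (A μ) u v (A' μ) (B μ)) (κ μ ν : Fin d) :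
    HasVar (SW.QF A κ μ ν) u v (QS A' μ ν κ) (dQS A' B μ ν κ) :=
  ((hA μ).star (((hA κ).pd ν).add (HasVar.fieldF hA ν κ))).add
    ((((hA κ).pd ν).add (HasVar.fieldF hA ν κ)).star (hA μ))

lemma HasVar.gaugeAF (hA : ∀ μ, HasVar (A μ) u v (A' μ) (B μ)) (he : HasVar e u v e' k)
    (κ : Fin d) : HasVar (SW.gaugeAF A e κ) u v (gaugeS A' e' κ)
      (pdSS κ k - I • (B κ ⋆ e' + A' κ ⋆ k) + I • (k ⋆ A' κ + e' ⋆ B κ)) :=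
  ((he.pd κ).sub (((hA κ).star he).smul _)).add ((he.star (hA κ)).smul _)

lemma HasVar.QEF (hA : ∀ μ, HasVar (A μ) u v (A' μ) (B μ)) (he : HasVar e u v e' k)
    (μ ν : Fin d) : HasVar (SW.QEF A e μ ν) u v (QES A' e' μ ν)
      (pdSS μ k ⋆ A' ν + pdSS μ e' ⋆ B ν + (B ν ⋆ pdSS μ e' + A' ν ⋆ pdSS μ k)) :=
  ((he.pd μ).star (hA ν)).add ((hA ν).star (he.pd μ))

lemma HasVar.QFF (hA : ∀ μ, HasVar (A μ) u v (A' μ) (B μ)) (hf : HasVar f u v f' g)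
    (μ ν : Fin d) : HasVar (SW.QFF A f μ ν) u v (QFS A' f' μ ν) (dQFS A' B f' g μ ν) :=
  ((hA μ).star (hf.pd ν)).add ((hA μ).star ((hf.pd ν).sub (((hA ν).star hf).smul _)))

lemma HasVar.covAdF (hA : ∀ μ, HasVar (A μ) u v (A' μ) (B μ)) (he : HasVar e u v e' k)
    (ν : Fin d) : HasVar (SW.covAdF A e ν) u v (covAdS A' e' ν) (dcovAdS A' B e' k ν) :=
  (he.pd ν).add (((he.pd ν).sub (((hA ν).star he).smul _)).add ((he.star (hA ν)).smul _))

lemma HasVar.QAdF (hA : ∀ μ, HasVar (A μ) u v (A' μ) (B μ)) (he : HasVar e u v e' k)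
    (μ ν : Fin d) : HasVar (SW.QAdF A e μ ν) u v (QAdS A' e' μ ν) (dQAdS A' B e' k μ ν) :=
  ((hA μ).star (HasVar.covAdF hA he ν)).add ((HasVar.covAdF hA he ν).star (hA μ))

end Var

/-! ### Right-hand sides -/

/-- Component of a functional with values in tensors with two indices. -/
def c2 {W : Type} (C : Fun d V (Fin d → Fin d → W)) (μ ν : Fin d) : Fun d V W :=
  fun J u x => C J u x μ ν

lemma IsLocal.c2     {C : Fun d V (Fin d → Fin d → W)} (hC : IsLocal C) (μ ν : Fin d) : IsLocal (SW.c2 C μ ν) :=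
  hC.postF ((proj (R := ℝ) (φ := fun _ : Fin d => W) ν).comp
    (proj (R := ℝ) (φ := fun _ : Fin d => Fin d → W) μ))

lemma subst_c2     {C : Fun d V (Fin d → Fin d → W)} (hC : IsLocal C) {u : Ser d V} (hu : SmoothS u)
    (μ ν : Fin d) : subst (c2 C μ ν) u = cpt2 (subst C u) μ ν :=
  subst_postF ((proj (R := ℝ) (φ := fun _ : Fin d => W) ν).comp
    (proj (R := ℝ) (φ := fun _ : Fin d => Fin d → W) μ)) hC hu

lemma variation_c2     {C : Fun d V (Fin d → Fin d → W)} (hC : IsLocal C) {u : Pt d → V} (hu : Smooth u)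
    {v : Ser d V} (hv : SmoothS v)
    (μ ν : Fin d) : variation (c2 C μ ν) u v = cpt2 (variation C u v) μ ν :=
  variation_postF ((proj (R := ℝ) (φ := fun _ : Fin d => W) ν).comp
    (proj (R := ℝ) (φ := fun _ : Fin d => Fin d → W) μ)) hC hu hv

/-- `c (Q_{μν} - Q_{νμ} + C_{μν} - C_{νμ})`. -/
def rhs (c : ℂ) (Q : Fin d → Fin d → Fun d V (Mat a b))
    (C : Fun d V (Fin d → Fin d → Mat a b)) (p : Idx d) : Fun d V (Mat a b) :=
  c • (Q p.1.1 p.1.2 - Q p.1.2 p.1.1 + (c2 C p.1.1 p.1.2 - c2 C p.1.2 p.1.1))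

lemma HasSub.rhs {Q : Fin d → Fin d → Fun d V (Mat a b)} {C : Fun d V (Fin d → Fin d → Mat a b)}
    (hC : IsLocal C) {u : Ser d V} {q k : Fin d → Fin d → SS d a b}
    (hQ : ∀ μ ν, HasSub (Q μ ν) u (q μ ν)) (hk : ∀ μ ν, cpt2 (subst C u) μ ν = (k μ ν).1)
    (c : ℂ) (p : Idx d) : HasSub (SW.rhs c Q C p) u
      (c • (q p.1.1 p.1.2 - q p.1.2 p.1.1 + (k p.1.1 p.1.2 - k p.1.2 p.1.1))) := by
  have h : ∀ μ ν, HasSub (c2 C μ ν) u (k μ ν) := fun μ ν =>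
    ⟨(hQ μ ν).smooth, hC.c2 μ ν, (subst_c2 hC (hQ μ ν).smooth μ ν).trans (hk μ ν)⟩
  exact (((hQ _ _).sub (hQ _ _)).add ((h _ _).sub (h _ _))).smul c

lemma smoothS_cpt2 {u : Ser d (Fin d → Fin d → Mat a b)} (hu : SmoothS u) (μ ν : Fin d) :
    SmoothS (cpt2 u μ ν) := fun J =>
  ((proj (R := ℝ) (φ := fun _ : Fin d => Mat a b) ν).comp
    (proj (R := ℝ) (φ := fun _ : Fin d => Fin d → Mat a b) μ)).contDiff.comp
    (hu J)

/-- Components of a power series of tensors. -/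
def cpt2S {u : Ser d (Fin d → Fin d → Mat a b)} (hu : SmoothS u) (μ ν : Fin d) : SS d a b :=
  ⟨cpt2 u μ ν, smoothS_cpt2 hu μ ν⟩

lemma HasVar.rhs {Q : Fin d → Fin d → Fun d V (Mat a b)} {C : Fun d V (Fin d → Fin d → Mat a b)}
    (hC : IsLocal C) {u : Pt d → V} (hu : Smooth u) {v : Ser d V} (hv : SmoothS v)
    {q q' : Fin d → Fin d → SS d a b} (hQ : ∀ μ ν, HasVar (Q μ ν) u v (q μ ν) (q' μ ν))
    (c : ℂ) (p : Idx d) : HasVar (SW.rhs c Q C p) u v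
      (c • (q p.1.1 p.1.2 - q p.1.2 p.1.1 + (cpt2S (hC.smoothS hu) p.1.1 p.1.2 -
        cpt2S (hC.smoothS hu) p.1.2 p.1.1)))
      (c • (q' p.1.1 p.1.2 - q' p.1.2 p.1.1 +
        (cpt2S (smoothS_variation hC hu hv) p.1.1 p.1.2 -
          cpt2S (smoothS_variation hC hu hv) p.1.2 p.1.1))) := by
  have h : ∀ μ ν, HasVar (c2 C μ ν) u v (cpt2S (hC.smoothS hu) μ ν)
      (cpt2S (smoothS_variation hC hu hv) μ ν) := fun μ ν =>
    ⟨hu, hv, hC.c2 μ ν, rfl, variation_c2 hC hu hv μ ν⟩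
  exact (((hQ _ _).sub (hQ _ _)).add ((h _ _).sub (h _ _))).smul c

lemma IsLocal.rhs {Q : Fin d → Fin d → Fun d V (Mat a b)} {C : Fun d V (Fin d → Fin d → Mat a b)}
    (hC : IsLocal C) (hQ : ∀ μ ν, IsLocal (Q μ ν)) (c : ℂ) (p : Idx d) :
    IsLocal (SW.rhs c Q C p) :=
  (((hQ _ _).sub (hQ _ _)).add ((hC.c2 _ _).sub (hC.c2 _ _))).smul c

/-- The differential equation in all antisymmetric directions. -/
lemma dTheta_rhs {Q : Fin d → Fin d → Fun d V (Mat a b)}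
    {C : Fun d V (Fin d → Fin d → Mat a b)} (hC : IsLocal C) {u : Ser d V} (hu : SmoothS u)
    {q : Fin d → Fin d → SS d a b} (hQ : ∀ μ ν, HasSub (Q μ ν) u (q μ ν)) (c : ℝ)
    (f : Ser d (Mat a b)) :
    (∀ δ : Fin d → Fin d → ℝ, (∀ μ ν, δ μ ν = -δ ν μ) → dTheta δ f =
      c • ∑ μ, ∑ ν, δ μ ν • ((q μ ν).1 + cpt2 (subst C u) μ ν)) ↔
      ∀ p, dT p f = subst (rhs c Q C p) u := by
  rw [dTheta_iff]
  refine forall_congr' fun p => ?_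
  rw [(HasSub.rhs hC hQ (k := cpt2S (smoothS_subst hC hu)) (fun μ ν => rfl) c p).val]
  have : ∀ (x y : SS d a b), (x + y).1 = x.1 + y.1 := fun _ _ => rfl
  have e : c • ((q p.1.1 p.1.2).1 + cpt2 (subst C u) p.1.1 p.1.2 -
      ((q p.1.2 p.1.1).1 + cpt2 (subst C u) p.1.2 p.1.1)) =
      (c : ℂ) • ((q p.1.1 p.1.2).1 - (q p.1.2 p.1.1).1 +
        (cpt2 (subst C u) p.1.1 p.1.2 - cpt2 (subst C u) p.1.2 p.1.1)) := by
    rw [coe_smul_ser]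
    congr 1
    abel
  rw [e]
  rfl

/-- Existence of the extra terms. -/
lemma exists_rhs {h : Fun d V V} (hh : IsLocal h) (h0 : ∀ v, Smooth v → h 0 v = v)
    {F : Fun d V (Mat a b)} (hF : IsLocal F) {Q : Fin d → Fin d → Fun d V (Mat a b)}
    (hQ : ∀ μ ν, IsLocal (Q μ ν)) {c : ℝ} (hc : c ≠ 0) :
    ∃ C : Fun d V (Fin d → Fin d → Mat a b), IsLocal C ∧
      (∀ J u x μ ν, C J u x μ ν = -C J u x ν μ) ∧
      (∀ v, Smooth v → subst C (app h v) = fun J x => asym fun p =>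
        ((1 / 2 : ℝ) • (c⁻¹ • dT p (app F v) -
          subst (Q p.1.1 p.1.2 - Q p.1.2 p.1.1) (app h v))) J x) ∧
      ∀ v, Smooth v → ∀ p, dT p (app F v) = subst (rhs c Q C p) (app h v) := by
  obtain ⟨C, hC, hCa, hCs⟩ := exists_extra hh h0 hF
    (Q := fun p => Q p.1.1 p.1.2 - Q p.1.2 p.1.1) (fun p => (hQ _ _).sub (hQ _ _)) c
  refine ⟨C, hC, hCa, hCs, fun v hv p => ?_⟩
  have hs := hh.smoothS hv
  have hq := fun μ ν => (⟨hs, hQ μ ν, rfl⟩ : HasSub (Q μ ν) (app h v)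
    ⟨subst (Q μ ν) (app h v), smoothS_subst (hQ μ ν) hs⟩)
  rw [(HasSub.rhs hC hq (k := cpt2S (smoothS_subst hC hs)) (fun μ ν => rfl) c p).val]
  have e : (SS d a b).subtype ((c : ℂ) •
      ((⟨subst (Q p.1.1 p.1.2) (app h v), smoothS_subst (hQ _ _) hs⟩ : SS d a b) -
      ⟨subst (Q p.1.2 p.1.1) (app h v), smoothS_subst (hQ _ _) hs⟩ +
      (cpt2S (smoothS_subst hC hs) p.1.1 p.1.2 - cpt2S (smoothS_subst hC hs) p.1.2 p.1.1))) =
      (c : ℂ) • (subst (Q p.1.1 p.1.2) (app h v) - subst (Q p.1.2 p.1.1) (app h v) +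
        (cpt2 (subst C (app h v)) p.1.1 p.1.2 - cpt2 (subst C (app h v)) p.1.2 p.1.1)) := rfl
  refine Eq.trans ?_ e.symm
  rw [coe_smul_ser, hCs v hv, ← subst_sub (hQ _ _) (hQ _ _) hs]
  ext1 J
  ext1 x
  simp only [cpt2, Pi.smul_apply, Pi.add_apply, Pi.sub_apply, asym_idx, asym_idx']
  rw [sub_neg_eq_add, ← add_smul, add_halves, one_smul, add_sub_cancel, smul_inv_smul₀ hc]

end Functionals

section Potential

variable {d N m : ℕ}

/-- The letters `A_μ`, for functionals of the potential. -/
def aP (d N : ℕ) (μ : Fin d) : Fun d (Pot d N) (Mat N N) := potF (ContinuousLinearMap.id ℝ _) μ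

/-- The letters `A_μ`, for functionals of a further field and the potential. -/
def aM (d N m : ℕ) (μ : Fin d) : Fun d (Mat N m × Pot d N) (Mat N N) :=
  potF (snd ℝ (Mat N m) (Pot d N)) μ

/-- The further field. -/
def fM (d N m : ℕ) : Fun d (Mat N m × Pot d N) (Mat N m) :=
  linF (fst ℝ (Mat N m) (Pot d N))

/-- Functional with one index fixed. -/
def sl (D : DFun d N) (κ : Fin d) : Fun d (Pot d N) (Fin d → Fin d → Mat N N) :=
  fun J A x μ ν => D J A x μ ν κ

/-- The linear map that fixes the last index. -/
def slL (d N : ℕ) (κ : Fin d) :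
    (Fin d → Fin d → Fin d → Mat N N) →L[ℝ] (Fin d → Fin d → Mat N N) :=
  ContinuousLinearMap.pi fun μ => ContinuousLinearMap.pi fun ν =>
    (proj (R := ℝ) (φ := fun _ : Fin d => Mat N N) κ).comp
      ((proj (R := ℝ) (φ := fun _ : Fin d => Fin d → Mat N N) ν).comp
        (proj (R := ℝ) (φ := fun _ : Fin d => Fin d → Fin d → Mat N N) μ))

lemma IsLocal.sl {D : DFun d N} (hD : IsLocal D) (κ : Fin d) : IsLocal (SW.sl D κ) :=
  hD.postF (slL d N κ)

lemma subst_sl {D : DFun d N} (hD : IsLocal D) {u : Ser d (Pot d N)} (hu : SmoothS u)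
    (κ μ ν : Fin d) : cpt2 (subst (sl D κ) u) μ ν = cpt3 (subst D u) μ ν κ :=
  congrArg (fun f => cpt2 f μ ν) (subst_postF (slL d N κ) hD hu)

lemma variation_sl {D : DFun d N} (hD : IsLocal D) {u : Pt d → Pot d N} (hu : Smooth u)
    {v : Ser d (Pot d N)} (hv : SmoothS v)
    (κ μ ν : Fin d) : cpt2 (variation (sl D κ) u v) μ ν = cpt3 (variation D u v) μ ν κ :=
  congrArg (fun f => cpt2 f μ ν) (variation_postF (slL d N κ) hD hu hv)

/-- The constant `-π/2`. -/
def cst : ℝ := -(Real.pi / 2)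

lemma cst_ne_zero : cst ≠ 0 := by
  unfold cst
  have := Real.pi_pos
  intro h
  linarith

/-- Right-hand side of the equation for the potential. -/
def RA (D : DFun d N) (p : Idx d) : Fun d (Pot d N) (Pot d N) :=
  piF fun κ => rhs (cst : ℂ) (QF (aP d N) κ) (sl D κ) p

/-- Right-hand side of the equation for the gauge parameter. -/
def RE (E : EFun d N) (p : Idx d) : Fun d (Mat N N × Pot d N) (Mat N N) :=
  rhs ((-cst : ℝ) : ℂ) (QEF (aM d N N) (fM d N N)) E p

/-- Gauge variation of the potential. -/
def VG (d N : ℕ) : Fun d (Mat N N × Pot d N) (Pot d N) :=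
  piF (gaugeAF (aM d N N) (fM d N N))

lemma hasSub_aP {u : Ser d (Pot d N)} (hu : SmoothS u) (μ : Fin d) :
    HasSub (aP d N μ) u (cptS hu μ) := HasSub.potF _ hu hu rfl μ

lemma hasSub_aM {e : Ser d (Mat N m)} {a : Ser d (Pot d N)} (he : SmoothS e) (ha : SmoothS a)
    (μ : Fin d) : HasSub (aM d N m μ) (pairS e a) (cptS ha μ) :=
  HasSub.potF _ (smoothS_pairS he ha) ha rfl μ

lemma hasSub_fM {e : Ser d (Mat N m)} {a : Ser d (Pot d N)} (he : SmoothS e) (ha : SmoothS a) :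
    HasSub (fM d N m) (pairS e a) ⟨e, he⟩ :=
  HasSub.lin _ (smoothS_pairS he ha) rfl

lemma hasVar_aP {A : Pt d → Pot d N} (hA : Smooth A) {v : Ser d (Pot d N)} (hv : SmoothS v)
    (μ : Fin d) : HasVar (aP d N μ) A v (potS hA μ) (cptS hv μ) :=
  HasVar.potF _ hA hv hA rfl hv rfl μ

lemma hasVar_aM {w : Pt d → Mat N m × Pot d N} (hw : Smooth w) {e : Ser d (Mat N m)}
    {a : Ser d (Pot d N)} (he : SmoothS e) (ha : SmoothS a) (μ : Fin d) :
    HasVar (aM d N m μ) w (pairS e a) (potS (smooth_snd hw) μ) (cptS ha μ) :=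
  HasVar.potF _ hw (smoothS_pairS he ha) (smooth_snd hw) rfl ha rfl μ

lemma hasVar_fM {w : Pt d → Mat N m × Pot d N} (hw : Smooth w) {e : Ser d (Mat N m)}
    {a : Ser d (Pot d N)} (he : SmoothS e) (ha : SmoothS a) :
    HasVar (fM d N m) w (pairS e a) (constS (smooth_fst hw)) ⟨e, he⟩ :=
  HasVar.lin _ hw (smoothS_pairS he ha) rfl rfl

lemma smoothS_zero :
    SmoothS (0 : Ser d V) := fun _ => contDiff_const

lemma isLocal_QF (κ μ ν : Fin d) : IsLocal (QF (aP d N) κ μ ν) :=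
  (HasSub.QF (fun μ => hasSub_aP smoothS_zero μ) κ μ ν).loc

lemma isLocal_QEF (μ ν : Fin d) : IsLocal (QEF (aM d N N) (fM d N N) μ ν) :=
  (HasSub.QEF (hasSub_aM smoothS_zero smoothS_zero) (hasSub_fM smoothS_zero smoothS_zero) μ ν).loc

lemma isLocal_gaugeAF (κ : Fin d) : IsLocal (gaugeAF (aM d N N) (fM d N N) κ) :=
  (HasSub.gaugeAF (hasSub_aM smoothS_zero smoothS_zero)
    (hasSub_fM smoothS_zero smoothS_zero) κ).loc

lemma isLocal_VG : IsLocal (VG d N) := IsLocal.piF isLocal_gaugeAF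

lemma isLocal_RAc {D : DFun d N} (hD : IsLocal D) (p : Idx d) (κ : Fin d) :
    IsLocal (rhs (cst : ℂ) (QF (aP d N) κ) (sl D κ) p) :=
  (hD.sl κ).rhs (isLocal_QF κ) _ p

lemma isLocal_RA {D : DFun d N} (hD : IsLocal D) (p : Idx d) : IsLocal (RA D p) :=
  IsLocal.piF (isLocal_RAc hD p)

lemma isLocal_RE {E : EFun d N} (hE : IsLocal E) (p : Idx d) : IsLocal (RE E p) :=
  hE.rhs isLocal_QEF _ p

lemma cpt_ext {W : Type} {f g : Ser d (Fin d → W)} (h : ∀ κ, cpt f κ = cpt g κ) : f = g := by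
  ext J x κ
  exact congrFun (congrFun (h κ) J) x

lemma subst_RA {D : DFun d N} (hD : IsLocal D) (p : Idx d) {u : Ser d (Pot d N)}
    (hu : SmoothS u) (κ : Fin d) :
    cpt (subst (RA D p) u) κ = subst (rhs (cst : ℂ) (QF (aP d N) κ) (sl D κ) p) u :=
  subst_piF (isLocal_RAc hD p) hu κ

lemma eqA_iff {Ah : PotFun d N} (hAh : IsLocal Ah) {D : DFun d N} (hD : IsLocal D) :
    EqA Ah D ↔ ∀ p A, Smooth A → dT p (app Ah A) = subst (RA D p) (app Ah A) := by
  have key : ∀ A, Smooth A → ∀ κ, (∀ δ : Fin d → Fin d → ℝ, (∀ μ ν, δ μ ν = -δ ν μ) →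
      dTheta δ (cpt (app Ah A) κ) = (-(Real.pi / 2)) • ∑ μ, ∑ ν, δ μ ν •
        (acomm (cpt (app Ah A) μ) (pdS ν (cpt (app Ah A) κ) + field (cpt (app Ah A)) ν κ) +
          cpt3 (subst D (app Ah A)) μ ν κ)) ↔
      ∀ p, dT p (cpt (app Ah A) κ) = cpt (subst (RA D p) (app Ah A)) κ := by
    intro A hA κ
    have hs := hAh.smoothS hA
    have := dTheta_rhs (hD.sl κ) hs (HasSub.QF (hasSub_aP hs) κ) cst (cpt (app Ah A) κ)
    simp only [subst_RA hD _ hs]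
    rw [← this]
    simp only [subst_sl hD hs]
    rfl
  constructor
  · intro h p A hA
    exact cpt_ext fun κ => (key A hA κ).mp (fun δ hδ => h A hA δ hδ κ) p
  · intro h A hA δ hδ κ
    exact (key A hA κ).mpr (fun p => congrArg (fun f => cpt f κ) (h p A hA)) δ hδ

lemma exists_D {Ah : PotFun d N} (hAh : IsPotMap Ah) :
    ∃ D : DFun d N, IsExtraD D ∧ EqA Ah D := by
  have h1 := fun κ => exists_rhs hAh.1 hAh.2
    (hAh.1.postF (proj (R := ℝ) (φ := fun _ : Fin d => Mat N N) κ))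
    (isLocal_QF (N := N) κ) cst_ne_zero
  choose C hC hCa _ hCe using h1
  let D : DFun d N := fun J A x μ ν κ => C κ J A x μ ν
  have hD : IsLocal D := by
    have : D = piF fun μ => piF fun ν => piF fun κ => c2 (C κ) μ ν := rfl
    rw [this]
    exact IsLocal.piF fun μ => IsLocal.piF fun ν => IsLocal.piF fun κ => (hC κ).c2 μ ν
  refine ⟨D, ⟨hD, fun A hA J x μ ν κ => hCa κ J A x μ ν⟩, (eqA_iff hAh.1 hD).mpr ?_⟩
  intro p A hA
  refine cpt_ext fun κ => ?_
  rw [subst_RA hD p (hAh.1.smoothS hA)]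
  exact hCe κ A hA p

lemma matter_eq_iff {Ah : PotFun d N} (hAh : IsLocal Ah) {ph : MatFun d N m} (hph : IsLocal ph)
    {Q : Fin d → Fin d → Fun d (Mat N m × Pot d N) (Mat N m)}
    {q : SS d N m → (Fin d → SS d N N) → Fin d → Fin d → SS d N m}
    (hQ : ∀ (e : Ser d (Mat N m)) (a : Ser d (Pot d N)) (he : SmoothS e) (ha : SmoothS a) (μ ν),
      HasSub (Q μ ν) (pairS e a) (q ⟨e, he⟩ (cptS ha) μ ν))
    {C : CFun d N m} (hC : IsLocal C) (c : ℝ) :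
    (∀ A φ (hA : Smooth A) (hφ : Smooth φ), ∀ δ : Fin d → Fin d → ℝ, (∀ μ ν, δ μ ν = -δ ν μ) →
      dTheta δ (app ph (fun x => (φ x, A x))) = c • ∑ μ, ∑ ν, δ μ ν •
        ((q ⟨app ph (fun x => (φ x, A x)), hph.smoothS (smooth_pair hφ hA)⟩
          (cptS (hAh.smoothS hA)) μ ν).1 +
          cpt2 (subst C (pairS (app ph (fun x => (φ x, A x))) (app Ah A))) μ ν)) ↔
      ∀ p w, Smooth w → dT p (app ph w) = subst (rhs c Q C p) (app (hatF Ah ph) w) := by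
  have key := fun A φ (hA : Smooth A) (hφ : Smooth φ) =>
    dTheta_rhs hC (smoothS_pairS (hph.smoothS (smooth_pair hφ hA)) (hAh.smoothS hA))
      (hQ _ _ (hph.smoothS (smooth_pair hφ hA)) (hAh.smoothS hA)) c
      (app ph (fun x => (φ x, A x)))
  constructor
  · intro h p w hw
    exact (key _ _ (smooth_snd hw) (smooth_fst hw)).mp (h _ _ (smooth_snd hw) (smooth_fst hw)) p
  · intro h A φ hA hφ
    exact (key A φ hA hφ).mpr fun p => h p _ (smooth_pair hφ hA)

lemma exists_C {Ah : PotFun d N} (hAh : IsPotMap Ah) {ph : MatFun d N m} (hph : IsLocal ph)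
    {R : Type} [Ring R] [Module R (Mat N m)] [SMulCommClass ℝ R (Mat N m)]
    [@ContinuousConstSMul R (Mat N m) PseudoMetricSpace.toUniformSpace.toTopologicalSpace _]
    (hlin : IsLinearFst R ph)
    (ph0 : ∀ φ A, Smooth φ → Smooth A → ph 0 (fun x => (φ x, A x)) = φ)
    (ρ : R → ℂ) (hρ : ∀ r (M : Mat N m), r • M = ρ r • M)
    {Q : Fin d → Fin d → Fun d (Mat N m × Pot d N) (Mat N m)}
    {q : SS d N m → (Fin d → SS d N N) → Fin d → Fin d → SS d N m}
    (hQ : ∀ (e : Ser d (Mat N m)) (a : Ser d (Pot d N)) (he : SmoothS e) (ha : SmoothS a) (μ ν),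
      HasSub (Q μ ν) (pairS e a) (q ⟨e, he⟩ (cptS ha) μ ν))
    (hq : ∀ e₁ e₂ (z : ℂ) a μ ν, q (e₁ + z • e₂) a μ ν = q e₁ a μ ν + z • q e₂ a μ ν)
    {c : ℝ} (hc : c ≠ 0) :
    ∃ C : CFun d N m, IsLocal C ∧ IsLinearFst R C ∧ Antisymm2 C ∧
      ∀ p w, Smooth w → dT p (app ph w) = subst (rhs c Q C p) (app (hatF Ah ph) w) := by
  have hhat : IsLocal (hatF Ah ph) := hph.pairF (hAh.1.preF _)
  have hat0 : ∀ w, Smooth w → hatF Ah ph 0 w = w := by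
    intro w hw
    ext1 y
    exact Prod.ext (congrFun (ph0 _ _ (smooth_fst hw) (smooth_snd hw)) y)
      (congrFun (hAh.2 _ (smooth_snd hw)) y)
  have hQl : ∀ μ ν, IsLocal (Q μ ν) := fun μ ν => (hQ 0 0 smoothS_zero smoothS_zero μ ν).loc
  obtain ⟨C, hC, hCa, hCs, hCe⟩ := exists_rhs hhat hat0 hph hQl hc
  refine ⟨C, hC, ?_, fun φ A _ _ J x μ ν => hCa J _ x μ ν, fun p w hw => hCe w hw p⟩
  refine isLinearFst_of_subst hAh.1 hAh.2 hph hlin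
    (fun w hw => ph0 _ _ (smooth_fst hw) (smooth_snd hw)) hC ?_
  intro u₁ u₂ v h₁ h₂ hv r
  have h12 : Smooth (fun y => u₁ y + r • u₂ y) := h₁.add (contDiff_smul h₂ r)
  have w12 := smooth_pair h12 hv
  have w1 := smooth_pair h₁ hv
  have w2 := smooth_pair h₂ hv
  have ha := hAh.1.smoothS hv
  let f : ∀ {w : Pt d → Mat N m × Pot d N}, Smooth w → SS d N m := fun hw =>
    ⟨app ph _, hph.smoothS hw⟩
  have hadd : f w12 = f w1 + ρ r • f w2 := by
    refine Subtype.ext ?_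
    ext1 J
    ext1 x
    refine (hlin J u₁ u₂ v h₁ h₂ hv r x).trans ?_
    rw [hρ]
    rfl
  let S : (Pt d → Mat N m) → Idx d → Ser d (Mat N m) := fun u p =>
    (1 / 2 : ℝ) • (c⁻¹ • dT p (app ph fun y => (u y, v y)) -
      subst (Q p.1.1 p.1.2 - Q p.1.2 p.1.1) (app (hatF Ah ph) fun y => (u y, v y)))
  let T : SS d N m → Idx d → SS d N m := fun f p =>
    ((1 / 2 : ℝ) : ℂ) • (((c⁻¹ : ℝ) : ℂ) • dTS p f -
      (q f (cptS ha) p.1.1 p.1.2 - q f (cptS ha) p.1.2 p.1.1))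
  have e : ∀ {u} (hw : Smooth fun y => (u y, v y)) p, S u p = (T (f hw) p).1 := by
    intro u hw p
    have h1 := ((hQ _ _ (hph.smoothS hw) ha p.1.1 p.1.2).sub
      (hQ _ _ (hph.smoothS hw) ha p.1.2 p.1.1)).val
    have h2 : app (hatF Ah ph) (fun y => (u y, v y)) = pairS (app ph _) (app Ah v) := rfl
    simp only [S]
    rw [h2, h1, ← coe_smul_ser, ← coe_smul_ser]
    rfl
  have key : ∀ p J x, S (fun y => u₁ y + r • u₂ y) p J x = S u₁ p J x + r • S u₂ p J x := by
    intro p J x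
    rw [e w12, e w1, e w2, hρ]
    have h3 : T (f w12) p = T (f w1) p + ρ r • T (f w2) p := by
      simp only [T]
      rw [hadd, hq, hq, map_add, map_smul]
      module
    exact congrFun (congrFun (congrArg Subtype.val h3) J) x
  rw [hCs _ w12, hCs _ w1, hCs _ w2]
  ext1 J
  ext1 x
  refine (congrArg asym (funext fun p => key p J x)).trans ?_
  have h5 := asym_add (fun p => S u₁ p J x) (r • fun p => S u₂ p J x)
  rw [asym_smul] at h5
  exact h5

end Potential

section Conditions

variable {d N m : ℕ}

lemma app_VG {w : Pt d → Mat N N × Pot d N} (hw : Smooth w) (κ : Fin d) :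
    cpt (app (VG d N) w) κ =
      (gaugeS (potS (smooth_snd hw)) (constS (smooth_fst hw)) κ).1 :=
  (HasVar.gaugeAF (hasVar_aM hw smoothS_zero smoothS_zero)
    (hasVar_fM hw smoothS_zero smoothS_zero) κ).val

lemma gaugeA_eq {w : Pt d → Mat N N × Pot d N} (hw : Smooth w) :
    gaugeA (pot fun y => (w y).2) (const fun y => (w y).1) = app (VG d N) w :=
  cpt_ext fun κ => (app_VG hw κ).symm

lemma smoothS_VG {w : Pt d → Mat N N × Pot d N} (hw : Smooth w) : SmoothS (app (VG d N) w) :=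
  isLocal_VG.smoothS hw

lemma cptS_VG {w : Pt d → Mat N N × Pot d N} (hw : Smooth w) :
    cptS (smoothS_VG hw) = gaugeS (potS (smooth_snd hw)) (constS (smooth_fst hw)) :=
  funext fun κ => Subtype.ext (app_VG hw κ)

/-- Violation of the constraint between `D` and `E`. -/
def ZD (D : DFun d N) (E : EFun d N) (w : Pt d → Mat N N × Pot d N) (μ ν κ : Fin d) :
    Ser d (Mat N N) :=
  dPrimeD D (fun y => (w y).2) (fun y => (w y).1) μ ν κ +
    covA (pot fun y => (w y).2) κ (cpt2 (app E w) μ ν)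

lemma constrD_iff (D : DFun d N) (E : EFun d N) :
    ConstrD D E ↔ ∀ w, Smooth w → ∀ μ ν κ, ZD D E w μ ν κ = 0 := by
  constructor
  · intro h w hw μ ν κ
    unfold ZD
    rw [h _ _ (smooth_snd hw) (smooth_fst hw)]
    exact neg_add_cancel _
  · intro h A ε hA hε μ ν κ
    exact eq_neg_of_add_eq_zero_left (h _ (smooth_pair hε hA) μ ν κ)

/-- Value of the right-hand side of the equation for the potential. -/
def RAS {D : DFun d N} (hD : IsLocal D) {A : Pt d → Pot d N} (hA : Smooth A) (p : Idx d)
    (κ : Fin d) : SS d N N :=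
  (cst : ℂ) • (QS (potS hA) p.1.1 p.1.2 κ - QS (potS hA) p.1.2 p.1.1 κ +
    (cpt2S ((hD.sl κ).smoothS hA) p.1.1 p.1.2 - cpt2S ((hD.sl κ).smoothS hA) p.1.2 p.1.1))

lemma app_RA {D : DFun d N} (hD : IsLocal D) {A : Pt d → Pot d N} (hA : Smooth A) (p : Idx d) :
    cptS ((isLocal_RA hD p).smoothS hA) = RAS hD hA p :=
  funext fun κ => Subtype.ext (HasVar.rhs (hD.sl κ) hA smoothS_zero
    (HasVar.QF (hasVar_aP hA smoothS_zero) κ) cst p).val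

/-- Value of the right-hand side of the equation for the gauge parameter. -/
def RES {E : EFun d N} (hE : IsLocal E) {w : Pt d → Mat N N × Pot d N} (hw : Smooth w)
    (p : Idx d) : SS d N N :=
  (-cst : ℂ) • (QES (potS (smooth_snd hw)) (constS (smooth_fst hw)) p.1.1 p.1.2 -
    QES (potS (smooth_snd hw)) (constS (smooth_fst hw)) p.1.2 p.1.1 +
    (cpt2S (hE.smoothS hw) p.1.1 p.1.2 - cpt2S (hE.smoothS hw) p.1.2 p.1.1))

lemma app_RE {E : EFun d N} (hE : IsLocal E) {w : Pt d → Mat N N × Pot d N} (hw : Smooth w)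
    (p : Idx d) : (⟨app (RE E p) w, (isLocal_RE hE p).smoothS hw⟩ : SS d N N) = RES hE hw p := by
  refine Subtype.ext ((HasVar.rhs hE hw (smoothS_pairS smoothS_zero smoothS_zero)
    (HasVar.QEF (hasVar_aM hw smoothS_zero smoothS_zero) (hasVar_fM hw smoothS_zero smoothS_zero))
    ((-cst : ℝ) : ℂ) p).val.trans ?_)
  rw [Complex.ofReal_neg]
  rfl

lemma cst_eq : (cst : ℂ) = -(Real.pi / 2 : ℂ) := by
  simp [cst]

lemma cst_ne_zero' : (cst : ℂ) ≠ 0 := by exact_mod_cast cst_ne_zero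

lemma eq_iff_of_sub {a b : ℕ} {x y z z' : SS d a b} {c : ℂ} (hc : c ≠ 0)
    (h : x - y = c • (z - z')) : x = y ↔ z = z' := by
  rw [← sub_eq_zero, h, smul_eq_zero, sub_eq_zero, or_iff_right hc]

lemma pot_cond_iff {D : DFun d N} (hD : IsLocal D) {E : EFun d N} (hE : IsLocal E)
    {w : Pt d → Mat N N × Pot d N} (hw : Smooth w) (p : Idx d) :
    variation (RA D p) (fun y => (w y).2) (app (VG d N) w) = dT p (app (VG d N) w) +
        variation (VG d N) w (pairS (app (RE E p) w) (app (RA D p) (fun y => (w y).2))) ↔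
      ∀ κ, ZD D E w p.1.1 p.1.2 κ = ZD D E w p.1.2 p.1.1 κ := by
  have hA := smooth_snd hw
  have hε := smooth_fst hw
  have hv := smoothS_VG hw
  have hRA := (isLocal_RA hD p).smoothS hA
  have hRE := (isLocal_RE hE p).smoothS hw
  have key : ∀ κ, (cpt (variation (RA D p) (fun y => (w y).2) (app (VG d N) w)) κ =
      cpt (dT p (app (VG d N) w) +
        variation (VG d N) w (pairS (app (RE E p) w) (app (RA D p) (fun y => (w y).2)))) κ) ↔
      ZD D E w p.1.1 p.1.2 κ = ZD D E w p.1.2 p.1.1 κ := by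
    intro κ
    have e1 : cpt (variation (RA D p) (fun y => (w y).2) (app (VG d N) w)) κ = _ :=
      (variation_piF (isLocal_RAc hD p) hA hv κ).trans
        (HasVar.rhs (hD.sl κ) hA hv (HasVar.QF (hasVar_aP hA hv) κ) cst p).var
    have e2 : cpt (variation (VG d N) w
        (pairS (app (RE E p) w) (app (RA D p) (fun y => (w y).2)))) κ = _ :=
      (variation_piF isLocal_gaugeAF hw (smoothS_pairS hRE hRA) κ).trans
        (HasVar.gaugeAF (hasVar_aM hw hRE hRA) (hasVar_fM hw hRE hRA) κ).var
    rw [cptS_VG hw] at e1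
    rw [app_RA hD hA, app_RE hE hw] at e2
    have e3 : cpt (dT p (app (VG d N) w)) κ = (dTS p (gaugeS (potS hA) (constS hε) κ)).1 := by
      rw [coe_dTS, ← app_VG hw κ]
      rfl
    have e4 : ∀ f g : Ser d (Pot d N), cpt (f + g) κ = cpt f κ + cpt g κ := fun _ _ => rfl
    rw [e4, e1, e2, e3]
    have id := gauge_identity p κ (potS hA) (constS hε) (dTS_potS hA p) (dTS_constS hε p)
      (cpt2S ((hD.sl κ).smoothS hA) p.1.1 p.1.2) (cpt2S ((hD.sl κ).smoothS hA) p.1.2 p.1.1)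
      (cpt2S (smoothS_variation (hD.sl κ) hA hv) p.1.1 p.1.2)
      (cpt2S (smoothS_variation (hD.sl κ) hA hv) p.1.2 p.1.1)
      (cpt2S (hE.smoothS hw) p.1.1 p.1.2) (cpt2S (hE.smoothS hw) p.1.2 p.1.1)
      (RAS hD hA p κ) (RES hE hw p) cst cst_eq rfl rfl
    have id2 := eq_iff_of_sub cst_ne_zero' id
    have e5 : ∀ μ ν, ZD D E w μ ν κ = (cpt2S (smoothS_variation (hD.sl κ) hA hv) μ ν -
        I • (constS hε ⋆ cpt2S ((hD.sl κ).smoothS hA) μ ν -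
          cpt2S ((hD.sl κ).smoothS hA) μ ν ⋆ constS hε) +
        gaugeS (potS hA) (cpt2S (hE.smoothS hw) μ ν) κ).1 := by
      intro μ ν
      have e6 : cpt3 (variation D (fun y => (w y).2)
          (gaugeA (pot fun y => (w y).2) (const fun y => (w y).1))) μ ν κ =
          (cpt2S (smoothS_variation (hD.sl κ) hA hv) μ ν).1 := by
        rw [gaugeA_eq hw]
        exact (variation_sl hD hA hv κ μ ν).symm
      unfold ZD dPrimeD
      rw [e6]
      rfl
    rw [e5, e5, Subtype.coe_inj, ← id2, ← Subtype.coe_inj]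
    rfl
  constructor
  · intro h κ
    exact (key κ).mp (congrArg (fun f => cpt f κ) h)
  · intro h
    exact cpt_ext fun κ => (key κ).mpr (h κ)

lemma ZD_antisymm {D : DFun d N} (hD : IsExtraD D) {E : EFun d N} (hE : IsExtraE E)
    {w : Pt d → Mat N N × Pot d N} (hw : Smooth w) (κ μ ν : Fin d) :
    ZD D E w μ ν κ = -ZD D E w ν μ κ := by
  have hA := smooth_snd hw
  have hε := smooth_fst hw
  have hv := smoothS_VG hw
  have e1 : ∀ A, Smooth A → cpt3 (app D A) μ ν κ = (-1 : ℂ) • cpt3 (app D A) ν μ κ := by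
    intro A hA
    ext1 J
    ext1 x
    exact (hD.2 A hA J x μ ν κ).trans (neg_one_smul ℂ (D J A x ν μ κ)).symm
  have e2 : cpt2 (app E w) μ ν = (-1 : ℂ) • cpt2 (app E w) ν μ := by
    ext1 J
    ext1 x
    exact (hE.2.2 _ _ hε hA J x μ ν).trans (neg_one_smul ℂ (E J w x ν μ)).symm
  have e3 : cpt3 (variation D (fun y => (w y).2) (app (VG d N) w)) μ ν κ =
      (-1 : ℂ) • cpt3 (variation D (fun y => (w y).2) (app (VG d N) w)) ν μ κ := by
    rw [← variation_sl hD.1 hA hv, ← variation_sl hD.1 hA hv,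
      ← variation_c2 (hD.1.sl κ) hA hv, ← variation_c2 (hD.1.sl κ) hA hv,
      ← variation_smul ((hD.1.sl κ).c2 ν μ) (-1 : ℂ) hA hv]
    exact variation_congr (F := c2 (sl D κ) μ ν) (G := (-1 : ℂ) • c2 (sl D κ) ν μ)
      (fun A hA => e1 A hA) (((hD.1.sl κ).c2 ν μ).smul _) hA hv
  have e4 : ∀ x : SS d N N, I • (constS hε ⋆ ((-1 : ℂ) • x) - ((-1 : ℂ) • x) ⋆ constS hε) =
      (-1 : ℂ) • I • (constS hε ⋆ x - x ⋆ constS hε) := by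
    intro x
    simp only [mulS_smul, smul_mulS]
    module
  have e5 : ∀ x : SS d N N, gaugeS (potS hA) ((-1 : ℂ) • x) κ =
      (-1 : ℂ) • gaugeS (potS hA) x κ := by
    intro x
    simp only [gaugeS, mulS_smul, smul_mulS, map_smul]
    module
  have e4' := congrArg Subtype.val (e4 (cpt2S ((hD.1.sl κ).smoothS hA) ν μ))
  have e5' := congrArg Subtype.val (e5 (cpt2S (hE.1.smoothS hw) ν μ))
  unfold ZD dPrimeD
  rw [gaugeA_eq hw, e3, e1 _ hA, e2]
  refine (congrArg₂ (fun a b => (-1 : ℂ) • cpt3 (variation D (fun y => (w y).2)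
    (app (VG d N) w)) ν μ κ - a + b) e4' e5').trans ?_
  have e6 : ∀ a b c : Ser d (Mat N N), (-1 : ℂ) • a - (-1 : ℂ) • b + (-1 : ℂ) • c = -(a - b + c) := by
    intro a b c
    module
  exact e6 _ _ _

lemma constrD_iff_idx {D : DFun d N} (hD : IsExtraD D) {E : EFun d N} (hE : IsExtraE E) :
    ConstrD D E ↔ ∀ (p : Idx d) w, Smooth w → ∀ κ,
      ZD D E w p.1.1 p.1.2 κ = ZD D E w p.1.2 p.1.1 κ := by
  rw [constrD_iff]
  constructor
  · intro h p w hw κ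
    rw [h w hw, h w hw]
  · intro h w hw μ ν κ
    exact eq_zero_of_antisymm (Z := fun μ ν => ZD D E w μ ν κ) (fun μ ν => ZD_antisymm hD hE hw κ μ ν)
      (fun p => sub_eq_zero.mpr (h p w hw κ)) μ ν

lemma VG_zero {w : Pt d → Mat N N × Pot d N} (hw : Smooth w) :
    VG d N 0 w = cgaugeA (fun y => (w y).2) (fun y => (w y).1) := by
  have h := congrFun (gaugeA_eq hw) 0
  refine h.symm.trans ?_
  ext1 x
  ext1 μ
  simp only [gaugeA, Pi.add_apply, Pi.sub_apply, Pi.smul_apply, star_apply_zero, pot,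
    const_apply_zero, cgaugeA, pdS]

lemma gaugeA_cpt {e : Ser d (Mat N N)} {a : Ser d (Pot d N)} (he : SmoothS e) (ha : SmoothS a) :
    gaugeA (cpt a) e = subst (VG d N) (pairS e a) :=
  cpt_ext fun κ => by
    refine Eq.trans ?_ (subst_piF isLocal_gaugeAF (smoothS_pairS he ha) κ).symm
    rw [(HasSub.gaugeAF (hasSub_aM he ha) (hasSub_fM he ha) κ).val]
    rfl

lemma swGauge_iff {Ah : PotFun d N} (hAh : IsPotMap Ah) {eh : ParFun d N} (heh : IsParMap eh) :
    SWGauge Ah eh ↔ ∀ w : Pt d → Mat N N × Pot d N, Smooth w →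
      app (dFun Ah) (fun y => ((w y).2, VG d N 0 w y)) = subst (VG d N) (app (hatF Ah eh) w) := by
  have key : ∀ w : Pt d → Mat N N × Pot d N, Smooth w →
      (variation Ah (fun y => (w y).2) (const (cgaugeA (fun y => (w y).2) fun y => (w y).1)) =
        gaugeA (cpt (app Ah fun y => (w y).2)) (app eh w) ↔
      app (dFun Ah) (fun y => ((w y).2, VG d N 0 w y)) =
        subst (VG d N) (app (hatF Ah eh) w)) := by
    intro w hw
    rw [variation_const, VG_zero hw,
      gaugeA_cpt (heh.1.smoothS hw) (hAh.1.smoothS (smooth_snd hw))]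
    rfl
  constructor
  · intro h w hw
    exact (key w hw).mp (h _ _ (smooth_snd hw) (smooth_fst hw))
  · intro h A ε hA hε
    exact (key _ (smooth_pair hε hA)).mpr (h _ (smooth_pair hε hA))

/-- The right-hand side of the equation for the gauge parameter, as a function of its values. -/
lemma hasSub_QEF (e : Ser d (Mat N N)) (a : Ser d (Pot d N)) (he : SmoothS e) (ha : SmoothS a)
    (μ ν : Fin d) : HasSub (QEF (aM d N N) (fM d N N) μ ν) (pairS e a)
      (QES (cptS ha) ⟨e, he⟩ μ ν) :=
  HasSub.QEF (hasSub_aM he ha) (hasSub_fM he ha) μ ν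

lemma eqE_iff {Ah : PotFun d N} (hAh : IsLocal Ah) {eh : ParFun d N} (heh : IsLocal eh)
    {E : EFun d N} (hE : IsLocal E) :
    EqE Ah eh E ↔ ∀ p w, Smooth w → dT p (app eh w) = subst (RE E p) (app (hatF Ah eh) w) := by
  unfold RE
  rw [← matter_eq_iff hAh heh (q := fun e a => QES a e) hasSub_QEF hE (-cst)]
  have : -cst = Real.pi / 2 := neg_neg _
  rw [this]
  rfl

lemma exists_E {Ah : PotFun d N} (hAh : IsPotMap Ah) {eh : ParFun d N} (heh : IsParMap eh) :
    ∃ E : EFun d N, IsExtraE E ∧ EqE Ah eh E := by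
  obtain ⟨E, h1, h2, h3, h4⟩ := exists_C hAh heh.1 heh.2.1 heh.2.2 (fun r : ℝ => (r : ℂ))
    (fun r M => (Complex.coe_smul r M).symm) (q := fun e a => QES a e) hasSub_QEF
    (fun e₁ e₂ z a μ ν => by
      simp only [QES, map_add, map_smul, add_mulS, mulS_add, smul_mulS, mulS_smul]
      module) (neg_ne_zero.mpr cst_ne_zero)
  exact ⟨E, ⟨h1, h2, h3⟩, (eqE_iff hAh.1 heh.1 h1).mpr h4⟩

lemma gauge_iff_constr {Ah : PotFun d N} (hAh : IsPotMap Ah) {eh : ParFun d N}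
    (heh : IsParMap eh) {D : DFun d N} (hD : IsExtraD D) {E : EFun d N} (hE : IsExtraE E)
    (hEqA : EqA Ah D) (hEqE : EqE Ah eh E) : SWGauge Ah eh ↔ ConstrD D E := by
  rw [swGauge_iff hAh heh, constrD_iff_idx hD hE,
    flow_iff hAh.1 hAh.2 heh.1 (fun w hw => heh.2.2 _ _ (smooth_fst hw) (smooth_snd hw))
      (isLocal_RA hD.1) (isLocal_RE hE.1) isLocal_VG ((eqA_iff hAh.1 hD.1).mp hEqA)
      ((eqE_iff hAh.1 heh.1 hE.1).mp hEqE)]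
  exact forall_congr' fun p => forall_congr' fun w => forall_congr' fun hw =>
    pot_cond_iff hD.1 hE.1 hw p

lemma general_solution {Ah : PotFun d N} (hAh : IsPotMap Ah) {eh : ParFun d N}
    (heh : IsParMap eh) : SWGauge Ah eh ↔ ∃ (D : DFun d N) (E : EFun d N), IsExtraD D ∧
      IsExtraE E ∧ EqA Ah D ∧ EqE Ah eh E ∧ ConstrD D E := by
  constructor
  · intro h
    obtain ⟨D, hD, hEqA⟩ := exists_D hAh
    obtain ⟨E, hE, hEqE⟩ := exists_E hAh heh
    exact ⟨D, E, hD, hE, hEqA, hEqE, (gauge_iff_constr hAh heh hD hE hEqA hEqE).mp h⟩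
  · rintro ⟨D, E, hD, hE, hEqA, hEqE, h⟩
    exact (gauge_iff_constr hAh heh hD hE hEqA hEqE).mpr h

end Conditions

lemma pairS_eq_iff {d : ℕ} {V W : Type} {a c : Ser d V} {b e : Ser d W} :
    pairS a b = pairS c e ↔ a = c ∧ b = e := by
  constructor
  · intro h
    exact ⟨congrArg (fun (f : Ser d (V × W)) J x => (f J x).1) h,
      congrArg (fun (f : Ser d (V × W)) J x => (f J x).2) h⟩
  · rintro ⟨rfl, rfl⟩; rfl

/-- The fields without the matter field. -/
notation "fgt(" w ")" => fun y => (Prod.fst (w y), Prod.snd (Prod.snd (w y)))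

section FlowPair

variable {d : ℕ} {E M P : Type} [NormedAddCommGroup E] [NormedSpace ℝ E]
  [NormedAddCommGroup M] [NormedSpace ℝ M] [NormedAddCommGroup P] [NormedSpace ℝ P]

/-- The map that forgets the matter field. -/
def forgetL (E M P : Type) [NormedAddCommGroup E] [NormedSpace ℝ E]
    [NormedAddCommGroup M] [NormedSpace ℝ M] [NormedAddCommGroup P] [NormedSpace ℝ P] :
    (E × (M × P)) →L[ℝ] (E × P) :=
  (fst ℝ _ _).prod
    ((snd ℝ _ _).comp (snd ℝ _ _))

lemma smooth_forget {w : Pt d → E × (M × P)} (hw : Smooth w) :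
    Smooth fgt(w) := (forgetL E M P).contDiff.comp hw

/-- `flow_iff` for a flow of potentials and matter fields. -/
lemma flow_pair_iff {h : Fun d P P} (hh : IsLocal h) (h0 : ∀ q, Smooth q → h 0 q = q)
    {eh : Fun d (E × P) E} (heh : IsLocal eh)
    (eh0 : ∀ w : Pt d → E × P, Smooth w → eh 0 w = fun y => (w y).1)
    {ph : Fun d (M × P) M} (hph : IsLocal ph)
    (ph0 : ∀ w : Pt d → M × P, Smooth w → ph 0 w = fun y => (w y).1)
    {RA : Idx d → Fun d P P} (hRA : ∀ p, IsLocal (RA p))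
    {RE : Idx d → Fun d (E × P) E} (hRE : ∀ p, IsLocal (RE p))
    {R : Idx d → Fun d (M × P) M} (hR : ∀ p, IsLocal (R p))
    {VG : Fun d (E × P) P} (hVG : IsLocal VG) {Vm : Fun d (E × (M × P)) M} (hVm : IsLocal Vm)
    (flowA : ∀ p q, Smooth q → dT p (app h q) = subst (RA p) (app h q))
    (flowE : ∀ p w, Smooth w → dT p (app eh w) = subst (RE p) (app (hatF h eh) w))
    (flow : ∀ p w, Smooth w → dT p (app ph w) = subst (R p) (app (hatF h ph) w)) :
    ((∀ w : Pt d → E × P, Smooth w → app (dFun h) (fun y => ((w y).2, VG 0 w y)) =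
        subst VG (app (hatF h eh) w)) ∧
      ∀ w : Pt d → E × (M × P), Smooth w → app (dFun ph) (fun y => ((w y).2,
        (Vm 0 w y, VG 0 fgt(w) y))) =
      subst Vm (pairS (app eh fgt(w))
        (app (hatF h ph) fun y => (w y).2))) ↔
    (∀ p, ∀ w : Pt d → E × P, Smooth w →
        variation (RA p) (fun y => (w y).2) (app VG w) = dT p (app VG w) +
          variation VG w (pairS (app (RE p) w) (app (RA p) (fun y => (w y).2)))) ∧
      ∀ p, ∀ w : Pt d → E × (M × P), Smooth w → variation (R p) (fun y => (w y).2)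
        (pairS (app Vm w) (app VG fgt(w))) =
      dT p (app Vm w) + variation Vm w (pairS (app (RE p) fgt(w))
        (pairS (app (R p) fun y => (w y).2) (app (RA p) fun y => (w y).2.2))) := by
  let S := snd ℝ M P
  let L := forgetL E M P
  have hh2 : IsLocal (hatF h ph) := hph.pairF (hh.preF S)
  have h02 : ∀ q, Smooth q → hatF h ph 0 q = q := by
    intro q hq
    ext1 y
    exact Prod.ext (congrFun (ph0 _ hq) y) (congrFun (h0 _ (smooth_snd hq)) y)
  let VG2 : Fun d (E × (M × P)) (M × P) := pairF Vm (preF VG L)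
  have hVG2 : IsLocal VG2 := hVm.pairF (hVG.preF L)
  let RQ2 : Idx d → Fun d (M × P) (M × P) := fun p => pairF (R p) (preF (RA p) S)
  have hRQ2 : ∀ p, IsLocal (RQ2 p) := fun p => (hR p).pairF ((hRA p).preF S)
  have main := flow_iff hh2 h02 (heh.preF L) (fun w hw => eh0 _ (smooth_forget hw)) hRQ2
    (fun p => (hRE p).preF L) hVG2
    (fun p q hq => by
      rw [subst_pairF (hR p) ((hRA p).preF S) (hh2.smoothS hq), subst_preF, ← flow p q hq]
      exact congrArg (pairS (dT p (app ph q))) (flowA p _ (smooth_snd hq)))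
    (fun p w hw => by
      rw [subst_preF]
      exact flowE p _ (smooth_forget hw))
  have left : ∀ w, Smooth w → (app (dFun (hatF h ph)) (fun y => ((w y).2, VG2 0 w y)) =
      subst VG2 (app (hatF (hatF h ph) (preF eh L)) w) ↔
      app (dFun ph) (fun y => ((w y).2,
        (Vm 0 w y, VG 0 fgt(w) y))) =
      subst Vm (pairS (app eh fgt(w))
        (app (hatF h ph) fun y => (w y).2)) ∧
      app (dFun h) (fun y => ((w y).2.2, VG 0 fgt(w) y)) =
        subst VG (app (hatF h eh) fgt(w))) := by
    intro w hw
    have hs : SmoothS (app (hatF (hatF h ph) (preF eh L)) w) :=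
      IsLocal.smoothS ((heh.preF L).pairF (hh2.preF _)) hw
    rw [subst_pairF hVm (hVG.preF L) hs, subst_preF, ← pairS_eq_iff]
    have hv : Smooth (fun y => ((w y).2, VG2 0 w y)) :=
      smooth_pair (smooth_snd hw) (Loc.smooth (hVG2 0) hw)
    have e : app (dFun (hatF h ph)) (fun y => ((w y).2, VG2 0 w y)) =
        pairS (app (dFun ph) (fun y => ((w y).2, VG2 0 w y)))
          (app (dFun (preF h S)) (fun y => ((w y).2, VG2 0 w y))) :=
      funext fun J => d1_prod (hph J) (hh.preF S J) hv
    rw [e]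
    rfl
  have right : ∀ p w, Smooth w →
      (variation (RQ2 p) (fun y => (w y).2) (app VG2 w) = dT p (app VG2 w) +
        variation VG2 w (pairS (app (preF (RE p) L) w) (app (RQ2 p) (fun y => (w y).2))) ↔
      variation (R p) (fun y => (w y).2)
        (pairS (app Vm w) (app VG fgt(w))) =
      dT p (app Vm w) + variation Vm w (pairS (app (RE p) fgt(w))
        (pairS (app (R p) fun y => (w y).2) (app (RA p) fun y => (w y).2.2))) ∧
      variation (RA p) (fun y => (w y).2.2) (app VG fgt(w)) =
        dT p (app VG fgt(w)) +
          variation VG fgt(w)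
          (pairS (app (RE p) fgt(w))
            (app (RA p) (fun y => (w y).2.2)))) := by
    intro p w hw
    have hq := smooth_snd hw
    have hd : SmoothS (pairS (app (preF (RE p) L) w) (app (RQ2 p) (fun y => (w y).2))) :=
      smoothS_pairS (((hRE p).preF L).smoothS hw) ((hRQ2 p).smoothS hq)
    rw [variation_pairF (hR p) ((hRA p).preF S) hq (hVG2.smoothS hw),
      variation_pairF hVm (hVG.preF L) hw hd, variation_preF, variation_preF,
      ← pairS_eq_iff]
    rfl
  have main' := ((forall_congr' fun w => forall_congr' fun hw => (left w hw).symm).trans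
    main).trans (forall_congr' fun p => forall_congr' fun w => forall_congr' fun hw =>
      right p w hw)
  have lift : ∀ w : Pt d → E × P, Smooth w →
      Smooth (fun y => ((w y).1, ((0 : M), (w y).2))) := fun w hw =>
    smooth_pair (smooth_fst hw) (smooth_pair contDiff_const (smooth_snd hw))
  constructor
  · rintro ⟨h1, h2⟩
    have h3 := main'.mp fun w hw => ⟨h2 w hw, h1 _ (smooth_forget hw)⟩
    exact ⟨fun p w hw => (h3 p _ (lift w hw)).2, fun p w hw => (h3 p w hw).1⟩
  · rintro ⟨h1, h2⟩
    have h3 := main'.mpr fun p w hw => ⟨h2 p w hw, h1 p _ (smooth_forget hw)⟩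
    exact ⟨fun w hw => (h3 _ (lift w hw)).2, fun w hw => (h3 w hw).1⟩

end FlowPair

section Matter

variable {d N m : ℕ}

lemma matter_flow_iff {Ah : PotFun d N} (hAh : IsPotMap Ah) {eh : ParFun d N}
    (heh : IsParMap eh) {ph : MatFun d N m} (hph : IsMatMap ph)
    {D : DFun d N} (hD : IsExtraD D) {E : EFun d N} (hE : IsExtraE E)
    (hEqA : EqA Ah D) (hEqE : EqE Ah eh E)
    {R : Idx d → Fun d (Mat N m × Pot d N) (Mat N m)} (hR : ∀ p, IsLocal (R p))
    (hflow : ∀ p w, Smooth w → dT p (app ph w) = subst (R p) (app (hatF Ah ph) w))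
    {Vm : Fun d (Mat N N × (Mat N m × Pot d N)) (Mat N m)} (hVm : IsLocal Vm) :
    (SWGauge Ah eh ∧ ∀ w : Pt d → Mat N N × (Mat N m × Pot d N), Smooth w →
      app (dFun ph) (fun y => ((w y).2,
        (Vm 0 w y, VG d N 0 fgt(w) y))) =
      subst Vm (pairS (app eh fgt(w))
        (app (hatF Ah ph) fun y => (w y).2))) ↔
    (ConstrD D E ∧ ∀ p w, Smooth w → variation (R p) (fun y => (w y).2)
        (pairS (app Vm w) (app (VG d N) fgt(w))) =
      dT p (app Vm w) + variation Vm w (pairS (app (RE E p) fgt(w))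
        (pairS (app (R p) fun y => (w y).2) (app (RA D p) fun y => (w y).2.2)))) := by
  rw [swGauge_iff hAh heh, constrD_iff_idx hD hE]
  refine (flow_pair_iff hAh.1 hAh.2 heh.1
    (fun w hw => heh.2.2 _ _ (smooth_fst hw) (smooth_snd hw)) hph.1
    (fun w hw => hph.2.2 _ _ (smooth_fst hw) (smooth_snd hw)) (isLocal_RA hD.1) (isLocal_RE hE.1)
    hR isLocal_VG hVm ((eqA_iff hAh.1 hD.1).mp hEqA) ((eqE_iff hAh.1 heh.1 hE.1).mp hEqE)
    hflow).trans (and_congr_left' ?_)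
  exact forall_congr' fun p => forall_congr' fun w => forall_congr' fun hw =>
    pot_cond_iff hD.1 hE.1 hw p

end Matter

section MatterConditions

variable {d N m : ℕ}

lemma antisymm_app {C : CFun d N m} (hC : Antisymm2 C) {q : Pt d → Mat N m × Pot d N}
    (hq : Smooth q) (μ ν : Fin d) : cpt2 (app C q) μ ν = (-1 : ℂ) • cpt2 (app C q) ν μ := by
  ext1 J
  ext1 x
  exact (hC _ _ (smooth_fst hq) (smooth_snd hq) J x μ ν).trans (neg_one_smul ℂ (C J q x ν μ)).symm

lemma antisymm_variation {C : CFun d N m} (hCl : IsLocal C) (hC : Antisymm2 C)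
    {q : Pt d → Mat N m × Pot d N} (hq : Smooth q) {v : Ser d (Mat N m × Pot d N)}
    (hv : SmoothS v) (μ ν : Fin d) :
    cpt2 (variation C q v) μ ν = (-1 : ℂ) • cpt2 (variation C q v) ν μ := by
  rw [← variation_c2 hCl hq hv, ← variation_c2 hCl hq hv,
    ← variation_smul (hCl.c2 ν μ) (-1 : ℂ) hq hv]
  exact variation_congr (F := c2 C μ ν) (G := (-1 : ℂ) • c2 C ν μ)
    (fun q hq => antisymm_app hC hq μ ν) ((hCl.c2 ν μ).smul _) hq hv

/-- The gauge parameter, for functionals of parameter, matter field and potential. -/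
def e3 (d N m : ℕ) : Fun d (Mat N N × (Mat N m × Pot d N)) (Mat N N) :=
  linF (fst ℝ (Mat N N) (Mat N m × Pot d N))

/-- The matter field, for functionals of parameter, matter field and potential. -/
def f3 (d N m : ℕ) : Fun d (Mat N N × (Mat N m × Pot d N)) (Mat N m) :=
  linF ((fst ℝ (Mat N m) (Pot d N)).comp
    (snd ℝ (Mat N N) (Mat N m × Pot d N)))

lemma hasSub_e3 {e : Ser d (Mat N N)} {f : Ser d (Mat N m × Pot d N)} (he : SmoothS e)
    (hf : SmoothS f) : HasSub (e3 d N m) (pairS e f) ⟨e, he⟩ :=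
  HasSub.lin _ (smoothS_pairS he hf) rfl

lemma hasSub_f3 {e : Ser d (Mat N N)} {f : Ser d (Mat N m)} {a : Ser d (Pot d N)}
    (he : SmoothS e) (hf : SmoothS f) (ha : SmoothS a) :
    HasSub (f3 d N m) (pairS e (pairS f a)) ⟨f, hf⟩ :=
  HasSub.lin _ (smoothS_pairS he (smoothS_pairS hf ha)) rfl

lemma hasVar_e3 {w : Pt d → Mat N N × (Mat N m × Pot d N)} (hw : Smooth w)
    {e : Ser d (Mat N N)} {f : Ser d (Mat N m × Pot d N)} (he : SmoothS e)
    (hf : SmoothS f) : HasVar (e3 d N m) w (pairS e f) (constS (smooth_fst hw)) ⟨e, he⟩ :=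
  HasVar.lin _ hw (smoothS_pairS he hf) rfl rfl

lemma hasVar_f3 {w : Pt d → Mat N N × (Mat N m × Pot d N)} (hw : Smooth w)
    {e : Ser d (Mat N N)} {f : Ser d (Mat N m)} {a : Ser d (Pot d N)}
    (he : SmoothS e) (hf : SmoothS f) (ha : SmoothS a) :
    HasVar (f3 d N m) w (pairS e (pairS f a)) (constS (smooth_fst (smooth_snd hw))) ⟨f, hf⟩ :=
  HasVar.lin _ hw (smoothS_pairS he (smoothS_pairS hf ha)) rfl rfl

/-- A representation of the gauge parameters on the matter fields, with the functionals that enter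
the differential equation of the matter field. -/
structure Rep (d N m : ℕ) where
  act : SS d N N → SS d N m → SS d N m
  neg_act : ∀ e f, act ((-1 : ℂ) • e) f = (-1 : ℂ) • act e f
  act_neg : ∀ e f, act e ((-1 : ℂ) • f) = (-1 : ℂ) • act e f
  act0 : Mat N N → Mat N m → Mat N m
  act_zero : ∀ {ε : Pt d → Mat N N} {φ : Pt d → Mat N m} (hε : Smooth ε) (hφ : Smooth φ),
    (act (constS hε) (constS hφ)).1 0 = fun y => act0 (ε y) (φ y)
  V : Fun d (Mat N N × (Mat N m × Pot d N)) (Mat N m)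
  hasSub_V : ∀ {e f a} (he : SmoothS e) (hf : SmoothS f), SmoothS a →
    HasSub V (pairS e (pairS f a)) (act ⟨e, he⟩ ⟨f, hf⟩)
  hasVar_V : ∀ {w} (hw : Smooth w) {e f a} (he : SmoothS e) (hf : SmoothS f), SmoothS a →
    HasVar V w (pairS e (pairS f a)) (act (constS (smooth_fst hw)) (constS (smooth_fst (smooth_snd hw))))
      (act ⟨e, he⟩ (constS (smooth_fst (smooth_snd hw))) + act (constS (smooth_fst hw)) ⟨f, hf⟩)
  Q : Fin d → Fin d → Fun d (Mat N m × Pot d N) (Mat N m)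
  q : SS d N m → (Fin d → SS d N N) → Fin d → Fin d → SS d N m
  dq : (Fin d → SS d N N) → (Fin d → SS d N N) → SS d N m → SS d N m → Fin d → Fin d → SS d N m
  q_add : ∀ e₁ e₂ (z : ℂ) a μ ν, q (e₁ + z • e₂) a μ ν = q e₁ a μ ν + z • q e₂ a μ ν
  hasSub_Q : ∀ e a (he : SmoothS e) (ha : SmoothS a) μ ν,
    HasSub (Q μ ν) (pairS e a) (q ⟨e, he⟩ (cptS ha) μ ν)
  hasVar_Q : ∀ {w} (hw : Smooth w) {e a} (he : SmoothS e) (ha : SmoothS a) μ ν,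
    HasVar (Q μ ν) w (pairS e a) (q (constS (smooth_fst hw)) (potS (smooth_snd hw)) μ ν)
      (dq (potS (smooth_snd hw)) (cptS ha) (constS (smooth_fst hw)) ⟨e, he⟩ μ ν)
  identity : ∀ (p : Idx d) (A : Fin d → SS d N N) (e : SS d N N) (f : SS d N m),
    dTS p e = 0 → dTS p f = 0 → ∀ (C₁ C₂ C₁' C₂' : SS d N m) (E₁ E₂ RE : SS d N N)
    (RC : SS d N m) (c : ℂ), c = -(Real.pi / 2 : ℂ) →
    RC = c • (q f A p.1.1 p.1.2 - q f A p.1.2 p.1.1 + (C₁ - C₂)) →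
    RE = (-c) • (QES A e p.1.1 p.1.2 - QES A e p.1.2 p.1.1 + (E₁ - E₂)) →
    c • (dq A (gaugeS A e) f (act e f) p.1.1 p.1.2 - dq A (gaugeS A e) f (act e f) p.1.2 p.1.1 +
      (C₁' - C₂')) - (dTS p (act e f) + (act RE f + act e RC)) =
    c • ((C₁' - act e C₁ + act E₁ f) - (C₂' - act e C₂ + act E₂ f))

namespace Rep

variable (M : Rep d N m)

lemma isLocal_V : IsLocal M.V := (M.hasSub_V smoothS_zero smoothS_zero smoothS_zero).loc

/-- Right-hand side of the equation for the matter field. -/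
def R (C : CFun d N m) (p : Idx d) : Fun d (Mat N m × Pot d N) (Mat N m) := rhs (cst : ℂ) M.Q C p

lemma isLocal_R {C : CFun d N m} (hC : IsLocal C) (p : Idx d) : IsLocal (M.R C p) :=
  hC.rhs (fun μ ν => (M.hasSub_Q 0 0 smoothS_zero smoothS_zero μ ν).loc) _ p

lemma app_V {w : Pt d → Mat N N × (Mat N m × Pot d N)} (hw : Smooth w) :
    app M.V w = (M.act (constS (smooth_fst hw)) (constS (smooth_fst (smooth_snd hw)))).1 :=
  (M.hasVar_V hw smoothS_zero smoothS_zero smoothS_zero).val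

lemma gauge_eq {w : Pt d → Mat N N × (Mat N m × Pot d N)} (hw : Smooth w) :
    pairS (M.act (constS (smooth_fst hw)) (constS (smooth_fst (smooth_snd hw)))).1
      (gaugeA (pot fun y => (w y).2.2) (const fun y => (w y).1)) =
    pairS (app M.V w) (app (VG d N) fgt(w)) := by
  rw [app_V M hw, ← gaugeA_eq (smooth_forget hw)]

lemma smoothS_gauge {w : Pt d → Mat N N × (Mat N m × Pot d N)} (hw : Smooth w) :
    SmoothS (pairS (app M.V w) (app (VG d N) fgt(w))) :=
  smoothS_pairS (M.isLocal_V.smoothS hw) (smoothS_VG (smooth_forget hw))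

/-- Violation of the constraint between `C` and `E`. -/
def Z {C : CFun d N m} (hC : IsLocal C) {E : EFun d N} (hE : IsLocal E)
    {w : Pt d → Mat N N × (Mat N m × Pot d N)} (hw : Smooth w) (μ ν : Fin d) : SS d N m :=
  cpt2S (smoothS_variation hC (smooth_snd hw) (M.smoothS_gauge hw)) μ ν -
    M.act (constS (smooth_fst hw)) (cpt2S (hC.smoothS (smooth_snd hw)) μ ν) +
    M.act (cpt2S (hE.smoothS (smooth_forget hw)) μ ν) (constS (smooth_fst (smooth_snd hw)))

lemma cond_iff {C : CFun d N m} (hC : IsLocal C) {D : DFun d N} (hD : IsLocal D)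
    {E : EFun d N} (hE : IsLocal E) {w : Pt d → Mat N N × (Mat N m × Pot d N)} (hw : Smooth w)
    (p : Idx d) :
    variation (M.R C p) (fun y => (w y).2)
        (pairS (app M.V w) (app (VG d N) fgt(w))) =
      dT p (app M.V w) + variation M.V w
        (pairS (app (RE E p) fgt(w))
          (pairS (app (M.R C p) fun y => (w y).2) (app (RA D p) fun y => (w y).2.2))) ↔
      M.Z hC hE hw p.1.1 p.1.2 = M.Z hC hE hw p.1.2 p.1.1 := by
  have hf := smooth_forget hw
  have hq := smooth_snd hw
  have hVm : SmoothS (app M.V w) := M.isLocal_V.smoothS hw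
  have hR := (M.isLocal_R hC p).smoothS hq
  have e1 := HasVar.rhs hC hq (M.smoothS_gauge hw) (M.hasVar_Q hq hVm (smoothS_VG hf)) cst p
  have e2 := (M.hasVar_V hw ((isLocal_RE hE p).smoothS hf) hR
    ((isLocal_RA hD p).smoothS (smooth_snd hq))).var
  have e3 : (⟨app (M.R C p) fun y => (w y).2, hR⟩ : SS d N m) = _ := Subtype.ext e1.val
  have e4 : (⟨app M.V w, hVm⟩ : SS d N m) = _ := Subtype.ext (M.app_V hw)
  have e5 : dT p (app M.V w) = (dTS p (M.act (constS (smooth_fst hw)) (constS (smooth_fst hq)))).1 := by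
    rw [M.app_V hw]
    rfl
  have e6 := e1.var
  rw [cptS_VG hf, e4] at e6
  rw [app_RE hE hf, e3] at e2
  have hv := smoothS_variation hC hq (M.smoothS_gauge hw)
  have id := M.identity p (potS (smooth_snd hq)) (constS (smooth_fst hw)) (constS (smooth_fst hq))
    (dTS_constS _ p) (dTS_constS _ p) (cpt2S (hC.smoothS hq) p.1.1 p.1.2)
    (cpt2S (hC.smoothS hq) p.1.2 p.1.1) (cpt2S hv p.1.1 p.1.2)
    (cpt2S hv p.1.2 p.1.1) (cpt2S (hE.smoothS hf) p.1.1 p.1.2)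
    (cpt2S (hE.smoothS hf) p.1.2 p.1.1) (RES hE hf p) _ cst cst_eq rfl rfl
  have e7 : variation (M.R C p) (fun y => (w y).2)
      (pairS (app M.V w) (app (VG d N) fgt(w))) = _ := e6
  rw [e7, e2, e5]
  refine Iff.trans ?_ (eq_iff_of_sub cst_ne_zero' id)
  rw [← Subtype.coe_inj]
  rfl

lemma Z_antisymm {C : CFun d N m} (hC : IsExtraC C) {E : EFun d N} (hE : IsExtraE E)
    {w : Pt d → Mat N N × (Mat N m × Pot d N)} (hw : Smooth w) (μ ν : Fin d) :
    M.Z hC.1 hE.1 hw μ ν = -M.Z hC.1 hE.1 hw ν μ := by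
  have hf := smooth_forget hw
  have hq := smooth_snd hw
  have hv := smoothS_variation hC.1 hq (M.smoothS_gauge hw)
  have e1 : cpt2S hv μ ν = (-1 : ℂ) • cpt2S hv ν μ :=
    Subtype.ext (antisymm_variation hC.1 hC.2.2 hq (M.smoothS_gauge hw) μ ν)
  have e2 : cpt2S (hC.1.smoothS hq) μ ν = (-1 : ℂ) • cpt2S (hC.1.smoothS hq) ν μ :=
    Subtype.ext (antisymm_app hC.2.2 hq μ ν)
  have e3 : cpt2S (hE.1.smoothS hf) μ ν = (-1 : ℂ) • cpt2S (hE.1.smoothS hf) ν μ :=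
    Subtype.ext (antisymm_app hE.2.2 hf μ ν)
  unfold Z
  rw [e1, e2, e3, M.neg_act, M.act_neg]
  module

lemma general_solution {Ah : PotFun d N} (hAh : IsPotMap Ah) {eh : ParFun d N}
    (heh : IsParMap eh) {ph : MatFun d N m} (hph : IsMatMap ph) {S : Prop}
    (hS : S ↔ ∀ w (hw : Smooth w), variation ph (fun y => (w y).2)
        (const fun y => (M.act0 (w y).1 (w y).2.1, cgaugeA (fun y => (w y).2.2) (fun y => (w y).1) y)) =
      (M.act ⟨app eh fgt(w), heh.1.smoothS (smooth_forget hw)⟩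
        ⟨app ph fun y => (w y).2, hph.1.smoothS (smooth_snd hw)⟩).1)
    {EqC : CFun d N m → Prop} (hEq : ∀ C, IsLocal C → (EqC C ↔
      ∀ p w, Smooth w → dT p (app ph w) = subst (M.R C p) (app (hatF Ah ph) w)))
    {Constr : EFun d N → CFun d N m → Prop} (hConstr : ∀ E (hE : IsLocal E) C (hC : IsLocal C),
      (Constr E C ↔ ∀ w (hw : Smooth w) μ ν, M.Z hC hE hw μ ν = 0)) :
    SWGauge Ah eh ∧ S ↔ ∃ (D : DFun d N) (E : EFun d N) (C : CFun d N m), IsExtraD D ∧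
      IsExtraE E ∧ IsExtraC C ∧ EqA Ah D ∧ EqE Ah eh E ∧ EqC C ∧ ConstrD D E ∧ Constr E C := by
  have sw : S ↔ ∀ w, Smooth w → app (dFun ph) (fun y => ((w y).2,
        (M.V 0 w y, VG d N 0 fgt(w) y))) =
      subst M.V (pairS (app eh fgt(w))
        (app (hatF Ah ph) fun y => (w y).2)) := by
    refine hS.trans (forall_congr' fun w => forall_congr' fun hw => ?_)
    have hq := smooth_snd hw
    have e1 : M.V 0 w = fun y => M.act0 (w y).1 (w y).2.1 :=
      (congrFun (M.app_V hw) 0).trans (M.act_zero _ _)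
    have e2 : app (hatF Ah ph) (fun y => (w y).2) =
      pairS (app ph fun y => (w y).2) (app Ah fun y => (w y).2.2) := rfl
    rw [variation_const, VG_zero (smooth_forget hw), e1, e2,
      (M.hasSub_V (heh.1.smoothS (smooth_forget hw)) (hph.1.smoothS hq)
        (hAh.1.smoothS (smooth_snd hq))).val]
  have key : ∀ {D : DFun d N} {E : EFun d N} {C : CFun d N m}, IsExtraD D → IsExtraE E →
      IsExtraC C → EqA Ah D → EqE Ah eh E → EqC C →
      (SWGauge Ah eh ∧ S ↔ ConstrD D E ∧ Constr E C) := by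
    intro D E C hD hE hC hEqA hEqE hEqC
    rw [sw, matter_flow_iff hAh heh hph hD hE hEqA hEqE (fun p => M.isLocal_R hC.1 p)
      ((hEq C hC.1).mp hEqC) M.isLocal_V, hConstr E hE.1 C hC.1]
    refine and_congr_right' ⟨fun h w hw μ ν => ?_, fun h p w hw => ?_⟩
    · exact Subtype.ext (eq_zero_of_antisymm (Z := fun μ ν => (M.Z hC.1 hE.1 hw μ ν).1)
        (fun μ ν => congrArg Subtype.val (M.Z_antisymm hC hE hw μ ν)) (fun p => sub_eq_zero.mpr
          (congrArg Subtype.val ((M.cond_iff hC.1 hD.1 hE.1 hw p).mp (h p w hw)))) μ ν)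
    · rw [M.cond_iff hC.1 hD.1 hE.1 hw p, h w hw, h w hw]
  constructor
  · intro h
    obtain ⟨D, hD, hEqA⟩ := exists_D hAh
    obtain ⟨E, hE, hEqE⟩ := exists_E hAh heh
    obtain ⟨C, h1, h2, h3, h4⟩ := exists_C hAh hph.1 hph.2.1 hph.2.2 (fun r : ℂ => r)
      (fun r M => rfl) M.hasSub_Q M.q_add cst_ne_zero
    have hEqC := (hEq C h1).mpr h4
    have := (key hD hE ⟨h1, h2, h3⟩ hEqA hEqE hEqC).mp h
    exact ⟨D, E, C, hD, hE, ⟨h1, h2, h3⟩, hEqA, hEqE, hEqC, this.1, this.2⟩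
  · rintro ⟨D, E, C, hD, hE, hC, hEqA, hEqE, hEqC, h1, h2⟩
    exact (key hD hE hC hEqA hEqE hEqC).mpr ⟨h1, h2⟩

end Rep

/-- The fundamental representation. -/
def repF (d N : ℕ) : Rep d N 1 where
  act e f := I • (e ⋆ f)
  neg_act e f := by rw [smul_mulS, smul_comm]
  act_neg e f := by rw [mulS_smul, smul_comm]
  act0 M v := I • (M * v)
  act_zero hε hφ := by
    ext1 y
    simp only [SetLike.val_smul, coe_mulS, constS, Pi.smul_apply, star_apply_zero, const_apply_zero]
  V := I • starF (e3 d N 1) (f3 d N 1)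
  hasSub_V he hf ha := ((hasSub_e3 he (smoothS_pairS hf ha)).star (hasSub_f3 he hf ha)).smul _
  hasVar_V hw _ _ _ he hf ha := by
    rw [← smul_add]
    exact ((hasVar_e3 hw he (smoothS_pairS hf ha)).star (hasVar_f3 hw he hf ha)).smul _
  Q := QFF (aM d N 1) (fM d N 1)
  q f A := QFS A f
  dq := dQFS
  q_add _ _ _ _ _ _ := by
    simp only [QFS, map_add, map_smul, mulS_add, mulS_smul, mulS_sub]
    module
  hasSub_Q _ _ he ha := HasSub.QFF (hasSub_aM he ha) (hasSub_fM he ha)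
  hasVar_Q hw _ _ he ha := HasVar.QFF (hasVar_aM hw he ha) (hasVar_fM hw he ha)
  identity p A e f he hf C₁ C₂ C₁' C₂' E₁ E₂ RE RC c hc hRC hRE := by
    subst hRC hRE hc
    simp only [dQFS, QFS, QES, gaugeS, map_add, map_sub, map_smul, dTS_mulS, pdSS_mulS,
      add_mulS, mulS_add, sub_mulS, mulS_sub, smul_mulS, mulS_smul, mulS_assoc, hf, he, zero_mulS,
      mulS_zero, ← pdSS_dTS, map_zero]
    match_scalars <;> ring_nf <;> simp only [Complex.I_sq] <;> ring_nf

/-- The adjoint representation. -/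
def repAd (d N : ℕ) : Rep d N N where
  act e f := I • (e ⋆ f) - I • (f ⋆ e)
  neg_act e f := by
    simp only [smul_mulS, mulS_smul]
    module
  act_neg e f := by
    simp only [smul_mulS, mulS_smul]
    module
  act0 M v := I • (M * v) - I • (v * M)
  act_zero hε hφ := by
    ext1 y
    simp only [Submodule.coe_sub, SetLike.val_smul, coe_mulS, constS, Pi.smul_apply, Pi.sub_apply,
      star_apply_zero, const_apply_zero]
  V := I • starF (e3 d N N) (f3 d N N) - I • starF (f3 d N N) (e3 d N N)
  hasSub_V he hf ha := (((hasSub_e3 he (smoothS_pairS hf ha)).star (hasSub_f3 he hf ha)).smul _).sub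
    (((hasSub_f3 he hf ha).star (hasSub_e3 he (smoothS_pairS hf ha))).smul _)
  hasVar_V hw _ _ _ he hf ha := by
    convert (((hasVar_e3 hw he (smoothS_pairS hf ha)).star (hasVar_f3 hw he hf ha)).smul
      I).sub (((hasVar_f3 hw he hf ha).star
        (hasVar_e3 hw he (smoothS_pairS hf ha))).smul I) using 1
    module
  Q := QAdF (aM d N N) (fM d N N)
  q f A := QAdS A f
  dq := dQAdS
  q_add _ _ _ _ _ _ := by
    simp only [QAdS, covAdS, map_add, map_smul, add_mulS, mulS_add, smul_mulS, mulS_smul, sub_mulS,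
      mulS_sub]
    module
  hasSub_Q _ _ he ha := HasSub.QAdF (hasSub_aM he ha) (hasSub_fM he ha)
  hasVar_Q hw _ _ he ha := HasVar.QAdF (hasVar_aM hw he ha) (hasVar_fM hw he ha)
  identity p A e f he hf C₁ C₂ C₁' C₂' E₁ E₂ RE RC c hc hRC hRE := by
    subst hRC hRE hc
    simp only [dQAdS, QAdS, dcovAdS, covAdS, QES, gaugeS, map_add, map_sub, map_smul, dTS_mulS,
      pdSS_mulS, add_mulS, mulS_add, sub_mulS, mulS_sub, smul_mulS, mulS_smul, mulS_assoc, hf, he,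
      zero_mulS, mulS_zero, ← pdSS_dTS, map_zero]
    match_scalars <;> ring_nf <;> simp only [Complex.I_sq] <;> ring_nf

lemma forall_fields {P : (Pt d → Mat N N) → (Pt d → Mat N m) → (Pt d → Pot d N) → Prop} :
    (∀ A ε φ, Smooth A → Smooth ε → Smooth φ → P ε φ A) ↔
      ∀ w : Pt d → Mat N N × (Mat N m × Pot d N), Smooth w →
        P (fun y => (w y).1) (fun y => (w y).2.1) (fun y => (w y).2.2) :=
  ⟨fun h w hw => h _ _ _ (smooth_snd (smooth_snd hw)) (smooth_fst hw) (smooth_fst (smooth_snd hw)),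
    fun h A ε φ hA hε hφ => h _ (smooth_pair hε (smooth_pair hφ hA))⟩

lemma general_solution_F {Ah : PotFun d N} (hAh : IsPotMap Ah) {eh : ParFun d N}
    (heh : IsParMap eh) {ph : MatFun d N 1} (hph : IsMatMap ph) :
    SWGauge Ah eh ∧ SWFund eh ph ↔ ∃ (D : DFun d N) (E : EFun d N) (C : CFun d N 1), IsExtraD D ∧
      IsExtraE E ∧ IsExtraC C ∧ EqA Ah D ∧ EqE Ah eh E ∧ EqF Ah ph C ∧ ConstrD D E ∧
      ConstrF E C := by
  refine (repF d N).general_solution hAh heh hph forall_fields (fun C hC => ?_)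
    fun E hE C hC => forall_fields.trans (forall_congr' fun w => forall_congr' fun hw =>
      forall_congr' fun μ => forall_congr' fun ν => ?_)
  · unfold Rep.R
    rw [← matter_eq_iff hAh.1 hph.1 (repF d N).hasSub_Q hC cst]
    rfl
  · unfold dPrimeF
    have h := (repF d N).gauge_eq hw
    change pairS (gaugeF (const fun y => (w y).1) (const fun y => (w y).2.1)) _ = _ at h
    rw [eq_neg_iff_add_eq_zero, h, ← Subtype.coe_inj]
    rfl

lemma general_solution_Ad {Ah : PotFun d N} (hAh : IsPotMap Ah) {eh : ParFun d N}
    (heh : IsParMap eh) {ph : MatFun d N N} (hph : IsMatMap ph) :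
    SWGauge Ah eh ∧ SWAdj eh ph ↔ ∃ (D : DFun d N) (E : EFun d N) (C : CFun d N N), IsExtraD D ∧
      IsExtraE E ∧ IsExtraC C ∧ EqA Ah D ∧ EqE Ah eh E ∧ EqAd Ah ph C ∧ ConstrD D E ∧
      ConstrAd E C := by
  refine (repAd d N).general_solution hAh heh hph forall_fields (fun C hC => ?_)
    fun E hE C hC => forall_fields.trans (forall_congr' fun w => forall_congr' fun hw =>
      forall_congr' fun μ => forall_congr' fun ν => ?_)
  · unfold Rep.R
    rw [← matter_eq_iff hAh.1 hph.1 (repAd d N).hasSub_Q hC cst]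
    rfl
  · unfold dPrimeAd comm
    have h := (repAd d N).gauge_eq hw
    change pairS (gaugeAd (const fun y => (w y).1) (const fun y => (w y).2.1)) _ = _ at h
    rw [eq_neg_iff_add_eq_zero, h, ← Subtype.coe_inj,
      smul_sub, smul_sub]
    rfl

end MatterConditions

section StarUnit

variable {d a b : ℕ}

lemma smooth_one {N : ℕ} : Smooth (fun _ : Pt d => (1 : Mat N N)) := contDiff_const

/-- The unit. -/
def oneS (d N : ℕ) : SS d N N := constS smooth_one

/-- Real square matrices. -/
abbrev SqM (d : ℕ) := Matrix (Fin d) (Fin d) ℝ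

lemma smooth_fun_const (v : V) :
    Smooth (fun _ : Pt d => v) := contDiff_const

lemma pdSS_constS (i : Fin d) (M : Mat a b) : pdSS i (constS (smooth_fun_const M)) = 0 := by
  refine Subtype.ext (funext fun J => ?_)
  have : (constS (smooth_fun_const (d := d) M)).1 J = fun _ => if J = 0 then M else 0 := by
    ext1 x
    by_cases h : J = 0 <;> simp [constS, const, h]
  change pd i ((constS (smooth_fun_const M)).1 J) = 0
  rw [this]
  exact pd_const _ i

lemma mulS_const_apply {c : ℕ} (M : Mat b c) (J : Mon d) : ∀ f : SS d a b,
    (f ⋆ constS (smooth_fun_const M)).1 J = fun x => f.1 J x * M := by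
  induction J using monomial_induction with
  | h0 =>
    intro f
    rw [coe_mulS, star_apply_zero]
    ext1 x
    simp [constS, const]
  | hs K p ih =>
    intro f
    have h1 := congrFun (congrArg Subtype.val (dTS_mulS p f (constS (smooth_fun_const M)))) K
    simp only [dTS_constS, pdSS_constS, mulS_zero, add_zero, sub_zero, smul_zero] at h1
    rw [ih] at h1
    have h3 : ((K p : ℝ) + 1) ≠ 0 := by positivity
    refine smul_right_injective _ h3 (h1.trans (funext fun x => ?_))
    exact Matrix.smul_mul ((K p : ℝ) + 1) (f.1 (K + single p 1) x) M

lemma mulS_one (f : SS d a b) : f ⋆ oneS d b = f :=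
  Subtype.ext (funext fun J => (mulS_const_apply 1 J f).trans
    (funext fun x => Matrix.mul_one (f.1 J x)))

lemma pdSS_oneS {N : ℕ} (i : Fin d) : pdSS i (oneS d N) = 0 := pdSS_constS i 1

lemma one_mulS_apply (J : Mon d) : ∀ f : SS d a b, (oneS d a ⋆ f).1 J = f.1 J := by
  induction J using monomial_induction with
  | h0 =>
    intro f
    rw [coe_mulS, star_apply_zero]
    ext1 x
    simp [oneS, constS, const]
  | hs K p ih =>
    intro f
    have h1 := congrFun (congrArg Subtype.val (dTS_mulS p (oneS d a) f)) K
    have h2 : dTS p (oneS d a) = 0 := dTS_constS _ p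
    simp only [h2, pdSS_oneS, zero_mulS, zero_add, sub_zero, smul_zero, add_zero] at h1
    rw [ih] at h1
    have h3 : ((K p : ℝ) + 1) ≠ 0 := by positivity
    exact smul_right_injective _ h3 h1

lemma one_mulS (f : SS d a b) : oneS d a ⋆ f = f :=
  Subtype.ext (funext fun J => one_mulS_apply J f)

end StarUnit

/-! ### Star polynomials as combinations of monomials -/

section Words

variable {d N m : ℕ} {L : Type}

/-- A linear change of coordinates, letters `A_μ` and further letters. -/
structure Cfg (d N : ℕ) (L : Type) where
  g : SqM d
  a : Fin d → SS d N N
  l : L → SS d N N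

/-- The transformed derivatives. -/
def del {a b : ℕ} (g : SqM d) (μ : Fin d) : SS d a b →ₗ[ℂ] SS d a b :=
  ∑ μ', (g μ μ' : ℂ) • pdSS μ'

lemma del_mulS {a b c : ℕ} (g : SqM d) (μ : Fin d) (f : SS d a b)
    (h : SS d b c) : del g μ (f ⋆ h) = del g μ f ⋆ h + f ⋆ del g μ h := by
  simp only [del, LinearMap.sum_apply, LinearMap.smul_apply, pdSS_mulS, smul_add,
    sum_add_distrib, sum_mulS, mulS_sum, smul_mulS, mulS_smul]

lemma del_oneS (g : SqM d) (μ : Fin d) : del g μ (oneS d N) = 0 := by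
  simp [del, pdSS_oneS]

lemma del_smul {a b : ℕ} (t : ℝ) (g : SqM d) (μ : Fin d) (f : SS d a b) :
    del (t • g) μ f = (t : ℂ) • del g μ f := by
  simp [del, smul_sum, mul_smul]

/-- Iterated transformed derivatives. -/
def delL {a b : ℕ} (g : SqM d) (I : List (Fin d)) (f : SS d a b) : SS d a b :=
  I.foldr (fun μ f => del g μ f) f

lemma delL_smul {a b : ℕ} (t : ℝ) (c : ℂ) (g : SqM d) (I : List (Fin d))
    (f : SS d a b) : delL (t • g) I (c • f) = ((t : ℂ) ^ I.length * c) • delL g I f := by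
  induction I with
  | nil => simp [delL]
  | cons μ I ih =>
    simp only [delL, List.foldr_cons, List.length_cons] at ih ⊢
    rw [ih, del_smul, map_smul, smul_smul]
    congr 1
    ring

/-- Value of a star polynomial. -/
def wordS (x : Cfg d N L) : Word d L → SS d N N
  | .A μ => x.a μ
  | .letter l => x.l l
  | .one => oneS d N
  | .add w v => wordS x w + wordS x v
  | .smul c w => c • wordS x w
  | .mul w v => wordS x w ⋆ wordS x v
  | .D μ w => del x.g μ (wordS x w) - I • (x.a μ ⋆ wordS x w) +
      I • (wordS x w ⋆ x.a μ)

/-- Value of a star polynomial in the fundamental representation. -/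
def fwordS (x : Cfg d N Empty) (f : SS d N 1) : FWord d → SS d N 1
  | .phi => f
  | .add w v => fwordS x f w + fwordS x f v
  | .smul c w => c • fwordS x f w
  | .mul v w => wordS x v ⋆ fwordS x f w
  | .D μ w => del x.g μ (fwordS x f w) - I • (x.a μ ⋆ fwordS x f w)

/-- The transformed letters `A_μ`. -/
def trS (g : SqM d) (A : Fin d → SS d N N) (μ : Fin d) : SS d N N :=
  ∑ μ', (g μ μ' : ℂ) • A μ'

lemma coe_sum {I : Type} {a b : ℕ} (s : Finset I) (f : I → SS d a b) :
    (∑ i ∈ s, f i).1 = ∑ i ∈ s, (f i).1 := map_sum (SS d a b).subtype f s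

lemma tr_eq (g : GL (Fin d) ℝ) {a b : ℕ} (f : Fin d → SS d a b) (μ : Fin d) :
    tr g (fun μ => (f μ).1) μ = (∑ μ', ((g.1 μ μ' : ℝ) : ℂ) • f μ').1 := by
  rw [coe_sum]
  refine sum_congr rfl fun μ' _ => ?_
  exact (coe_smul_ser _ _).symm

lemma tr_covA (g : GL (Fin d) ℝ) (A : Fin d → SS d N N) (μ : Fin d) (f : SS d N N) :
    tr g (covA fun μ => (A μ).1) μ f.1 = (del g.1 μ f - I • (trS g.1 A μ ⋆ f) +
      I • (f ⋆ trS g.1 A μ)).1 := by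
  have h1 : tr g (covA fun μ => (A μ).1) μ f.1 =
      tr g (fun μ => (pdSS μ f - I • (A μ ⋆ f) + I • (f ⋆ A μ)).1) μ := by
    simp only [tr, Finset.sum_apply, Pi.smul_apply]
    rfl
  rw [h1, tr_eq, Subtype.coe_inj]
  simp only [del, trS, LinearMap.sum_apply, LinearMap.smul_apply, sum_mulS, mulS_sum, smul_mulS,
    mulS_smul, smul_add, smul_sub, sum_add_distrib, sum_sub_distrib, smul_sum,
    smul_comm I]

lemma tr_covF (g : GL (Fin d) ℝ) (A : Fin d → SS d N N) (μ : Fin d) (f : SS d N 1) :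
    tr g (covF fun μ => (A μ).1) μ f.1 = (del g.1 μ f - I • (trS g.1 A μ ⋆ f)).1 := by
  have h1 : tr g (covF fun μ => (A μ).1) μ f.1 =
      tr g (fun μ => (pdSS μ f - I • (A μ ⋆ f)).1) μ := by
    simp only [tr, Finset.sum_apply, Pi.smul_apply]
    rfl
  rw [h1, tr_eq, Subtype.coe_inj]
  simp only [del, trS, LinearMap.sum_apply, LinearMap.smul_apply, sum_mulS, smul_mulS,
    smul_sub, sum_sub_distrib, smul_sum, smul_comm I]

lemma eval_tr (g : GL (Fin d) ℝ) (A : Fin d → SS d N N) (ℓ : L → SS d N N) (W : Word d L) :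
    W.eval (tr g fun μ => (A μ).1) (tr g (covA fun μ => (A μ).1)) (fun l => (ℓ l).1) =
      (wordS ⟨g.1, trS g.1 A, ℓ⟩ W).1 := by
  induction W with
  | A μ => exact tr_eq g A μ
  | letter l => rfl
  | one => rfl
  | add w v hw hv => simp only [Word.eval, hw, hv]; rfl
  | smul c w hw => simp only [Word.eval, hw]; rfl
  | mul w v hw hv => simp only [Word.eval, hw, hv]; rfl
  | D μ w hw => simp only [Word.eval, hw, tr_covA]; rfl

lemma feval_tr (g : GL (Fin d) ℝ) (A : Fin d → SS d N N) (f : SS d N 1) (W : FWord d) :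
    W.eval (tr g fun μ => (A μ).1) (tr g (covA fun μ => (A μ).1))
      (tr g (covF fun μ => (A μ).1)) f.1 = (fwordS ⟨g.1, trS g.1 A, Empty.elim⟩ f W).1 := by
  induction W with
  | phi => rfl
  | add w v hw hv => simp only [FWord.eval, hw, hv]; rfl
  | smul c w hw => simp only [FWord.eval, hw]; rfl
  | mul v w hw =>
    have e : (fun l : Empty => ((Empty.elim l : SS d N N)).1) =
      (Empty.elim : Empty → Ser d (Mat N N)) := funext fun l => l.elim
    have := eval_tr g A Empty.elim v
    rw [e] at this
    simp only [FWord.eval, hw, this]; rfl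
  | D μ w hw => simp only [FWord.eval, hw, tr_covF]; rfl

lemma trS_one (A : Fin d → SS d N N) : trS 1 A = A := by
  ext1 μ
  simp [trS, Matrix.one_apply, apply_ite Complex.ofReal, ite_smul]

lemma del_one {a b : ℕ} (μ : Fin d) (f : SS d a b) : del 1 μ f = pdSS μ f := by
  simp [del, Matrix.one_apply, apply_ite Complex.ofReal, ite_smul]

lemma tr_one {M : Type} [AddCommGroup M] [Module ℝ M] (a : Fin d → M) :
    tr (1 : GL (Fin d) ℝ) a = a := by
  ext1 μ
  simp [tr, Matrix.one_apply, ite_smul]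

/-- Products of derivatives of letters. -/
inductive Mono (d : ℕ) (L : Type) : Type
  | one : Mono d L
  | A (I : List (Fin d)) (μ : Fin d) (m : Mono d L) : Mono d L
  | E (I : List (Fin d)) (l : L) (m : Mono d L) : Mono d L

/-- Value of a monomial. -/
def Mono.val (x : Cfg d N L) : Mono d L → SS d N N
  | .one => oneS d N
  | .A I μ m => delL x.g I (x.a μ) ⋆ m.val x
  | .E I l m => delL x.g I (x.l l) ⋆ m.val x

/-- Degree in the letters `A_μ` and the derivatives. -/
def Mono.deg : Mono d L → ℕ
  | .one => 0
  | .A I _ m => I.length + 1 + m.deg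
  | .E I _ m => I.length + m.deg

/-- Degree in the further letters. -/
def Mono.degE : Mono d L → ℕ
  | .one => 0
  | .A _ _ m => m.degE
  | .E _ _ m => 1 + m.degE

/-- Rescaled letters. -/
def Cfg.scale (t u : ℝ) (x : Cfg d N L) : Cfg d N L :=
  ⟨t • x.g, fun μ => (t : ℂ) • x.a μ, fun l => (u : ℂ) • x.l l⟩

lemma Mono.val_scale (t u : ℝ) (x : Cfg d N L) (m : Mono d L) :
    m.val (x.scale t u) = ((t : ℂ) ^ m.deg * (u : ℂ) ^ m.degE) • m.val x := by
  induction m with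
  | one => simp [Mono.val, Mono.deg, Mono.degE]
  | A I μ m ih =>
    simp only [Mono.val, ih, Mono.deg, Mono.degE]
    simp only [Cfg.scale, delL_smul, smul_mulS, mulS_smul, smul_smul]
    congr 1
    ring
  | E I l m ih =>
    simp only [Mono.val, ih, Mono.deg, Mono.degE]
    simp only [Cfg.scale, delL_smul, smul_mulS, mulS_smul, smul_smul]
    congr 1
    ring

/-- Combinations of monomials. -/
def polys (d N : ℕ) (L : Type) : Submodule ℂ (Cfg d N L → SS d N N) :=
  Submodule.span ℂ (Set.range fun m : Mono d L => fun x => m.val x)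

lemma val_mem_polys (m : Mono d L) : (fun x : Cfg d N L => m.val x) ∈ polys d N L :=
  Submodule.subset_span ⟨m, rfl⟩

/-- Concatenation of monomials. -/
def Mono.append : Mono d L → Mono d L → Mono d L
  | .one, n => n
  | .A I μ m, n => .A I μ (m.append n)
  | .E I l m, n => .E I l (m.append n)

lemma Mono.val_append (x : Cfg d N L) (m n : Mono d L) :
    (m.append n).val x = m.val x ⋆ n.val x := by
  induction m with
  | one => simp [Mono.append, Mono.val, one_mulS]
  | A I μ m ih => simp [Mono.append, Mono.val, ih, mulS_assoc]
  | E I l m ih => simp [Mono.append, Mono.val, ih, mulS_assoc]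

lemma mem_of_span {X Y V W : Type} [AddCommGroup V] [Module ℂ V] [AddCommGroup W] [Module ℂ W]
    {s : Set (X → V)} {f : X → V} (hf : f ∈ Submodule.span ℂ s) (π : Y → X) (T : Y → V →ₗ[ℂ] W)
    {S : Submodule ℂ (Y → W)} (h : ∀ g ∈ s, (fun y => T y (g (π y))) ∈ S) :
    (fun y => T y (f (π y))) ∈ S := by
  induction hf using Submodule.span_induction with
  | mem g hg => exact h g hg
  | zero =>
    simp only [Pi.zero_apply, map_zero]
    exact S.zero_mem
  | add g k _ _ h1 h2 =>
    simp only [Pi.add_apply, map_add]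
    exact S.add_mem h1 h2
  | smul c g _ h1 =>
    simp only [Pi.smul_apply, map_smul]
    exact S.smul_mem c h1

lemma mul_mem_polys {f h : Cfg d N L → SS d N N} (hf : f ∈ polys d N L)
    (hh : h ∈ polys d N L) : (fun x => f x ⋆ h x) ∈ polys d N L := by
  refine mem_of_span hf id (fun x => (mulSL d N N N).flip (h x)) ?_
  rintro _ ⟨m, rfl⟩
  refine mem_of_span hh id (fun x => mulSL d N N N (m.val x)) ?_
  rintro _ ⟨n, rfl⟩
  have := val_mem_polys (N := N) (m.append n)
  simp only [Mono.val_append] at this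
  exact this

lemma letter_mem_polys (I : List (Fin d)) (μ : Fin d) :
    (fun x : Cfg d N L => delL x.g I (x.a μ)) ∈ polys d N L := by
  have := val_mem_polys (N := N) (L := L) (.A I μ .one)
  simpa only [Mono.val, mulS_one] using this

lemma letterE_mem_polys (I : List (Fin d)) (l : L) :
    (fun x : Cfg d N L => delL x.g I (x.l l)) ∈ polys d N L := by
  have := val_mem_polys (N := N) (.E I l .one)
  simpa only [Mono.val, mulS_one] using this

lemma del_mem_polys (μ : Fin d) {f : Cfg d N L → SS d N N} (hf : f ∈ polys d N L) :
    (fun x => del x.g μ (f x)) ∈ polys d N L := by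
  refine mem_of_span hf id (fun x => del x.g μ) ?_
  rintro _ ⟨m, rfl⟩
  simp only [id]
  induction m with
  | one =>
    simp only [Mono.val, del_oneS]
    exact Submodule.zero_mem (polys d N L)
  | A I ν m ih =>
    simp only [Mono.val, del_mulS]
    exact Submodule.add_mem _ (mul_mem_polys (letter_mem_polys (μ :: I) ν) (val_mem_polys m))
      (mul_mem_polys (letter_mem_polys I ν) ih)
  | E I l m ih =>
    simp only [Mono.val, del_mulS]
    exact Submodule.add_mem _ (mul_mem_polys (letterE_mem_polys (μ :: I) l) (val_mem_polys m))
      (mul_mem_polys (letterE_mem_polys I l) ih)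

lemma wordS_mem_polys (W : Word d L) : (fun x : Cfg d N L => wordS x W) ∈ polys d N L := by
  induction W with
  | A μ => exact letter_mem_polys [] μ
  | letter l => exact letterE_mem_polys [] l
  | one => exact val_mem_polys .one
  | add w v hw hv => exact Submodule.add_mem _ hw hv
  | smul c w hw => exact Submodule.smul_mem _ c hw
  | mul w v hw hv => exact mul_mem_polys hw hv
  | D μ w hw =>
    exact Submodule.add_mem _ (Submodule.sub_mem _ (del_mem_polys μ hw)
      (Submodule.smul_mem _ I (mul_mem_polys (letter_mem_polys [] μ) hw)))
      (Submodule.smul_mem _ I (mul_mem_polys hw (letter_mem_polys [] μ)))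

/-- Combinations of monomials times derivatives of the fundamental field. -/
def fpolys (d N : ℕ) : Submodule ℂ (Cfg d N Empty × SS d N 1 → SS d N 1) :=
  Submodule.span ℂ (Set.range fun (m : Mono d Empty × List (Fin d)) x =>
    m.1.val x.1 ⋆ delL x.1.g m.2 x.2)

lemma mul_mem_fpolys {f : Cfg d N Empty → SS d N N} {h : Cfg d N Empty × SS d N 1 → SS d N 1}
    (hf : f ∈ polys d N Empty) (hh : h ∈ fpolys d N) : (fun x => f x.1 ⋆ h x) ∈ fpolys d N := by
  refine mem_of_span hf Prod.fst (fun x => (mulSL d N N 1).flip (h x)) ?_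
  rintro _ ⟨m, rfl⟩
  refine mem_of_span hh id (fun x => mulSL d N N 1 (m.val x.1)) ?_
  rintro _ ⟨n, rfl⟩
  refine Submodule.subset_span ⟨(m.append n.1, n.2), ?_⟩
  simp only [Mono.val_append, mulS_assoc]
  rfl

lemma field_mem_fpolys (I : List (Fin d)) :
    (fun x : Cfg d N Empty × SS d N 1 => delL x.1.g I x.2) ∈ fpolys d N :=
  Submodule.subset_span ⟨(.one, I), by simp only [Mono.val, one_mulS]⟩

lemma del_mem_fpolys (μ : Fin d) {f : Cfg d N Empty × SS d N 1 → SS d N 1}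
    (hf : f ∈ fpolys d N) : (fun x => del x.1.g μ (f x)) ∈ fpolys d N := by
  refine mem_of_span hf id (fun x => del x.1.g μ) ?_
  rintro _ ⟨m, rfl⟩
  have h1 := mul_mem_fpolys (N := N) (f := fun x => del x.g μ (m.1.val x))
    (h := fun x => delL x.1.g m.2 x.2) (del_mem_polys μ (val_mem_polys m.1))
    (field_mem_fpolys m.2)
  have h2 := mul_mem_fpolys (N := N) (f := fun x => m.1.val x)
    (h := fun x => delL x.1.g (μ :: m.2) x.2) (val_mem_polys m.1) (field_mem_fpolys (μ :: m.2))
  simp only [id, del_mulS]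
  exact Submodule.add_mem (fpolys d N) h1 h2

lemma fwordS_mem_fpolys (W : FWord d) :
    (fun x : Cfg d N Empty × SS d N 1 => fwordS x.1 x.2 W) ∈ fpolys d N := by
  induction W with
  | phi => exact field_mem_fpolys []
  | add w v hw hv => exact Submodule.add_mem _ hw hv
  | smul c w hw => exact Submodule.smul_mem _ c hw
  | mul v w hw => exact mul_mem_fpolys (N := N) (f := fun x => wordS x v) (wordS_mem_polys v) hw
  | D μ w hw =>
    have h1 := del_mem_fpolys μ hw
    have h2 := Submodule.smul_mem (fpolys d N) I
      (mul_mem_fpolys (N := N) (f := fun x => x.a μ) (letter_mem_polys [] μ) hw)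
    exact Submodule.sub_mem (fpolys d N) h1 h2

end Words

section Homogeneous

lemma eq_sum_of_pow {M V : Type} [AddCommGroup V] [Module ℂ V] (s : Finset M) (l : M → ℂ)
    (l₀ : ℂ) (U : M → V) (v : V) (h : ∀ j : ℕ, ∑ m ∈ s, l m ^ j • U m = l₀ ^ j • v) :
    v = ∑ m ∈ s with l m = l₀, U m := by
  classical
  have h1 : ∀ Q : Polynomial ℂ, ∑ m ∈ s, Q.eval (l m) • U m = Q.eval l₀ • v := by
    intro Q
    induction Q using Polynomial.induction_on' with
    | add P Q hP hQ => simp only [Polynomial.eval_add, add_smul, sum_add_distrib, hP, hQ]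
    | monomial n a =>
      simp only [Polynomial.eval_monomial, mul_smul, ← smul_sum, h]
  let t := insert l₀ (s.image l)
  have h2 := h1 (Lagrange.basis t id l₀)
  have e0 : (Lagrange.basis t id l₀).eval l₀ = 1 :=
    Lagrange.eval_basis_self (fun _ _ _ _ h => h) (mem_insert_self _ _)
  rw [e0, one_smul] at h2
  rw [← h2, Finset.sum_filter]
  refine sum_congr rfl fun m hm => ?_
  split_ifs with hl
  · rw [hl, e0, one_smul]
  · have : (Lagrange.basis t id l₀).eval (id (l m)) = 0 :=
      Lagrange.eval_basis_of_ne (fun e => hl e.symm)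
        (mem_insert_of_mem (Finset.mem_image_of_mem l hm))
    rw [id] at this
    rw [this, zero_smul]

lemma exists_homogeneous {X M V : Type} [AddCommGroup V] [Module ℂ V] {val : M → X → V}
    {sc : X → X} {l : M → ℂ} (hv : ∀ m x, val m (sc x) = l m • val m x) {f : X → V}
    (hf : f ∈ Submodule.span ℂ (Set.range val)) (l₀ : ℂ) {G : Set X}
    (hG : ∀ x ∈ G, sc x ∈ G ∧ f (sc x) = l₀ • f x) :
    ∃ Φ ∈ Submodule.span ℂ (val '' {m | l m = l₀}), ∀ x ∈ G, f x = Φ x := by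
  obtain ⟨c, rfl⟩ := (Finsupp.mem_span_range_iff_exists_finsupp).mp hf
  refine ⟨∑ m ∈ c.support with l m = l₀, c m • val m, ?_, fun x hx => ?_⟩
  · refine Submodule.sum_mem _ fun m hm => Submodule.smul_mem _ _ (Submodule.subset_span ?_)
    exact ⟨m, (Finset.mem_filter.mp hm).2, rfl⟩
  · have hi : ∀ j : ℕ, sc^[j] x ∈ G ∧ (c.sum fun m a => a • val m) (sc^[j] x) =
        l₀ ^ j • (c.sum fun m a => a • val m) x := by
      intro j
      induction j with
      | zero => exact ⟨hx, by simp⟩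
      | succ j ih =>
        rw [Function.iterate_succ_apply']
        exact ⟨(hG _ ih.1).1, by rw [(hG _ ih.1).2, ih.2, smul_smul, pow_succ']⟩
    have hvi : ∀ m (j : ℕ), val m (sc^[j] x) = l m ^ j • val m x := by
      intro m j
      induction j with
      | zero => simp
      | succ j ih => rw [Function.iterate_succ_apply', hv, ih, smul_smul, pow_succ']
    have := eq_sum_of_pow c.support l l₀ (fun m => c m • val m x)
      ((c.sum fun m a => a • val m) x) (fun j => by
        rw [← (hi j).2]
        simp only [Finsupp.sum, Finset.sum_apply, Pi.smul_apply, hvi, smul_comm (c _)])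
    rw [this, Finset.sum_apply]
    rfl

lemma two_three_pow {a b n k : ℕ} (h : (2 : ℂ) ^ a * 3 ^ b = 2 ^ n * 3 ^ k) : a = n ∧ b = k := by
  have h1 : 2 ^ a * 3 ^ b = 2 ^ n * 3 ^ k := by exact_mod_cast h
  have h2 := congrArg (padicValNat 2) h1
  have h3 := congrArg (padicValNat 3) h1
  have : Fact (Nat.Prime 2) := ⟨Nat.prime_two⟩
  have : Fact (Nat.Prime 3) := ⟨Nat.prime_three⟩
  have e1 : padicValNat 2 3 = 0 := padicValNat.eq_zero_of_not_dvd (by decide)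
  have e2 : padicValNat 3 2 = 0 := padicValNat.eq_zero_of_not_dvd (by decide)
  rw [padicValNat.mul (by positivity) (by positivity),
    padicValNat.mul (by positivity) (by positivity)] at h2 h3
  simp only [padicValNat.pow, padicValNat.self,
    e1, e2, mul_zero, mul_one, add_zero, zero_add, Nat.one_lt_ofNat] at h2 h3
  exact ⟨h2, h3⟩

end Homogeneous

/-! ### Enumeration of the monomials of low degree -/

section Enumeration

variable {d : ℕ} {L : Type}

lemma Mono.deg_zero : ∀ m : Mono d L, m.deg = 0 → m.degE = 0 → m = .one := by
  rintro (_ | ⟨I, μ, m⟩ | ⟨I, l, m⟩) h h' <;> simp [Mono.deg, Mono.degE] at *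

lemma Mono.deg_one (m : Mono d L) (h : m.deg = 1) (h' : m.degE = 0) : ∃ a, m = .A [] a .one := by
  rcases m with _ | ⟨I, a, m⟩ | ⟨I, l, m⟩ <;> simp only [Mono.deg, Mono.degE] at h h'
  · omega
  · have h1 := m.deg_zero (by omega) h'
    have h2 : I = [] := List.length_eq_zero_iff.mp (by omega)
    exact ⟨a, by rw [h1, h2]⟩
  · omega

lemma Mono.deg_two (m : Mono d L) (h : m.deg = 2) (h' : m.degE = 0) :
    (∃ a b, m = .A [a] b .one) ∨ ∃ a b, m = .A [] a (.A [] b .one) := by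
  rcases m with _ | ⟨_ | ⟨a, _ | ⟨b, I⟩⟩, μ, m⟩ | ⟨I, l, m⟩ <;>
    simp only [Mono.deg, Mono.degE, List.length_nil, List.length_cons] at h h'
  · omega
  · obtain ⟨b, rfl⟩ := m.deg_one (by omega) h'
    exact .inr ⟨μ, b, rfl⟩
  · obtain rfl := m.deg_zero (by omega) h'
    exact .inl ⟨a, μ, rfl⟩
  · omega
  · omega

lemma Mono.deg_three (m : Mono d L) (h : m.deg = 3) (h' : m.degE = 0) :
    (∃ a b c, m = .A [a, b] c .one) ∨ (∃ a b c, m = .A [a] b (.A [] c .one)) ∨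
      (∃ a b c, m = .A [] a (.A [b] c .one)) ∨
        ∃ a b c, m = .A [] a (.A [] b (.A [] c .one)) := by
  rcases m with _ | ⟨_ | ⟨a, _ | ⟨b, _ | ⟨c, I⟩⟩⟩, μ, m⟩ | ⟨I, l, m⟩ <;>
    simp only [Mono.deg, Mono.degE, List.length_nil, List.length_cons] at h h'
  · omega
  · obtain ⟨b, c, rfl⟩ | ⟨b, c, rfl⟩ := m.deg_two (by omega) h'
    · exact .inr (.inr (.inl ⟨μ, b, c, rfl⟩))
    · exact .inr (.inr (.inr ⟨μ, b, c, rfl⟩))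
  · obtain ⟨c, rfl⟩ := m.deg_one (by omega) h'
    exact .inr (.inl ⟨a, μ, c, rfl⟩)
  · obtain rfl := m.deg_zero (by omega) h'
    exact .inl ⟨a, b, μ, rfl⟩
  · omega
  · omega

lemma Mono.deg_zero_one (m : Mono d L) (h : m.deg = 0) (h' : m.degE = 1) :
    ∃ l, m = .E [] l .one := by
  rcases m with _ | ⟨I, a, m⟩ | ⟨I, l, m⟩ <;> simp only [Mono.deg, Mono.degE] at h h'
  · omega
  · omega
  · have h1 := m.deg_zero (by omega) (by omega)
    have h2 : I = [] := List.length_eq_zero_iff.mp (by omega)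
    exact ⟨l, by rw [h1, h2]⟩

lemma Mono.deg_one_one (m : Mono d L) (h : m.deg = 1) (h' : m.degE = 1) :
    ∃ a l, m = .E [a] l .one ∨ m = .A [] a (.E [] l .one) ∨ m = .E [] l (.A [] a .one) := by
  rcases m with _ | ⟨I, a, m⟩ | ⟨_ | ⟨a, _ | ⟨b, I⟩⟩, l, m⟩ <;>
    simp only [Mono.deg, Mono.degE, List.length_nil, List.length_cons] at h h'
  · omega
  · obtain ⟨l, rfl⟩ := m.deg_zero_one (by omega) h'
    have h2 : I = [] := List.length_eq_zero_iff.mp (by omega)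
    subst h2
    exact ⟨a, l, .inr (.inl rfl)⟩
  · obtain ⟨a, rfl⟩ := m.deg_one (by omega) (by omega)
    exact ⟨a, l, .inr (.inr rfl)⟩
  · obtain rfl := m.deg_zero (by omega) (by omega)
    exact ⟨a, l, .inl rfl⟩
  · omega

lemma Mono.deg_two_one (m : Mono d L) (h : m.deg = 2) (h' : m.degE = 1) :
    ∃ a b l, m = .E [a, b] l .one ∨ m = .E [a] l (.A [] b .one) ∨ m = .A [] a (.E [b] l .one) ∨
      m = .A [a] b (.E [] l .one) ∨ m = .E [] l (.A [a] b .one) ∨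
      m = .A [] a (.A [] b (.E [] l .one)) ∨ m = .A [] a (.E [] l (.A [] b .one)) ∨
      m = .E [] l (.A [] a (.A [] b .one)) := by
  rcases m with _ | ⟨_ | ⟨a, _ | ⟨b, I⟩⟩, μ, m⟩ | ⟨_ | ⟨a, _ | ⟨b, _ | ⟨c, I⟩⟩⟩, l, m⟩ <;>
    simp only [Mono.deg, Mono.degE, List.length_nil, List.length_cons] at h h'
  · omega
  · obtain ⟨b, l, rfl | rfl | rfl⟩ := m.deg_one_one (by omega) h' <;> exact ⟨μ, b, l, by simp⟩
  · obtain ⟨l, rfl⟩ := m.deg_zero_one (by omega) h'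
    exact ⟨a, μ, l, by simp⟩
  · omega
  · obtain ⟨a, b, rfl⟩ | ⟨a, b, rfl⟩ := m.deg_two (by omega) (by omega) <;>
      exact ⟨a, b, l, by simp⟩
  · obtain ⟨b, rfl⟩ := m.deg_one (by omega) (by omega)
    exact ⟨a, b, l, by simp⟩
  · obtain rfl := m.deg_zero (by omega) (by omega)
    exact ⟨a, b, l, by simp⟩
  · omega

lemma Mono.degE_empty (m : Mono d Empty) : m.degE = 0 := by
  induction m with
  | one => rfl
  | A I μ m ih => exact ih
  | E I l m => exact l.elim

end Enumeration

/-! ### Arrays of coefficients -/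

section Arrays

variable {d N : ℕ}

/-- Linear combination with an array of coefficients. -/
def lc {ι V : Type} [Fintype ι] [AddCommGroup V] [Module ℂ V] (c : ι → ℂ) (u : ι → V) : V :=
  ∑ i, c i • u i

section lc

variable {ι V W : Type} [Fintype ι] [AddCommGroup V] [Module ℂ V] [AddCommGroup W] [Module ℂ W]

lemma lc_add_left (c c' : ι → ℂ) (u : ι → V) : lc (c + c') u = lc c u + lc c' u := by
  simp [lc, add_smul, sum_add_distrib]

lemma lc_sub_left (c c' : ι → ℂ) (u : ι → V) : lc (c - c') u = lc c u - lc c' u := by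
  simp [lc, sub_smul, sum_sub_distrib]

lemma lc_smul_left (r : ℂ) (c : ι → ℂ) (u : ι → V) : lc (r • c) u = r • lc c u := by
  simp [lc, mul_smul, smul_sum]

lemma lc_zero_left (u : ι → V) : lc (0 : ι → ℂ) u = 0 := by simp [lc]

lemma lc_single [DecidableEq ι] (j : ι) (z : ℂ) (u : ι → V) :
    lc (Pi.single j z) u = z • u j := by
  simp [lc, Pi.single_apply, ite_smul]

lemma lc_add (c : ι → ℂ) (u v : ι → V) : lc c (fun i => u i + v i) = lc c u + lc c v := by
  simp [lc, sum_add_distrib]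

lemma lc_sub (c : ι → ℂ) (u v : ι → V) : lc c (fun i => u i - v i) = lc c u - lc c v := by
  simp [lc, smul_sub, sum_sub_distrib]

lemma lc_smul (c : ι → ℂ) (r : ℂ) (u : ι → V) : lc c (fun i => r • u i) = r • lc c u := by
  simp [lc, smul_sum, smul_comm r]

lemma lc_smul_const (c : ι → ℂ) (x : ι → ℂ) (v : V) : lc c (fun i => x i • v) = lc c x • v := by
  simp [lc, sum_smul, mul_smul]

lemma lc_zero (c : ι → ℂ) : lc c (fun _ => (0 : V)) = 0 := by simp [lc]

end lc

/-- Pairs of indices. -/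
abbrev T2 (d : ℕ) := Fin d × Fin d

/-- Triples of indices. -/
abbrev T3 (d : ℕ) := Fin d × Fin d × Fin d

/-- Combination of the monomials of degree three in `A_μ` and the derivatives. -/
def polyD (c : Fin 4 → T3 d → ℂ) (g : SqM d) (A : Fin d → SS d N N) :
    SS d N N :=
  lc (c 0) (fun i => del g i.1 (del g i.2.1 (A i.2.2))) +
  lc (c 1) (fun i => del g i.1 (A i.2.1) ⋆ A i.2.2) +
  lc (c 2) (fun i => A i.1 ⋆ del g i.2.1 (A i.2.2)) +
  lc (c 3) (fun i => A i.1 ⋆ (A i.2.1 ⋆ A i.2.2))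

/-- Combination of the monomials of degree two in `A_μ` and the derivatives, linear in a further
letter. -/
def polyE (c : Fin 8 → T2 d → ℂ) (g : SqM d) (A : Fin d → SS d N N)
    (e : SS d N N) : SS d N N :=
  lc (c 0) (fun i => del g i.1 (del g i.2 e)) +
  lc (c 1) (fun i => del g i.1 e ⋆ A i.2) +
  lc (c 2) (fun i => A i.1 ⋆ del g i.2 e) +
  lc (c 3) (fun i => del g i.1 (A i.2) ⋆ e) +
  lc (c 4) (fun i => e ⋆ del g i.1 (A i.2)) +
  lc (c 5) (fun i => A i.1 ⋆ (A i.2 ⋆ e)) +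
  lc (c 6) (fun i => A i.1 ⋆ (e ⋆ A i.2)) +
  lc (c 7) (fun i => e ⋆ (A i.1 ⋆ A i.2))

/-- Combination of the monomials of degree two in `A_μ` and the derivatives, linear in a
fundamental field. -/
def polyF (c : Fin 4 → T2 d → ℂ) (g : SqM d) (A : Fin d → SS d N N)
    (f : SS d N 1) : SS d N 1 :=
  lc (c 0) (fun i => del g i.1 (del g i.2 f)) +
  lc (c 1) (fun i => del g i.1 (A i.2) ⋆ f) +
  lc (c 2) (fun i => A i.1 ⋆ del g i.2 f) +
  lc (c 3) (fun i => A i.1 ⋆ (A i.2 ⋆ f))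

lemma exists_polyD {Φ : Cfg d N Empty → SS d N N}
    (hΦ : Φ ∈ Submodule.span ℂ ((fun (m : Mono d Empty) x => m.val x) ''
      {m | m.deg = 3 ∧ m.degE = 0})) :
    ∃ c : Fin 4 → T3 d → ℂ, ∀ x, Φ x = polyD c x.g x.a := by
  let p : (Fin 4 → T3 d → ℂ) →ₗ[ℂ] Cfg d N Empty → SS d N N :=
    ⟨⟨fun c x => polyD c x.g x.a, fun c c' => funext fun x => by
      simp only [Pi.add_apply, polyD, lc_add_left]
      abel⟩, fun r c => funext fun x => by
      simp only [Pi.smul_apply, polyD, lc_smul_left, smul_add, RingHom.id_apply]⟩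
  obtain ⟨c, rfl⟩ := (Submodule.span_le (p := LinearMap.range p)).mpr (by
    rintro _ ⟨m, ⟨h1, h2⟩, rfl⟩
    obtain ⟨a, b, c, rfl⟩ | ⟨a, b, c, rfl⟩ | ⟨a, b, c, rfl⟩ | ⟨a, b, c, rfl⟩ :=
      m.deg_three h1 h2 <;>
    [use Pi.single 0 (Pi.single (a, b, c) 1); use Pi.single 1 (Pi.single (a, b, c) 1);
      use Pi.single 2 (Pi.single (a, b, c) 1); use Pi.single 3 (Pi.single (a, b, c) 1)] <;>
    exact funext fun x => by simp [p, polyD, lc_single, lc_zero_left, Mono.val, delL, mulS_one]) hΦ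
  exact ⟨c, fun _ => rfl⟩

lemma exists_polyE {Φ : Cfg d N Unit → SS d N N}
    (hΦ : Φ ∈ Submodule.span ℂ ((fun (m : Mono d Unit) x => m.val x) ''
      {m | m.deg = 2 ∧ m.degE = 1})) :
    ∃ c : Fin 8 → T2 d → ℂ, ∀ x, Φ x = polyE c x.g x.a (x.l ()) := by
  let p : (Fin 8 → T2 d → ℂ) →ₗ[ℂ] Cfg d N Unit → SS d N N :=
    ⟨⟨fun c x => polyE c x.g x.a (x.l ()), fun c c' => funext fun x => by
      simp only [Pi.add_apply, polyE, lc_add_left]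
      abel⟩, fun r c => funext fun x => by
      simp only [Pi.smul_apply, polyE, lc_smul_left, smul_add, RingHom.id_apply]⟩
  obtain ⟨c, rfl⟩ := (Submodule.span_le (p := LinearMap.range p)).mpr (by
    rintro _ ⟨m, ⟨h1, h2⟩, rfl⟩
    obtain ⟨a, b, l, h⟩ := m.deg_two_one h1 h2
    have key : ∀ n, (fun x => m.val x) = p (Pi.single n (Pi.single (a, b) 1)) →
      (fun x => m.val x) ∈ LinearMap.range p := fun n hn => ⟨_, hn.symm⟩
    rcases h with h | h | h | h | h | h | h | h <;>
      [apply key 0; apply key 1; apply key 2; apply key 3; apply key 4; apply key 5; apply key 6;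
        apply key 7] <;> subst h <;>
    exact funext fun x => by simp [p, polyE, lc_single, lc_zero_left, Mono.val, delL, mulS_one]) hΦ
  exact ⟨c, fun _ => rfl⟩

lemma exists_polyF {Φ : Cfg d N Empty × SS d N 1 → SS d N 1}
    (hΦ : Φ ∈ Submodule.span ℂ ((fun (m : Mono d Empty × List (Fin d)) x =>
      m.1.val x.1 ⋆ delL x.1.g m.2 x.2) '' {m | m.1.deg + m.2.length = 2})) :
    ∃ c : Fin 4 → T2 d → ℂ, ∀ x, Φ x = polyF c x.1.g x.1.a x.2 := by
  let p : (Fin 4 → T2 d → ℂ) →ₗ[ℂ] Cfg d N Empty × SS d N 1 → SS d N 1 :=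
    ⟨⟨fun c x => polyF c x.1.g x.1.a x.2, fun c c' => funext fun x => by
      simp only [Pi.add_apply, polyF, lc_add_left]
      abel⟩, fun r c => funext fun x => by
      simp only [Pi.smul_apply, polyF, lc_smul_left, smul_add, RingHom.id_apply]⟩
  obtain ⟨c, rfl⟩ := (Submodule.span_le (p := LinearMap.range p)).mpr (by
    rintro _ ⟨⟨m, I⟩, h, rfl⟩
    have h' := m.degE_empty
    have key : ∀ n i, p (Pi.single n (Pi.single i 1)) = (fun x => m.val x.1 ⋆ delL x.1.g I x.2) →
      (fun x => m.val x.1 ⋆ delL x.1.g I x.2) ∈ LinearMap.range p := fun n i hn => ⟨_, hn⟩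
    rcases I with _ | ⟨a, _ | ⟨b, _ | ⟨c, I⟩⟩⟩ <;>
      simp only [Set.mem_ofPred_eq, List.length_nil, List.length_cons] at h
    · obtain ⟨a, b, rfl⟩ | ⟨a, b, rfl⟩ := m.deg_two (by omega) h' <;>
        [apply key 1 (a, b); apply key 3 (a, b)] <;>
      exact funext fun x => by
        simp [p, polyF, lc_single, lc_zero_left, Mono.val, delL, mulS_one, mulS_assoc]
    · obtain ⟨b, rfl⟩ := m.deg_one (by omega) h'
      exact key 2 (b, a) (funext fun x => by
        simp [p, polyF, lc_single, lc_zero_left, Mono.val, delL, mulS_one])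
    · obtain rfl := m.deg_zero (by omega) h'
      exact key 0 (a, b) (funext fun x => by
        simp [p, polyF, lc_single, lc_zero_left, Mono.val, delL, one_mulS])
    · omega) hΦ
  exact ⟨c, fun _ => rfl⟩

end Arrays

section Classes

variable {d N : ℕ}

lemma trS_smul (t : ℝ) (g : SqM d) (A : Fin d → SS d N N) (μ : Fin d) :
    trS (t • g) A μ = (t : ℂ) • trS g A μ := by
  simp only [trS, Matrix.smul_apply, smul_eq_mul, Complex.ofReal_mul, mul_smul, smul_sum]

/-- Twice a coordinate transformation. -/
def twice (g : GL (Fin d) ℝ) : GL (Fin d) ℝ := (Units.mk0 (2 : ℝ) two_ne_zero) • g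

lemma twice_val (g : GL (Fin d) ℝ) : (twice g).1 = (2 : ℝ) • g.1 := rfl

lemma isLinearFst_real {a : ℕ} {F : Fun d (Mat N a × Pot d N) (Fin d → Fin d → Mat N a)}
    (h : IsLinearFst ℂ F) : IsLinearFst ℝ F := by
  intro J u₁ u₂ v h₁ h₂ hv c x
  have e1 : ∀ (M : Mat N a), c • M = (c : ℂ) • M := fun M => by ext i j; simp
  have e2 : ∀ (M : Fin d → Fin d → Mat N a), c • M = (c : ℂ) • M := fun M => by
    ext μ ν i j; simp
  simp only [e1, e2]
  exact h J u₁ u₂ v h₁ h₂ hv c x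

lemma smooth_three {a : ℕ} {ε : Pt d → Mat N a} (hε : Smooth ε) :
    Smooth (fun x => ε x + (2 : ℝ) • ε x) := ContDiff.add hε (ContDiff.const_smul _ hε)

lemma constS_three {a : ℕ} {ε : Pt d → Mat N a} (hε : Smooth ε) :
    constS (smooth_three hε) = (3 : ℂ) • constS hε := by
  refine Subtype.ext (funext fun J => funext fun x => ?_)
  by_cases h : J = 0
  · ext i j
    simp [constS, const, h]
    ring
  · simp [constS, const, h]

lemma app_three {a : ℕ} {F : Fun d (Mat N a × Pot d N) (Fin d → Fin d → Mat N a)}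
    (h : IsLinearFst ℝ F) {ε : Pt d → Mat N a} (hε : Smooth ε) {A : Pt d → Pot d N} (hA : Smooth A)
    (μ ν : Fin d) : cpt2 (app F fun x => (ε x + (2 : ℝ) • ε x, A x)) μ ν =
      (3 : ℂ) • cpt2 (app F fun x => (ε x, A x)) μ ν := by
  ext J x i j
  have := congrFun (congrFun (congrFun (congrFun (h J ε ε A hε hε hA 2 x) μ) ν) i) j
  refine this.trans ?_
  simp [cpt2, app]
  ring

/-- Fields without `θ`-dependence. -/
def IsConst {a b : ℕ} (f : SS d a b) : Prop := ∃ (h : Pt d → Mat a b) (hs : Smooth h), f = constS hs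

lemma IsConst.add {a b : ℕ} {f g : SS d a b} (hf : IsConst f) (hg : IsConst g) :
    IsConst (f + g) := by
  obtain ⟨u, hu, rfl⟩ := hf
  obtain ⟨v, hv, rfl⟩ := hg
  refine ⟨u + v, ContDiff.add hu hv, Subtype.ext (funext fun J => funext fun x => ?_)⟩
  by_cases h : J = 0 <;> simp [constS, const, h]

lemma IsConst.smul {a b : ℕ} (c : ℂ) {f : SS d a b} (hf : IsConst f) : IsConst (c • f) := by
  obtain ⟨u, hu, rfl⟩ := hf
  refine ⟨c • u, ContDiff.const_smul c hu, Subtype.ext (funext fun J => funext fun x => ?_)⟩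
  by_cases h : J = 0 <;> simp [constS, const, h]

lemma exists_potS {A : Fin d → SS d N N} (h : ∀ μ, IsConst (A μ)) :
    ∃ (a : Pt d → Pot d N) (ha : Smooth a), A = potS ha := by
  choose a ha e using h
  exact ⟨fun x μ => a μ x, contDiff_pi.mpr ha, funext e⟩

lemma isConst_potS {A : Pt d → Pot d N} (hA : Smooth A) (μ : Fin d) : IsConst (potS hA μ) :=
  ⟨_, smooth_cpt hA μ, rfl⟩

/-- The values of `D` are given by arrays of coefficients. -/
def RepD (D : DFun d N) (c : Fin d → Fin d → Fin d → Fin 4 → T3 d → ℂ) : Prop :=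
  ∀ (A : Pt d → Pot d N) (hA : Smooth A) μ ν κ,
    cpt3 (app D A) μ ν κ = (polyD (c μ ν κ) 1 (potS hA)).1

/-- The values of `C` are given by functions of the fields. -/
def Rep2 {m : ℕ} (C : CFun d N m) (P : Fin d → Fin d → (Fin d → SS d N N) → SS d N m → SS d N m) : Prop :=
  ∀ (φ : Pt d → Mat N m) (A : Pt d → Pot d N) (hφ : Smooth φ) (hA : Smooth A) μ ν,
    cpt2 (app C fun x => (φ x, A x)) μ ν = (P μ ν (potS hA) (constS hφ)).1

/-- Weights of a tensor with two lower indices. -/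
def wt2 (g : GL (Fin d) ℝ) (i j : T2 d) : ℂ := ((g.1 i.1 j.1 * g.1 i.2 j.2 : ℝ) : ℂ)

/-- Weights of a tensor with three lower indices. -/
def wt3 (g : GL (Fin d) ℝ) (i j : T3 d) : ℂ :=
  ((g.1 i.1 j.1 * g.1 i.2.1 j.2.1 * g.1 i.2.2 j.2.2 : ℝ) : ℂ)

lemma eval_potS (g : GL (Fin d) ℝ) {A : Pt d → Pot d N} (hA : Smooth A) (w : Word d Empty) :
    w.eval (tr g (pot A)) (tr g (covA (pot A))) Empty.elim =
      (wordS ⟨g.1, trS g.1 (potS hA), Empty.elim⟩ w).1 := by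
  have := eval_tr g (potS hA) Empty.elim w
  rwa [show (fun l : Empty => ((Empty.elim l : SS d N N)).1) = Empty.elim from
    funext fun l => l.elim] at this

lemma eval_potS_one {A : Pt d → Pot d N} (hA : Smooth A) (w : Word d Empty) :
    w.eval (pot A) (covA (pot A)) Empty.elim = (wordS ⟨1, potS hA, Empty.elim⟩ w).1 := by
  simpa [tr_one, trS_one] using eval_potS 1 hA w

lemma isCovStarPolyD_iff {D : DFun d N} : IsCovStarPolyD D ↔ ∃ W : T3 d → Word d Empty,
    (∀ (A : Pt d → Pot d N) (hA : Smooth A) μ ν κ,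
      cpt3 (app D A) μ ν κ = (wordS ⟨1, potS hA, Empty.elim⟩ (W (μ, ν, κ))).1) ∧
    ∀ (g : GL (Fin d) ℝ) (A : Fin d → SS d N N), (∀ μ, IsConst (A μ)) → ∀ i,
      wordS ⟨g.1, trS g.1 A, Empty.elim⟩ (W i) =
        ∑ j, wt3 g i j • wordS ⟨1, A, Empty.elim⟩ (W j) := by
  rw [IsCovStarPolyD, ← (Equiv.trans (Equiv.arrowCongr (Equiv.refl _) (Equiv.curry _ _ _)).symm
    (Equiv.curry (Fin d) (T2 d) (Word d Empty)).symm).exists_congr_right]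
  refine exists_congr fun W => and_congr ?_ ⟨fun h g A hA i => ?_, fun h g A hA μ ν κ => ?_⟩
  · exact forall₂_congr fun A hA => by simp only [eval_potS_one hA]; rfl
  · obtain ⟨a, ha, rfl⟩ := exists_potS hA
    refine Subtype.ext ((eval_potS g ha _).symm.trans ((h g a ha _ _ _).trans ?_))
    simp only [eval_potS_one ha, Fintype.sum_prod_type, coe_sum, ← coe_smul_ser]
    rfl
  · have := congrArg Subtype.val (h g (potS hA) (isConst_potS hA) (μ, ν, κ))
    refine (eval_potS g hA _).trans (this.trans ?_)
    simp only [eval_potS_one hA, Fintype.sum_prod_type, coe_sum, ← coe_smul_ser]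
    rfl

lemma isCovStarPoly2_iff {E : EFun d N} : IsCovStarPoly2 E ↔ ∃ W : T2 d → Word d Unit,
    (Rep2 E fun μ ν A e => wordS ⟨1, A, fun _ => e⟩ (W (μ, ν))) ∧
    ∀ (g : GL (Fin d) ℝ) (A : Fin d → SS d N N) e, (∀ μ, IsConst (A μ)) → IsConst e → ∀ i,
      wordS ⟨g.1, trS g.1 A, fun _ => e⟩ (W i) =
        ∑ j, wt2 g i j • wordS ⟨1, A, fun _ => e⟩ (W j) := by
  have key : ∀ (A : Pt d → Pot d N) (ε : Pt d → Mat N N) (hA : Smooth A) (hε : Smooth ε)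
      (w : Word d Unit), w.eval (pot A) (covA (pot A)) (fun _ => const ε) =
        (wordS ⟨1, potS hA, fun _ => constS hε⟩ w).1 := fun A ε hA hε w => by
    have := eval_tr 1 (potS hA) (fun _ => constS hε) w
    simp only [tr_one, trS_one, Units.val_one] at this
    exact this
  rw [IsCovStarPoly2, ← (Equiv.curry _ _ _).symm.exists_congr_right]
  refine exists_congr fun W => and_congr ?_ ⟨fun h g A e hA he i => ?_, fun h g ε A hε hA μ ν => ?_⟩
  · exact forall₄_congr fun ε A hε hA => by simp only [key A ε hA hε]; rfl
  · obtain ⟨a, ha, rfl⟩ := exists_potS hA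
    obtain ⟨ε, hε, rfl⟩ := he
    refine Subtype.ext ((eval_tr g (potS ha) (fun _ => constS hε) _).symm.trans
      ((h g ε a hε ha _ _).trans ?_))
    simp only [key a ε ha hε, Fintype.sum_prod_type, coe_sum, ← coe_smul_ser]
    rfl
  · have := congrArg Subtype.val (h g (potS hA) _ (isConst_potS hA) ⟨ε, hε, rfl⟩ (μ, ν))
    refine (eval_tr g (potS hA) (fun _ => constS hε) _).trans (this.trans ?_)
    simp only [key A ε hA hε, Fintype.sum_prod_type, coe_sum, ← coe_smul_ser]
    rfl

lemma isCovStarPolyF_iff {C : CFun d N 1} : IsCovStarPolyF C ↔ ∃ W : T2 d → FWord d,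
    (Rep2 C fun μ ν A f => fwordS ⟨1, A, Empty.elim⟩ f (W (μ, ν))) ∧
    ∀ (g : GL (Fin d) ℝ) (A : Fin d → SS d N N) f, (∀ μ, IsConst (A μ)) → IsConst f → ∀ i,
      fwordS ⟨g.1, trS g.1 A, Empty.elim⟩ f (W i) =
        ∑ j, wt2 g i j • fwordS ⟨1, A, Empty.elim⟩ f (W j) := by
  have key : ∀ (A : Pt d → Pot d N) (φ : Pt d → Mat N 1) (hA : Smooth A) (hφ : Smooth φ)
      (w : FWord d), w.eval (pot A) (covA (pot A)) (covF (pot A)) (const φ) =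
        (fwordS ⟨1, potS hA, Empty.elim⟩ (constS hφ) w).1 := fun A φ hA hφ w => by
    have := feval_tr 1 (potS hA) (constS hφ) w
    simp only [tr_one, trS_one, Units.val_one] at this
    exact this
  rw [IsCovStarPolyF, ← (Equiv.curry _ _ _).symm.exists_congr_right]
  refine exists_congr fun W => and_congr ?_ ⟨fun h g A f hA hf i => ?_, fun h g φ A hφ hA μ ν => ?_⟩
  · exact forall₄_congr fun φ A hφ hA => by simp only [key A φ hA hφ]; rfl
  · obtain ⟨a, ha, rfl⟩ := exists_potS hA
    obtain ⟨φ, hφ, rfl⟩ := hf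
    refine Subtype.ext ((feval_tr g (potS ha) (constS hφ) _).symm.trans
      ((h g φ a hφ ha _ _).trans ?_))
    simp only [key a φ ha hφ, Fintype.sum_prod_type, coe_sum, ← coe_smul_ser]
    rfl
  · have := congrArg Subtype.val (h g (potS hA) _ (isConst_potS hA) ⟨φ, hφ, rfl⟩ (μ, ν))
    refine (feval_tr g (potS hA) (constS hφ) _).trans (this.trans ?_)
    simp only [key A φ hA hφ, Fintype.sum_prod_type, coe_sum, ← coe_smul_ser]
    rfl

/-- Covariance selects the monomials of the right degree. -/
lemma exists_arrays {I X Y V M K : Type} [Fintype I] [AddCommGroup V] [Module ℂ V]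
    {val : M → X → V} {sc : X → X} {l : M → ℂ} (hv : ∀ m x, val m (sc x) = l m • val m x)
    {f : I → X → V} (hf : ∀ i, f i ∈ Submodule.span ℂ (Set.range val))
    {x : SqM d → Y → X} {s : Y → Y} {w : GL (Fin d) ℝ → I → I → ℂ} {k k' : ℂ}
    (hx : ∀ g y, sc (x g y) = x ((2 : ℝ) • g) (s y))
    (hcov : ∀ (g : GL (Fin d) ℝ) y i, f i (x g.1 y) = ∑ j, w g i j • f j (x 1 y))
    (hw : ∀ g i j, w (twice g) i j = k * w g i j) (hs : ∀ i y, f i (x 1 (s y)) = k' • f i (x 1 y))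
    {P : K → X → V} (hP : ∀ Φ ∈ Submodule.span ℂ (val '' {m | l m = k * k'}), ∃ c, ∀ x, Φ x = P c x) :
    ∃ c : I → K, ∀ i (g : GL (Fin d) ℝ) y, f i (x g.1 y) = P (c i) (x g.1 y) := by
  have : ∀ i, ∃ c : K, ∀ (g : GL (Fin d) ℝ) y, f i (x g.1 y) = P c (x g.1 y) := fun i => by
    obtain ⟨Φ, hΦ, h⟩ := exists_homogeneous hv (hf i) (k * k')
      (G := {z | ∃ (g : GL (Fin d) ℝ) (y : Y), z = x g.1 y}) (by
        rintro _ ⟨g, y, rfl⟩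
        refine ⟨⟨twice g, s y, hx g.1 y⟩, ?_⟩
        rw [hx, ← twice_val, hcov, hcov, smul_sum]
        exact sum_congr rfl fun j _ => by rw [hw, hs, smul_smul, smul_smul, mul_right_comm])
    obtain ⟨c, hc⟩ := hP Φ hΦ
    exact ⟨c, fun g y => (h _ ⟨g, y, rfl⟩).trans (hc _)⟩
  choose c hc using this
  exact ⟨c, hc⟩

/-- A covariant star polynomial in `A_μ, D_μ` as an array of coefficients. -/
lemma arrays_D {D : DFun d N} (hD : IsCovStarPolyD D) :
    ∃ c : Fin d → Fin d → Fin d → Fin 4 → T3 d → ℂ, RepD D c ∧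
      ∀ (g : GL (Fin d) ℝ) (A : Fin d → SS d N N), (∀ μ, IsConst (A μ)) → ∀ i : T3 d,
        polyD (c i.1 i.2.1 i.2.2) g.1 (trS g.1 A) =
          ∑ j : T3 d, wt3 g i j • polyD (c j.1 j.2.1 j.2.2) 1 A := by
  obtain ⟨W, hW, hcov⟩ := isCovStarPolyD_iff.mp hD
  obtain ⟨c, hc⟩ := exists_arrays (I := T3 d) (val := fun (m : Mono d Empty) (x : Cfg d N Empty) => m.val x) (sc := Cfg.scale 2 3)
    (l := fun m => ((2 : ℝ) : ℂ) ^ m.deg * ((3 : ℝ) : ℂ) ^ m.degE)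
    (k := 2 ^ 3) (k' := 1) (s := id) (w := wt3) (P := fun c x => polyD c x.g x.a)
    (fun m x => Mono.val_scale 2 3 x m) (fun i => wordS_mem_polys (N := N) (W i))
    (x := fun g (A : {A : Fin d → SS d N N // ∀ μ, IsConst (A μ)}) => ⟨g, trS g A.1, Empty.elim⟩)
    (fun g A => by
      simp only [Cfg.scale, Cfg.mk.injEq, true_and]
      exact ⟨funext fun μ => (trS_smul _ _ _ _).symm, funext fun l => l.elim⟩)
    (fun g A i => by simpa only [trS_one] using hcov g A.1 A.2 i)
    (fun g i j => by
      simp only [wt3, twice_val, Matrix.smul_apply, smul_eq_mul]; push_cast; ring)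
    (fun _ _ => (one_smul _ _).symm) fun Φ hΦ => exists_polyD (Submodule.span_mono
      (Set.image_mono fun m hm => two_three_pow (a := m.deg) (b := m.degE) (n := 3) (k := 0) (by simpa using hm)) hΦ)
  have h1 : ∀ A : Fin d → SS d N N, (∀ μ, IsConst (A μ)) → ∀ i,
      wordS ⟨1, A, Empty.elim⟩ (W i) = polyD (c i) 1 A := fun A hA i => by
    simpa only [trS_one, Units.val_one] using hc i 1 ⟨A, hA⟩
  refine ⟨fun μ ν κ => c (μ, ν, κ), fun A hA μ ν κ => by rw [hW A hA, h1 _ (isConst_potS hA)],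
    fun g A hA i => ?_⟩
  simpa only [h1 A hA] using (hc i g ⟨A, hA⟩).symm.trans (hcov g A hA i)

/-- Potentials and matter fields without `θ`-dependence. -/
abbrev CFld (d N m : ℕ) := {x : (Fin d → SS d N N) × SS d N m // (∀ μ, IsConst (x.1 μ)) ∧ IsConst x.2}

/-- A covariant star polynomial in `A_μ, D_μ`, linear in a further letter, as an array of
coefficients. -/
lemma arrays_E {E : EFun d N} (hE : IsCovStarPoly2 E) (hl : IsLinearFst ℝ E) :
    ∃ c : Fin d → Fin d → Fin 8 → T2 d → ℂ, (Rep2 E fun μ ν => polyE (c μ ν) 1) ∧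
      ∀ (g : GL (Fin d) ℝ) (x : CFld d N N) (i : T2 d), polyE (c i.1 i.2) g.1 (trS g.1 x.1.1) x.1.2 =
        ∑ j : T2 d, wt2 g i j • polyE (c j.1 j.2) 1 x.1.1 x.1.2 := by
  obtain ⟨W, hW, hcov⟩ := isCovStarPoly2_iff.mp hE
  obtain ⟨c, hc⟩ := exists_arrays (I := T2 d) (val := fun (m : Mono d Unit) (x : Cfg d N Unit) => m.val x) (sc := Cfg.scale 2 3)
    (l := fun m => ((2 : ℝ) : ℂ) ^ m.deg * ((3 : ℝ) : ℂ) ^ m.degE)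
    (k := 2 ^ 2) (k' := 3) (w := wt2) (P := fun c x => polyE c x.g x.a (x.l ()))
    (s := fun y : CFld d N N => ⟨(y.1.1, (3 : ℂ) • y.1.2), y.2.1, y.2.2.smul 3⟩)
    (fun m x => Mono.val_scale 2 3 x m) (fun i => wordS_mem_polys (N := N) (W i))
    (x := fun g y => ⟨g, trS g y.1.1, fun _ => y.1.2⟩)
    (fun g A => by
      simp only [Cfg.scale, Cfg.mk.injEq, true_and]
      exact ⟨funext fun μ => (trS_smul _ _ _ _).symm, by norm_num⟩)
    (fun g y i => by simpa only [trS_one] using hcov g _ _ y.2.1 y.2.2 i)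
    (fun g i j => by
      simp only [wt2, twice_val, Matrix.smul_apply, smul_eq_mul]; push_cast; ring)
    (fun i y => by
      obtain ⟨⟨A, e⟩, hA, ε, hε, he⟩ := y
      change e = _ at he
      subst he
      obtain ⟨a, ha, rfl⟩ := exists_potS hA
      simp only [trS_one, ← constS_three]
      refine Subtype.ext ((hW _ a (smooth_three hε) ha _ _).symm.trans
        ((app_three hl hε ha _ _).trans ?_))
      rw [hW _ a hε ha]
      rfl)
    fun Φ hΦ => exists_polyE (Submodule.span_mono (Set.image_mono fun m hm =>
      two_three_pow (a := m.deg) (b := m.degE) (n := 2) (k := 1) (by simpa using hm)) hΦ)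
  have h1 : ∀ (y : CFld d N N) i,
      wordS ⟨1, y.1.1, fun _ => y.1.2⟩ (W i) = polyE (c i) 1 y.1.1 y.1.2 := fun y i => by
    simpa only [trS_one, Units.val_one] using hc i 1 y
  refine ⟨fun μ ν => c (μ, ν), fun ε A hε hA μ ν => (hW ε A hε hA μ ν).trans
    (congrArg Subtype.val (h1 ⟨(_, _), isConst_potS hA, ε, hε, rfl⟩ _)), fun g y i => ?_⟩
  simpa only [h1 y] using (hc i g y).symm.trans (hcov g _ _ y.2.1 y.2.2 i)

/-- A covariant star polynomial in `A_μ, D_μ`, linear in a fundamental field, as an array of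
coefficients. -/
lemma arrays_F {C : CFun d N 1} (hC : IsCovStarPolyF C) :
    ∃ c : Fin d → Fin d → Fin 4 → T2 d → ℂ, (Rep2 C fun μ ν => polyF (c μ ν) 1) ∧
      ∀ (g : GL (Fin d) ℝ) (x : CFld d N 1) (i : T2 d), polyF (c i.1 i.2) g.1 (trS g.1 x.1.1) x.1.2 =
        ∑ j : T2 d, wt2 g i j • polyF (c j.1 j.2) 1 x.1.1 x.1.2 := by
  obtain ⟨W, hW, hcov⟩ := isCovStarPolyF_iff.mp hC
  obtain ⟨c, hc⟩ := exists_arrays (I := T2 d) (k := 2 ^ 2) (k' := 1) (s := id) (w := wt2)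
    (sc := fun x : Cfg d N Empty × SS d N 1 => (x.1.scale 2 3, x.2))
    (l := fun m : Mono d Empty × List (Fin d) => (2 : ℂ) ^ (m.1.deg + m.2.length))
    (val := fun m x => m.1.val x.1 ⋆ delL x.1.g m.2 x.2)
    (P := fun c x => polyF c x.1.g x.1.a x.2)
    (fun m x => by
      have h1 := delL_smul 2 (1 : ℂ) x.1.g m.2 x.2
      rw [one_smul, mul_one] at h1
      simp only [Mono.val_scale, m.1.degE_empty]
      change (_ • _) ⋆ delL ((2 : ℝ) • x.1.g) m.2 x.2 = _
      rw [h1, smul_mulS, mulS_smul, smul_smul]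
      congr 1
      push_cast
      ring) (fun i => fwordS_mem_fpolys (N := N) (W i))
    (x := fun g (y : CFld d N 1) => (⟨g, trS g y.1.1, Empty.elim⟩, y.1.2))
    (fun g A => by
      simp only [Cfg.scale, Cfg.mk.injEq, true_and, Prod.mk.injEq, and_true, id]
      exact ⟨funext fun μ => (trS_smul _ _ _ _).symm, funext fun l => l.elim⟩)
    (fun g y i => by simpa only [trS_one] using hcov g _ _ y.2.1 y.2.2 i)
    (fun g i j => by
      simp only [wt2, twice_val, Matrix.smul_apply, smul_eq_mul]; push_cast; ring)
    (fun _ _ => (one_smul _ _).symm) fun Φ hΦ => exists_polyF (Submodule.span_mono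
      (Set.image_mono fun m hm => (two_three_pow (a := m.1.deg + m.2.length) (b := 0) (n := 2)
        (k := 0) (by simpa using hm)).1) hΦ)
  have h1 : ∀ (y : CFld d N 1) i,
      fwordS ⟨1, y.1.1, Empty.elim⟩ y.1.2 (W i) = polyF (c i) 1 y.1.1 y.1.2 := fun y i => by
    simpa only [trS_one, Units.val_one] using hc i 1 y
  refine ⟨fun μ ν => c (μ, ν), fun φ A hφ hA μ ν => (hW φ A hφ hA μ ν).trans
    (congrArg Subtype.val (h1 ⟨(_, _), isConst_potS hA, φ, hφ, rfl⟩ _)), fun g y i => ?_⟩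
  simpa only [h1 y] using (hc i g y).symm.trans (hcov g _ _ y.2.1 y.2.2 i)

end Classes

/-! ### Plane waves -/

section Waves

variable {d N m : ℕ}

/-- The phase `k · x`. -/
def phase (k : Fin d → ℂ) (x : Pt d) : ℂ := ∑ μ, k μ * (x μ : ℂ)

lemma smooth_wave (k : Fin d → ℂ) (M : Mat N m) :
    Smooth fun x : Pt d => Complex.exp (phase k x) • M := by
  have h : ContDiff ℝ ∞ fun x : Pt d => phase k x := by
    unfold phase
    refine ContDiff.sum fun μ _ => contDiff_const.mul ?_
    exact Complex.ofRealCLM.contDiff.comp (contDiff_apply ℝ ℝ μ)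
  exact h.cexp.smul contDiff_const

/-- Plane waves. -/
def wave (k : Fin d → ℂ) (M : Mat N m) : SS d N m := constS (smooth_wave k M)

lemma pd_wave (k : Fin d → ℂ) (M : Mat N m) (μ : Fin d) (x : Pt d) :
    pd μ (fun x : Pt d => Complex.exp (phase k x) • M) x =
      k μ • (Complex.exp (phase k x) • M) := by
  have h1 : HasFDerivAt (phase k) (∑ ν, k ν • (Complex.ofRealCLM.comp
      (proj (R := ℝ) (φ := fun _ : Fin d => ℝ) ν))) x := by
    unfold phase
    refine HasFDerivAt.fun_sum fun ν _ => ?_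
    exact (Complex.ofRealCLM.comp
      (proj (R := ℝ) (φ := fun _ : Fin d => ℝ) ν)).hasFDerivAt.const_mul (k ν)
  have h2 := (h1.cexp.smul_const M).fderiv
  unfold pd
  rw [h2]
  simp [Pi.single_apply, smul_smul, apply_ite Complex.ofReal, mul_comm]

lemma pdSS_wave (k : Fin d → ℂ) (M : Mat N m) (μ : Fin d) :
    pdSS μ (wave k M) = k μ • wave k M := by
  refine Subtype.ext (funext fun J => funext fun x => ?_)
  change pd μ (const (fun x : Pt d => Complex.exp (phase k x) • M) J) x =
    k μ • const (fun x : Pt d => Complex.exp (phase k x) • M) J x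
  by_cases h : J = 0
  · simp only [const, h, if_true]
    exact pd_wave k M μ x
  · simp [const, h]

lemma dTS_wave (k : Fin d → ℂ) (M : Mat N m) (p : Idx d) : dTS p (wave k M) = 0 :=
  dTS_constS _ p

/-- A momentum eigenvector with a given phase in the direction `p`. -/
structure IsWave (p : Idx d) (k : Fin d → ℂ) (c : ℂ) {a b : ℕ} (f : SS d a b) : Prop where
  pd : ∀ μ, pdSS μ f = k μ • f
  dT : dTS p f = (Real.pi * I * c : ℂ) • f

lemma isWave_wave (p : Idx d) (k : Fin d → ℂ) (M : Mat N m) : IsWave p k 0 (wave k M) :=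
  ⟨pdSS_wave k M, by simp [dTS_wave]⟩

/-- The component of `k ∧ l` in the direction `p`. -/
def wdg (p : Idx d) (k l : Fin d → ℂ) : ℂ := k p.1.1 * l p.1.2 - k p.1.2 * l p.1.1

lemma IsWave.mul {p : Idx d} {k l : Fin d → ℂ} {c c' : ℂ} {a b e : ℕ} {f : SS d a b}
    {h : SS d b e} (hf : IsWave p k c f) (hh : IsWave p l c' h) :
    IsWave p (k + l) (c + c' + wdg p k l) (f ⋆ h) := by
  refine ⟨fun μ => ?_, ?_⟩
  · rw [pdSS_mulS, hf.pd, hh.pd, smul_mulS, mulS_smul, Pi.add_apply, add_smul]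
  · rw [dTS_mulS, hf.dT, hh.dT]
    simp only [hf.pd, hh.pd, smul_mulS, mulS_smul, wdg]
    module

lemma wave_zero_apply (k : Fin d → ℂ) (M : Mat N m) :
    (wave k M).1 0 = fun x => Complex.exp (phase k x) • M := by
  simp [wave, constS, const]

lemma mulS_apply_zero {a b e : ℕ} (f : SS d a b) (h : SS d b e) (x : Pt d) :
    (f ⋆ h).1 0 x = f.1 0 x * h.1 0 x := by
  rw [coe_mulS, star_apply_zero]

/-- Vectors with different phases are independent. -/
lemma eq_zero_of_waves {ι : Type} [Fintype ι] {p : Idx d} {a b : ℕ} {f : ι → SS d a b}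
    {k : ι → Fin d → ℂ} {c : ι → ℂ} (hf : ∀ i, IsWave p (k i) (c i) (f i)) (h0 : ∀ i, f i ≠ 0)
    (hc : Function.Injective c) {F : ι → ℂ} (h : ∑ i, F i • f i = 0) (i : ι) : F i = 0 := by
  have hpi : (Real.pi * I : ℂ) ≠ 0 :=
    mul_ne_zero (by exact_mod_cast Real.pi_ne_zero) Complex.I_ne_zero
  have hl := Module.End.eigenvectors_linearIndependent' (dTS p)
    (fun i => (Real.pi * I * c i : ℂ)) (fun i j hij => hc (mul_left_cancel₀ hpi hij)) f
    (fun i => ⟨Module.End.mem_eigenspace_iff.mpr (hf i).dT, h0 i⟩)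
  exact Fintype.linearIndependent_iff.mp hl F h i

end Waves

/-! ### Extraction of coefficients -/

section Extraction

open Filter Topology

variable {d N : ℕ}

lemma quad_ne_zero {A B C : ℂ} (hA : A ≠ 0) :
    ∀ᶠ s in 𝓝[≠] (0 : ℂ), A * s ^ 2 + B * s + C ≠ 0 := by
  let P : Polynomial ℂ := Polynomial.C A * Polynomial.X ^ 2 + Polynomial.C B * Polynomial.X +
    Polynomial.C C
  have hP : P ≠ 0 := by
    intro h
    have := congrArg (fun Q => Polynomial.coeff Q 2) h
    simp [P] at this
    exact hA this
  have h1 : ((P.roots.toFinset : Set ℂ) \ {0})ᶜ ∈ 𝓝 (0 : ℂ) :=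
    (P.roots.toFinset.finite_toSet.subset Set.sdiff_subset).isClosed.isOpen_compl.mem_nhds (by simp)
  filter_upwards [mem_nhdsWithin_of_mem_nhds h1, self_mem_nhdsWithin] with s hs hs0 h
  refine hs ⟨?_, hs0⟩
  simp only [Finset.mem_coe, Multiset.mem_toFinset, Polynomial.mem_roots hP, Polynomial.IsRoot]
  simpa [P] using h

lemma eq_zero_of_near {𝕜 : Type} [NontriviallyNormedField 𝕜] {f : 𝕜 → ℂ} (hf : Continuous f)
    (h : ∀ᶠ s in 𝓝[≠] (0 : 𝕜), f s = 0) :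
    f 0 = 0 := by
  have h1 : Tendsto f (𝓝[≠] 0) (𝓝 (f 0)) := hf.continuousAt.mono_left nhdsWithin_le_nhds
  exact tendsto_nhds_unique h1 (tendsto_const_nhds.congr' (h.mono fun s hs => hs.symm))

/-- Scalar plane waves. -/
def wv (N : ℕ) (k : Fin d → ℂ) : SS d N N := wave k 1

lemma pdSS_wv (k : Fin d → ℂ) (μ : Fin d) : pdSS μ (wv N k) = k μ • wv N k := pdSS_wave k 1 μ

lemma exp_smul_ne_zero {a b : ℕ} (z : ℂ) {M : Mat a b} (hM : M ≠ 0) :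
    Complex.exp z • M ≠ 0 := smul_ne_zero (Complex.exp_ne_zero z) hM

lemma wv_ne_zero (hN : 0 < N) (k : Fin d → ℂ) : wv N k ≠ 0 := by
  have : Nonempty (Fin N) := ⟨⟨0, hN⟩⟩
  intro h
  have := congrFun (congrFun (congrArg Subtype.val h) 0) 0
  rw [wv, wave_zero_apply] at this
  exact exp_smul_ne_zero _ one_ne_zero this

lemma wv2_ne_zero (hN : 0 < N) (k l : Fin d → ℂ) : wv N k ⋆ wv N l ≠ 0 := by
  have : Nonempty (Fin N) := ⟨⟨0, hN⟩⟩
  intro h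
  have := congrFun (congrFun (congrArg Subtype.val h) 0) 0
  rw [mulS_apply_zero, wv, wv, wave_zero_apply, wave_zero_apply, smul_mul_smul_comm, mul_one,
    ← Complex.exp_add] at this
  exact exp_smul_ne_zero _ one_ne_zero this

lemma wv3_ne_zero (hN : 0 < N) (k l q : Fin d → ℂ) : wv N k ⋆ (wv N l ⋆ wv N q) ≠ 0 := by
  have : Nonempty (Fin N) := ⟨⟨0, hN⟩⟩
  intro h
  have := congrFun (congrFun (congrArg Subtype.val h) 0) 0
  rw [mulS_apply_zero, mulS_apply_zero, wv, wv, wv, wave_zero_apply, wave_zero_apply,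
    wave_zero_apply, smul_mul_smul_comm, smul_mul_smul_comm, mul_one, mul_one, ← Complex.exp_add,
    ← Complex.exp_add] at this
  exact exp_smul_ne_zero _ one_ne_zero this

lemma extract_two (p : Idx d) (hN : 0 < N) {F G : (Fin d → ℂ) → (Fin d → ℂ) → ℂ}
    (hF : Continuous fun x : (Fin d → ℂ) × (Fin d → ℂ) => F x.1 x.2)
    (hG : Continuous fun x : (Fin d → ℂ) × (Fin d → ℂ) => G x.1 x.2)
    (h : ∀ k l, F k l • (wv N k ⋆ wv N l) + G k l • (wv N l ⋆ wv N k) = 0) (k l : Fin d → ℂ) :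
    F k l = 0 ∧ G k l = 0 := by
  have hne : p.1.1 ≠ p.1.2 := p.2.ne
  let k' : Fin d → ℂ := Pi.single p.1.1 1
  let l' : Fin d → ℂ := Pi.single p.1.2 1
  have hw : ∀ᶠ s in 𝓝[≠] (0 : ℂ), wdg p (k + s • k') (l + s • l') ≠ 0 := by
    filter_upwards [quad_ne_zero (A := 1) (B := l p.1.2 + k p.1.1) (C := wdg p k l) one_ne_zero]
      with s hs h
    refine hs (Eq.trans ?_ h)
    simp [wdg, k', l', hne, hne.symm]
    ring
  have key : ∀ᶠ s in 𝓝[≠] (0 : ℂ), ∀ i, (![F, G] i) (k + s • k') (l + s • l') = 0 := by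
    filter_upwards [hw] with s hs
    generalize k + s • k' = k at hs
    generalize l + s • l' = l at hs
    have := eq_zero_of_waves (ι := Fin 2) (p := p) (f := ![wv N k ⋆ wv N l, wv N l ⋆ wv N k])
      (k := ![k + l, l + k]) (c := ![0 + 0 + wdg p k l, 0 + 0 + wdg p l k])
      (F := ![F k l, G k l])
      (fun i => by
        fin_cases i
        · exact (isWave_wave p k 1).mul (isWave_wave p l 1)
        · exact (isWave_wave p l 1).mul (isWave_wave p k 1))
      (fun i => by fin_cases i <;> exact wv2_ne_zero hN _ _)
      (by
        have e : wdg p l k = -wdg p k l := by simp only [wdg]; ring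
        have h1 : wdg p k l ≠ -wdg p k l := fun e => hs (self_eq_neg.mp e)
        intro i j hij
        fin_cases i <;> fin_cases j <;> simp [e] at hij ⊢
        · exact h1 hij
        · exact h1 hij.symm)
      (by simpa [Fin.sum_univ_two] using h k l)
    intro i
    have := this i
    fin_cases i <;> simpa using this
  have hc : Continuous fun s : ℂ => (k + s • k', l + s • l') := by fun_prop
  have e : ∀ u v : Fin d → ℂ, u + (0 : ℂ) • v = u := fun u v => by simp
  constructor
  · have := eq_zero_of_near (hF.comp hc) (key.mono fun s hs => hs 0)
    simpa [e] using this
  · have := eq_zero_of_near (hG.comp hc) (key.mono fun s hs => hs 1)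
    simpa [e] using this

/-- The six orderings of three plane waves. -/
def six (N : ℕ) (k l q : Fin d → ℂ) : Fin 6 → SS d N N :=
  ![wv N k ⋆ (wv N l ⋆ wv N q), wv N k ⋆ (wv N q ⋆ wv N l), wv N l ⋆ (wv N k ⋆ wv N q),
    wv N l ⋆ (wv N q ⋆ wv N k), wv N q ⋆ (wv N k ⋆ wv N l), wv N q ⋆ (wv N l ⋆ wv N k)]

lemma six_signs_injective {a b c : ℂ} (ha : a ≠ 0) (hb : b ≠ 0) (hc : c ≠ 0) (hab : a + b ≠ 0)
    (hbc : b + c ≠ 0) (habc : a + b + c ≠ 0) (hac : a - c ≠ 0) (h1 : a + b - c ≠ 0)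
    (h2 : a - b - c ≠ 0) :
    Function.Injective ![a + b + c, a + b - c, -a + b + c, -a - b + c, a - b - c, -a - b - c] := by
  have two : ∀ z : ℂ, 2 * z = 0 → z = 0 := fun z hz => by simpa using hz
  intro i j hij
  fin_cases i <;> fin_cases j <;> first | rfl | (exfalso; simp at hij; first
    | exact ha (two _ (by linear_combination hij)) | exact ha (two _ (by linear_combination -hij))
    | exact hb (two _ (by linear_combination hij)) | exact hb (two _ (by linear_combination -hij))
    | exact hc (two _ (by linear_combination hij)) | exact hc (two _ (by linear_combination -hij))
    | exact hab (two _ (by linear_combination hij)) | exact hab (two _ (by linear_combination -hij))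
    | exact hbc (two _ (by linear_combination hij)) | exact hbc (two _ (by linear_combination -hij))
    | exact habc (two _ (by linear_combination hij))
    | exact habc (two _ (by linear_combination -hij))
    | exact hac (two _ (by linear_combination hij)) | exact hac (two _ (by linear_combination -hij))
    | exact h1 (two _ (by linear_combination hij)) | exact h1 (two _ (by linear_combination -hij))
    | exact h2 (two _ (by linear_combination hij)) | exact h2 (two _ (by linear_combination -hij)))

lemma extract_six (p : Idx d) (hN : 0 < N)
    {F : Fin 6 → (Fin d → ℂ) → (Fin d → ℂ) → (Fin d → ℂ) → ℂ}
    (hF : ∀ i, Continuous fun x : (Fin d → ℂ) × (Fin d → ℂ) × (Fin d → ℂ) => F i x.1 x.2.1 x.2.2)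
    (h : ∀ k l q, ∑ i, F i k l q • six N k l q i = 0) (i : Fin 6) (k l q : Fin d → ℂ) :
    F i k l q = 0 := by
  have hne : p.1.1 ≠ p.1.2 := p.2.ne
  let v : ℂ → ℂ → Fin d → ℂ := fun x y => x • Pi.single p.1.1 1 + y • Pi.single p.1.2 1
  have hw : ∀ (k l : Fin d → ℂ) (x y x' y' s : ℂ), wdg p (k + s • v x y) (l + s • v x' y') =
      (x * y' - y * x') * s ^ 2 + (k p.1.1 * y' + x * l p.1.2 - k p.1.2 * x' - y * l p.1.1) * s +
        wdg p k l := by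
    intro k l x y x' y' s
    simp [wdg, v, hne, hne.symm]
    ring
  let k' := v 1 0
  let l' := v 0 1
  let q' := v 4 2
  have key : ∀ᶠ s in 𝓝[≠] (0 : ℂ), F i (k + s • k') (l + s • l') (q + s • q') = 0 := by
    have gen : ∀ x y z : ℂ, x + 2 * y - 4 * z ≠ 0 → ∀ᶠ s in 𝓝[≠] (0 : ℂ),
        x * wdg p (k + s • k') (l + s • l') + y * wdg p (k + s • k') (q + s • q') +
          z * wdg p (l + s • l') (q + s • q') ≠ 0 := by
      intro x y z hxyz
      filter_upwards [quad_ne_zero (A := x + 2 * y - 4 * z)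
        (B := x * (k p.1.1 + l p.1.2) +
          y * (k p.1.1 * 2 + q p.1.2 - k p.1.2 * 4) +
          z * (l p.1.1 * 2 - l p.1.2 * 4 - q p.1.1))
        (C := x * wdg p k l + y * wdg p k q + z * wdg p l q) hxyz] with s hs h
      refine hs (Eq.trans ?_ h)
      simp only [k', l', q', hw]
      ring
    filter_upwards [gen 1 0 0 (by norm_num), gen 0 1 0 (by norm_num), gen 0 0 1 (by norm_num),
      gen 1 1 0 (by norm_num), gen 0 1 1 (by norm_num), gen 1 1 1 (by norm_num),
      gen 1 0 (-1) (by norm_num), gen 1 1 (-1) (by norm_num), gen 1 (-1) (-1) (by norm_num)]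
      with s a1 a2 a3 a4 a5 a6 a7 a8 a9
    generalize k + s • k' = k at *
    generalize l + s • l' = l at *
    generalize q + s • q' = q at *
    have e : ∀ k l : Fin d → ℂ, wdg p l k = -wdg p k l := fun k l => by simp only [wdg]; ring
    have e2 : ∀ k l q : Fin d → ℂ, wdg p k (l + q) = wdg p k l + wdg p k q := fun k l q => by
      simp only [wdg, Pi.add_apply]; ring
    have W : ∀ k l q : Fin d → ℂ, IsWave p (k + (l + q)) (wdg p k l + wdg p k q + wdg p l q)
        (wv N k ⋆ (wv N l ⋆ wv N q)) := by
      intro k l q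
      have := (isWave_wave p k (1 : Mat N N)).mul
        ((isWave_wave p l (1 : Mat N N)).mul (isWave_wave p q (1 : Mat N N)))
      refine ⟨this.pd, this.dT.trans ?_⟩
      rw [e2]
      congr 2
      ring
    refine eq_zero_of_waves (ι := Fin 6) (p := p) (f := six N k l q)
      (k := ![k + (l + q), k + (q + l), l + (k + q), l + (q + k), q + (k + l), q + (l + k)])
      (c := ![wdg p k l + wdg p k q + wdg p l q, wdg p k q + wdg p k l + wdg p q l,
        wdg p l k + wdg p l q + wdg p k q, wdg p l q + wdg p l k + wdg p q k,
        wdg p q k + wdg p q l + wdg p k l, wdg p q l + wdg p q k + wdg p l k])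
      (F := fun i => F i k l q) (fun i => by fin_cases i <;> exact W _ _ _)
      (fun i => by fin_cases i <;> exact wv3_ne_zero hN _ _ _) ?_ (h k l q) i
    rw [e k l, e k q, e l q]
    convert six_signs_injective (a := wdg p k l) (b := wdg p k q) (c := wdg p l q)
      (by simpa using a1) (by simpa using a2) (by simpa using a3) (by simpa using a4)
      (by simpa using a5) (by simpa using a6) (by simpa [sub_eq_add_neg] using a7)
      (by simpa [sub_eq_add_neg] using a8) (by simpa [sub_eq_add_neg] using a9) using 2
    ring_nf
  have hc : Continuous fun s : ℂ => (k + s • k', l + s • l', q + s • q') := by fun_prop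
  have e : ∀ u v : Fin d → ℂ, u + (0 : ℂ) • v = u := fun u v => by simp
  have := eq_zero_of_near ((hF i).comp hc) key
  simpa [e] using this

end Extraction

section Symbols

open Filter Topology

variable {d N : ℕ}

lemma isConst_wave {m : ℕ} (k : Fin d → ℂ) (M : Mat N m) : IsConst (wave k M) :=
  ⟨_, smooth_wave k M, rfl⟩

lemma isConst_wv (k : Fin d → ℂ) : IsConst (wv N k) := isConst_wave k 1

/-- Action of a matrix on momenta. -/
def mv (g : SqM d) (k : Fin d → ℂ) (μ : Fin d) : ℂ := ∑ ν, (g μ ν : ℂ) * k ν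

lemma mv_zero (g : SqM d) : mv g 0 = 0 := by
  ext1 μ; simp [mv]

lemma mv_one (k : Fin d → ℂ) : mv 1 k = k := by
  ext1 μ; simp [mv, Matrix.one_apply, apply_ite Complex.ofReal]

lemma mv_smul (g : SqM d) (s : ℂ) (k : Fin d → ℂ) :
    mv g (s • k) = s • mv g k := by
  ext1 μ; simp [mv, mul_sum, mul_left_comm]

lemma del_wave {m : ℕ} (g : SqM d) (μ : Fin d) (k : Fin d → ℂ)
    (M : Mat N m) : del g μ (wave k M) = mv g k μ • wave k M := by
  simp [del, mv, pdSS_wave, sum_smul, mul_smul]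

lemma del_wv (g : SqM d) (μ : Fin d) (k : Fin d → ℂ) :
    del g μ (wv N k) = mv g k μ • wv N k := del_wave g μ k 1

lemma trS_wv (g : SqM d) (v k : Fin d → ℂ) :
    trS g (fun μ => v μ • wv N k) = fun μ => mv g v μ • wv N k := by
  ext1 μ
  simp only [trS, mv, sum_smul, mul_smul]

/-- Bilinear form of an array. -/
def s2 (c : T2 d → ℂ) (x y : Fin d → ℂ) : ℂ := lc c fun i => x i.1 * y i.2

/-- Trilinear form of an array. -/
def s3 (c : T3 d → ℂ) (x y z : Fin d → ℂ) : ℂ := lc c fun i => x i.1 * (y i.2.1 * z i.2.2)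

@[fun_prop] theorem continuous_s2 {X : Type} [TopologicalSpace X] (c : T2 d → ℂ)
    {x y : X → Fin d → ℂ} (hx : Continuous x) (hy : Continuous y) :
    Continuous fun t => s2 c (x t) (y t) := by
  unfold s2 lc
  fun_prop

@[fun_prop] theorem continuous_s3 {X : Type} [TopologicalSpace X] (c : T3 d → ℂ)
    {x y z : X → Fin d → ℂ} (hx : Continuous x) (hy : Continuous y) (hz : Continuous z) :
    Continuous fun t => s3 c (x t) (y t) (z t) := by
  unfold s3 lc
  fun_prop

@[fun_prop] theorem continuous_mv {X : Type} [TopologicalSpace X]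
    {g : X → SqM d} (hg : Continuous g) {k : X → Fin d → ℂ}
    (hk : Continuous k) : Continuous fun t => mv (g t) (k t) := by
  unfold mv
  refine continuous_pi fun μ => continuous_finsetSum _ fun ν _ => ?_
  have : Continuous fun t => g t μ ν := (continuous_apply ν).comp ((continuous_apply μ).comp hg)
  fun_prop

lemma s2_zero_left (c : T2 d → ℂ) (y : Fin d → ℂ) : s2 c 0 y = 0 := by simp [s2, lc]

lemma s2_zero_right (c : T2 d → ℂ) (y : Fin d → ℂ) : s2 c y 0 = 0 := by simp [s2, lc]

lemma s3_zero₁ (c : T3 d → ℂ) (x y : Fin d → ℂ) : s3 c 0 x y = 0 := by simp [s3, lc]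

lemma s3_zero₂ (c : T3 d → ℂ) (x y : Fin d → ℂ) : s3 c x 0 y = 0 := by simp [s3, lc]

lemma s3_zero₃ (c : T3 d → ℂ) (x y : Fin d → ℂ) : s3 c x y 0 = 0 := by simp [s3, lc]

lemma s2_smul_right (c : T2 d → ℂ) (s : ℂ) (x y : Fin d → ℂ) : s2 c x (s • y) = s * s2 c x y := by
  simp only [s2, ← smul_eq_mul (a := s), ← lc_smul]
  congr 1
  ext1 i
  simp
  ring

lemma s2_smul_left (c : T2 d → ℂ) (s : ℂ) (x y : Fin d → ℂ) : s2 c (s • x) y = s * s2 c x y := by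
  simp only [s2, ← smul_eq_mul (a := s), ← lc_smul]
  congr 1
  ext1 i
  simp
  ring

lemma s3_smul₁ (c : T3 d → ℂ) (s : ℂ) (x y z : Fin d → ℂ) :
    s3 c (s • x) y z = s * s3 c x y z := by
  simp only [s3, ← smul_eq_mul (a := s), ← lc_smul]
  congr 1
  ext1 i
  simp
  ring

lemma s3_smul₂ (c : T3 d → ℂ) (s : ℂ) (x y z : Fin d → ℂ) :
    s3 c x (s • y) z = s * s3 c x y z := by
  simp only [s3, ← smul_eq_mul (a := s), ← lc_smul]
  congr 1
  ext1 i
  simp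
  ring

lemma s3_smul₃ (c : T3 d → ℂ) (s : ℂ) (x y z : Fin d → ℂ) :
    s3 c x y (s • z) = s * s3 c x y z := by
  simp only [s3, ← smul_eq_mul (a := s), ← lc_smul]
  congr 1
  ext1 i
  simp
  ring

lemma s2_single (c : T2 d → ℂ) (a b : Fin d) : s2 c (Pi.single a 1) (Pi.single b 1) = c (a, b) := by
  simp [s2, lc, Fintype.sum_prod_type, Pi.single_apply]

lemma s3_single (c : T3 d → ℂ) (a b e : Fin d) :
    s3 c (Pi.single a 1) (Pi.single b 1) (Pi.single e 1) = c (a, b, e) := by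
  simp [s3, lc, Fintype.sum_prod_type, Pi.single_apply]

lemma polyD_wave (c : Fin 4 → T3 d → ℂ) (g : SqM d) (p v : Fin d → ℂ) :
    polyD c g (fun μ => v μ • wv N p) = s3 (c 0) (mv g p) (mv g p) v • wv N p +
      (s3 (c 1) (mv g p) v v + s3 (c 2) v (mv g p) v) • (wv N p ⋆ wv N p) +
      s3 (c 3) v v v • (wv N p ⋆ (wv N p ⋆ wv N p)) := by
  simp only [polyD, s3, add_smul, ← add_assoc]
  refine congrArg₂ (· + ·) (congrArg₂ (· + ·) (congrArg₂ (· + ·) ?_ ?_) ?_) ?_ <;>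
    refine Eq.trans (congrArg _ (funext fun i => ?_)) (lc_smul_const _ _ _) <;>
    simp only [map_smul, del_wv, smul_mulS, mulS_smul, smul_smul] <;> module

lemma polyE_wave (c : Fin 8 → T2 d → ℂ) (g : SqM d) (k p v : Fin d → ℂ) :
    polyE c g (fun μ => v μ • wv N p) (wv N k) = s2 (c 0) (mv g k) (mv g k) • wv N k +
      ((s2 (c 1) (mv g k) v + s2 (c 4) (mv g p) v) • (wv N k ⋆ wv N p) +
        (s2 (c 2) v (mv g k) + s2 (c 3) (mv g p) v) • (wv N p ⋆ wv N k)) +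
      (s2 (c 5) v v • (wv N p ⋆ (wv N p ⋆ wv N k)) + s2 (c 6) v v • (wv N p ⋆ (wv N k ⋆ wv N p)) +
        s2 (c 7) v v • (wv N k ⋆ (wv N p ⋆ wv N p))) := by
  simp only [polyE, map_smul, del_wv, smul_mulS, mulS_smul, smul_smul, lc_smul_const, s2]
  simp only [mul_comm]
  module

lemma polyF_wave (c : Fin 4 → T2 d → ℂ) (g : SqM d) (k p v : Fin d → ℂ)
    (M : Mat N 1) :
    polyF c g (fun μ => v μ • wv N p) (wave k M) = s2 (c 0) (mv g k) (mv g k) • wave k M +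
      (s2 (c 1) (mv g p) v + s2 (c 2) v (mv g k)) • (wv N p ⋆ wave k M) +
      s2 (c 3) v v • (wv N p ⋆ (wv N p ⋆ wave k M)) := by
  simp only [polyF, map_smul, del_wv, del_wave, smul_mulS, mulS_smul, smul_smul, lc_smul_const, s2]
  simp only [mul_comm]
  module

lemma wave_ne_zero {m : ℕ} (k : Fin d → ℂ) {M : Mat N m} (hM : M ≠ 0) : wave k M ≠ 0 := by
  intro h
  have := congrFun (congrFun (congrArg Subtype.val h) 0) 0
  rw [wave_zero_apply] at this
  exact exp_smul_ne_zero _ hM this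

lemma wv_mulS_wave_ne_zero {m : ℕ} (k l : Fin d → ℂ) {M : Mat N m} (hM : M ≠ 0) :
    wv N k ⋆ wave l M ≠ 0 := by
  intro h
  have := congrFun (congrFun (congrArg Subtype.val h) 0) 0
  rw [mulS_apply_zero, wv, wave_zero_apply, wave_zero_apply] at this
  simp only [Matrix.smul_mul, Matrix.mul_smul, Matrix.one_mul, smul_smul, ← Complex.exp_add] at this
  exact exp_smul_ne_zero _ hM this

variable {J : Type} [Fintype J] (r : J → ℂ) (g : J → SqM d)

lemma symbol_D (hN : 0 < N) (c : J → Fin 4 → T3 d → ℂ)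
    (h : ∀ A : Fin d → SS d N N, (∀ μ, IsConst (A μ)) →
      ∑ j, r j • polyD (c j) (g j) (trS (g j) A) = 0) (p v : Fin d → ℂ) :
    ∑ j, r j * s3 (c j 0) (mv (g j) p) (mv (g j) p) (mv (g j) v) = 0 := by
  have h1 : ∀ s : ℂ, ∑ j, r j • polyD (c j) (g j) (trS (g j) fun μ => (s • v) μ • wv N p) = 0 :=
    fun s => h _ fun μ => (isConst_wv p).smul _
  simp only [trS_wv, polyD_wave, mv_smul, s3_smul₁, s3_smul₂, s3_smul₃, smul_add, smul_smul,
    sum_add_distrib, ← sum_smul, ← mul_add, mul_left_comm (r _), ← mul_sum]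
    at h1
  have h2 : (∑ j, r j * s3 (c j 0) (mv (g j) p) (mv (g j) p) (mv (g j) v)) • wv N p = 0 := by
    linear_combination (norm := module) h1 1 - (1 / 3 : ℂ) • h1 (-1) - (1 / 6 : ℂ) • h1 2
  exact (smul_eq_zero.mp h2).resolve_right (wv_ne_zero hN p)

lemma symbol_E (p : Idx d) (hN : 0 < N) (c : J → Fin 8 → T2 d → ℂ)
    (h : ∀ (A : Fin d → SS d N N) (e : SS d N N), (∀ μ, IsConst (A μ)) → IsConst e →
      ∑ j, r j • polyE (c j) (g j) (trS (g j) A) e = 0) (k l v : Fin d → ℂ) :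
    ∑ j, r j * s2 (c j 0) (mv (g j) k) (mv (g j) k) = 0 ∧
    ∑ j, r j * (s2 (c j 1) (mv (g j) k) (mv (g j) v) + s2 (c j 4) (mv (g j) l) (mv (g j) v)) = 0 ∧
    ∑ j, r j * (s2 (c j 2) (mv (g j) v) (mv (g j) k) + s2 (c j 3) (mv (g j) l) (mv (g j) v)) = 0 := by
  have h1 : ∀ (k l : Fin d → ℂ) (s : ℂ), ∑ j, r j • polyE (c j) (g j)
      (trS (g j) fun μ => (s • v) μ • wv N l) (wv N k) = 0 :=
    fun k l s => h _ _ (fun μ => (isConst_wv l).smul _) (isConst_wv k)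
  simp only [trS_wv, polyE_wave, mv_smul, s2_smul_left, s2_smul_right, smul_add, smul_smul,
    sum_add_distrib, ← sum_smul, ← mul_add, mul_left_comm (r _), ← mul_sum]
    at h1
  have h2 : ∀ k l : Fin d → ℂ,
      (∑ j, r j * (s2 (c j 1) (mv (g j) k) (mv (g j) v) + s2 (c j 4) (mv (g j) l) (mv (g j) v))) •
        (wv N k ⋆ wv N l) +
      (∑ j, r j * (s2 (c j 2) (mv (g j) v) (mv (g j) k) + s2 (c j 3) (mv (g j) l) (mv (g j) v))) •
        (wv N l ⋆ wv N k) = 0 := fun k l => by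
    linear_combination (norm := module) (1 / 2 : ℂ) • h1 k l 1 - (1 / 2 : ℂ) • h1 k l (-1)
  have h3 : (∑ j, r j * s2 (c j 0) (mv (g j) k) (mv (g j) k)) • wv N k = 0 := by
    linear_combination (norm := module) h1 k l 0
  exact ⟨(smul_eq_zero.mp h3).resolve_right (wv_ne_zero hN k),
    extract_two p hN (by fun_prop) (by fun_prop) h2 k l⟩

lemma symbol_F (hN : 0 < N) (c : J → Fin 4 → T2 d → ℂ)
    (h : ∀ (A : Fin d → SS d N N) (f : SS d N 1), (∀ μ, IsConst (A μ)) → IsConst f →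
      ∑ j, r j • polyF (c j) (g j) (trS (g j) A) f = 0) (k l v : Fin d → ℂ) :
    ∑ j, r j * s2 (c j 0) (mv (g j) k) (mv (g j) k) = 0 ∧
    ∑ j, r j * (s2 (c j 1) (mv (g j) l) (mv (g j) v) + s2 (c j 2) (mv (g j) v) (mv (g j) k)) =
      0 := by
  obtain ⟨M, hM⟩ : ∃ M : Mat N 1, M ≠ 0 := ⟨Matrix.of fun _ _ => 1, fun h => by
    simpa using congrFun (congrFun h ⟨0, hN⟩) 0⟩
  have h1 : ∀ s : ℂ, ∑ j, r j • polyF (c j) (g j)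
      (trS (g j) fun μ => (s • v) μ • wv N l) (wave k M) = 0 :=
    fun s => h _ _ (fun μ => (isConst_wv l).smul _) (isConst_wave k _)
  simp only [trS_wv, polyF_wave, mv_smul, s2_smul_left, s2_smul_right, smul_add, smul_smul,
    sum_add_distrib, ← sum_smul, ← mul_add, mul_left_comm (r _), ← mul_sum]
    at h1
  have h2 : (∑ j, r j * (s2 (c j 1) (mv (g j) l) (mv (g j) v) +
      s2 (c j 2) (mv (g j) v) (mv (g j) k))) • (wv N l ⋆ wave k M) = 0 := by
    linear_combination (norm := module) (1 / 2 : ℂ) • h1 1 - (1 / 2 : ℂ) • h1 (-1)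
  have h3 : (∑ j, r j * s2 (c j 0) (mv (g j) k) (mv (g j) k)) •
      wave k M = 0 := by
    linear_combination (norm := module) h1 0
  exact ⟨(smul_eq_zero.mp h3).resolve_right (wave_ne_zero k hM),
    (smul_eq_zero.mp h2).resolve_right (wv_mulS_wave_ne_zero l k hM)⟩

end Symbols

/-! ### Covariant arrays -/

section Covariance

open Filter Topology

variable {d : ℕ}

lemma eq_zero_of_forall_GL {f : SqM d → ℂ} (hf : Continuous f)
    (h : ∀ g : GL (Fin d) ℝ, f g.1 = 0) (g : SqM d) : f g = 0 := by
  have h1 : (((-g).charpoly.roots.toFinset : Set ℝ) \ {0})ᶜ ∈ 𝓝 (0 : ℝ) :=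
    ((-g).charpoly.roots.toFinset.finite_toSet.subset
      Set.sdiff_subset).isClosed.isOpen_compl.mem_nhds (by simp)
  have h2 : ∀ᶠ s in 𝓝[≠] (0 : ℝ), f (g + s • (1 : SqM d)) = 0 := by
    filter_upwards [mem_nhdsWithin_of_mem_nhds h1, self_mem_nhdsWithin] with s hs hs0
    have hdet : (g + s • (1 : SqM d)).det ≠ 0 := by
      intro h
      refine hs ⟨?_, hs0⟩
      simp only [Finset.mem_coe, Multiset.mem_toFinset,
        Polynomial.mem_roots (Matrix.charpoly_monic _).ne_zero, Polynomial.IsRoot,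
        Matrix.eval_charpoly]
      rw [← h]
      congr 1
      rw [sub_neg_eq_add, add_comm, Matrix.scalar_apply, ← Matrix.smul_one_eq_diagonal]
    exact h (Matrix.GeneralLinearGroup.mkOfDetNeZero _ hdet)
  have hc : Continuous fun s : ℝ => f (g + s • (1 : SqM d)) :=
    hf.comp (by fun_prop)
  simpa using eq_zero_of_near hc h2

/-- Real vectors as complex vectors. -/
def rc (x : Fin d → ℝ) (μ : Fin d) : ℂ := (x μ : ℂ)

lemma rc_single (a : Fin d) : rc (Pi.single a 1) = Pi.single a 1 := by
  ext1 μ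
  simp [rc, Pi.single_apply, apply_ite Complex.ofReal]

lemma rc_add (x y : Fin d → ℝ) : rc (x + y) = rc x + rc y := by
  ext1 μ; simp [rc]

lemma rc_smul (s : ℝ) (x : Fin d → ℝ) : rc (s • x) = (s : ℂ) • rc x := by
  ext1 μ; simp [rc]

/-- A matrix with two prescribed columns. -/
def frame (p : Idx d) (x y : Fin d → ℝ) : SqM d :=
  Matrix.of fun μ μ' => if μ' = p.1.1 then x μ else if μ' = p.1.2 then y μ else 0

lemma frame_sum (p : Idx d) (x y : Fin d → ℝ) (μ : Fin d) (X : Fin d → ℂ) :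
    ∑ μ', ((frame p x y μ μ' : ℝ) : ℂ) * X μ' = rc x μ * X p.1.1 + rc y μ * X p.1.2 := by
  have hne : p.1.1 ≠ p.1.2 := p.2.ne
  have : ∀ μ', ((frame p x y μ μ' : ℝ) : ℂ) * X μ' =
      (if μ' = p.1.1 then rc x μ * X μ' else 0) + (if μ' = p.1.2 then rc y μ * X μ' else 0) := by
    intro μ'
    by_cases h : μ' = p.1.1
    · have h' : μ' ≠ p.1.2 := fun e => hne (h.symm.trans e)
      simp [frame, h, rc, hne]
    · by_cases h' : μ' = p.1.2 <;> simp [frame, h, h', rc, hne.symm]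
  simp only [this, sum_add_distrib, Finset.sum_ite_eq', mem_univ, if_true]

lemma mv_frame_fst (p : Idx d) (x y : Fin d → ℝ) :
    mv (frame p x y) (Pi.single p.1.1 1) = rc x := by
  have hne : p.1.1 ≠ p.1.2 := p.2.ne
  ext1 μ
  simp [mv, frame_sum, hne.symm]

lemma mv_frame_snd (p : Idx d) (x y : Fin d → ℝ) :
    mv (frame p x y) (Pi.single p.1.2 1) = rc y := by
  have hne : p.1.1 ≠ p.1.2 := p.2.ne
  ext1 μ
  simp [mv, frame_sum, hne]

lemma s2_add_left (c : T2 d → ℂ) (x x' y : Fin d → ℂ) :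
    s2 c (x + x') y = s2 c x y + s2 c x' y := by
  simp only [s2, ← lc_add, Pi.add_apply, add_mul]

lemma s2_add_right (c : T2 d → ℂ) (x y y' : Fin d → ℂ) :
    s2 c x (y + y') = s2 c x y + s2 c x y' := by
  simp only [s2, ← lc_add, Pi.add_apply, mul_add]

lemma s3_add₁ (c : T3 d → ℂ) (x x' y z : Fin d → ℂ) :
    s3 c (x + x') y z = s3 c x y z + s3 c x' y z := by
  simp only [s3, ← lc_add, Pi.add_apply, add_mul]

lemma s3_add₂ (c : T3 d → ℂ) (x y y' z : Fin d → ℂ) :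
    s3 c x (y + y') z = s3 c x y z + s3 c x y' z := by
  simp only [s3, ← lc_add, Pi.add_apply, mul_add, add_mul]

lemma lc_eq_zero_of_perm {ι V : Type} [Fintype ι] [AddCommGroup V] [Module ℂ V] {c : ι → ℂ}
    {u : ι → V} (σ : Equiv.Perm ι) (hc : ∀ i, c i + c (σ i) = 0) (hu : ∀ i, u (σ i) = u i) :
    lc c u = 0 := by
  have h1 : lc c u = ∑ i, c (σ i) • u (σ i) := (Equiv.sum_comp σ fun i => c i • u i).symm
  have h2 : lc c u + lc c u = 0 := by
    nth_rw 2 [h1]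
    rw [lc, ← sum_add_distrib]
    refine Finset.sum_eq_zero fun i _ => ?_
    rw [hu, ← add_smul, hc, zero_smul]
  rw [← two_smul ℂ] at h2
  exact (smul_eq_zero.mp h2).resolve_left two_ne_zero

lemma lc_eq_zero_of_s2 {V : Type} [AddCommGroup V] [Module ℂ V] {c : T2 d → ℂ}
    (h : ∀ x, s2 c (rc x) (rc x) = 0) {u : T2 d → V} (hu : ∀ a b, u (a, b) = u (b, a)) :
    lc c u = 0 := by
  refine lc_eq_zero_of_perm (Equiv.prodComm _ _) (fun ⟨a, b⟩ => ?_) fun ⟨a, b⟩ => hu b a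
  have h1 := h (Pi.single a 1 + Pi.single b 1)
  have h2 := h (Pi.single a 1)
  have h3 := h (Pi.single b 1)
  simp only [rc_add, rc_single, s2_add_left, s2_add_right, s2_single] at h1 h2 h3
  change c (a, b) + c (b, a) = 0
  linear_combination h1 - h2 - h3

lemma lc_eq_zero_of_s3 {V : Type} [AddCommGroup V] [Module ℂ V] {c : T3 d → ℂ}
    (h : ∀ x y, s3 c (rc x) (rc x) (rc y) = 0) {u : T3 d → V}
    (hu : ∀ a b e, u (a, b, e) = u (b, a, e)) : lc c u = 0 := by
  let σ : Equiv.Perm (T3 d) :=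
    ⟨fun i => (i.2.1, i.1, i.2.2), fun i => (i.2.1, i.1, i.2.2), fun _ => rfl, fun _ => rfl⟩
  refine lc_eq_zero_of_perm σ (fun ⟨a, b, e⟩ => ?_) fun ⟨a, b, e⟩ => hu b a e
  have h1 := h (Pi.single a 1 + Pi.single b 1) (Pi.single e 1)
  have h2 := h (Pi.single a 1) (Pi.single e 1)
  have h3 := h (Pi.single b 1) (Pi.single e 1)
  simp only [rc_add, rc_single, s3_add₁, s3_add₂, s3_single] at h1 h2 h3
  change c (a, b, e) + c (b, a, e) = 0
  linear_combination h1 - h2 - h3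

lemma covariant_sym (p : Idx d) {T : Fin d → Fin d → T2 d → ℂ}
    (hcov : ∀ (g : GL (Fin d) ℝ) x μ ν, s2 (T μ ν) (mv g.1 x) (mv g.1 x) =
      ∑ μ', ∑ ν', ((g.1 μ μ' * g.1 ν ν' : ℝ) : ℂ) * s2 (T μ' ν') x x)
    (hanti : ∀ μ ν x, s2 (T μ ν) x x = -s2 (T ν μ) x x) (μ ν : Fin d) {V : Type} [AddCommGroup V]
    [Module ℂ V] {u : T2 d → V} (hu : ∀ a b, u (a, b) = u (b, a)) : lc (T μ ν) u = 0 := by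
  refine lc_eq_zero_of_s2 (fun x => ?_) hu
  have h1 := eq_zero_of_forall_GL (f := fun g => s2 (T μ ν) (mv g (Pi.single p.1.1 1))
      (mv g (Pi.single p.1.1 1)) - ∑ μ', ∑ ν', ((g μ μ' * g ν ν' : ℝ) : ℂ) *
        s2 (T μ' ν') (Pi.single p.1.1 1) (Pi.single p.1.1 1))
    (by fun_prop) (fun g => sub_eq_zero.mpr (hcov g _ μ ν)) (frame p x 0)
  simp only [mv_frame_fst, Complex.ofReal_mul, mul_assoc, ← mul_sum, frame_sum] at h1
  have h2 := hanti p.1.1 p.1.1 (Pi.single p.1.1 1)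
  have h3 : s2 (T p.1.1 p.1.1) (Pi.single p.1.1 1) (Pi.single p.1.1 1) = 0 := by
    linear_combination h2 / 2
  have h4 : ∀ μ, rc (0 : Fin d → ℝ) μ = 0 := fun μ => by simp [rc]
  simpa [h3, h4] using h1

lemma covariant_two (p : Idx d) {T : Fin d → Fin d → T2 d → ℂ}
    (hcov : ∀ (g : GL (Fin d) ℝ) x y μ ν, s2 (T μ ν) (mv g.1 x) (mv g.1 y) =
      ∑ μ', ∑ ν', ((g.1 μ μ' * g.1 ν ν' : ℝ) : ℂ) * s2 (T μ' ν') x y)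
    (hanti : ∀ μ ν x y, s2 (T μ ν) x y = -s2 (T ν μ) x y) :
    ∃ t : ℂ, ∀ μ ν, T μ ν = t • (Pi.single (μ, ν) 1 - Pi.single (ν, μ) 1) := by
  refine ⟨s2 (T p.1.1 p.1.2) (Pi.single p.1.1 1) (Pi.single p.1.2 1), fun μ ν => ?_⟩
  ext1 ⟨a, b⟩
  have h1 := eq_zero_of_forall_GL (f := fun g => s2 (T μ ν) (mv g (Pi.single p.1.1 1))
      (mv g (Pi.single p.1.2 1)) - ∑ μ', ∑ ν', ((g μ μ' * g ν ν' : ℝ) : ℂ) *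
        s2 (T μ' ν') (Pi.single p.1.1 1) (Pi.single p.1.2 1))
    (by fun_prop) (fun g => sub_eq_zero.mpr (hcov g _ _ μ ν))
    (frame p (Pi.single a 1) (Pi.single b 1))
  simp only [mv_frame_fst, mv_frame_snd, Complex.ofReal_mul, mul_assoc, ← mul_sum,
    frame_sum, rc_single] at h1
  rw [s2_single] at h1
  have h2 := hanti p.1.1 p.1.1 (Pi.single p.1.1 1) (Pi.single p.1.2 1)
  have h3 := hanti p.1.2 p.1.2 (Pi.single p.1.1 1) (Pi.single p.1.2 1)
  have h4 := hanti p.1.1 p.1.2 (Pi.single p.1.1 1) (Pi.single p.1.2 1)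
  have e : ∀ x y z w : Fin d, (Pi.single (x, y) 1 : T2 d → ℂ) (z, w) =
      (Pi.single z 1 : Fin d → ℂ) x * (Pi.single w 1 : Fin d → ℂ) y := by
    intro x y z w
    by_cases h : z = x <;> simp [Pi.single_apply, ite_and, @eq_comm _ x z, @eq_comm _ y w, h]
  simp only [Pi.smul_apply, Pi.sub_apply, smul_eq_mul, e]
  generalize (Pi.single a 1 : Fin d → ℂ) μ = aμ at *
  generalize (Pi.single a 1 : Fin d → ℂ) ν = aν at *
  generalize (Pi.single b 1 : Fin d → ℂ) μ = bμ at *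
  generalize (Pi.single b 1 : Fin d → ℂ) ν = bν at *
  linear_combination h1 + aμ * aν / 2 * h2 + bμ * bν / 2 * h3 + bμ * aν * h4

lemma covariant_three (p : Idx d) {T : Fin d → Fin d → Fin d → T3 d → ℂ}
    (hcov : ∀ (g : GL (Fin d) ℝ) x y μ ν κ, s3 (T μ ν κ) (mv g.1 x) (mv g.1 x) (mv g.1 y) =
      ∑ μ', ∑ ν', ∑ κ', ((g.1 μ μ' * g.1 ν ν' * g.1 κ κ' : ℝ) : ℂ) * s3 (T μ' ν' κ') x x y)
    (hanti : ∀ μ ν κ x y, s3 (T μ ν κ) x x y = -s3 (T ν μ κ) x x y) :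
    ∃ t : ℂ, ∀ μ ν κ {V : Type} [AddCommGroup V] [Module ℂ V] (u : T3 d → V),
      (∀ a b e, u (a, b, e) = u (b, a, e)) →
        lc (T μ ν κ) u = t • (u (κ, μ, ν) - u (κ, ν, μ)) := by
  have hne : p.1.1 ≠ p.1.2 := p.2.ne
  let S : Fin d → Fin d → Fin d → ℂ := fun μ ν κ =>
    s3 (T μ ν κ) (Pi.single p.1.1 1) (Pi.single p.1.1 1) (Pi.single p.1.2 1)
  have h1 : ∀ μ ν κ x y, s3 (T μ ν κ) (rc x) (rc x) (rc y) =
      (rc x μ * rc y ν - rc y μ * rc x ν) *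
        (rc x κ * S p.1.1 p.1.2 p.1.1 + rc y κ * S p.1.1 p.1.2 p.1.2) := by
    intro μ ν κ x y
    have h1 := eq_zero_of_forall_GL (f := fun g => s3 (T μ ν κ) (mv g (Pi.single p.1.1 1))
        (mv g (Pi.single p.1.1 1)) (mv g (Pi.single p.1.2 1)) -
        ∑ μ', ∑ ν', ∑ κ', ((g μ μ' * g ν ν' * g κ κ' : ℝ) : ℂ) * S μ' ν' κ')
      (by fun_prop) (fun g => sub_eq_zero.mpr (hcov g _ _ μ ν κ)) (frame p x y)
    simp only [mv_frame_fst, mv_frame_snd, Complex.ofReal_mul, mul_assoc, ← mul_sum,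
      frame_sum] at h1
    have h2 : ∀ μ ν κ, S μ ν κ = -S ν μ κ := fun μ ν κ => hanti μ ν κ _ _
    linear_combination h1 + rc x μ * rc x ν / 2 * (rc x κ * h2 p.1.1 p.1.1 p.1.1 +
      rc y κ * h2 p.1.1 p.1.1 p.1.2) + rc y μ * rc y ν / 2 * (rc x κ * h2 p.1.2 p.1.2 p.1.1 +
      rc y κ * h2 p.1.2 p.1.2 p.1.2) + rc y μ * rc x ν * (rc x κ * h2 p.1.2 p.1.1 p.1.1 +
      rc y κ * h2 p.1.2 p.1.1 p.1.2)
  have h2 : S p.1.1 p.1.2 p.1.2 = 0 := by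
    have h3 := h1 p.1.1 p.1.2 p.1.2 (Pi.single p.1.1 1) ((2 : ℝ) • Pi.single p.1.2 1)
    have h4 := h1 p.1.1 p.1.2 p.1.2 (Pi.single p.1.1 1) (Pi.single p.1.2 1)
    rw [rc_smul, s3_smul₃, rc_single, rc_single] at h3
    rw [rc_single, rc_single] at h4
    simp [hne, hne.symm] at h3 h4
    linear_combination h4 - h3
  refine ⟨S p.1.1 p.1.2 p.1.1, fun μ ν κ V _ _ u hu => ?_⟩
  have h3 : lc (T μ ν κ - S p.1.1 p.1.2 p.1.1 • (Pi.single (κ, μ, ν) 1 - Pi.single (κ, ν, μ) 1))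
      u = 0 := by
    refine lc_eq_zero_of_s3 (fun x y => ?_) hu
    rw [s3, lc_sub_left, lc_smul_left, lc_sub_left, lc_single, lc_single]
    have := h1 μ ν κ x y
    rw [h2, s3] at this
    rw [this]
    simp only [smul_eq_mul]
    ring
  rw [lc_sub_left, lc_smul_left, lc_sub_left, lc_single, lc_single, one_smul, one_smul] at h3
  exact sub_eq_zero.mp h3

end Covariance

section Variations

variable {d N m : ℕ}

lemma HasVar.lc {ι : Type} [Fintype ι] {a b : ℕ}
    {F : ι → Fun d V (Mat a b)} {u : Pt d → V} {v : Ser d V} {f f' : ι → SS d a b}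
    (hu : Smooth u) (hv : SmoothS v) (h : ∀ i, HasVar (F i) u v (f i) (f' i)) (c : ι → ℂ) :
    HasVar (SW.lc c F) u v (SW.lc c f) (SW.lc c f') := by
  unfold SW.lc
  induction (univ : Finset ι) using Finset.cons_induction with
  | empty =>
    have := HasVar.lin (0 : V →L[ℝ] Mat a b) hu hv (f := 0) (f' := 0)
      (funext fun J => by by_cases h : J = 0 <;> simp [const, h]; rfl) rfl
    have e : linF (d := d) (0 : V →L[ℝ] Mat a b) = 0 := by
      exact funext fun J => funext fun u => funext fun x => ite_eq_right_iff.mpr fun _ => rfl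
    simpa only [Finset.sum_empty, e] using this
  | cons i s hi ih =>
    simp only [Finset.sum_cons]
    exact ((h i).smul _).add ih

/-- First-order change of `polyD`. -/
def dpolyD (c : Fin 4 → T3 d → ℂ) (A B : Fin d → SS d N N) : SS d N N :=
  lc (c 0) (fun i => pdSS i.1 (pdSS i.2.1 (B i.2.2))) +
  lc (c 1) (fun i => pdSS i.1 (B i.2.1) ⋆ A i.2.2 + pdSS i.1 (A i.2.1) ⋆ B i.2.2) +
  lc (c 2) (fun i => B i.1 ⋆ pdSS i.2.1 (A i.2.2) + A i.1 ⋆ pdSS i.2.1 (B i.2.2)) +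
  lc (c 3) (fun i => B i.1 ⋆ (A i.2.1 ⋆ A i.2.2) +
    A i.1 ⋆ (B i.2.1 ⋆ A i.2.2 + A i.2.1 ⋆ B i.2.2))

/-- First-order change of `polyE`. -/
def dpolyE (c : Fin 8 → T2 d → ℂ) (A B : Fin d → SS d N N) (e f : SS d N N) : SS d N N :=
  lc (c 0) (fun i => pdSS i.1 (pdSS i.2 f)) +
  lc (c 1) (fun i => pdSS i.1 f ⋆ A i.2 + pdSS i.1 e ⋆ B i.2) +
  lc (c 2) (fun i => B i.1 ⋆ pdSS i.2 e + A i.1 ⋆ pdSS i.2 f) +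
  lc (c 3) (fun i => pdSS i.1 (B i.2) ⋆ e + pdSS i.1 (A i.2) ⋆ f) +
  lc (c 4) (fun i => f ⋆ pdSS i.1 (A i.2) + e ⋆ pdSS i.1 (B i.2)) +
  lc (c 5) (fun i => B i.1 ⋆ (A i.2 ⋆ e) + A i.1 ⋆ (B i.2 ⋆ e + A i.2 ⋆ f)) +
  lc (c 6) (fun i => B i.1 ⋆ (e ⋆ A i.2) + A i.1 ⋆ (f ⋆ A i.2 + e ⋆ B i.2)) +
  lc (c 7) (fun i => f ⋆ (A i.1 ⋆ A i.2) + e ⋆ (B i.1 ⋆ A i.2 + A i.1 ⋆ B i.2))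

/-- First-order change of `polyF`. -/
def dpolyF (c : Fin 4 → T2 d → ℂ) (A B : Fin d → SS d N N) (e f : SS d N 1) : SS d N 1 :=
  lc (c 0) (fun i => pdSS i.1 (pdSS i.2 f)) +
  lc (c 1) (fun i => pdSS i.1 (B i.2) ⋆ e + pdSS i.1 (A i.2) ⋆ f) +
  lc (c 2) (fun i => B i.1 ⋆ pdSS i.2 e + A i.1 ⋆ pdSS i.2 f) +
  lc (c 3) (fun i => B i.1 ⋆ (A i.2 ⋆ e) + A i.1 ⋆ (B i.2 ⋆ e + A i.2 ⋆ f))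

lemma variation_repD {D : DFun d N} {c : Fin d → Fin d → Fin d → Fin 4 → T3 d → ℂ}
    (h : RepD D c) {A : Pt d → Pot d N} (hA : Smooth A) {v : Ser d (Pot d N)} (hv : SmoothS v)
    (μ ν κ : Fin d) :
    cpt3 (variation D A v) μ ν κ = (dpolyD (c μ ν κ) (potS hA) (cptS hv)).1 := by
  have key : ∀ μ ν κ, ∃ F : Fun d (Pot d N) (Mat N N), ∀ {A : Pt d → Pot d N} (hA : Smooth A)
      {v : Ser d (Pot d N)} (hv : SmoothS v),
      HasVar F A v (polyD (c μ ν κ) 1 (potS hA)) (dpolyD (c μ ν κ) (potS hA) (cptS hv)) := by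
    intro μ ν κ
    simp only [polyD, del_one, dpolyD]
    refine ⟨lc (c μ ν κ 0) (fun i => pdF i.1 (pdF i.2.1 (aP d N i.2.2))) +
      lc (c μ ν κ 1) (fun i => starF (pdF i.1 (aP d N i.2.1)) (aP d N i.2.2)) +
      lc (c μ ν κ 2) (fun i => starF (aP d N i.1) (pdF i.2.1 (aP d N i.2.2))) +
      lc (c μ ν κ 3) (fun i => starF (aP d N i.1) (starF (aP d N i.2.1) (aP d N i.2.2))),
      fun {A} hA {v} hv => ?_⟩
    have h := hasVar_aP hA hv
    refine HasVar.add (HasVar.add (HasVar.add (HasVar.lc hA hv (fun i => ?_) _)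
      (HasVar.lc hA hv (fun i => ?_) _)) (HasVar.lc hA hv (fun i => ?_) _))
      (HasVar.lc hA hv (fun i => ?_) _)
    · exact ((h _).pd _).pd _
    · exact ((h _).pd _).star (h _)
    · exact (h _).star ((h _).pd _)
    · exact (h _).star ((h _).star (h _))
  choose F hF using key
  have l1 : ∀ μ ν κ, IsLocal (F μ ν κ) := fun μ ν κ => (hF μ ν κ hA hv).loc
  have l2 : ∀ μ ν, IsLocal (piF (F μ ν)) := fun μ ν => IsLocal.piF (l1 μ ν)
  have l3 : ∀ μ, IsLocal (piF fun ν => piF (F μ ν)) := fun μ => IsLocal.piF (l2 μ)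
  rw [variation_congr (G := piF fun μ => piF fun ν => piF (F μ ν)) (fun A hA => ?_)
    (IsLocal.piF l3) hA hv, ← (hF μ ν κ hA hv).var]
  · ext1 J
    ext1 x
    have e1 := congrFun (congrFun (variation_piF l3 hA hv μ) J) x
    have e2 := congrFun (congrFun (variation_piF (l2 μ) hA hv ν) J) x
    have e3 := congrFun (congrFun (variation_piF (l1 μ ν) hA hv κ) J) x
    rw [← e3, ← e2, ← e1]
    rfl
  · ext1 J
    ext1 x
    ext1 μ
    ext1 ν
    ext1 κ
    exact congrFun (congrFun ((h A hA μ ν κ).trans (hF μ ν κ hA smoothS_zero).val.symm) J) x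

lemma variation_rep2 {C : CFun d N m}
    {P : Fin d → Fin d → (Fin d → SS d N N) → SS d N m → SS d N m}
    {P' : Fin d → Fin d → (Fin d → SS d N N) → (Fin d → SS d N N) → SS d N m → SS d N m → SS d N m}
    (h : Rep2 C P)
    (key : ∀ μ ν, ∃ F : Fun d (Mat N m × Pot d N) (Mat N m), ∀ {w : Pt d → Mat N m × Pot d N}
      (hw : Smooth w) {e : Ser d (Mat N m)} {a : Ser d (Pot d N)} (he : SmoothS e)
      (ha : SmoothS a), HasVar F w (pairS e a) (P μ ν (potS (smooth_snd hw))
        (constS (smooth_fst hw))) (P' μ ν (potS (smooth_snd hw)) (cptS ha)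
        (constS (smooth_fst hw)) ⟨e, he⟩))
    {w : Pt d → Mat N m × Pot d N} (hw : Smooth w) {e : Ser d (Mat N m)} {a : Ser d (Pot d N)}
    (he : SmoothS e) (ha : SmoothS a) (μ ν : Fin d) :
    cpt2 (variation C w (pairS e a)) μ ν = (P' μ ν (potS (smooth_snd hw)) (cptS ha)
      (constS (smooth_fst hw)) ⟨e, he⟩).1 := by
  choose F hF using key
  have l1 : ∀ μ ν, IsLocal (F μ ν) := fun μ ν => (hF μ ν hw he ha).loc
  have l2 : ∀ μ, IsLocal (piF (F μ)) := fun μ => IsLocal.piF (l1 μ)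
  have hv := smoothS_pairS he ha
  rw [variation_congr (G := piF fun μ => piF (F μ)) (fun w hw => ?_)
    (IsLocal.piF l2) hw hv, ← (hF μ ν hw he ha).var]
  · ext1 J
    ext1 x
    have e1 := congrFun (congrFun (variation_piF l2 hw hv μ) J) x
    have e2 := congrFun (congrFun (variation_piF (l1 μ) hw hv ν) J) x
    rw [← e2, ← e1]
    rfl
  · ext1 J
    ext1 x
    ext1 μ
    ext1 ν
    exact congrFun (congrFun ((h _ _ (smooth_fst hw) (smooth_snd hw) μ ν).trans
      (hF μ ν hw smoothS_zero smoothS_zero).val.symm) J) x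

lemma variation_repE {C : CFun d N N} {c : Fin d → Fin d → Fin 8 → T2 d → ℂ}
    (h : Rep2 C fun μ ν => polyE (c μ ν) 1) {w : Pt d → Mat N N × Pot d N} (hw : Smooth w)
    {e : Ser d (Mat N N)} {a : Ser d (Pot d N)} (he : SmoothS e) (ha : SmoothS a) (μ ν : Fin d) :
    cpt2 (variation C w (pairS e a)) μ ν = (dpolyE (c μ ν) (potS (smooth_snd hw)) (cptS ha)
      (constS (smooth_fst hw)) ⟨e, he⟩).1 := by
  refine variation_rep2 (P' := fun μ ν => dpolyE (c μ ν)) h (fun μ ν => ?_) hw he ha μ ν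
  simp only [polyE, del_one, dpolyE]
  refine ⟨lc (c μ ν 0) (fun i => pdF i.1 (pdF i.2 (fM d N N))) +
    lc (c μ ν 1) (fun i => starF (pdF i.1 (fM d N N)) (aM d N N i.2)) +
    lc (c μ ν 2) (fun i => starF (aM d N N i.1) (pdF i.2 (fM d N N))) +
    lc (c μ ν 3) (fun i => starF (pdF i.1 (aM d N N i.2)) (fM d N N)) +
    lc (c μ ν 4) (fun i => starF (fM d N N) (pdF i.1 (aM d N N i.2))) +
    lc (c μ ν 5) (fun i => starF (aM d N N i.1) (starF (aM d N N i.2) (fM d N N))) +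
    lc (c μ ν 6) (fun i => starF (aM d N N i.1) (starF (fM d N N) (aM d N N i.2))) +
    lc (c μ ν 7) (fun i => starF (fM d N N) (starF (aM d N N i.1) (aM d N N i.2))),
    fun {w} hw {e} {a} he ha => ?_⟩
  have h := hasVar_aM hw he ha
  have hf := hasVar_fM hw he ha
  have hv := smoothS_pairS he ha
  refine HasVar.add (HasVar.add (HasVar.add (HasVar.add (HasVar.add (HasVar.add (HasVar.add (HasVar.lc hw hv (fun i => ?_) _)
    (HasVar.lc hw hv (fun i => ?_) _))
    (HasVar.lc hw hv (fun i => ?_) _))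
    (HasVar.lc hw hv (fun i => ?_) _))
    (HasVar.lc hw hv (fun i => ?_) _))
    (HasVar.lc hw hv (fun i => ?_) _))
    (HasVar.lc hw hv (fun i => ?_) _))
    (HasVar.lc hw hv (fun i => ?_) _)
  · exact (hf.pd _).pd _
  · exact (hf.pd _).star (h _)
  · exact (h _).star (hf.pd _)
  · exact ((h _).pd _).star hf
  · exact hf.star ((h _).pd _)
  · exact (h _).star ((h _).star hf)
  · exact (h _).star (hf.star (h _))
  · exact hf.star ((h _).star (h _))

lemma variation_repF {C : CFun d N 1} {c : Fin d → Fin d → Fin 4 → T2 d → ℂ}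
    (h : Rep2 C fun μ ν => polyF (c μ ν) 1) {w : Pt d → Mat N 1 × Pot d N} (hw : Smooth w)
    {e : Ser d (Mat N 1)} {a : Ser d (Pot d N)} (he : SmoothS e) (ha : SmoothS a) (μ ν : Fin d) :
    cpt2 (variation C w (pairS e a)) μ ν = (dpolyF (c μ ν) (potS (smooth_snd hw)) (cptS ha)
      (constS (smooth_fst hw)) ⟨e, he⟩).1 := by
  refine variation_rep2 (P' := fun μ ν => dpolyF (c μ ν)) h (fun μ ν => ?_) hw he ha μ ν
  simp only [polyF, del_one, dpolyF]
  refine ⟨lc (c μ ν 0) (fun i => pdF i.1 (pdF i.2 (fM d N 1))) +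
    lc (c μ ν 1) (fun i => starF (pdF i.1 (aM d N 1 i.2)) (fM d N 1)) +
    lc (c μ ν 2) (fun i => starF (aM d N 1 i.1) (pdF i.2 (fM d N 1))) +
    lc (c μ ν 3) (fun i => starF (aM d N 1 i.1) (starF (aM d N 1 i.2) (fM d N 1))),
    fun {w} hw {e} {a} he ha => ?_⟩
  have h := hasVar_aM hw he ha
  have hf := hasVar_fM hw he ha
  have hv := smoothS_pairS he ha
  refine HasVar.add (HasVar.add (HasVar.add (HasVar.lc hw hv (fun i => ?_) _)
    (HasVar.lc hw hv (fun i => ?_) _))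
    (HasVar.lc hw hv (fun i => ?_) _))
    (HasVar.lc hw hv (fun i => ?_) _)
  · exact (hf.pd _).pd _
  · exact ((h _).pd _).star hf
  · exact (h _).star (hf.pd _)
  · exact (h _).star ((h _).star hf)

/-- Violation of the constraint between `D` and `E`. -/
def KD (c : Fin 4 → T3 d → ℂ) (e : Fin 8 → T2 d → ℂ) (κ : Fin d) (A : Fin d → SS d N N)
    (ε : SS d N N) : SS d N N :=
  dpolyD c A (gaugeS A ε) - I • (ε ⋆ polyD c 1 A - polyD c 1 A ⋆ ε) +
    gaugeS A (polyE e 1 A ε) κ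

/-- Violation of the constraint between `C` and `E`, fundamental representation. -/
def KF (c : Fin 4 → T2 d → ℂ) (e : Fin 8 → T2 d → ℂ) (A : Fin d → SS d N N)
    (ε : SS d N N) (φ : SS d N 1) : SS d N 1 :=
  dpolyF c A (gaugeS A ε) φ (I • (ε ⋆ φ)) - I • (ε ⋆ polyF c 1 A φ) +
    I • (polyE e 1 A ε ⋆ φ)

/-- Violation of the constraint between `C` and `E`, adjoint representation. -/
def KAd (c : Fin 8 → T2 d → ℂ) (e : Fin 8 → T2 d → ℂ) (A : Fin d → SS d N N)
    (ε φ : SS d N N) : SS d N N :=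
  dpolyE c A (gaugeS A ε) φ (I • (ε ⋆ φ) - I • (φ ⋆ ε)) -
    I • (ε ⋆ polyE c 1 A φ - polyE c 1 A φ ⋆ ε) +
    I • (polyE e 1 A ε ⋆ φ - φ ⋆ polyE e 1 A ε)

lemma eq_neg_iff_of_sub_add {a b : ℕ} {X Y : Ser d (Mat a b)} {u : SS d a b}
    (h : X + Y = u.1) : X = -Y ↔ u = 0 := by
  rw [eq_neg_iff_add_eq_zero, h]
  exact Submodule.coe_eq_zero

lemma constrD_iff_rep {D : DFun d N} {E : EFun d N}
    {c : Fin d → Fin d → Fin d → Fin 4 → T3 d → ℂ} {e : Fin d → Fin d → Fin 8 → T2 d → ℂ}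
    (hD : RepD D c) (hE : Rep2 E fun μ ν => polyE (e μ ν) 1) :
    ConstrD D E ↔ ∀ (A : Fin d → SS d N N) ε, (∀ μ, IsConst (A μ)) → IsConst ε → ∀ μ ν κ,
      KD (c μ ν κ) (e μ ν) κ A ε = 0 := by
  have key : ∀ A ε (hA : Smooth A) (hε : Smooth ε) μ ν κ, (dPrimeD D A ε μ ν κ =
      -covA (pot A) κ (cpt2 (app E (fun x => (ε x, A x))) μ ν) ↔
      KD (c μ ν κ) (e μ ν) κ (potS hA) (constS hε) = 0) := by
    intro A ε hA hε μ ν κ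
    refine eq_neg_iff_of_sub_add ?_
    have hw := smooth_pair hε hA
    have h1 : gaugeA (pot A) (const ε) = app (VG d N) fun y => (ε y, A y) := gaugeA_eq hw
    unfold dPrimeD
    rw [h1, variation_repD hD hA (smoothS_VG hw), cptS_VG hw, hD A hA, hE ε A hε hA]
    rfl
  constructor
  · intro h A ε hA hε μ ν κ
    obtain ⟨a, ha, rfl⟩ := exists_potS hA
    obtain ⟨e, he, rfl⟩ := hε
    exact (key a e ha he μ ν κ).mp (h a e ha he μ ν κ)
  · intro h A ε hA hε μ ν κ
    exact (key A ε hA hε μ ν κ).mpr (h _ _ (isConst_potS hA) ⟨_, hε, rfl⟩ μ ν κ)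

lemma forall_isConst_iff {P : (Pt d → Pot d N) → (Pt d → Mat N N) → (Pt d → Mat N m) → Fin d →
    Fin d → Prop} {K : Fin d → Fin d → (Fin d → SS d N N) → SS d N N → SS d N m → SS d N m}
    (key : ∀ A ε φ (hA : Smooth A) (hε : Smooth ε) (hφ : Smooth φ) μ ν,
      (P A ε φ μ ν ↔ K μ ν (potS hA) (constS hε) (constS hφ) = 0)) :
    (∀ A ε φ, Smooth A → Smooth ε → Smooth φ → ∀ μ ν, P A ε φ μ ν) ↔
      ∀ A ε φ, (∀ μ, IsConst (A μ)) → IsConst ε → IsConst φ → ∀ μ ν, K μ ν A ε φ = 0 := by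
  constructor
  · intro h A ε φ hA hε hφ μ ν
    obtain ⟨a, ha, rfl⟩ := exists_potS hA
    obtain ⟨e, he, rfl⟩ := hε
    obtain ⟨f, hf, rfl⟩ := hφ
    exact (key a e f ha he hf μ ν).mp (h a e f ha he hf μ ν)
  · intro h A ε φ hA hε hφ μ ν
    exact (key A ε φ hA hε hφ μ ν).mpr (h _ _ _ (isConst_potS hA) ⟨_, hε, rfl⟩ ⟨_, hφ, rfl⟩ μ ν)

lemma constrF_iff_rep {C : CFun d N 1} {E : EFun d N}
    {c : Fin d → Fin d → Fin 4 → T2 d → ℂ} {e : Fin d → Fin d → Fin 8 → T2 d → ℂ}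
    (hC : Rep2 C fun μ ν => polyF (c μ ν) 1) (hE : Rep2 E fun μ ν => polyE (e μ ν) 1) :
    ConstrF E C ↔ ∀ (A : Fin d → SS d N N) ε φ, (∀ μ, IsConst (A μ)) → IsConst ε → IsConst φ →
      ∀ μ ν, KF (c μ ν) (e μ ν) A ε φ = 0 := by
  have key : ∀ A ε φ (hA : Smooth A) (hε : Smooth ε) (hφ : Smooth φ) μ ν, (dPrimeF C A ε φ μ ν =
      -(I • star (cpt2 (app E (fun x => (ε x, A x))) μ ν) (const φ)) ↔
      KF (c μ ν) (e μ ν) (potS hA) (constS hε) (constS hφ) = 0) := by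
    intro A ε φ hA hε hφ μ ν
    refine eq_neg_iff_of_sub_add ?_
    have hw := smooth_pair hε hA
    have h1 : gaugeA (pot A) (const ε) = app (VG d N) fun y => (ε y, A y) := gaugeA_eq hw
    unfold dPrimeF
    have h2 : gaugeF (const ε) (const φ) = (I • (constS hε ⋆ constS hφ)).1 := rfl
    rw [h1, h2, variation_repF hC (smooth_pair hφ hA) (I • (constS hε ⋆ constS hφ)).2
      (smoothS_VG hw), cptS_VG hw, hC φ A hφ hA, hE ε A hε hA]
    rfl
  exact forall_isConst_iff key

lemma constrAd_iff_rep {C E : EFun d N} {c e : Fin d → Fin d → Fin 8 → T2 d → ℂ}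
    (hC : Rep2 C fun μ ν => polyE (c μ ν) 1) (hE : Rep2 E fun μ ν => polyE (e μ ν) 1) :
    ConstrAd E C ↔ ∀ (A : Fin d → SS d N N) ε φ, (∀ μ, IsConst (A μ)) → IsConst ε → IsConst φ →
      ∀ μ ν, KAd (c μ ν) (e μ ν) A ε φ = 0 := by
  have key : ∀ A ε φ (hA : Smooth A) (hε : Smooth ε) (hφ : Smooth φ) μ ν, (dPrimeAd C A ε φ μ ν =
      -(I • comm (cpt2 (app E (fun x => (ε x, A x))) μ ν) (const φ)) ↔
      KAd (c μ ν) (e μ ν) (potS hA) (constS hε) (constS hφ) = 0) := by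
    intro A ε φ hA hε hφ μ ν
    refine eq_neg_iff_of_sub_add ?_
    have hw := smooth_pair hε hA
    have h1 : gaugeA (pot A) (const ε) = app (VG d N) fun y => (ε y, A y) := gaugeA_eq hw
    unfold dPrimeAd
    have h2 : gaugeAd (const ε) (const φ) = (I • (constS hε ⋆ constS hφ) -
      I • (constS hφ ⋆ constS hε)).1 := rfl
    rw [h1, h2, variation_repE hC (smooth_pair hφ hA) (I • (constS hε ⋆ constS hφ) -
      I • (constS hφ ⋆ constS hε)).2 (smoothS_VG hw), cptS_VG hw, hC φ A hφ hA, hE ε A hε hA]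
    rfl
  exact forall_isConst_iff key

end Variations

section NormalForms

variable {d N : ℕ}

/-- The antisymmetric unit array. -/
def wedge (μ ν : Fin d) : T2 d → ℂ := Pi.single (μ, ν) 1 - Pi.single (ν, μ) 1

lemma lc_wedge {V : Type} [AddCommGroup V] [Module ℂ V] (μ ν : Fin d) (u : T2 d → V) :
    lc (wedge μ ν) u = u (μ, ν) - u (ν, μ) := by
  rw [wedge, lc_sub_left, lc_single, lc_single, one_smul, one_smul]

/-- Covariance and antisymmetry pass to symbols. -/
lemma cov_anti {I X V : Type} [Fintype I] [AddCommGroup V] [Module ℂ V]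
    {P : I → SqM d → X → V} {w : GL (Fin d) ℝ → I → I → ℂ} {σ : I → I}
    (hcov : ∀ (g : GL (Fin d) ℝ) x i, P i g.1 x = ∑ i', w g i i' • P i' 1 x)
    (hanti : ∀ x i, P i 1 x = -P (σ i) 1 x) {S : I → SqM d → ℂ}
    (H : ∀ {J : Type} [Fintype J] (r : J → ℂ) (g : J → SqM d) (i : J → I),
      (∀ x, ∑ j, r j • P (i j) (g j) x = 0) → ∑ j, r j * S (i j) (g j) = 0) :
    (∀ (g : GL (Fin d) ℝ) i, S i g.1 = ∑ i', w g i i' * S i' 1) ∧ ∀ i, S i 1 = -S (σ i) 1 := by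
  constructor
  · intro g i
    have := H (J := Option I) (fun j => j.elim 1 fun i' => -w g i i')
      (fun j => j.elim g.1 fun _ => 1) (fun j => j.elim i id) fun x => by
        simp [Fintype.sum_option, hcov, neg_smul]
    simp only [Fintype.sum_option, Option.elim, one_mul, id, neg_mul, Finset.sum_neg_distrib]
      at this
    exact add_neg_eq_zero.mp this
  · intro i
    have := H (J := Bool) (fun _ => 1) (fun _ => 1) (fun j => bif j then i else σ i) fun x => by
      simp [hanti x i]
    simp only [Fintype.sum_bool, cond_true, cond_false, one_mul] at this
    exact eq_neg_of_add_eq_zero_left this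

lemma normal_D (p : Idx d) (hN : 0 < N) {D : DFun d N} (h : ClassD D) :
    ∃ (α : ℂ) (c : Fin d → Fin d → Fin d → Fin 4 → T3 d → ℂ), RepD D c ∧ ∀ μ ν κ,
      c μ ν κ 0 = α • (Pi.single (κ, μ, ν) 1 - Pi.single (κ, ν, μ) 1) := by
  obtain ⟨c, hc, hcov⟩ := arrays_D h.1
  have key := fun x y => cov_anti (I := T3 d) (X := {A : Fin d → SS d N N // ∀ μ, IsConst (A μ)})
    (P := fun i g A => polyD (c i.1 i.2.1 i.2.2) g (trS g A.1))
    (w := wt3) (σ := fun i => (i.2.1, i.1, i.2.2))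
    (S := fun i g => s3 (c i.1 i.2.1 i.2.2 0) (mv g x) (mv g x) (mv g y)) (fun g A i => by
      simpa only [trS_one] using hcov g A.1 A.2 i) (fun A i => by
      obtain ⟨a, ha, e⟩ := exists_potS A.2
      simp only [trS_one, e]
      refine Subtype.ext ?_
      rw [Submodule.coe_neg, ← hc a ha, ← hc a ha]
      exact funext fun J => funext fun x => h.2 a ha J x _ _ _) fun r g i h =>
        symbol_D r g hN _ (fun A hA => h ⟨A, hA⟩) x y
  obtain ⟨α, hα⟩ := covariant_three p (T := fun μ ν κ => c μ ν κ 0) (fun g x y μ ν κ => by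
    simpa only [mv_one, Fintype.sum_prod_type, wt3] using (key x y).1 g (μ, ν, κ))
    (fun μ ν κ x y => by simpa only [mv_one] using (key x y).2 (μ, ν, κ))
  refine ⟨α, fun μ ν κ => Function.update (c μ ν κ) 0
    (α • (Pi.single (κ, μ, ν) 1 - Pi.single (κ, ν, μ) 1)), fun A hA μ ν κ => ?_,
    fun μ ν κ => Function.update_self _ _ _⟩
  rw [hc A hA]
  simp only [polyD, del_one, ne_eq, Fin.reduceEq, not_false_eq_true, Function.update_of_ne,
    Function.update_self, lc_smul_left, lc_sub_left, lc_single, one_smul]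
  rw [hα μ ν κ _ fun a b e => pdSS_comm _ _ _]

lemma symbols_two {m : ℕ} {C : CFun d N m} (hC : Antisymm2 C) {K : Type} {c : Fin d → Fin d → K}
    {P : K → SqM d → (Fin d → SS d N N) → SS d N m → SS d N m}
    (hP : Rep2 C fun μ ν => P (c μ ν) 1)
    (hcov : ∀ (g : GL (Fin d) ℝ) (x : CFld d N m) (i : T2 d),
      P (c i.1 i.2) g.1 (trS g.1 x.1.1) x.1.2 = ∑ j : T2 d, wt2 g i j • P (c j.1 j.2) 1 x.1.1 x.1.2)
    {S : Fin d → Fin d → SqM d → ℂ}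
    (H : ∀ {J : Type} [Fintype J] (r : J → ℂ) (g : J → SqM d) (i : J → T2 d),
      (∀ A e, (∀ μ, IsConst (A μ)) → IsConst e →
        ∑ j, r j • P (c (i j).1 (i j).2) (g j) (trS (g j) A) e = 0) →
      ∑ j, r j * S (i j).1 (i j).2 (g j) = 0) :
    (∀ (g : GL (Fin d) ℝ) μ ν, S μ ν g.1 =
      ∑ μ', ∑ ν', ((g.1 μ μ' * g.1 ν ν' : ℝ) : ℂ) * S μ' ν' 1) ∧ ∀ μ ν, S μ ν 1 = -S ν μ 1 := by
  obtain ⟨h1, h2⟩ := cov_anti (I := T2 d) (X := CFld d N m)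
    (P := fun i g x => P (c i.1 i.2) g (trS g x.1.1) x.1.2)
    (w := wt2) (σ := fun i => (i.2, i.1)) (S := fun i => S i.1 i.2)
    (fun g x i => by simpa only [trS_one] using hcov g x i) (fun x i => by
      obtain ⟨a, ha, e⟩ := exists_potS x.2.1
      obtain ⟨ε, hε, e'⟩ := x.2.2
      simp only [trS_one, e, e']
      refine Subtype.ext ?_
      rw [Submodule.coe_neg, ← hP ε a hε ha, ← hP ε a hε ha]
      exact funext fun J => funext fun x => hC ε a hε ha J x _ _)
    fun r g i h => H r g i fun A e hA he => h ⟨(A, e), hA, he⟩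
  exact ⟨fun g μ ν => by simpa only [Fintype.sum_prod_type, wt2] using h1 g (μ, ν), fun μ ν => h2 (μ, ν)⟩

lemma normal_E (p : Idx d) (hN : 0 < N) {E : EFun d N} (h1 : IsCovStarPoly2 E)
    (h2 : IsLinearFst ℝ E) (h3 : Antisymm2 E) :
    ∃ (t : Fin 8 → ℂ) (c : Fin d → Fin d → Fin 8 → T2 d → ℂ), Rep2 E (fun μ ν => polyE (c μ ν) 1) ∧
      ∀ μ ν, c μ ν 0 = 0 ∧ ∀ n : Fin 8, 1 ≤ n → n ≤ 4 → c μ ν n = t n • wedge μ ν := by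
  obtain ⟨c, hc, hcov⟩ := arrays_E h1 h2
  have two : ∀ n : Fin 8, 1 ≤ n → n ≤ 4 → ∃ t : ℂ, ∀ μ ν, c μ ν n = t • wedge μ ν := by
    intro n hn hn'
    have := fun x y => symbols_two h3 hc hcov (S := fun μ ν g => s2 (c μ ν n) (mv g x) (mv g y))
      fun r g i h => by
        have hs := symbol_E r g p hN _ h
        have a1 := hs x 0 y
        have a2 := hs 0 x y
        have a3 := hs y 0 x
        simp only [mv_zero, s2_zero_left, s2_zero_right, add_zero, zero_add] at a1 a2 a3
        have : n = 1 ∨ n = 2 ∨ n = 3 ∨ n = 4 := by omega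
        obtain rfl | rfl | rfl | rfl := this
        exacts [a1.2.1, a3.2.2, a2.2.2, a2.2.1]
    simp only [mv_one] at this
    exact covariant_two p (fun g x y => (this x y).1 g) fun μ ν x y => (this x y).2 μ ν
  have sym := fun x => symbols_two h3 hc hcov (S := fun μ ν g => s2 (c μ ν 0) (mv g x) (mv g x))
    fun r g i h => (symbol_E r g p hN _ h x 0 0).1
  simp only [mv_one] at sym
  choose! t ht using two
  refine ⟨t, fun μ ν => Function.update (c μ ν) 0 0, fun ε A hε hA μ ν => ?_, fun μ ν =>
    ⟨Function.update_self _ _ _, fun n hn hn' => ?_⟩⟩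
  · rw [hc ε A hε hA]
    simp only [polyE, del_one, ne_eq, Fin.reduceEq, not_false_eq_true, Function.update_of_ne,
      Function.update_self, lc_zero_left]
    rw [covariant_sym p (fun g x => (sym x).1 g) (fun μ ν x => (sym x).2 μ ν) μ ν
      fun a b => pdSS_comm _ _ _]
  · exact (Function.update_of_ne (by rintro rfl; exact absurd hn (by decide)) _ _).trans
      (ht n hn hn' μ ν)

lemma normal_F (p : Idx d) (hN : 0 < N) {C : CFun d N 1} (h : ClassF C) :
    ∃ (t : Fin 4 → ℂ) (c : Fin d → Fin d → Fin 4 → T2 d → ℂ), Rep2 C (fun μ ν => polyF (c μ ν) 1) ∧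
      ∀ μ ν, c μ ν 0 = 0 ∧ c μ ν 1 = t 1 • wedge μ ν ∧ c μ ν 2 = t 2 • wedge μ ν := by
  obtain ⟨c, hc, hcov⟩ := arrays_F h.1
  have two : ∀ n : Fin 4, 1 ≤ n → n ≤ 2 → ∃ t : ℂ, ∀ μ ν, c μ ν n = t • wedge μ ν := by
    intro n hn hn'
    have := fun x y => symbols_two h.2.2 hc hcov (S := fun μ ν g => s2 (c μ ν n) (mv g x) (mv g y))
      fun r g i h => by
        have hs := symbol_F r g hN _ h
        have a1 := hs 0 x y
        have a2 := hs y 0 x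
        simp only [mv_zero, s2_zero_left, s2_zero_right, add_zero, zero_add] at a1 a2
        have : n = 1 ∨ n = 2 := by omega
        obtain rfl | rfl := this
        exacts [a1.2, a2.2]
    simp only [mv_one] at this
    exact covariant_two p (fun g x y => (this x y).1 g) fun μ ν x y => (this x y).2 μ ν
  have sym := fun x => symbols_two h.2.2 hc hcov (S := fun μ ν g => s2 (c μ ν 0) (mv g x) (mv g x))
    fun r g i h => (symbol_F r g hN _ h x 0 0).1
  simp only [mv_one] at sym
  choose! t ht using two
  refine ⟨t, fun μ ν => Function.update (c μ ν) 0 0, fun ε A hε hA μ ν => ?_, fun μ ν =>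
    ⟨Function.update_self _ _ _, ?_, ?_⟩⟩
  · rw [hc ε A hε hA]
    simp only [polyF, del_one, ne_eq, Fin.reduceEq, not_false_eq_true, Function.update_of_ne,
      Function.update_self, lc_zero_left]
    rw [covariant_sym p (fun g x => (sym x).1 g) (fun μ ν x => (sym x).2 μ ν) μ ν
      fun a b => pdSS_comm _ _ _]
  · exact (Function.update_of_ne (by decide) _ _).trans (ht 1 (by decide) (by decide) μ ν)
  · exact (Function.update_of_ne (by decide) _ _).trans (ht 2 (by decide) (by decide) μ ν)

end NormalForms

section Uniqueness

variable {d N : ℕ}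

lemma KD_sub (c c' : Fin 4 → T3 d → ℂ) (e e' : Fin 8 → T2 d → ℂ) (κ : Fin d)
    (A : Fin d → SS d N N) (ε : SS d N N) :
    KD (c - c') (e - e') κ A ε = KD c e κ A ε - KD c' e' κ A ε := by
  simp only [KD, dpolyD, polyD, polyE, gaugeS, Pi.sub_apply, lc_sub_left, mulS_sub, sub_mulS,
    mulS_add, add_mulS, map_sub, map_add]
  module

lemma KD_linear {c : Fin 4 → T3 d → ℂ} {e : Fin 8 → T2 d → ℂ} (hc : c 0 = 0) (he : e 0 = 0)
    (κ : Fin d) {A : Fin d → SS d N N} {ε : SS d N N}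
    (h : ∀ s : ℂ, KD c e κ (fun μ => s • A μ) ε = 0) :
    lc (c 1) (fun i => pdSS i.1 (pdSS i.2.1 ε) ⋆ A i.2.2 + pdSS i.1 (A i.2.1) ⋆ pdSS i.2.2 ε) +
      lc (c 2) (fun i => pdSS i.1 ε ⋆ pdSS i.2.1 (A i.2.2) +
        A i.1 ⋆ pdSS i.2.1 (pdSS i.2.2 ε)) + pdSS κ (lc (e 1) (fun i => pdSS i.1 ε ⋆ A i.2) +
      lc (e 2) (fun i => A i.1 ⋆ pdSS i.2 ε) + lc (e 3) (fun i => pdSS i.1 (A i.2) ⋆ ε) +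
      lc (e 4) (fun i => ε ⋆ pdSS i.1 (A i.2))) = 0 := by
  simp only [KD, dpolyD, polyD, polyE, gaugeS, hc, he, del_one, lc_zero_left, map_zero, zero_mulS,
    mulS_zero, map_add, map_sub,
    map_smul, smul_mulS, mulS_smul, add_mulS, mulS_add, sub_mulS, mulS_sub, lc_add, lc_sub, lc_smul]
    at h ⊢
  linear_combination (norm := module) h 1 - (1 / 3 : ℂ) • h (-1) - (1 / 6 : ℂ) • h 2

lemma KD_quadratic {c : Fin 4 → T3 d → ℂ} {e : Fin 8 → T2 d → ℂ} (hc : c 0 = 0) (hc1 : c 1 = 0)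
    (hc2 : c 2 = 0) (he : ∀ n ≤ 4, e n = 0)
    (κ : Fin d) {A : Fin d → SS d N N} {ε : SS d N N}
    (h : ∀ s : ℂ, KD c e κ (fun μ => s • A μ) ε = 0) :
    lc (c 3) (fun i => pdSS i.1 ε ⋆ (A i.2.1 ⋆ A i.2.2) + A i.1 ⋆ (pdSS i.2.1 ε ⋆ A i.2.2 +
      A i.2.1 ⋆ pdSS i.2.2 ε)) + pdSS κ (lc (e 5) (fun i => A i.1 ⋆ (A i.2 ⋆ ε)) +
      lc (e 6) (fun i => A i.1 ⋆ (ε ⋆ A i.2)) + lc (e 7) (fun i => ε ⋆ (A i.1 ⋆ A i.2))) = 0 := by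
  simp only [KD, dpolyD, polyD, polyE, gaugeS, hc, hc1, hc2, he 0 (by decide), he 1 (by decide),
    he 2 (by decide), he 3 (by decide), he 4 le_rfl, lc_zero_left, map_zero, zero_mulS,
    mulS_zero, map_add, map_sub,
    map_smul, smul_mulS, mulS_smul, add_mulS, mulS_add, sub_mulS, mulS_sub, lc_add, lc_sub, lc_smul]
    at h ⊢
  linear_combination (norm := module) (1 / 2 : ℂ) • h 1 + (1 / 2 : ℂ) • h (-1)

lemma eq_zero_of_s3 {c : T3 d → ℂ} (h : ∀ x y z, s3 c x y z = 0) : c = 0 :=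
  funext fun i => by rw [← s3_single c i.1 i.2.1 i.2.2, h]; rfl

lemma eq_zero_of_s2 {c : T2 d → ℂ} (h : ∀ x y, s2 c x y = 0) : c = 0 :=
  funext fun i => by rw [← s2_single c i.1 i.2, h]; rfl

lemma s3_zero_left (x y z : Fin d → ℂ) : s3 0 x y z = 0 := lc_zero_left _

lemma unique_D (p : Idx d) (hN : 0 < N) {c : Fin d → Fin d → Fin d → Fin 4 → T3 d → ℂ}
    {e : Fin d → Fin d → Fin 8 → T2 d → ℂ} {t : Fin 8 → ℂ} (hc : ∀ μ ν κ, c μ ν κ 0 = 0)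
    (he0 : ∀ μ ν, e μ ν 0 = 0) (he1 : t 1 = 0)
    (he : ∀ μ ν n, 1 ≤ n → n ≤ 4 → e μ ν n = t n • wedge μ ν)
    (h : ∀ (A : Fin d → SS d N N) ε, (∀ μ, IsConst (A μ)) → IsConst ε → ∀ μ ν κ,
      KD (c μ ν κ) (e μ ν) κ A ε = 0) : c = 0 ∧ e = 0 := by
  have hne : p.1.1 ≠ p.1.2 := p.2.ne
  have h1 : ∀ μ ν κ v k q, s3 (c μ ν κ 1) k k v + s3 (c μ ν κ 2) k q v +
      (k κ + q κ) * (t 4 * (q μ * v ν - q ν * v μ)) = 0 ∧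
      s3 (c μ ν κ 1) q v k + s3 (c μ ν κ 2) v k k + (k κ + q κ) *
        (t 2 * (v μ * k ν - v ν * k μ) + t 3 * (q μ * v ν - q ν * v μ)) = 0 := by
    intro μ ν κ v
    refine extract_two p hN (by fun_prop) (by fun_prop) fun k q => ?_
    have := KD_linear (hc μ ν κ) (he0 μ ν) κ (A := fun μ => v μ • wv N q) (ε := wv N k) fun s =>
      h _ _ (fun μ => ((isConst_wv q).smul _).smul _) (isConst_wv k) μ ν κ
    rw [he μ ν 1 (by decide) (by decide), he μ ν 2 (by decide) (by decide),
      he μ ν 3 (by decide) (by decide), he μ ν 4 (by decide) (by decide), he1] at this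
    simp only [pdSS_wv, map_smul, smul_mulS, mulS_smul, smul_smul, lc_add, lc_smul_const, map_add,
      pdSS_mulS, lc_smul_left, lc_wedge, smul_eq_mul] at this
    simp only [s3, mul_comm, mul_left_comm, mul_assoc] at this ⊢
    linear_combination (norm := module) this
  have t34 : t 4 = 0 ∧ t 3 = 0 := by
    have := h1 p.1.1 p.1.2 p.1.1 (Pi.single p.1.2 1) 0 (Pi.single p.1.1 1)
    simpa [s3_zero₁, s3_zero₂, s3_zero₃, hne, hne.symm] using this
  have c2 : ∀ μ ν κ, c μ ν κ 2 = 0 := fun μ ν κ => eq_zero_of_s3 fun k q v => by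
    have a1 := (h1 μ ν κ v k q).1
    have a2 := (h1 μ ν κ v k 0).1
    simp only [t34.1, s3_zero₂, zero_mul, mul_zero, add_zero] at a1 a2
    linear_combination a1 - a2
  have t2 : t 2 = 0 := by
    have := (h1 p.1.1 p.1.2 p.1.1 (Pi.single p.1.2 1) (Pi.single p.1.1 1) 0).2
    simpa [s3_zero₁, c2, s3_zero_left, hne, hne.symm] using this
  have c1 : ∀ μ ν κ, c μ ν κ 1 = 0 := fun μ ν κ => eq_zero_of_s3 fun q v k => by
    simpa [c2, t2, t34.2, s3_zero_left] using (h1 μ ν κ v k q).2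
  have he' : ∀ μ ν n, n ≤ 4 → e μ ν n = 0 := fun μ ν n hn => by
    by_cases h0 : n = 0
    · rw [h0, he0]
    · rw [he μ ν n (Fin.one_le_of_ne_zero h0) hn]
      have : n = 1 ∨ n = 2 ∨ n = 3 ∨ n = 4 := by omega
      obtain rfl | rfl | rfl | rfl := this <;> simp [he1, t2, t34]
  let F : Fin d → Fin d → Fin d → (Fin d → ℂ) → (Fin d → ℂ) → Fin 6 → (Fin d → ℂ) →
      (Fin d → ℂ) → (Fin d → ℂ) → ℂ := fun μ ν κ v w i k l q =>
    ![s3 (c μ ν κ 3) k v w + (k κ + l κ + q κ) * s2 (e μ ν 7) v w,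
      s3 (c μ ν κ 3) k w v + (k κ + l κ + q κ) * s2 (e μ ν 7) w v,
      s3 (c μ ν κ 3) v k w + (k κ + l κ + q κ) * s2 (e μ ν 6) v w,
      s3 (c μ ν κ 3) v w k + (k κ + l κ + q κ) * s2 (e μ ν 5) v w,
      s3 (c μ ν κ 3) w k v + (k κ + l κ + q κ) * s2 (e μ ν 6) w v,
      s3 (c μ ν κ 3) w v k + (k κ + l κ + q κ) * s2 (e μ ν 5) w v] i
  have h2 : ∀ μ ν κ v w i k l q, F μ ν κ v w i k l q = 0 := by
    intro μ ν κ v w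
    refine extract_six p hN (fun i => ?_) fun k l q => ?_
    · fin_cases i <;> simp only [F] <;> fun_prop
    · have := fun v w : Fin d → ℂ => KD_quadratic (hc μ ν κ) (c1 μ ν κ) (c2 μ ν κ) (he' μ ν) κ
        (A := fun μ => v μ • wv N l + w μ • wv N q) (ε := wv N k) fun s => h _ _
        (fun μ => (((isConst_wv l).smul _).add ((isConst_wv q).smul _)).smul _) (isConst_wv k) μ ν κ
      have h1 := this v w
      have h2 := this v 0
      have h3 := this 0 w
      simp only [F, six, Fin.sum_univ_six, Matrix.cons_val, s3, s2]
      simp only [pdSS_wv, map_smul, smul_mulS, mulS_smul, add_mulS, mulS_add, smul_add, smul_smul,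
        lc_add, lc_smul_const, map_add, pdSS_mulS, Pi.zero_apply, zero_smul, mulS_zero, zero_mulS,
        zero_add, add_zero, map_zero, lc_zero, smul_zero] at h1 h2 h3
      simp only [mul_comm, mul_left_comm] at h1 h2 h3 ⊢
      linear_combination (norm := module) h1 - h2 - h3
  have q0 : ∀ μ ν v w, s2 (e μ ν 7) v w = 0 ∧ s2 (e μ ν 6) v w = 0 ∧ s2 (e μ ν 5) v w = 0 := by
    intro μ ν v w
    have := fun i => h2 μ ν p.1.1 v w i 0 (Pi.single p.1.1 1) 0
    have a1 := this 0
    have a2 := this 2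
    have a3 := this 3
    simp [F, s3_zero₁, s3_zero₂, s3_zero₃] at a1 a2 a3
    exact ⟨a1, a2, a3⟩
  refine ⟨funext fun μ => funext fun ν => funext fun κ => funext fun n => ?_,
    funext fun μ => funext fun ν => funext fun n => ?_⟩
  · fin_cases n
    · exact hc μ ν κ
    · exact c1 μ ν κ
    · exact c2 μ ν κ
    · exact eq_zero_of_s3 fun k v w => by simpa [F, q0] using h2 μ ν κ v w 0 k 0 0
  · have : n ≤ 4 ∨ n = 5 ∨ n = 6 ∨ n = 7 := by omega
    obtain hn | rfl | rfl | rfl := this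
    exacts [he' μ ν n hn, eq_zero_of_s2 fun x y => (q0 μ ν x y).2.2,
      eq_zero_of_s2 fun x y => (q0 μ ν x y).2.1, eq_zero_of_s2 fun x y => (q0 μ ν x y).1]

end Uniqueness

section Uniqueness

variable {d N : ℕ}

lemma KF_sub (c c' : Fin 4 → T2 d → ℂ) (e : Fin 8 → T2 d → ℂ) (A : Fin d → SS d N N)
    (ε : SS d N N) (φ : SS d N 1) : KF (c - c') 0 A ε φ = KF c e A ε φ - KF c' e A ε φ := by
  simp only [KF, dpolyF, polyF, polyE, Pi.sub_apply, Pi.zero_apply, lc_zero_left, lc_sub_left,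
    mulS_sub, mulS_add, add_zero, zero_mulS, smul_zero]
  module

lemma KAd_sub (c c' e : Fin 8 → T2 d → ℂ) (A : Fin d → SS d N N) (ε φ : SS d N N) :
    KAd (c - c') 0 A ε φ = KAd c e A ε φ - KAd c' e A ε φ := by
  simp only [KAd, dpolyE, polyE, Pi.sub_apply, Pi.zero_apply, lc_zero_left, lc_sub_left,
    mulS_sub, sub_mulS, add_mulS, mulS_add, add_zero, zero_mulS, mulS_zero, sub_self, smul_zero]
  module

lemma KF_linear {c : Fin 4 → T2 d → ℂ} (h0 : c 0 = 0) (h1 : c 1 = 0) (h2 : c 2 = 0)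
    {A : Fin d → SS d N N} {ε : SS d N N} {φ : SS d N 1}
    (h : ∀ s : ℂ, KF c 0 (fun μ => s • A μ) ε φ = 0) :
    lc (c 3) (fun i => pdSS i.1 ε ⋆ (A i.2 ⋆ φ) + A i.1 ⋆ (pdSS i.2 ε ⋆ φ)) = 0 := by
  simp only [KF, dpolyF, polyF, polyE, gaugeS, h0, h1, h2, lc_zero_left, Pi.zero_apply, zero_mulS,
    smul_zero, add_zero, zero_add, smul_mulS, mulS_smul, mulS_add, add_mulS, sub_mulS, mulS_sub,
    lc_add, lc_sub, lc_smul, mulS_assoc] at h ⊢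
  linear_combination (norm := module) (1 / 2 : ℂ) • h 1 - (1 / 2 : ℂ) • h (-1)

lemma KAd_linear {c : Fin 8 → T2 d → ℂ} (hc : ∀ n ≤ 4, c n = 0)
    {A : Fin d → SS d N N} {ε φ : SS d N N} (h : ∀ s : ℂ, KAd c 0 (fun μ => s • A μ) ε φ = 0) :
    lc (c 5) (fun i => pdSS i.1 ε ⋆ (A i.2 ⋆ φ) + A i.1 ⋆ (pdSS i.2 ε ⋆ φ)) +
      lc (c 6) (fun i => pdSS i.1 ε ⋆ (φ ⋆ A i.2) + A i.1 ⋆ (φ ⋆ pdSS i.2 ε)) +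
      lc (c 7) (fun i => φ ⋆ (pdSS i.1 ε ⋆ A i.2) + φ ⋆ (A i.1 ⋆ pdSS i.2 ε)) = 0 := by
  simp only [KAd, dpolyE, polyE, gaugeS, hc 0 (by decide), hc 1 (by decide), hc 2 (by decide),
    hc 3 (by decide), hc 4 le_rfl, lc_zero_left, Pi.zero_apply, zero_mulS, mulS_zero,
    smul_zero, sub_zero, add_zero, zero_add, smul_mulS, mulS_smul, mulS_add, add_mulS, sub_mulS,
    mulS_sub, lc_add, lc_sub, lc_smul, mulS_assoc] at h ⊢
  linear_combination (norm := module) (1 / 2 : ℂ) • h 1 - (1 / 2 : ℂ) • h (-1)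

lemma eq_zero_of_mulS_const {f : SS d N N} (h : ∀ M : Mat N 1, f ⋆ wave 0 M = 0) : f = 0 := by
  refine Subtype.ext (funext fun J => funext fun x => ?_)
  ext i j
  have e : ∀ M : Mat N 1, wave 0 M = constS (smooth_fun_const (d := d) M) := fun M => by
    simp [wave, phase]
  have := h (Matrix.of fun l _ => (Pi.single j 1 : Fin N → ℂ) l)
  rw [e] at this
  have := (mulS_const_apply _ J f).symm.trans (congrFun (congrArg Subtype.val this) J)
  simpa [Matrix.mul_apply, Pi.single_apply] using congrFun (congrFun (congrFun this x) i) 0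

lemma unique_F (p : Idx d) (hN : 0 < N) {c : Fin d → Fin d → Fin 4 → T2 d → ℂ} {t : ℂ}
    (h0 : ∀ μ ν, c μ ν 0 = 0) (h1 : ∀ μ ν, c μ ν 1 = 0) (h2 : ∀ μ ν, c μ ν 2 = t • wedge μ ν)
    (h : ∀ (A : Fin d → SS d N N) ε φ, (∀ μ, IsConst (A μ)) → IsConst ε → IsConst φ →
      ∀ μ ν, KF (c μ ν) 0 A ε φ = 0) : c = 0 := by
  have hne : p.1.1 ≠ p.1.2 := p.2.ne
  have ht : t = 0 := by
    have h3 := h (fun μ => (0 : ℂ) • wv N 0) (wv N (Pi.single p.1.1 1))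
      (wave (Pi.single p.1.2 1) (Matrix.of fun _ _ => 1)) (fun μ => (isConst_wv 0).smul 0)
      (isConst_wv _) (isConst_wave _ _) p.1.1 p.1.2
    simp only [KF, dpolyF, polyF, polyE, gaugeS, h0, h1, h2, lc_zero_left, lc_smul_left, lc_wedge,
      Pi.zero_apply, map_zero, zero_smul, zero_mulS, mulS_zero, smul_zero, sub_zero, add_zero,
      zero_add, pdSS_wv, pdSS_wave, smul_mulS, mulS_smul, lc_zero] at h3
    simp only [Pi.single_eq_same, Pi.single_apply, hne, hne.symm, if_false, zero_smul, sub_zero,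
      one_smul, smul_zero] at h3
    refine (smul_eq_zero.mp h3).resolve_right (wv_mulS_wave_ne_zero _ _ fun hM => ?_)
    simpa using congrFun (congrFun hM ⟨0, hN⟩) 0
  have h3 : ∀ (μ ν) (v k q : Fin d → ℂ), s2 (c μ ν 3) k v = 0 ∧ s2 (c μ ν 3) v k + 0 * q p.1.1 = 0 := by
    intro μ ν v k q
    refine extract_two (F := fun k q => s2 (c μ ν 3) k v)
      (G := fun k q => s2 (c μ ν 3) v k + 0 * q p.1.1) p hN (by fun_prop) (by fun_prop)
      (fun k q => eq_zero_of_mulS_const fun M => ?_) k q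
    have := KF_linear (h0 μ ν) (h1 μ ν) ((h2 μ ν).trans (by rw [ht, zero_smul]))
      (A := fun μ => v μ • wv N q) (ε := wv N k) (φ := wave 0 M) fun s => h _ _ _
      (fun μ => ((isConst_wv q).smul _).smul _) (isConst_wv _) (isConst_wave _ _) μ ν
    simp only [pdSS_wv, smul_mulS, mulS_smul, smul_smul, lc_add, lc_smul_const] at this
    simp only [s2, add_mulS, smul_mulS, mulS_assoc]
    simp only [mul_comm] at this ⊢
    linear_combination (norm := module) this
  refine funext fun μ => funext fun ν => funext fun n => ?_
  fin_cases n
  · exact h0 μ ν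
  · exact h1 μ ν
  · exact (h2 μ ν).trans (by rw [ht, zero_smul]; rfl)
  · exact eq_zero_of_s2 fun x y => (h3 μ ν y x 0).1

lemma unique_Ad (p : Idx d) (hN : 0 < N) {c : Fin d → Fin d → Fin 8 → T2 d → ℂ} {t : Fin 8 → ℂ}
    (h0 : ∀ μ ν, c μ ν 0 = 0) (hw : ∀ μ ν n, 1 ≤ n → n ≤ 4 → c μ ν n = t n • wedge μ ν)
    (h3 : t 3 = 0) (h4 : t 4 = 0)
    (h : ∀ (A : Fin d → SS d N N) ε φ, (∀ μ, IsConst (A μ)) → IsConst ε → IsConst φ →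
      ∀ μ ν, KAd (c μ ν) 0 A ε φ = 0) : c = 0 := by
  have hne : p.1.1 ≠ p.1.2 := p.2.ne
  have c3 : ∀ μ ν, c μ ν 3 = 0 := fun μ ν => by
    rw [hw μ ν 3 (by decide) (by decide), h3, zero_smul]
  have c4 : ∀ μ ν, c μ ν 4 = 0 := fun μ ν => by
    rw [hw μ ν 4 (by decide) (by decide), h4, zero_smul]
  have ht : t 2 = 0 ∧ t 1 = 0 := by
    have := extract_two (F := fun k q => t 2 * (k p.1.1 * q p.1.2 - k p.1.2 * q p.1.1))
      (G := fun k q => t 1 * (q p.1.1 * k p.1.2 - q p.1.2 * k p.1.1)) p hN (by fun_prop)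
      (by fun_prop) (fun k q => by
        have hs := h (fun μ => (0 : ℂ) • wv N 0) (wv N k) (wv N q) (fun μ => (isConst_wv 0).smul 0)
          (isConst_wv _) (isConst_wv _) p.1.1 p.1.2
        simp only [KAd, dpolyE, polyE, gaugeS, h0, c3, c4, hw _ _ 1 (by decide) (by decide),
          hw _ _ 2 (by decide) (by decide), lc_zero_left, lc_smul_left, lc_wedge,
          Pi.zero_apply, map_zero, zero_smul, zero_mulS, mulS_zero, smul_zero, sub_zero, add_zero,
          zero_add, pdSS_wv, smul_mulS, mulS_smul, lc_zero] at hs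
        linear_combination (norm := module) hs) (Pi.single p.1.1 1) (Pi.single p.1.2 1)
    simpa [hne, hne.symm] using this
  have hz : ∀ μ ν n, n ≤ 4 → c μ ν n = 0 := fun μ ν n hn => by
    by_cases hn0 : n = 0
    · rw [hn0, h0]
    · rw [hw μ ν n (Fin.one_le_of_ne_zero hn0) hn]
      have : n = 1 ∨ n = 2 ∨ n = 3 ∨ n = 4 := by omega
      obtain rfl | rfl | rfl | rfl := this <;> simp [ht, h3, h4]
  have h6 : ∀ μ ν v i k l q, (fun i k (_ _ : Fin d → ℂ) => ![s2 (c μ ν 5) k v, s2 (c μ ν 6) k v,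
      s2 (c μ ν 5) v k, s2 (c μ ν 6) v k, s2 (c μ ν 7) k v, s2 (c μ ν 7) v k] i) i k l q = 0 := by
    intro μ ν v
    refine extract_six p hN (fun i => ?_) fun k l q => ?_
    · fin_cases i <;> simp only [] <;> fun_prop
    · have := KAd_linear (hz μ ν)
        (A := fun μ => v μ • wv N l) (ε := wv N k) (φ := wv N q) fun s => h _ _ _
        (fun μ => ((isConst_wv l).smul _).smul _) (isConst_wv _) (isConst_wv _) μ ν
      simp only [pdSS_wv, smul_mulS, mulS_smul, smul_smul, lc_add, lc_smul_const] at this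
      simp only [six, Fin.sum_univ_six, Matrix.cons_val, s2]
      simp only [mul_comm] at this ⊢
      linear_combination (norm := module) this
  refine funext fun μ => funext fun ν => funext fun n => ?_
  have : n ≤ 4 ∨ n = 5 ∨ n = 6 ∨ n = 7 := by omega
  obtain hn | rfl | rfl | rfl := this
  exacts [hz μ ν n hn, eq_zero_of_s2 fun x y => h6 μ ν y 0 x 0 0,
    eq_zero_of_s2 fun x y => h6 μ ν y 1 x 0 0, eq_zero_of_s2 fun x y => h6 μ ν y 4 x 0 0]

end Uniqueness

section Solutions

variable {d N : ℕ}

/-- Covariant derivative in the adjoint representation. -/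
def covS (A : Fin d → SS d N N) (μ : Fin d) (f : SS d N N) : SS d N N :=
  pdSS μ f - I • (A μ ⋆ f) + I • (f ⋆ A μ)

/-- Coefficients of `α D_κ F_{μν} - β D_κ [A_μ, A_ν]_⋆`. -/
def solD (α β : ℂ) (μ ν κ : Fin d) : Fin 4 → T3 d → ℂ :=
  let u : T3 d → ℂ := Pi.single (κ, μ, ν) 1 - Pi.single (κ, ν, μ) 1
  let v : T3 d → ℂ := Pi.single (μ, ν, κ) 1 - Pi.single (ν, μ, κ) 1
  let w : T3 d → ℂ := Pi.single (μ, κ, ν) 1 - Pi.single (ν, κ, μ) 1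
  ![α • u, -(I * α + β) • u + (I * α) • v,
    -(I * α + β) • w - (I * α) • u,
    (-α + I * β) • u + (α - I * β) • v]

/-- Coefficients of `β ([∂_μ ε, A_ν]_⋆ - [∂_ν ε, A_μ]_⋆)`. -/
def solE (β : ℂ) (μ ν : Fin d) (n : Fin 8) : T2 d → ℂ :=
  (![0, β, β, 0, 0, 0, 0, 0] : Fin 8 → ℂ) n • wedge μ ν

/-- Coefficients of `-i β [A_μ, A_ν]_⋆ ⋆ φ + γ F_{μν} ⋆ φ`. -/
def solF (β γ : ℂ) (μ ν : Fin d) (n : Fin 4) : T2 d → ℂ :=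
  (![0, γ, 0, -(I * (β + γ))] : Fin 4 → ℂ) n • wedge μ ν

/-- Coefficients of `-i β [[A_μ, A_ν]_⋆, Ψ]_⋆ + γ' F_{μν} ⋆ Ψ + γ̃ Ψ ⋆ F_{μν}`. -/
def solAd (β γ' γt : ℂ) (μ ν : Fin d) (n : Fin 8) : T2 d → ℂ :=
  (![0, 0, 0, γ', γt, -(I * (β + γ')), 0, I * (β - γt)] : Fin 8 → ℂ) n • wedge μ ν

lemma polyD_solD (α β : ℂ) (μ ν κ : Fin d) (A : Fin d → SS d N N) :
    polyD (solD α β μ ν κ) 1 A = (α • covS A κ (fieldS A μ ν) -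
      β • covS A κ (A μ ⋆ A ν - A ν ⋆ A μ)) := by
  simp only [polyD, solD, Matrix.cons_val, lc_add_left, lc_sub_left, lc_smul_left, lc_single,
    one_smul, del_one, covS, fieldS, map_sub, map_add, map_smul, pdSS_mulS, mulS_sub, mulS_add,
    sub_mulS, add_mulS, smul_mulS, mulS_smul, mulS_assoc]
  match_scalars <;> ring_nf <;> try (simp only [Complex.I_sq]; ring_nf)

lemma polyE_solE (β : ℂ) (μ ν : Fin d) (A : Fin d → SS d N N) (e : SS d N N) :
    polyE (solE β μ ν) 1 A e = β • ((pdSS μ e ⋆ A ν - A ν ⋆ pdSS μ e) -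
      (pdSS ν e ⋆ A μ - A μ ⋆ pdSS ν e)) := by
  simp only [polyE, solE, Matrix.cons_val, lc_smul_left, lc_wedge, lc_zero_left, del_one, zero_smul]
  module

lemma polyF_solF (β γ : ℂ) (μ ν : Fin d) (A : Fin d → SS d N N) (f : SS d N 1) :
    polyF (solF β γ μ ν) 1 A f = -((I * β) • ((A μ ⋆ A ν - A ν ⋆ A μ) ⋆ f)) +
      γ • (fieldS A μ ν ⋆ f) := by
  simp only [polyF, solF, Matrix.cons_val, lc_smul_left, lc_wedge, lc_zero_left, del_one, zero_smul, fieldS,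
    sub_mulS, add_mulS, smul_mulS, mulS_assoc]
  module

lemma polyE_solAd (β γ' γt : ℂ) (μ ν : Fin d) (A : Fin d → SS d N N) (f : SS d N N) :
    polyE (solAd β γ' γt μ ν) 1 A f = -((I * β) • ((A μ ⋆ A ν - A ν ⋆ A μ) ⋆ f -
      f ⋆ (A μ ⋆ A ν - A ν ⋆ A μ))) + γ' • (fieldS A μ ν ⋆ f) + γt • (f ⋆ fieldS A μ ν) := by
  simp only [polyE, solAd, Matrix.cons_val, lc_smul_left, lc_wedge, lc_zero_left, del_one, zero_smul, fieldS,
    sub_mulS, add_mulS, smul_mulS, mulS_sub, mulS_add, mulS_smul, mulS_assoc]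
  module

lemma solD_iff {α β : ℂ} {D : DFun d N} : SolD α β D ↔ RepD D (solD α β) :=
  forall₂_congr fun A hA => by simp only [polyD_solD]; rfl

lemma solE_iff {β : ℂ} {E : EFun d N} : SolE β E ↔ Rep2 E fun μ ν => polyE (solE β μ ν) 1 := by
  simp only [Rep2, polyE_solE]
  exact ⟨fun h ε A hε hA => h A ε hA hε, fun h A ε hA hε => h ε A hε hA⟩

lemma solF_iff {β γ : ℂ} {C : CFun d N 1} :
    SolF β γ C ↔ Rep2 C fun μ ν => polyF (solF β γ μ ν) 1 := by
  simp only [Rep2, polyF_solF]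
  exact ⟨fun h ε A hε hA => h A ε hA hε, fun h A ε hA hε => h ε A hε hA⟩

lemma solAd_iff {β γ' γt : ℂ} {C : CFun d N N} :
    SolAd β γ' γt C ↔ Rep2 C fun μ ν => polyE (solAd β γ' γt μ ν) 1 := by
  simp only [Rep2, polyE_solAd]
  exact ⟨fun h ε A hε hA => h A ε hA hε, fun h A ε hA hε => h ε A hε hA⟩

lemma KD_sol (α β : ℂ) (μ ν κ : Fin d) (A : Fin d → SS d N N) (ε : SS d N N) :
    KD (solD α β μ ν κ) (solE β μ ν) κ A ε = 0 := by
  simp only [KD, polyE_solE, dpolyD, polyD, solD, Matrix.cons_val, lc_add_left, lc_sub_left,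
    lc_smul_left, lc_single, one_smul, del_one, gaugeS, map_sub, map_add, map_smul, pdSS_mulS,
    mulS_sub, mulS_add, sub_mulS, add_mulS, smul_mulS, mulS_smul, mulS_assoc, pdSS_comm]
  match_scalars <;> ring_nf <;> try (simp only [Complex.I_sq]; ring_nf)

lemma KF_sol (β γ : ℂ) (μ ν : Fin d) (A : Fin d → SS d N N) (ε : SS d N N) (φ : SS d N 1) :
    KF (solF β γ μ ν) (solE β μ ν) A ε φ = 0 := by
  simp only [KF, polyE_solE, dpolyF, polyF, solF, Matrix.cons_val, lc_smul_left, lc_wedge,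
    lc_zero_left, mulS_zero, zero_smul, del_one, gaugeS, map_sub, map_add, map_smul, pdSS_mulS, mulS_sub, mulS_add,
    sub_mulS, add_mulS, smul_mulS, mulS_smul, mulS_assoc, pdSS_comm]
  match_scalars <;> ring

lemma KAd_sol (β γ' γt : ℂ) (μ ν : Fin d) (A : Fin d → SS d N N) (ε φ : SS d N N) :
    KAd (solAd β γ' γt μ ν) (solE β μ ν) A ε φ = 0 := by
  simp only [KAd, polyE_solE, polyE_solAd, fieldS, mulS_neg, neg_mulS, dpolyE, solAd, Matrix.cons_val, lc_smul_left, lc_wedge,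
    lc_zero_left, zero_smul, gaugeS, map_sub, map_add, map_smul, pdSS_mulS, mulS_sub, mulS_add,
    sub_mulS, add_mulS, smul_mulS, mulS_smul, mulS_assoc, pdSS_comm]
  match_scalars <;> ring

lemma eq_solD (p : Idx d) (hN : 0 < N) {D : DFun d N} {E : EFun d N} (hD : ClassD D)
    (hE : ClassE E) (h : ConstrD D E) : ∃ α β, RepD D (solD α β) ∧
      Rep2 E fun μ ν => polyE (solE β μ ν) 1 := by
  obtain ⟨α, c, hc, hc0⟩ := normal_D p hN hD
  obtain ⟨t, e, he, he0⟩ := normal_E p hN hE.1 hE.2.1 hE.2.2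
  have := unique_D p hN (c := fun μ ν κ => c μ ν κ - solD α (t 1) μ ν κ)
    (e := fun μ ν => e μ ν - solE (t 1) μ ν)
    (t := fun n => t n - (![0, t 1, t 1, 0, 0, 0, 0, 0] : Fin 8 → ℂ) n)
    (fun μ ν κ => sub_eq_zero.mpr (hc0 μ ν κ))
    (fun μ ν => sub_eq_zero.mpr ((he0 μ ν).1.trans (zero_smul ℂ _).symm)) (by simp)
    (fun μ ν n h1 h2 => by rw [sub_smul, ← (he0 μ ν).2 n h1 h2]; rfl)
    fun A ε hA hε μ ν κ => by
      rw [KD_sub, KD_sol, sub_zero, (constrD_iff_rep hc he).mp h A ε hA hε]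
  obtain rfl : c = solD α (t 1) := sub_eq_zero.mp this.1
  obtain rfl : e = solE (t 1) := sub_eq_zero.mp this.2
  exact ⟨α, t 1, hc, he⟩

lemma eq_solF (p : Idx d) (hN : 0 < N) {E : EFun d N} {C : CFun d N 1} {β : ℂ}
    (hE : Rep2 E fun μ ν => polyE (solE β μ ν) 1) (hC : ClassF C) (h : ConstrF E C) :
    ∃ γ, Rep2 C fun μ ν => polyF (solF β γ μ ν) 1 := by
  obtain ⟨t, c, hc, h0⟩ := normal_F p hN hC
  have := unique_F p hN (c := fun μ ν => c μ ν - solF β (t 1) μ ν) (t := t 2)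
    (fun μ ν => sub_eq_zero.mpr ((h0 μ ν).1.trans (zero_smul ℂ _).symm))
    (fun μ ν => sub_eq_zero.mpr (h0 μ ν).2.1)
    (fun μ ν => (congrArg₂ _ (h0 μ ν).2.2 (zero_smul ℂ _)).trans (sub_zero _))
    fun A ε φ hA hε hφ μ ν => by
      rw [KF_sub _ _ (solE β μ ν), KF_sol, sub_zero, (constrF_iff_rep hc hE).mp h A ε φ hA hε hφ]
  obtain rfl : c = solF β (t 1) := sub_eq_zero.mp this
  exact ⟨t 1, hc⟩

lemma eq_solAd (p : Idx d) (hN : 0 < N) {E C : EFun d N} {β : ℂ}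
    (hE : Rep2 E fun μ ν => polyE (solE β μ ν) 1) (hC : ClassAd C) (h : ConstrAd E C) :
    ∃ γ' γt, Rep2 C fun μ ν => polyE (solAd β γ' γt μ ν) 1 := by
  obtain ⟨t, c, hc, h0⟩ := normal_E p hN hC.1 (isLinearFst_real hC.2.1) hC.2.2
  have := unique_Ad p hN (c := fun μ ν => c μ ν - solAd β (t 3) (t 4) μ ν)
    (t := fun n => t n - (![0, 0, 0, t 3, t 4, 0, 0, 0] : Fin 8 → ℂ) n)
    (fun μ ν => sub_eq_zero.mpr ((h0 μ ν).1.trans (zero_smul ℂ _).symm))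
    (fun μ ν n h1 h2 => by
      rw [sub_smul, ← (h0 μ ν).2 n h1 h2]
      have : n = 1 ∨ n = 2 ∨ n = 3 ∨ n = 4 := by omega
      obtain rfl | rfl | rfl | rfl := this <;> simp [solAd]) (by simp) (by simp)
    fun A ε φ hA hε hφ μ ν => by
      rw [KAd_sub _ _ (solE β μ ν), KAd_sol, sub_zero, (constrAd_iff_rep hc hE).mp h A ε φ hA hε hφ]
  obtain rfl : c = solAd β (t 3) (t 4) := sub_eq_zero.mp this
  exact ⟨t 3, t 4, hc⟩

end Solutions

section Covariance

variable {d N : ℕ}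

/-- `x` is the transform of `y` with the weights `w`. -/
def Cov {I V : Type} [Fintype I] [AddCommGroup V] [Module ℂ V] (w : I → I → ℂ) (x y : I → V) : Prop :=
  ∀ i, x i = ∑ j, w i j • y j

namespace Cov

variable {I J V W : Type} [Fintype I] [Fintype J] [AddCommGroup V] [Module ℂ V] [AddCommGroup W]
  [Module ℂ W] {w : I → I → ℂ} {x y x' y' : I → V}

lemma add (h : Cov w x y) (h' : Cov w x' y') : Cov w (fun i => x i + x' i) fun i => y i + y' i :=
  fun i => by simp only [h i, h' i, smul_add, sum_add_distrib]

lemma map (F : V →ₗ[ℂ] W) (h : Cov w x y) : Cov w (fun i => F (x i)) fun i => F (y i) :=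
  fun i => by simp only [h i, map_sum, map_smul]

lemma smul (c : ℂ) (h : Cov w x y) : Cov w (fun i => c • x i) fun i => c • y i :=
  h.map (c • LinearMap.id)

lemma sub (h : Cov w x y) (h' : Cov w x' y') : Cov w (fun i => x i - x' i) fun i => y i - y' i :=
  fun i => by simp only [h i, h' i, smul_sub, sum_sub_distrib]

lemma reindex (e : J ≃ I) (h : Cov w x y) :
    Cov (fun i j => w (e i) (e j)) (fun i => x (e i)) fun i => y (e i) :=
  fun i => (h _).trans (Equiv.sum_comp e fun j => w (e i) j • y j).symm

lemma op {u : J → J → ℂ} {S T : J → V →ₗ[ℂ] W} (hS : Cov u S T) (h : Cov w x y) :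
    Cov (fun i j : J × I => u i.1 j.1 * w i.2 j.2) (fun i => S i.1 (x i.2)) fun i => T i.1 (y i.2) :=
  fun i => by
    beta_reduce
    rw [hS i.1, h i.2, LinearMap.sum_apply, Fintype.sum_prod_type]
    simp only [LinearMap.smul_apply, map_sum, map_smul, smul_smul, mul_comm (w _ _)]

end Cov

/-- Weights of a covector. -/
def wt1 (g : GL (Fin d) ℝ) (μ ν : Fin d) : ℂ := (g.1 μ ν : ℂ)

lemma Cov.op₂ {V W : Type} [AddCommGroup V] [Module ℂ V] [AddCommGroup W] [Module ℂ W]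
    {g : GL (Fin d) ℝ} {S T : Fin d → V →ₗ[ℂ] W} {x y : Fin d → V} (hS : Cov (wt1 g) S T)
    (h : Cov (wt1 g) x y) : Cov (wt2 g) (fun i => S i.1 (x i.2) - S i.2 (x i.1))
      fun i => T i.1 (y i.2) - T i.2 (y i.1) := by
  have h1 : Cov (wt2 g) (fun i => S i.1 (x i.2)) fun i => T i.1 (y i.2) := by
    have e : wt2 g = fun i j => wt1 g i.1 j.1 * wt1 g i.2 j.2 := by
      ext i j
      simp [wt1, wt2]
    exact e ▸ hS.op h
  have h2 := h1.reindex (Equiv.prodComm _ _)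
  simp only [wt2, Equiv.prodComm_apply, Prod.fst_swap, Prod.snd_swap, mul_comm] at h2
  refine h1.sub fun i => (h2 i).trans ?_
  simp only [wt2]

/-- The star product as a bilinear map. -/
def mulL (d a b c : ℕ) : SS d a b →ₗ[ℂ] SS d b c →ₗ[ℂ] SS d a c :=
  LinearMap.mk₂ ℂ (fun f g => f ⋆ g) add_mulS (fun c f g => smul_mulS c f g) mulS_add
    (fun c f g => mulS_smul c f g)

/-- The star commutator as a bilinear map. -/
def adL (d N : ℕ) : SS d N N →ₗ[ℂ] SS d N N →ₗ[ℂ] SS d N N :=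
  LinearMap.mk₂ ℂ (fun f g => f ⋆ g - g ⋆ f) (fun f f' g => by rw [add_mulS, mulS_add]; abel)
    (fun c f g => by rw [smul_mulS, mulS_smul, smul_sub])
    (fun f g g' => by rw [add_mulS, mulS_add]; abel)
    fun c f g => by rw [smul_mulS, mulS_smul, smul_sub]

/-- The transformed covariant derivatives. -/
def covL (g : SqM d) (A : Fin d → SS d N N) (μ : Fin d) : SS d N N →ₗ[ℂ] SS d N N :=
  del g μ - I • adL d N (A μ)

variable (g : GL (Fin d) ℝ) (A : Fin d → SS d N N)

lemma cov_trS : Cov (wt1 g) (trS g.1 A) A := fun _ => rfl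

lemma cov_del {a b : ℕ} (f : SS d a b) :
    Cov (wt1 g) (fun μ => del g.1 μ f) fun μ => del 1 μ f := fun μ => by
  simp only [del_one]
  simp [del, wt1]

lemma cov_covL : Cov (wt1 g) (covL g.1 (trS g.1 A)) (covL 1 A) := fun μ =>
  LinearMap.ext fun f => by
    have h1 : del g.1 μ f = ∑ ν, wt1 g μ ν • del 1 ν f := cov_del g f μ
    have h2 : adL d N (trS g.1 A μ) f = ∑ ν, wt1 g μ ν • adL d N (A ν) f :=
      ((cov_trS g A).map ((adL d N).flip f)) μ
    simp only [covL, LinearMap.sum_apply, LinearMap.smul_apply, LinearMap.sub_apply, h1, h2,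
      smul_sub, sum_sub_distrib, smul_sum, smul_comm I]

variable {L : Type}

/-- `[A_μ, A_ν]_⋆`. -/
def commW (i : T2 d) : Word d L := .add (.mul (.A i.1) (.A i.2)) (.smul (-1) (.mul (.A i.2) (.A i.1)))

/-- `F_{μν}`. -/
def fieldW (i : T2 d) : Word d L :=
  .add (.add (.D i.1 (.A i.2)) (.smul (-1) (.D i.2 (.A i.1)))) (.smul I (commW i))

lemma wordS_D (x : Cfg d N L) (μ : Fin d) (w : Word d L) :
    wordS x (.D μ w) = covL x.g x.a μ (wordS x w) := by
  simp only [wordS, covL, adL, LinearMap.sub_apply, LinearMap.smul_apply, LinearMap.mk₂_apply]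
  module

lemma wordS_commW (x : Cfg d N L) (i : T2 d) :
    wordS x (commW i) = x.a i.1 ⋆ x.a i.2 - x.a i.2 ⋆ x.a i.1 := by
  simp only [commW, wordS]
  module

lemma wordS_fieldW (x : Cfg d N L) (i : T2 d) : wordS x (fieldW i) =
    (covL x.g x.a i.1 (x.a i.2) - covL x.g x.a i.2 (x.a i.1)) + I • wordS x (commW i) := by
  rw [fieldW, wordS, wordS, wordS, wordS, wordS_D, wordS_D, wordS, wordS]
  module

lemma wordS_fieldW_one (l : L → SS d N N) (i : T2 d) :
    wordS ⟨1, A, l⟩ (fieldW i) = fieldS A i.1 i.2 := by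
  simp only [fieldW, commW, wordS, del_one, fieldS]
  module

lemma cov_commW (l : L → SS d N N) : Cov (wt2 g)
    (fun i => wordS ⟨g.1, trS g.1 A, l⟩ (commW i)) fun i => wordS ⟨1, A, l⟩ (commW i) := by
  simp only [wordS_commW]
  exact Cov.op₂ ((cov_trS g A).map (mulL d N N N)) (cov_trS g A)

lemma cov_fieldW (l : L → SS d N N) : Cov (wt2 g)
    (fun i => wordS ⟨g.1, trS g.1 A, l⟩ (fieldW i)) fun i => wordS ⟨1, A, l⟩ (fieldW i) := by
  simp only [wordS_fieldW]
  exact (Cov.op₂ (cov_covL g A) (cov_trS g A)).add ((cov_commW g A l).smul _)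

variable {m : ℕ}

lemma isLinearFst_of_rep {C : CFun d N m}
    {P : Fin d → Fin d → (Fin d → SS d N N) → SS d N m → SS d N m} (h : Rep2 C P)
    (hP : ∀ μ ν A e f (c : ℂ), P μ ν A (e + c • f) = P μ ν A e + c • P μ ν A f) :
    IsLinearFst ℂ C := by
  intro J u₁ u₂ v h₁ h₂ hv c x
  refine funext fun μ => funext fun ν => ?_
  have h3 : Smooth fun y => u₁ y + c • u₂ y := ContDiff.add h₁ (ContDiff.const_smul c h₂)
  have e : constS h3 = constS h₁ + c • constS h₂ := Subtype.ext (funext fun J => funext fun x => by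
    by_cases h : J = 0 <;> simp [constS, const, h])
  refine (congrFun (congrFun (h _ v h3 hv μ ν) J) x).trans ?_
  rw [e, hP]
  exact congrArg₂ (fun M M' => M + c • M') (congrFun (congrFun (h _ v h₁ hv μ ν) J) x).symm
    (congrFun (congrFun (h _ v h₂ hv μ ν) J) x).symm

lemma antisymm_of_rep {C : CFun d N m}
    {P : Fin d → Fin d → (Fin d → SS d N N) → SS d N m → SS d N m} (h : Rep2 C P)
    (hP : ∀ μ ν A e, P μ ν A e = -P ν μ A e) : Antisymm2 C := fun φ A hφ hA J x μ ν =>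
  (congrFun (congrFun ((h φ A hφ hA μ ν).trans (congrArg Subtype.val (hP _ _ _ _))) J) x).trans
    (congrArg Neg.neg (congrFun (congrFun (h φ A hφ hA ν μ) J) x).symm)

lemma eq_zero_of_eq_neg {V : Type} [AddCommGroup V] [Module ℂ V] {v : V} (h : v = -v) : v = 0 := by
  linear_combination (norm := module) (1 / 2 : ℂ) • h

lemma eq_zero_of_degenerate (hd : ¬(Nonempty (Idx d) ∧ 0 < N)) {f : Fin d → Fin d → Ser d (Mat N m)}
    (h : ∀ μ ν, f μ ν = -f ν μ) (μ ν : Fin d) : f μ ν = 0 := by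
  refine funext fun J => funext fun x => Matrix.ext fun i j => ?_
  obtain rfl : μ = ν := by
    by_contra hne
    exact hd ⟨(lt_or_gt_of_ne hne).elim (fun h => ⟨⟨(μ, ν), h⟩⟩) fun h => ⟨⟨(ν, μ), h⟩⟩, i.pos⟩
  rw [eq_zero_of_eq_neg (h μ μ)]

lemma rep_of_degenerate (hd : ¬(Nonempty (Idx d) ∧ 0 < N)) {C : CFun d N m} (hC : Antisymm2 C)
    {P : Fin d → Fin d → (Fin d → SS d N N) → SS d N m → SS d N m}
    (hP : ∀ μ ν A e, P μ ν A e = -P ν μ A e) : Rep2 C P := fun φ A hφ hA μ ν =>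
  (eq_zero_of_degenerate hd (f := fun μ ν => cpt2 (app C fun x => (φ x, A x)) μ ν)
    (fun μ ν => funext fun J => funext fun x => hC φ A hφ hA J x μ ν) μ ν).trans
  (eq_zero_of_degenerate hd (f := fun μ ν => (P μ ν (potS hA) (constS hφ)).1)
    (fun μ ν => congrArg Subtype.val (hP μ ν _ _)) μ ν).symm

end Covariance

section Classification

variable {d N : ℕ}

lemma polyD_solD_swap (α β : ℂ) (μ ν κ : Fin d) (A : Fin d → SS d N N) :
    polyD (solD α β μ ν κ) 1 A = -polyD (solD α β ν μ κ) 1 A := by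
  simp only [polyD, solD, Matrix.cons_val, lc_add_left, lc_sub_left, lc_smul_left]
  module

lemma polyE_wedge_swap (t : Fin 8 → ℂ) (μ ν : Fin d) (A : Fin d → SS d N N) (e : SS d N N) :
    polyE (fun n => t n • wedge μ ν) 1 A e = -polyE (fun n => t n • wedge ν μ) 1 A e := by
  simp only [polyE, lc_smul_left, lc_wedge]
  module

lemma polyF_wedge_swap (t : Fin 4 → ℂ) (μ ν : Fin d) (A : Fin d → SS d N N) (e : SS d N 1) :
    polyF (fun n => t n • wedge μ ν) 1 A e = -polyF (fun n => t n • wedge ν μ) 1 A e := by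
  simp only [polyF, lc_smul_left, lc_wedge]
  module

lemma polyE_linear (c : Fin 8 → T2 d → ℂ) (A : Fin d → SS d N N) (e f : SS d N N) (r : ℂ) :
    polyE c 1 A (e + r • f) = polyE c 1 A e + r • polyE c 1 A f := by
  simp only [polyE, map_add, map_smul, add_mulS, mulS_add, smul_mulS, mulS_smul, lc_add, lc_smul]
  module

lemma polyF_linear (c : Fin 4 → T2 d → ℂ) (A : Fin d → SS d N N) (e f : SS d N 1) (r : ℂ) :
    polyF c 1 A (e + r • f) = polyF c 1 A e + r • polyF c 1 A f := by
  simp only [polyF, map_add, map_smul, mulS_add, mulS_smul, lc_add, lc_smul]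
  module

lemma classD_sol {α β : ℂ} {D : DFun d N} (h : RepD D (solD α β)) : ClassD D := by
  refine ⟨isCovStarPolyD_iff.mpr ⟨fun i => .D i.2.2 (.add (.smul α (fieldW (i.1, i.2.1)))
    (.smul (-β) (commW (i.1, i.2.1)))), fun A hA μ ν κ => ?_, fun g A _ i => ?_⟩,
    fun A hA J x μ ν κ => ?_⟩
  · rw [h A hA, polyD_solD, wordS_D, wordS, wordS, wordS, wordS_fieldW_one, wordS_commW]
    simp only [map_add, map_smul, covL, covS, adL, del_one, LinearMap.sub_apply,
      LinearMap.smul_apply, LinearMap.mk₂_apply, Subtype.coe_inj]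
    module
  · have h1 := (cov_covL g A).op (((cov_fieldW g A Empty.elim).smul α).add
      ((cov_commW g A Empty.elim).smul (-β)))
    have h2 := h1.reindex ((Equiv.prodAssoc _ _ _).symm.trans (Equiv.prodComm _ _)) i
    simp only [wordS_D]
    refine h2.trans (sum_congr rfl fun j _ => ?_)
    congr 1
    simp [wt1, wt2, wt3]
    ring
  · have h1 := (h A hA μ ν κ).trans (congrArg Subtype.val (polyD_solD_swap α β μ ν κ _))
    exact (congrFun (congrFun h1 J) x).trans
      (congrArg Neg.neg (congrFun (congrFun (h A hA ν μ κ) J) x).symm)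

lemma classE_sol {β : ℂ} {E : EFun d N} (h : Rep2 E fun μ ν => polyE (solE β μ ν) 1) :
    ClassE E := by
  let de : Fin d → Word d Unit := fun μ => .add (.D μ (.letter ())) (.smul I
    (.add (.mul (.A μ) (.letter ())) (.smul (-1) (.mul (.letter ()) (.A μ)))))
  have hde : ∀ (x : Cfg d N Unit) μ, wordS x (de μ) = del x.g μ (x.l ()) := fun x μ => by
    simp only [de, wordS]
    module
  let W : T2 d → Word d Unit := fun i => .smul β (.add
    (.add (.mul (de i.1) (.A i.2)) (.smul (-1) (.mul (.A i.2) (de i.1))))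
    (.smul (-1) (.add (.mul (de i.2) (.A i.1)) (.smul (-1) (.mul (.A i.1) (de i.2))))))
  have hW : ∀ (x : Cfg d N Unit) i, wordS x (W i) = β •
      (adL d N (del x.g i.1 (x.l ())) (x.a i.2) - adL d N (del x.g i.2 (x.l ())) (x.a i.1)) :=
    fun x i => by
      simp only [W, wordS, hde, adL, LinearMap.mk₂_apply]
      module
  refine ⟨isCovStarPoly2_iff.mpr ⟨W, fun ε A hε hA μ ν => ?_, fun g A e _ _ i => ?_⟩,
    isLinearFst_real (isLinearFst_of_rep h fun _ _ => polyE_linear _),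
    antisymm_of_rep h fun _ _ => polyE_wedge_swap _ _ _⟩
  · rw [h ε A hε hA]
    beta_reduce
    rw [polyE_solE, hW]
    simp only [del_one, adL, LinearMap.mk₂_apply]
  · simp only [hW]
    exact (Cov.op₂ ((cov_del g e).map (adL d N)) (cov_trS g A)).smul β i

lemma classF_sol {β γ : ℂ} {C : CFun d N 1} (h : Rep2 C fun μ ν => polyF (solF β γ μ ν) 1) :
    ClassF C := by
  let W : T2 d → Word d Empty := fun i =>
    .add (.smul (-(I * β)) (commW i)) (.smul γ (fieldW i))
  refine ⟨isCovStarPolyF_iff.mpr ⟨fun i => .mul (W i) .phi, fun ε A hε hA μ ν => ?_,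
    fun g A e _ _ i => ?_⟩, isLinearFst_of_rep h fun _ _ => polyF_linear _,
    antisymm_of_rep h fun _ _ => polyF_wedge_swap _ _ _⟩
  · rw [h ε A hε hA]
    beta_reduce
    rw [polyF_solF, fwordS, wordS, wordS, wordS, wordS_commW, wordS_fieldW_one]
    simp only [fwordS, add_mulS, smul_mulS, Subtype.coe_inj]
    module
  · exact (((cov_commW g A Empty.elim).smul _).add ((cov_fieldW g A Empty.elim).smul γ)).map
      ((mulL d N N 1).flip e) i

lemma classAd_sol {β γ' γt : ℂ} {C : CFun d N N}
    (h : Rep2 C fun μ ν => polyE (solAd β γ' γt μ ν) 1) : ClassAd C := by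
  let W : T2 d → Word d Unit := fun i => .add (.add (.smul (-(I * β))
      (.add (.mul (commW i) (.letter ())) (.smul (-1) (.mul (.letter ()) (commW i)))))
    (.smul γ' (.mul (fieldW i) (.letter ())))) (.smul γt (.mul (.letter ()) (fieldW i)))
  have hW : ∀ (x : Cfg d N Unit) i, wordS x (W i) = (-(I * β)) •
      (adL d N).flip (x.l ()) (wordS x (commW i)) + γ' • (mulL d N N N).flip (x.l ())
        (wordS x (fieldW i)) + γt • mulL d N N N (x.l ()) (wordS x (fieldW i)) :=
    fun x i => by
      simp only [W, wordS, adL, mulL, LinearMap.flip_apply, LinearMap.mk₂_apply]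
      module
  refine ⟨isCovStarPoly2_iff.mpr ⟨W, fun ε A hε hA μ ν => ?_, fun g A e _ _ i => ?_⟩,
    isLinearFst_of_rep h fun _ _ => polyE_linear _,
    antisymm_of_rep h fun _ _ => polyE_wedge_swap _ _ _⟩
  · rw [h ε A hε hA]
    beta_reduce
    rw [polyE_solAd, hW, wordS_commW, wordS_fieldW_one]
    simp only [adL, mulL, LinearMap.flip_apply, LinearMap.mk₂_apply, Subtype.coe_inj]
    module
  · simp only [hW]
    have h1 := cov_commW g A fun _ : Unit => e
    have h2 := cov_fieldW g A fun _ : Unit => e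
    exact (((h1.map ((adL d N).flip e)).smul _).add ((h2.map ((mulL d N N N).flip e)).smul γ')).add
      ((h2.map (mulL d N N N e)).smul γt) i

lemma classification (D : DFun d N) (E : EFun d N) : ClassD D ∧ ClassE E ∧ ConstrD D E ↔
    ∃ α β, SolD α β D ∧ SolE β E := by
  simp only [solD_iff, solE_iff]
  constructor
  · rintro ⟨hD, hE, h⟩
    by_cases hd : Nonempty (Idx d) ∧ 0 < N
    · exact eq_solD hd.1.some hd.2 hD hE h
    · refine ⟨0, 0, fun A hA μ ν κ => ?_, rep_of_degenerate hd hE.2.2 fun _ _ => polyE_wedge_swap _ _ _⟩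
      exact (eq_zero_of_degenerate hd (f := fun μ ν => cpt3 (app D A) μ ν κ)
        (fun μ ν => funext fun J => funext fun x => hD.2 A hA J x μ ν κ) μ ν).trans
        (eq_zero_of_degenerate hd (f := fun μ ν => (polyD (solD 0 0 μ ν κ) 1 (potS hA)).1)
          (fun μ ν => congrArg Subtype.val (polyD_solD_swap 0 0 μ ν κ _)) μ ν).symm
  · rintro ⟨α, β, hD, hE⟩
    exact ⟨classD_sol hD, classE_sol hE, (constrD_iff_rep hD hE).mpr fun A ε _ _ μ ν κ =>
      KD_sol α β μ ν κ A ε⟩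

lemma classification_F (D : DFun d N) (E : EFun d N) (C : CFun d N 1) :
    ClassD D ∧ ClassE E ∧ ClassF C ∧ ConstrD D E ∧ ConstrF E C ↔
      ∃ α β γ, SolD α β D ∧ SolE β E ∧ SolF β γ C := by
  constructor
  · rintro ⟨hD, hE, hC, h, h'⟩
    obtain ⟨α, β, hD, hE⟩ := (classification D E).mp ⟨hD, hE, h⟩
    by_cases hd : Nonempty (Idx d) ∧ 0 < N
    · obtain ⟨γ, hγ⟩ := eq_solF hd.1.some hd.2 (solE_iff.mp hE) hC h'
      exact ⟨α, β, γ, hD, hE, solF_iff.mpr hγ⟩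
    · exact ⟨α, β, 0, hD, hE, solF_iff.mpr (rep_of_degenerate hd hC.2.2 fun _ _ =>
        polyF_wedge_swap _ _ _)⟩
  · rintro ⟨α, β, γ, hD, hE, hC⟩
    obtain ⟨h1, h2, h3⟩ := (classification D E).mpr ⟨α, β, hD, hE⟩
    rw [solF_iff] at hC
    exact ⟨h1, h2, classF_sol hC, h3, (constrF_iff_rep hC (solE_iff.mp hE)).mpr
      fun A ε φ _ _ _ μ ν => KF_sol β γ μ ν A ε φ⟩

lemma classification_Ad (D : DFun d N) (E : EFun d N) (C : CFun d N N) :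
    ClassD D ∧ ClassE E ∧ ClassAd C ∧ ConstrD D E ∧ ConstrAd E C ↔
      ∃ α β γ' γt, SolD α β D ∧ SolE β E ∧ SolAd β γ' γt C := by
  constructor
  · rintro ⟨hD, hE, hC, h, h'⟩
    obtain ⟨α, β, hD, hE⟩ := (classification D E).mp ⟨hD, hE, h⟩
    by_cases hd : Nonempty (Idx d) ∧ 0 < N
    · obtain ⟨γ', γt, hγ⟩ := eq_solAd hd.1.some hd.2 (solE_iff.mp hE) hC h'
      exact ⟨α, β, γ', γt, hD, hE, solAd_iff.mpr hγ⟩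
    · exact ⟨α, β, 0, 0, hD, hE, solAd_iff.mpr (rep_of_degenerate hd hC.2.2 fun _ _ =>
        polyE_wedge_swap _ _ _)⟩
  · rintro ⟨α, β, γ', γt, hD, hE, hC⟩
    obtain ⟨h1, h2, h3⟩ := (classification D E).mpr ⟨α, β, hD, hE⟩
    rw [solAd_iff] at hC
    exact ⟨h1, h2, classAd_sol hC, h3, (constrAd_iff_rep hC (solE_iff.mp hE)).mpr
      fun A ε φ _ _ _ μ ν => KAd_sol β γ' γt μ ν A ε φ⟩

end Classification

end SW

end

theorem mainTheorem5 (d N : ℕ) :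
    -- the Seiberg-Witten conditions amount to the extended differential equations
    (∀ (Ah : SW.PotFun d N) (eh : SW.ParFun d N), SW.IsPotMap Ah → SW.IsParMap eh →
      (SW.SWGauge Ah eh ↔
        ∃ (D : SW.DFun d N) (E : SW.EFun d N), SW.IsExtraD D ∧ SW.IsExtraE E ∧
          SW.EqA Ah D ∧ SW.EqE Ah eh E ∧ SW.ConstrD D E)) ∧
    (∀ (Ah : SW.PotFun d N) (eh : SW.ParFun d N) (ph : SW.MatFun d N 1),
      SW.IsPotMap Ah → SW.IsParMap eh → SW.IsMatMap ph →
      (SW.SWGauge Ah eh ∧ SW.SWFund eh ph ↔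
        ∃ (D : SW.DFun d N) (E : SW.EFun d N) (C : SW.CFun d N 1),
          SW.IsExtraD D ∧ SW.IsExtraE E ∧ SW.IsExtraC C ∧
          SW.EqA Ah D ∧ SW.EqE Ah eh E ∧ SW.EqF Ah ph C ∧
          SW.ConstrD D E ∧ SW.ConstrF E C)) ∧
    (∀ (Ah : SW.PotFun d N) (eh : SW.ParFun d N) (ph : SW.MatFun d N N),
      SW.IsPotMap Ah → SW.IsParMap eh → SW.IsMatMap ph →
      (SW.SWGauge Ah eh ∧ SW.SWAdj eh ph ↔
        ∃ (D : SW.DFun d N) (E : SW.EFun d N) (C : SW.CFun d N N),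
          SW.IsExtraD D ∧ SW.IsExtraE E ∧ SW.IsExtraC C ∧
          SW.EqA Ah D ∧ SW.EqE Ah eh E ∧ SW.EqAd Ah ph C ∧
          SW.ConstrD D E ∧ SW.ConstrAd E C)) ∧
    -- classification of the covariant star polynomial solutions of the constraints
    (∀ (D : SW.DFun d N) (E : SW.EFun d N),
      (SW.ClassD D ∧ SW.ClassE E ∧ SW.ConstrD D E ↔
        ∃ α β : ℂ, SW.SolD α β D ∧ SW.SolE β E)) ∧
    (∀ (D : SW.DFun d N) (E : SW.EFun d N) (C : SW.CFun d N 1),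
      (SW.ClassD D ∧ SW.ClassE E ∧ SW.ClassF C ∧ SW.ConstrD D E ∧ SW.ConstrF E C ↔
        ∃ α β γ : ℂ, SW.SolD α β D ∧ SW.SolE β E ∧ SW.SolF β γ C)) ∧
    (∀ (D : SW.DFun d N) (E : SW.EFun d N) (C : SW.CFun d N N),
      (SW.ClassD D ∧ SW.ClassE E ∧ SW.ClassAd C ∧ SW.ConstrD D E ∧ SW.ConstrAd E C ↔
        ∃ α β γ' γt : ℂ, SW.SolD α β D ∧ SW.SolE β E ∧ SW.SolAd β γ' γt C)) := by
  refine ⟨fun Ah eh hA he => SW.general_solution hA he,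
    fun Ah eh ph hA he hp => SW.general_solution_F hA he hp,
    fun Ah eh ph hA he hp => SW.general_solution_Ad hA he hp, SW.classification,
    SW.classification_F, SW.classification_Ad⟩
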